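/- **Setting.** Let $d\ge 3$, $\Omega=(0,1)^d$, and for $N\in\mathbb N$ let $h=\frac1{N+1}$, $\mathcal K_h=h(\mathbb Z^d\cap[0,N+1]^d)$, $\Omega_h=\Omega\cap\mathcal K_h$, $\partial\Omega_h=\partial\Omega\cap\mathcal K_h$. For a finite set of points $W$ put $W_k^*=\{x\pm\frac h2e_k: x\in W\}$, $\overline W_k=(W_k^*)_k^*$, $\partial_kW=\overline W_k\setminus W$, and $\overline W=\bigcup_{k}\bigcup_{j\neq k}\big((\overline W_k+he_j)\cup(\overline W_k-he_j)\big)$. For $x\in\partial_kW$ let $n_k(x)=1$ if $x-\frac h2e_k\in W_k^*$ and $x+\frac h2e_k\notin W_k^*$, and $n_k(x)=-1$ if $x-\frac h2e_k\notin W_k^*$ and $x+\frac h2e_k\in W_k^*$; put $n_k=0$ otherwise, and $\partial_k^\pm W=\{x\in\partial_kW: n_k(x)=\pm1\}$. For mesh functions let $$D_ku(x)=\frac{u(x+\frac h2e_k)-u(x-\frac h2e_k)}h,\qquad A_ku(x)=\frac{u(x+\frac h2e_k)+u(x-\frac h2e_k)}2 .$$ Norms: $\|u\|_{L^\infty_h(W)}=\max_{W}|u|$,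 $\|u\|^2_{L^2_h(W)}=h^d\sum_{x\in W}|u(x)|^2$, $\|u\|_{H^1_h(W)}^2=\|u\|^2_{L^2_h(\overline W)}+\sum_k\|D_ku\|^2_{L^2_h(W_k^*)}$, and $|g|^2_{L^2_h(\Gamma_h)}=h^{d-1}\sum_{x\in\Gamma_h}|g(x)|^2$ for $\Gamma_h\subset\partial\Omega_h$. The coefficients $\sigma^1,\dots,\sigma^d$ are positive continuous functions on $\overline\Omega$ (extended to $\mathbb R^d$ in any way), sampled on the meshes, such that for all mesh sizes $h\le h_1$, where $h_1>0$ is fixed, $$\sum_{k,j}\|D_j\sigma^k\|_{L^\infty_h((\overline{\Omega_h})_k)}<1,\qquad \sum_{k,j}\|A_j\sigma^k-1\|_{L^\infty_h((\overline{\Omega_h})_k)}<1,$$ and $\sum_k\|\sigma^k\|_{L^\infty_h((\overline{\Omega_h})_k^*)}$ is bounded independently of $h$. Put $\Delta_hu=\sum_kD_k(\sigma^kD_ku)$ on $\Omega_h$ and $\partial_nu(x)=\sum_{k}(\sigma^kD_ku)\big(x-n_k(x)\tfrac h2e_k\big)\,n_k(x)$ for $x\in\partial\Omega_h$, with $n_k$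 the normal of $W=\Omega_h$. Let $M\in\mathbb R$, let $\mathcal O\subset\Omega$ and $\varrho>0$ be such that $\{x\in\Omega:\operatorname{dist}(x,\partial\Omega)<8\varrho\}\subset\mathcal O$ (so $\mathcal O$ is a neighbourhood of $\partial\Omega$ in $\Omega$), and put $\mathcal O_h=\mathcal O\cap\Omega_h$ and $\omega_h(\varrho,3\varrho)=\{x\in\Omega_h:\varrho<\operatorname{dist}(x,\partial\Omega)<3\varrho\}$. **Proposition 4.1 (Unique continuation estimate).** Let $\Gamma$ be a non-empty relatively open subset of $\partial\Omega$ that lies in one face, in the sense that for some $i\in\{1,\dots,d\}$ and one choice of sign, $\Gamma_h:=\Gamma\cap\partial\Omega_h\subset\partial_i^{\pm}\Omega_h$ for every mesh size $h$. Then there are constants $0<h_0<1$, $\widetilde\varepsilon>0$, $C>0$, $\alpha_1>0$, $\alpha_2>0$, independent of $h$, $\tau$, $\sigma$, $q$, $f$ and $u$, such that for all coefficients $\sigma$ as above, all mesh sizes $h\le h_0$, all $\tau$ with $0<h\tau\le\widetilde\varepsilon$, all real $q,f$ on $\Omega_h$ with $\|q\|_{L^\infty_h(\Omega_h)}\le M$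 and $f=0$ in $\mathcal O_h$, and all real $u$ on $\overline\Omega\cap\mathcal K_h$ with $$(-\Delta_h+q)u=f\ \text{ in }\Omega_h,\qquad u=0\ \text{ on }\partial\Omega_h,$$ we have $$\|u\|_{H_h^1(\omega_h(\varrho,3\varrho))}\le C\left(e^{-\alpha_1\tau}\|u\|_{H_h^1(\Omega_h)}+e^{\alpha_2\tau}|\partial_nu|_{L_h^2(\Gamma_h)}\right).$$ -/

import Mathlib

open scoped NNReal

noncomputable section

namespace DiscreteUC

/-- The ambient space `ℝ^d` with the Euclidean norm. -/
abbrev E (d : ℕ) : Type := EuclideanSpace ℝ (Fin d)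

/-- The vector `(h/2) e_k`. -/
def halfStep {d : ℕ} (h : ℝ) (k : Fin d) : E d := (h / 2) • EuclideanSpace.single k (1 : ℝ)

/-! ### Mesh operations on finite sets of points -/

/-- `W_k^* = τ_k(W) ∪ τ_{-k}(W)`. -/
def star {d : ℕ} (h : ℝ) (k : Fin d) (W : Finset (E d)) : Finset (E d) :=
  open scoped Classical in
  W.image (fun x => x + halfStep h k) ∪ W.image (fun x => x - halfStep h k)

/-- The closure in direction `k`: `(W_k^*)_k^*`. -/
def closureDir {d : ℕ} (h : ℝ) (k : Fin d) (W : Finset (E d)) : Finset (E d) :=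
  star h k (star h k W)

/-- `∂_k W = (W_k^*)_k^* \ W`. -/
def bdryDir {d : ℕ} (h : ℝ) (k : Fin d) (W : Finset (E d)) : Finset (E d) :=
  open scoped Classical in closureDir h k W \ W

/-- The discrete closure of `W`: the union over `k` and `j ≠ k` of the translates by `± h e_j` of
the closure of `W` in direction `k`. -/
def meshClosure {d : ℕ} (h : ℝ) (W : Finset (E d)) : Finset (E d) :=
  open scoped Classical in
  Finset.univ.biUnion fun k : Fin d => (Finset.univ.erase k).biUnion fun j : Fin d =>
    (closureDir h k W).image (fun x => x + (2 : ℝ) • halfStep h j) ∪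
      (closureDir h k W).image (fun x => x - (2 : ℝ) • halfStep h j)

/-- The outward normal `n_k` of `W` in direction `k`, extended by `0` outside `∂_k W`. -/
def normal {d : ℕ} (h : ℝ) (k : Fin d) (W : Finset (E d)) (x : E d) : ℝ :=
  open scoped Classical in
  if x ∈ bdryDir h k W then
    if x - halfStep h k ∈ star h k W ∧ x + halfStep h k ∉ star h k W then 1
    else if x - halfStep h k ∉ star h k W ∧ x + halfStep h k ∈ star h k W then -1
    else 0
  else 0

/-- `∂_k^+ W`. -/
def bdryPos {d : ℕ} (h : ℝ) (k : Fin d) (W : Finset (E d)) : Finset (E d) :=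
  open scoped Classical in (bdryDir h k W).filter fun x => normal h k W x = 1

/-- `∂_k^- W`. -/
def bdryNeg {d : ℕ} (h : ℝ) (k : Fin d) (W : Finset (E d)) : Finset (E d) :=
  open scoped Classical in (bdryDir h k W).filter fun x => normal h k W x = -1

/-! ### Difference, average and trace operators

A mesh function is represented by a function on `ℝ^d`; only its values on the relevant mesh are
ever used. -/

/-- `D_k u (x) = (u(x + (h/2) e_k) - u(x - (h/2) e_k)) / h`. -/
def D {d : ℕ} (h : ℝ) (k : Fin d) (u : E d → ℝ) (x : E d) : ℝ :=
  (u (x + halfStep h k) - u (x - halfStep h k)) / h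

/-- `A_k u (x) = (u(x + (h/2) e_k) + u(x - (h/2) e_k)) / 2`. -/
def A {d : ℕ} (h : ℝ) (k : Fin d) (u : E d → ℝ) (x : E d) : ℝ :=
  (u (x + halfStep h k) + u (x - halfStep h k)) / 2

/-- The trace `t_r^k`, for the set `W` (extended by `0` outside `∂_k W`). -/
def trace {d : ℕ} (h : ℝ) (k : Fin d) (W : Finset (E d)) (u : E d → ℝ) (x : E d) : ℝ :=
  open scoped Classical in
  if normal h k W x = 1 then u (x - halfStep h k)
  else if normal h k W x = -1 then u (x + halfStep h k)
  else 0

/-- The discrete operator `Δ_h u = ∑_k D_k (σ^k D_k u)`. -/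
def laplacian {d : ℕ} (h : ℝ) (σ : Fin d → E d → ℝ) (u : E d → ℝ) (x : E d) : ℝ :=
  ∑ k, D h k (fun y => σ k y * D h k u y) x

/-- The discrete normal derivative `∂_n u = ∑_k t_r^k(σ^k D_k u) n_k`. -/
def normalDeriv {d : ℕ} (h : ℝ) (W : Finset (E d)) (σ : Fin d → E d → ℝ) (u : E d → ℝ)
    (x : E d) : ℝ :=
  ∑ k, trace h k W (fun y => σ k y * D h k u y) x * normal h k W x

/-! ### Norms -/

/-- `‖u‖_{L_h^∞(W)} = max_{x ∈ W} |u(x)|` (and `0` if `W` is empty). -/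
def normLInf {d : ℕ} (W : Finset (E d)) (u : E d → ℝ) : ℝ :=
  ((W.sup fun x => ‖u x‖₊ : ℝ≥0) : ℝ)

/-- `‖u‖_{L_h^2(W)}^2 = h^d ∑_{x ∈ W} |u(x)|^2`. -/
def sqNormL2 {d : ℕ} (h : ℝ) (W : Finset (E d)) (u : E d → ℝ) : ℝ :=
  h ^ d * ∑ x ∈ W, |u x| ^ 2

/-- `‖u‖_{H_h^1(W)}`, with square `‖u‖_{L_h^2(W̄)}^2 + ∑_k ∫_{W_k^*} |D_k u|^2`. -/
def normH1 {d : ℕ} (h : ℝ) (W : Finset (E d)) (u : E d → ℝ) : ℝ :=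
  Real.sqrt (sqNormL2 h (meshClosure h W) u + ∑ k, sqNormL2 h (star h k W) (D h k u))

/-- The boundary norm `|g|_{L_h^2(Γ_h)} = (h^{d-1} ∑_{x ∈ Γ_h} |g(x)|^2)^{1/2}`. -/
def bdryNormL2 {d : ℕ} (h : ℝ) (G : Finset (E d)) (g : E d → ℝ) : ℝ :=
  Real.sqrt (h ^ (d - 1) * ∑ x ∈ G, |g x| ^ 2)

/-! ### The unit cube and its meshes -/

/-- `Ω = (0,1)^d`. -/
def cube (d : ℕ) : Set (E d) := {x | ∀ i, 0 < x i ∧ x i < 1}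

/-- `h = 1/(N+1)`. -/
def meshSize (N : ℕ) : ℝ := 1 / ((N : ℝ) + 1)

/-- `K_h = h [[0, N+1]]^d`. -/
def grid (d N : ℕ) : Finset (E d) :=
  open scoped Classical in
  Finset.univ.image fun m : Fin d → Fin (N + 2) =>
    (WithLp.toLp 2 fun i => meshSize N * ((m i : ℕ) : ℝ) : E d)

/-- `S_h = S ∩ K_h` for a set `S ⊆ ℝ^d`. -/
def sample {d : ℕ} (N : ℕ) (S : Set (E d)) : Finset (E d) :=
  open scoped Classical in (grid d N).filter fun x => x ∈ S

/-- `Ω_h = Ω ∩ K_h`. -/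
def cubeMesh (d N : ℕ) : Finset (E d) := sample N (cube d)

/-- `∂Ω_h = ∂Ω ∩ K_h`. -/
def cubeBdry (d N : ℕ) : Finset (E d) := sample N (frontier (cube d))

/-- `ω(r) = {x ∈ Ω : dist(x, ∂Ω) < r}`. -/
def collar (d : ℕ) (r : ℝ) : Set (E d) :=
  {x | x ∈ cube d ∧ Metric.infDist x (frontier (cube d)) < r}

/-- `ω(r₁, r₂) = {x ∈ Ω : r₁ < dist(x, ∂Ω) < r₂}`. -/
def shell (d : ℕ) (r₁ r₂ : ℝ) : Set (E d) :=
  {x | x ∈ cube d ∧ r₁ < Metric.infDist x (frontier (cube d)) ∧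
    Metric.infDist x (frontier (cube d)) < r₂}

/-! ### The coefficients -/

/-- `ε_d(h) = ∑_{k,j} ‖D_j σ^k‖` with the maximum norm on the closure of `Ω_h` in direction `k`. -/
def epsD {d : ℕ} (N : ℕ) (σ : Fin d → E d → ℝ) : ℝ :=
  ∑ k, ∑ j, normLInf (closureDir (meshSize N) k (cubeMesh d N)) (D (meshSize N) j (σ k))

/-- `ε_a(h) = ∑_{k,j} ‖A_j σ^k - 1‖` with the maximum norm on the closure of `Ω_h` in
direction `k`. -/
def epsA {d : ℕ} (N : ℕ) (σ : Fin d → E d → ℝ) : ℝ :=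
  ∑ k, ∑ j, normLInf (closureDir (meshSize N) k (cubeMesh d N))
    (fun x => A (meshSize N) j (σ k) x - 1)

/-- `M(h) = ∑_k ‖σ^k‖` with the maximum norm on `(Ω̄_h)_k^*`. -/
def coeffBound {d : ℕ} (N : ℕ) (σ : Fin d → E d → ℝ) : ℝ :=
  ∑ k, normLInf (star (meshSize N) k (meshClosure (meshSize N) (cubeMesh d N))) (σ k)

/-- The coefficients `σ^1, …, σ^d` are positive continuous functions on the closed cube (their
values outside enter only through the half steps across the boundary in the three quantities
below) such that, over the mesh sizes `h ≤ h₁`, `M(h)` is bounded and `ε_d(h), ε_a(h) < 1`. -/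
structure CoeffAssumption {d : ℕ} (h₁ : ℝ) (σ : Fin d → E d → ℝ) : Prop where
  continuousOn : ∀ k, ContinuousOn (σ k) (closure (cube d))
  pos : ∀ k, ∀ x ∈ closure (cube d), 0 < σ k x
  bounded : ∃ M₀ : ℝ, ∀ N : ℕ, meshSize N ≤ h₁ → coeffBound N σ ≤ M₀
  epsD_lt : ∀ N : ℕ, meshSize N ≤ h₁ → epsD N σ < 1
  epsA_lt : ∀ N : ℕ, meshSize N ≤ h₁ → epsA N σ < 1

end DiscreteUC

end

/-! The boundary data are converted into interior data, so no Carleman estimate up to the boundary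
is needed. Extend `u` by zero to a periodic mesh on `[-1,2)^d`. Since `u` vanishes on the boundary,
the extension solves the equation inside the cube, is zero outside, and at a face point away from
the edges the undivided operator applied to it equals `-h ∂_n u` (`ellip_ext_face`). In a small ball
centred on a face point of `Γ` this surface source is removed by a function `w` solving a Dirichlet
problem with exactly that source. The Poincaré and trace inequalities bound the energy of `w` by the
norm of `∂_n u` on `Γ` (`exists_lift`). The difference `v` of the extension and `w` then satisfies
`|Lv| ≤ h² (M|v| + |Mw|)` in the connected open set made of the collar and the ball, and beyond the
face `v = -w` is already controlled (`FacePatch.exists_config`).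

What remains is propagation of smallness in the interior. `Good` records that the energy in a set is
at most `C (e^{-ατ} QA + e^{βτ} QB)`, with `QA` the total energy and `QB` the data. A Carleman
estimate with weight `φ = ψ + λψ²/2`, `ψ = s - |x-y|²`, passes this property from a ball to a
slightly larger concentric ball; the exponential loss is compensated by running the step at a fixed
fraction of `τ` (`Good.of_propagate`, `exists_good_step`). Iteration gives all concentric balls
inside the region (`Good.ball`), an open-and-closed argument reaches every point, and compactness
reaches a neighbourhood of the shell (`good_of_isCompact`).

For the Carleman estimate (`carleman_core`, `carleman`), the conjugated operator is, up to first
order terms carrying a factor `h`, a sum `S + T` of a part that is symmetric and a part that is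
antisymmetric to leading order. From `‖(S+T)V‖² ≥ ‖SV‖² + 2⟨SV,TV⟩`, exact summation by parts turns
the inner product into a quadratic form governed by the Hessian of `φ`, plus remainders containing
second differences. The form is positive for large `λ` after a zero order multiplier `m` has been
shifted between the two parts (`grad_form_lower`, `zero_form_lower`). The second differences are
absorbed by a fraction of order `1/τ` of `‖SV‖²`, through discrete `H²` regularity (`hessSq_le`).
All this needs `τ` large and `τh` small.

The coefficients need only two facts. Letting the mesh size tend to zero in the hypotheses shows
that each `σ^k` lies in `[2/3, 4/3]` in the cube and is `1`-Lipschitz along coordinate directions.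
-/

namespace DiscreteUC

/-! ### Difference calculus and summation by parts on a finite abelian group -/

section Calculus

variable {G : Type*} [AddCommGroup G]

/-- The undivided forward difference of `f` along the step `e`. -/
def fd (e : G) (f : G → ℝ) (n : G) : ℝ := f (n + e) - f n

/-- The undivided symmetric second difference of `f` along the step `e`. -/
def sd (e : G) (f : G → ℝ) (n : G) : ℝ := f (n + e) + f (n - e) - 2 * f n

/-- The undivided central difference of `f` along the step `e`. -/
def cd (e : G) (f : G → ℝ) (n : G) : ℝ := f (n + e) - f (n - e)

theorem fd_mul (e : G) (f g : G → ℝ) (n : G) :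
    fd e (fun n => f n * g n) n = fd e f n * g (n + e) + f n * fd e g n := by
  simp only [fd]; ring

theorem sd_eq (e : G) (f : G → ℝ) (n : G) : sd e f n = fd e f n - fd e f (n - e) := by
  simp only [fd, sd, sub_add_cancel]; ring

theorem fd_sd_comm (e e' : G) (f : G → ℝ) (n : G) : fd e (sd e' f) n = sd e' (fd e f) n := by
  simp only [fd, sd, add_right_comm n e e', add_sub_right_comm n e e']; ring

theorem fd_cd_comm (e e' : G) (f : G → ℝ) (n : G) : fd e (cd e' f) n = cd e' (fd e f) n := by
  simp only [fd, cd, add_right_comm n e e', add_sub_right_comm n e e']; ring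

variable [Fintype G]

theorem sum_shift (e : G) (f : G → ℝ) : ∑ n, f (n + e) = ∑ n, f n :=
  Fintype.sum_equiv (Equiv.addRight e) _ _ fun _ => rfl

theorem sum_shift_sub (e : G) (f : G → ℝ) : ∑ n, f (n - e) = ∑ n, f n :=
  Fintype.sum_equiv (Equiv.subRight e) _ _ fun _ => rfl

theorem sum_by_parts (e : G) (f g : G → ℝ) :
    ∑ n, f n * (g n - g (n - e)) = -∑ n, fd e f n * g n := by
  have h1 := sum_shift_sub e fun n => f (n + e) * g n
  simp only [sub_add_cancel] at h1
  simp only [fd, mul_sub, sub_mul, Finset.sum_sub_distrib, h1]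
  ring

/-- Central differences are antisymmetric: after a translation each product `V n * V (n + e)`
appears with weight `r n - r (n + e)`, so only the variation of the weight survives. -/
theorem sum_mul_cd (e : G) (r V : G → ℝ) :
    ∑ n, r n * V n * cd e V n = -∑ n, fd e r n * (V n * V (n + e)) := by
  have h1 := sum_shift e fun n => r n * V n * V (n - e)
  simp only [add_sub_cancel_right] at h1
  simp only [cd, mul_sub, Finset.sum_sub_distrib, fd, sub_mul, ← h1]
  rw [← Finset.sum_sub_distrib, ← Finset.sum_sub_distrib, ← Finset.sum_neg_distrib]
  exact Finset.sum_congr rfl fun n _ => by ring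

theorem sum_mul_sd (e : G) (w V : G → ℝ) :
    ∑ n, w n * V n * sd e V n =
      -∑ n, w n * fd e V n ^ 2 - ∑ n, fd e w n * V (n + e) * fd e V n := by
  have h1 := sum_by_parts e (fun n => w n * V n) (fd e V)
  simp only [← sd_eq] at h1
  rw [h1, ← neg_add', ← Finset.sum_add_distrib]
  congr 1
  exact Finset.sum_congr rfl fun n _ => by rw [fd_mul]; ring

/-- Summing by parts in `e` leaves the top order term `γ * fd e V * cd e' (fd e V)`. This is a
central difference paired with the function itself, so `sum_mul_cd` moves it onto `γ` as well. It is
the discrete form of the multiplier computation for the principal part of the commutator. -/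
theorem sum_sd_mul_cd (e e' : G) (γ V : G → ℝ) :
    ∑ n, γ n * sd e V n * cd e' V n =
      -∑ n, fd e γ n * (fd e V n * cd e' V (n + e)) +
        ∑ n, fd e' γ n * (fd e V n * fd e V (n + e')) := by
  have h1 := sum_by_parts e (fun n => γ n * cd e' V n) (fd e V)
  have h2 := sum_mul_cd e' γ (fd e V)
  have h3 : ∑ n, γ n * sd e V n * cd e' V n =
      ∑ n, γ n * cd e' V n * (fd e V n - fd e V (n - e)) :=
    Finset.sum_congr rfl fun n _ => by rw [sd_eq]; ring
  rw [h3, h1]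
  have h4 : ∑ n, fd e (fun n => γ n * cd e' V n) n * fd e V n =
      ∑ n, fd e γ n * (fd e V n * cd e' V (n + e)) + ∑ n, γ n * fd e V n * cd e' (fd e V) n := by
    rw [← Finset.sum_add_distrib]
    exact Finset.sum_congr rfl fun n _ => by rw [fd_mul, fd_cd_comm]; ring
  rw [h4, h2]; ring

/-- Two integrations by parts turn a product of pure second differences into the square of the mixed
one. The errors carry a difference of `γ` and are of lower order. This is the mechanism of `H²`
regularity. -/
theorem sum_sd_mul_sd (e e' : G) (γ V : G → ℝ) :
    ∑ n, γ n * sd e V n * sd e' V n =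
      ∑ n, γ n * fd e' (fd e V) n ^ 2 +
        ∑ n, fd e' γ n * fd e V (n + e') * fd e' (fd e V) n -
        ∑ n, fd e γ n * fd e V n * sd e' V (n + e) := by
  have h1 := sum_by_parts e (fun n => γ n * sd e' V n) (fd e V)
  have h2 := sum_mul_sd e' γ (fd e V)
  have h3 : ∑ n, γ n * sd e V n * sd e' V n =
      ∑ n, γ n * sd e' V n * (fd e V n - fd e V (n - e)) :=
    Finset.sum_congr rfl fun n _ => by rw [sd_eq]; ring
  rw [h3, h1]
  have h4 : ∑ n, fd e (fun n => γ n * sd e' V n) n * fd e V n =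
      ∑ n, fd e γ n * fd e V n * sd e' V (n + e) + ∑ n, γ n * fd e V n * sd e' (fd e V) n := by
    rw [← Finset.sum_add_distrib]
    exact Finset.sum_congr rfl fun n _ => by rw [fd_mul, fd_sd_comm]; ring
  rw [h4, h2]; ring

end Calculus

/-! ### Taylor estimates for hyperbolic functions at small arguments -/

section Hyperbolic

theorem abs_mul_le_mul {x y X Y : ℝ} (hx : |x| ≤ X) (hy : |y| ≤ Y) : |x * y| ≤ X * Y := by
  rw [abs_mul]
  exact mul_le_mul hx hy (abs_nonneg _) ((abs_nonneg _).trans hx)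

theorem abs_add_le_add {x y X Y : ℝ} (hx : |x| ≤ X) (hy : |y| ≤ Y) : |x + y| ≤ X + Y :=
  (abs_add_le _ _).trans (add_le_add hx hy)

theorem cosh_sub_one_le {x r : ℝ} (hr : r ≤ 1) (hx : |x| ≤ r) : |Real.cosh x - 1| ≤ r ^ 2 := by
  have h0 := abs_nonneg x
  have h1 : Real.cosh x ≤ Real.exp (x ^ 2 / 2) := Real.cosh_le_exp_half_sq x
  have h2 : |x ^ 2 / 2| ≤ 1 := by
    rw [abs_of_nonneg (by positivity), ← sq_abs]; nlinarith
  have h3 := Real.abs_exp_sub_one_le h2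
  rw [abs_of_nonneg (a := x ^ 2 / 2) (by positivity)] at h3
  have h4 := abs_le.mp h3
  have h5 := Real.one_le_cosh x
  rw [abs_of_nonneg (by linarith)]
  have : x ^ 2 ≤ r ^ 2 := by rw [← sq_abs x]; gcongr
  linarith

/-- Mean value inequality on `[-r, r]`. The expansions below form a ladder: each remainder is the
derivative of the next, so one application of this bound raises the order by one. -/
theorem abs_image_sub_le_of_deriv {f f' : ℝ → ℝ} {r C a b : ℝ}
    (hf : ∀ x, HasDerivAt f (f' x) x) (hC : ∀ x, |x| ≤ r → |f' x| ≤ C)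
    (ha : |a| ≤ r) (hb : |b| ≤ r) : |f b - f a| ≤ C * |b - a| := by
  have := (convex_Icc (-r) r).norm_image_sub_le_of_norm_hasDerivWithin_le (f := f) (f' := f')
    (C := C) (fun x _ => (hf x).hasDerivWithinAt) (fun x hx => hC x (abs_le.mpr hx))
    (abs_le.mp ha) (abs_le.mp hb)
  simpa [Real.norm_eq_abs] using this

theorem sinh_sub_sub_le {r a b : ℝ} (hr : r ≤ 1) (ha : |a| ≤ r) (hb : |b| ≤ r) :
    |Real.sinh b - Real.sinh a - (b - a)| ≤ r ^ 2 * |b - a| := by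
  have := abs_image_sub_le_of_deriv (f := fun x => Real.sinh x - x)
    (fun x => (Real.hasDerivAt_sinh x).sub (hasDerivAt_id x))
    (fun x hx => cosh_sub_one_le hr hx) ha hb
  rwa [show Real.sinh b - b - (Real.sinh a - a) = Real.sinh b - Real.sinh a - (b - a) by ring]
    at this

theorem abs_sinh_sub_le {r x : ℝ} (hr : r ≤ 1) (hx : |x| ≤ r) : |Real.sinh x - x| ≤ r ^ 3 := by
  have h0 : 0 ≤ r := (abs_nonneg _).trans hx
  have := sinh_sub_sub_le hr (a := 0) (by simpa using h0) hx
  simp only [Real.sinh_zero, sub_zero] at this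
  nlinarith [sq_nonneg r]

theorem abs_sinh_le {r x : ℝ} (hr : r ≤ 1) (hx : |x| ≤ r) : |Real.sinh x| ≤ 2 * r := by
  have h0 : 0 ≤ r := (abs_nonneg _).trans hx
  have h := abs_add_le_add (abs_sinh_sub_le hr hx) hx
  rw [sub_add_cancel] at h
  nlinarith [mul_nonneg h0 h0]

theorem cosh_sub_le {r a b : ℝ} (hr : r ≤ 1) (ha : |a| ≤ r) (hb : |b| ≤ r) :
    |Real.cosh b - Real.cosh a| ≤ 2 * r * |b - a| :=
  abs_image_sub_le_of_deriv Real.hasDerivAt_cosh (fun _ hx => abs_sinh_le hr hx) ha hb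

theorem cosh_sub_half_sq_le {r a b : ℝ} (hr : r ≤ 1) (ha : |a| ≤ r) (hb : |b| ≤ r) :
    |Real.cosh b - Real.cosh a - (b ^ 2 - a ^ 2) / 2| ≤ r ^ 3 * |b - a| := by
  have h : ∀ x, HasDerivAt (fun x : ℝ => Real.cosh x - x ^ 2 / 2) (Real.sinh x - x) x := by
    intro x
    refine ((Real.hasDerivAt_cosh x).sub ((hasDerivAt_pow 2 x).div_const 2)).congr_deriv ?_
    push_cast
    ring
  have := abs_image_sub_le_of_deriv h (fun x hx => abs_sinh_sub_le hr hx) ha hb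
  rwa [show Real.cosh b - b ^ 2 / 2 - (Real.cosh a - a ^ 2 / 2) =
    Real.cosh b - Real.cosh a - (b ^ 2 - a ^ 2) / 2 by ring] at this


/-- Expansions of `sinh` and `cosh` at two neighbouring points `p`, `p'` of size `O(ε)` whose
difference is `ε h Φ` up to higher order; `ζ` dominates both `ε` and `h`. -/
theorem sinh_cosh_expansion {B ε h ζ p p' Φ : ℝ} (hB : 1 ≤ B) (hε : 0 ≤ ε) (hh : 0 ≤ h)
    (hεζ : ε ≤ ζ) (hhζ : h ≤ ζ) (hBε : B * ε ≤ 1) (hζ : ζ ≤ 1)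
    (hp : |p| ≤ B * ε) (hp' : |p'| ≤ B * ε) (hΦ : |Φ| ≤ B)
    (hd : |p' - p - ε * h * Φ| ≤ B * (ε * h) * ζ) :
    |p' - p| ≤ 2 * B * (ε * h) ∧ |Real.sinh p' - Real.sinh p| ≤ 4 * B * (ε * h) ∧
    |Real.sinh p' - Real.sinh p - ε * h * Φ| ≤ 3 * B ^ 3 * (ε * h) * ζ ∧
    |Real.cosh p' - Real.cosh p| ≤ 4 * B ^ 2 * (ε * h) * ε ∧
    |Real.cosh p' - Real.cosh p - p * (ε * h * Φ)| ≤ 5 * B ^ 4 * (ε * h) * ε * ζ := by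
  have hμ : 0 ≤ ε * h := mul_nonneg hε hh
  have hζ0 : 0 ≤ ζ := hε.trans hεζ
  have hB0 : 0 ≤ B := by linarith
  have hr0 : 0 ≤ B * ε := mul_nonneg hB0 hε
  have h1 : |p' - p| ≤ 2 * B * (ε * h) := by
    have := abs_add_le_add hd (abs_mul_le_mul (le_of_eq (abs_of_nonneg hμ)) hΦ)
    rw [sub_add_cancel] at this
    nlinarith [mul_nonneg hB0 hμ, mul_nonneg (mul_nonneg hB0 hμ) (sub_nonneg.mpr hζ)]
  have h2 := sinh_sub_sub_le hBε hp hp'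
  have h3 := cosh_sub_le hBε hp hp'
  have h4 := cosh_sub_half_sq_le hBε hp hp'
  have hr2 : (B * ε) ^ 2 ≤ B ^ 2 * ζ := by
    rw [mul_pow]
    have : ε ^ 2 ≤ ζ := by nlinarith
    gcongr
  have hr3 : (B * ε) ^ 3 ≤ B ^ 3 * ε * ζ := by
    have : (B * ε) ^ 3 = B ^ 3 * ε * ε ^ 2 := by ring
    rw [this]
    have : ε ^ 2 ≤ ζ := by nlinarith
    gcongr
  have hd0 := abs_nonneg (p' - p)
  refine ⟨h1, ?_, ?_, ?_, ?_⟩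
  · have := abs_add_le_add h2 h1
    rw [sub_add_cancel] at this
    have h5 : (B * ε) ^ 2 * |p' - p| ≤ 1 * |p' - p| := by
      gcongr; exact pow_le_one₀ hr0 hBε
    linarith
  · have := abs_add_le_add h2 hd
    rw [show Real.sinh p' - Real.sinh p - (p' - p) + (p' - p - ε * h * Φ) =
      Real.sinh p' - Real.sinh p - ε * h * Φ by ring] at this
    refine this.trans ?_
    have h5 : (B * ε) ^ 2 * |p' - p| ≤ B ^ 2 * ζ * (2 * B * (ε * h)) := by gcongr
    have h6 : B * (ε * h) * ζ ≤ B ^ 3 * (ε * h) * ζ := by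
      gcongr; exact le_self_pow₀ hB (by norm_num)
    nlinarith
  · refine h3.trans ?_
    calc 2 * (B * ε) * |p' - p| ≤ 2 * (B * ε) * (2 * B * (ε * h)) := by gcongr
      _ = _ := by ring
  -- The increment of `cosh` is compared with `(p'² - p²)/2 = p (p' - p) + (p' - p)²/2`. The last
  -- square is of size `(ε h)²`, and its second factor `h` is what supplies `ζ`.
  · have e1 : |p' - p| * |p' - p| ≤ 2 * B * (ε * h) * (2 * B * (ε * h)) := by gcongr
    have h7 : |(p' - p) * (p' - p) / 2| ≤ 2 * B ^ 2 * (ε * h) * (ε * h) := by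
      rw [abs_div, abs_mul, abs_two]; nlinarith
    have h8 := abs_add_le_add (abs_add_le_add h4 h7) (abs_mul_le_mul hp hd)
    rw [show Real.cosh p' - Real.cosh p - (p' ^ 2 - p ^ 2) / 2 + (p' - p) * (p' - p) / 2 +
      p * (p' - p - ε * h * Φ) = Real.cosh p' - Real.cosh p - p * (ε * h * Φ) by ring] at h8
    refine h8.trans ?_
    have b1 : (B * ε) ^ 3 * |p' - p| ≤ 2 * B ^ 4 * (ε * h) * ε * ζ := by
      calc (B * ε) ^ 3 * |p' - p| ≤ B ^ 3 * ε * ζ * (2 * B * (ε * h)) := by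
            gcongr
        _ = _ := by ring
    have b2 : 2 * B ^ 2 * (ε * h) * (ε * h) ≤ 2 * B ^ 4 * (ε * h) * ε * ζ := by
      calc 2 * B ^ 2 * (ε * h) * (ε * h) = 2 * B ^ 2 * (ε * h) * ε * h := by ring
        _ ≤ _ := by
            gcongr ?_ * _ * _ * ?_
            have : B ^ 2 ≤ B ^ 4 := pow_le_pow_right₀ hB (by norm_num)
            linarith
    have b3 : B * ε * (B * (ε * h) * ζ) ≤ B ^ 4 * (ε * h) * ε * ζ := by
      calc B * ε * (B * (ε * h) * ζ) = B ^ 2 * (ε * h) * ε * ζ := by ring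
        _ ≤ _ := by
            gcongr ?_ * _ * _ * ?_
            exact pow_le_pow_right₀ hB (by norm_num)
    linarith

end Hyperbolic

/-! ### First variation of the commutator coefficients across one mesh edge -/

section LocalExpansion

variable {d : ℕ}

/-- `α_k β_j`, the product of the leading coefficient of the symmetric part in direction `k` and of
the coefficient of the antisymmetric part in direction `j`. -/
noncomputable def gam (ε : ℝ) (a g : Fin d → ℝ) (k j : Fin d) : ℝ :=
  a k * a j * (Real.cosh (ε * g k) * Real.sinh (ε * g j))

/-- The zero order coefficient of the symmetric part. -/
noncomputable def rho (ε : ℝ) (a g : Fin d → ℝ) : ℝ := ∑ k, a k * (2 * (Real.cosh (ε * g k) - 1))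

/-- Coefficients `a`, `a'` and gradients `g`, `g'` at two neighbouring mesh points; `Φ` is the row
of the Hessian in the direction of the step. -/
structure LocalStep (B ε h ζ : ℝ) (a a' g g' Φ : Fin d → ℝ) : Prop where
  one_le : 1 ≤ B
  eps_nonneg : 0 ≤ ε
  h_nonneg : 0 ≤ h
  eps_le : ε ≤ ζ
  h_le : h ≤ ζ
  zeta_le : ζ ≤ 1
  mul_le : B * ε ≤ 1
  a_nonneg : ∀ k, 0 ≤ a k
  a_le : ∀ k, a k ≤ 4 / 3
  a_nonneg' : ∀ k, 0 ≤ a' k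
  a_le' : ∀ k, a' k ≤ 4 / 3
  a_sub : ∀ k, |a' k - a k| ≤ h
  g_le : ∀ k, |g k| ≤ B
  g_le' : ∀ k, |g' k| ≤ B
  hess_le : ∀ k, |Φ k| ≤ B
  g_sub : ∀ k, |g' k - g k - h * Φ k| ≤ B * h * ζ

variable {B ε h ζ : ℝ} {a a' g g' Φ : Fin d → ℝ}

namespace LocalStep

theorem arg_le (H : LocalStep B ε h ζ a a' g g' Φ) (k : Fin d) : |ε * g k| ≤ B * ε := by
  rw [abs_mul, abs_of_nonneg H.eps_nonneg, mul_comm]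
  exact mul_le_mul_of_nonneg_right (H.g_le k) H.eps_nonneg

theorem arg_le' (H : LocalStep B ε h ζ a a' g g' Φ) (k : Fin d) : |ε * g' k| ≤ B * ε := by
  rw [abs_mul, abs_of_nonneg H.eps_nonneg, mul_comm]
  exact mul_le_mul_of_nonneg_right (H.g_le' k) H.eps_nonneg

theorem expansion (H : LocalStep B ε h ζ a a' g g' Φ) (k : Fin d) :
    |ε * g' k - ε * g k| ≤ 2 * B * (ε * h) ∧
    |Real.sinh (ε * g' k) - Real.sinh (ε * g k)| ≤ 4 * B * (ε * h) ∧
    |Real.sinh (ε * g' k) - Real.sinh (ε * g k) - ε * h * Φ k| ≤ 3 * B ^ 3 * (ε * h) * ζ ∧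
    |Real.cosh (ε * g' k) - Real.cosh (ε * g k)| ≤ 4 * B ^ 2 * (ε * h) * ε ∧
    |Real.cosh (ε * g' k) - Real.cosh (ε * g k) - ε * g k * (ε * h * Φ k)| ≤
      5 * B ^ 4 * (ε * h) * ε * ζ := by
  refine sinh_cosh_expansion H.one_le H.eps_nonneg H.h_nonneg H.eps_le H.h_le H.mul_le H.zeta_le
    (H.arg_le k) (H.arg_le' k) (H.hess_le k) ?_
  rw [show ε * g' k - ε * g k - ε * h * Φ k = ε * (g' k - g k - h * Φ k) by ring, abs_mul,
    abs_of_nonneg H.eps_nonneg]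
  calc ε * |g' k - g k - h * Φ k| ≤ ε * (B * h * ζ) :=
        mul_le_mul_of_nonneg_left (H.g_sub k) H.eps_nonneg
    _ = _ := by ring

/-- To first order `cosh` is `1` and `sinh (ε g_j)` is `ε g_j`, so the increment consists of the
Hessian term and of a term from the variation of the coefficients. Both have size `ε h`; everything
else gains a further factor `ζ`. -/
theorem gam_sub (H : LocalStep B ε h ζ a a' g g' Φ) (k j : Fin d) :
    |gam ε a' g' k j - gam ε a g k j -
      (ε * h * (a k * a j * Φ j) + (a' k * a' j - a k * a j) * (ε * g j))| ≤
      60 * B ^ 3 * (ε * h) * ζ := by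
  obtain ⟨-, hs, hs', hc, -⟩ := H.expansion j
  obtain ⟨-, -, -, hck, -⟩ := H.expansion k
  have hB := H.one_le
  have hε := H.eps_nonneg
  have hh := H.h_nonneg
  have hB0 : 0 ≤ B := by linarith
  have hζ0 : 0 ≤ ζ := hε.trans H.eps_le
  have hε2 : ε ^ 2 ≤ ζ := by nlinarith [H.eps_le, H.zeta_le]
  have hA : |a' k * a' j - a k * a j| ≤ 3 * h := by
    have := abs_add_le_add
      (abs_mul_le_mul (H.a_sub k) ((abs_of_nonneg (H.a_nonneg' j)).trans_le (H.a_le' j)))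
      (abs_mul_le_mul ((abs_of_nonneg (H.a_nonneg k)).trans_le (H.a_le k)) (H.a_sub j))
    rw [show (a' k - a k) * a' j + a k * (a' j - a j) = a' k * a' j - a k * a j by ring] at this
    linarith
  have hA0 : |a k * a j| ≤ 2 := by
    have := abs_mul_le_mul ((abs_of_nonneg (H.a_nonneg k)).trans_le (H.a_le k))
      ((abs_of_nonneg (H.a_nonneg j)).trans_le (H.a_le j))
    linarith
  have c1 := cosh_sub_one_le H.mul_le (H.arg_le' k)
  have s1 := abs_sinh_le H.mul_le (H.arg_le' j)
  have s0 := abs_sinh_le H.mul_le (H.arg_le j)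
  have s2 := abs_sinh_sub_le H.mul_le (H.arg_le j)
  unfold gam
  set c := Real.cosh (ε * g k)
  set c' := Real.cosh (ε * g' k)
  set s := Real.sinh (ε * g j)
  set s' := Real.sinh (ε * g' j)
  have hBB : B ≤ B ^ 3 := le_self_pow₀ hB (by norm_num)
  have e1 : |c' * s' - ε * g j| ≤ 7 * B ^ 3 * ε * ζ := by
    have := abs_add_le_add (abs_add_le_add (abs_mul_le_mul c1 s1) hs) s2
    rw [show (c' - 1) * s' + (s' - s) + (s - ε * g j) = c' * s' - ε * g j by ring] at this
    refine this.trans ?_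
    have b1 : (B * ε) ^ 2 * (2 * (B * ε)) ≤ 2 * B ^ 3 * ε * ζ := by
      calc _ = 2 * B ^ 3 * ε * ε ^ 2 := by ring
        _ ≤ _ := by gcongr
    have b2 : 4 * B * (ε * h) ≤ 4 * B ^ 3 * ε * ζ := by
      calc _ = 4 * B * ε * h := by ring
        _ ≤ _ := by gcongr; exact H.h_le
    have b3 : (B * ε) ^ 3 ≤ B ^ 3 * ε * ζ := by
      calc _ = B ^ 3 * ε * ε ^ 2 := by ring
        _ ≤ _ := by gcongr
    linarith
  have e2 : |c' * s' - c * s - ε * h * Φ j| ≤ 15 * B ^ 3 * (ε * h) * ζ := by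
    have := abs_add_le_add (abs_add_le_add (abs_mul_le_mul c1 hs) hs') (abs_mul_le_mul hck s0)
    rw [show (c' - 1) * (s' - s) + (s' - s - ε * h * Φ j) + (c' - c) * s =
      c' * s' - c * s - ε * h * Φ j by ring] at this
    refine this.trans ?_
    have b1 : (B * ε) ^ 2 * (4 * B * (ε * h)) ≤ 4 * B ^ 3 * (ε * h) * ζ := by
      calc _ = 4 * B ^ 3 * (ε * h) * ε ^ 2 := by ring
        _ ≤ _ := by gcongr
    have b3 : 4 * B ^ 2 * (ε * h) * ε * (2 * (B * ε)) ≤ 8 * B ^ 3 * (ε * h) * ζ := by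
      calc _ = 8 * B ^ 3 * (ε * h) * ε ^ 2 := by ring
        _ ≤ _ := by gcongr
    linarith
  have := abs_add_le_add (abs_mul_le_mul hA e1) (abs_mul_le_mul hA0 e2)
  rw [show (a' k * a' j - a k * a j) * (c' * s' - ε * g j) +
    a k * a j * (c' * s' - c * s - ε * h * Φ j) =
    a' k * a' j * (c' * s') - a k * a j * (c * s) -
      (ε * h * (a k * a j * Φ j) + (a' k * a' j - a k * a j) * (ε * g j)) by ring] at this
  refine this.trans ?_
  have : 0 ≤ B ^ 3 * (ε * h) * ζ := by positivity
  nlinarith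

/-- The leading part of `rho` is the squared length of the scaled gradient, since `2 (cosh p - 1)`
is `p²` up to fourth order. -/
theorem rho_sub_sq (H : LocalStep B ε h ζ a a' g g' Φ) :
    |rho ε a g - ∑ k, a k * (ε * g k) ^ 2| ≤ d * (3 * B ^ 4 * ε ^ 2 * ζ) := by
  have hε := H.eps_nonneg
  have hζ0 : 0 ≤ ζ := hε.trans H.eps_le
  have hε2 : ε ^ 2 ≤ ζ := by nlinarith [H.eps_le, H.zeta_le]
  have hB0 : 0 ≤ B := by linarith [H.one_le]
  rw [rho, ← Finset.sum_sub_distrib]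
  refine (Finset.abs_sum_le_sum_abs _ _).trans ((Finset.sum_le_card_nsmul _ _ _ ?_).trans_eq
    (by rw [Finset.card_univ, Fintype.card_fin, nsmul_eq_mul]))
  intro k _
  have h1 := cosh_sub_half_sq_le H.mul_le (a := 0)
    (by simpa using mul_nonneg hB0 hε) (H.arg_le k)
  rw [Real.cosh_zero, sub_zero] at h1
  have h2 := abs_mul_le_mul ((abs_of_nonneg (H.a_nonneg k)).trans_le (H.a_le k)) h1
  have h3 : (B * ε) ^ 3 * |ε * g k| ≤ B ^ 4 * ε ^ 2 * ζ := by
    calc (B * ε) ^ 3 * |ε * g k| ≤ (B * ε) ^ 3 * (B * ε) := by gcongr; exact H.arg_le k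
      _ = B ^ 4 * ε ^ 2 * ε ^ 2 := by ring
      _ ≤ _ := by gcongr
  rw [show a k * (2 * (Real.cosh (ε * g k) - 1)) - a k * (ε * g k) ^ 2 =
    2 * (a k * (Real.cosh (ε * g k) - 1 - ((ε * g k) ^ 2 - 0 ^ 2) / 2)) by ring, abs_mul, abs_two]
  have : 0 ≤ B ^ 4 * ε ^ 2 * ζ := by positivity
  nlinarith

theorem abs_rho_le (H : LocalStep B ε h ζ a a' g g' Φ) :
    |rho ε a g| ≤ d * (3 * B ^ 2 * ε ^ 2) := by
  refine (Finset.abs_sum_le_sum_abs _ _).trans ((Finset.sum_le_card_nsmul _ _ _ ?_).trans_eq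
    (by rw [Finset.card_univ, Fintype.card_fin, nsmul_eq_mul]))
  intro k _
  have h1 := cosh_sub_one_le H.mul_le (H.arg_le k)
  have h2 := abs_mul_le_mul ((abs_of_nonneg (H.a_nonneg k)).trans_le (H.a_le k)) h1
  rw [show a k * (2 * (Real.cosh (ε * g k) - 1)) = 2 * (a k * (Real.cosh (ε * g k) - 1)) by ring,
    abs_mul, abs_two]
  nlinarith [sq_nonneg (B * ε)]

/-- The first variation of `rho`. -/
theorem rho_sub (H : LocalStep B ε h ζ a a' g g' Φ) :
    |rho ε a' g' - rho ε a g -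
      ∑ k, ((a' k - a k) * (ε * g k) ^ 2 + 2 * a k * (ε * g k) * (ε * h * Φ k))| ≤
      d * (24 * B ^ 4 * (ε * h) * ε * ζ) := by
  have hε := H.eps_nonneg
  have hh := H.h_nonneg
  have hB := H.one_le
  have hζ0 : 0 ≤ ζ := hε.trans H.eps_le
  have hε2 : ε ^ 2 ≤ ζ := by nlinarith [H.eps_le, H.zeta_le]
  have hB0 : 0 ≤ B := by linarith [H.one_le]
  rw [rho, rho, ← Finset.sum_sub_distrib, ← Finset.sum_sub_distrib]
  refine (Finset.abs_sum_le_sum_abs _ _).trans ((Finset.sum_le_card_nsmul _ _ _ ?_).trans_eq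
    (by rw [Finset.card_univ, Fintype.card_fin, nsmul_eq_mul]))
  intro k _
  obtain ⟨-, -, -, hc, hc'⟩ := H.expansion k
  have h1 := cosh_sub_half_sq_le H.mul_le (a := 0)
    (by simpa using mul_nonneg hB0 hε) (H.arg_le k)
  rw [Real.cosh_zero, sub_zero] at h1
  have h3 : (B * ε) ^ 3 * |ε * g k| ≤ B ^ 4 * ε ^ 2 * ζ := by
    calc (B * ε) ^ 3 * |ε * g k| ≤ (B * ε) ^ 3 * (B * ε) := by gcongr; exact H.arg_le k
      _ = B ^ 4 * ε ^ 2 * ε ^ 2 := by ring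
      _ ≤ _ := by gcongr
  have h4 := abs_mul_le_mul (H.a_sub k) (abs_add_le_add hc (h1.trans h3))
  have h5 := abs_mul_le_mul ((abs_of_nonneg (H.a_nonneg k)).trans_le (H.a_le k)) hc'
  have h6 := abs_add_le_add h4 h5
  have e : a' k * (2 * (Real.cosh (ε * g' k) - 1)) - a k * (2 * (Real.cosh (ε * g k) - 1)) -
      ((a' k - a k) * (ε * g k) ^ 2 + 2 * a k * (ε * g k) * (ε * h * Φ k)) =
      2 * ((a' k - a k) * (Real.cosh (ε * g' k) - Real.cosh (ε * g k) +
        (Real.cosh (ε * g k) - 1 - ((ε * g k) ^ 2 - 0 ^ 2) / 2)) +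
      a k * (Real.cosh (ε * g' k) - Real.cosh (ε * g k) - ε * g k * (ε * h * Φ k))) := by ring
  rw [e, abs_mul, abs_two]
  have b1 : h * (4 * B ^ 2 * (ε * h) * ε) ≤ 4 * B ^ 4 * (ε * h) * ε * ζ := by
    calc _ = 4 * B ^ 2 * (ε * h) * ε * h := by ring
      _ ≤ _ := by
          have := pow_le_pow_right₀ hB (show 2 ≤ 4 by norm_num)
          have := H.h_le
          gcongr
  have : 0 ≤ B ^ 4 * (ε * h) * ε * ζ := by positivity
  nlinarith

/-- Product rule for `ρ β_j`, in which `ρ`, `β_j` and their increments are replaced by their leading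
parts. The main term has size `ε h ε²`, which is the scale of the zero order energy in the Carleman
estimate. -/
theorem rho_mul_sub (H : LocalStep B ε h ζ a a' g g' Φ) (j : Fin d) :
    |rho ε a' g' * (a' j * Real.sinh (ε * g' j)) - rho ε a g * (a j * Real.sinh (ε * g j)) -
      ((∑ k, ((a' k - a k) * (ε * g k) ^ 2 + 2 * a k * (ε * g k) * (ε * h * Φ k))) *
          (a j * (ε * g j)) +
        (∑ k, a k * (ε * g k) ^ 2) * ((a' j - a j) * (ε * g j) + a j * (ε * h * Φ j)))| ≤
      d * (150 * B ^ 5 * (ε * h) * ε ^ 2 * ζ) := by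
  have hε := H.eps_nonneg
  have hh := H.h_nonneg
  have hB := H.one_le
  have hζ0 : 0 ≤ ζ := hε.trans H.eps_le
  have hε2 : ε ^ 2 ≤ ζ := by nlinarith [H.eps_le, H.zeta_le]
  have hB0 : 0 ≤ B := by linarith [H.one_le]
  have hBB : B ≤ B ^ 3 := le_self_pow₀ hB (by norm_num)
  obtain ⟨-, hs, hs', -, -⟩ := H.expansion j
  have s1 := abs_sinh_le H.mul_le (H.arg_le' j)
  have s2 := abs_sinh_sub_le H.mul_le (H.arg_le j)
  have hD : |∑ k, ((a' k - a k) * (ε * g k) ^ 2 + 2 * a k * (ε * g k) * (ε * h * Φ k))| ≤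
      d * (4 * B ^ 2 * (ε * h) * ε) := by
    refine (Finset.abs_sum_le_sum_abs _ _).trans ((Finset.sum_le_card_nsmul _ _ _ ?_).trans_eq
      (by rw [Finset.card_univ, Fintype.card_fin, nsmul_eq_mul]))
    intro k _
    have h1 := H.arg_le k
    have h2 : |ε * h * Φ k| ≤ ε * h * B :=
      abs_mul_le_mul (le_of_eq (abs_of_nonneg (by positivity))) (H.hess_le k)
    have h3 := abs_add_le_add (abs_mul_le_mul (H.a_sub k) (abs_mul_le_mul h1 h1))
      (abs_mul_le_mul (abs_mul_le_mul ((abs_of_nonneg (H.a_nonneg k)).trans_le (H.a_le k)) h1) h2)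
    have h4 := abs_mul_le_mul (abs_mul_le_mul
      ((abs_of_nonneg (H.a_nonneg k)).trans_le (H.a_le k)) h1) h2
    rw [show (a' k - a k) * (ε * g k) ^ 2 + 2 * a k * (ε * g k) * (ε * h * Φ k) =
      (a' k - a k) * (ε * g k * (ε * g k)) + a k * (ε * g k) * (ε * h * Φ k) +
        a k * (ε * g k) * (ε * h * Φ k) by ring]
    refine (abs_add_le_add h3 h4).trans ?_
    have : 0 ≤ B ^ 2 * (ε * h) * ε := by positivity
    nlinarith
  have hr := H.rho_sub
  have hr0 := H.rho_sub_sq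
  have hr1 := H.abs_rho_le
  set D := ∑ k, ((a' k - a k) * (ε * g k) ^ 2 + 2 * a k * (ε * g k) * (ε * h * Φ k))
  set r0 := ∑ k, a k * (ε * g k) ^ 2
  set r := rho ε a g
  set r' := rho ε a' g'
  set s := Real.sinh (ε * g j)
  set s' := Real.sinh (ε * g' j)
  have ha := (abs_of_nonneg (H.a_nonneg j)).trans_le (H.a_le j)
  have ha' := (abs_of_nonneg (H.a_nonneg' j)).trans_le (H.a_le' j)
  have m1 : 4 * B * (ε * h) ≤ 4 * B ^ 3 * ε * ζ := by
    calc _ = 4 * B * ε * h := by ring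
      _ ≤ _ := by gcongr; exact H.h_le
  have m2 : (B * ε) ^ 3 ≤ B ^ 3 * ε * ζ := by
    calc _ = B ^ 3 * ε * ε ^ 2 := by ring
      _ ≤ _ := by gcongr
  have b1 : |a' j * s'| ≤ 3 * B * ε := by
    have := abs_mul_le_mul ha' s1
    nlinarith [mul_nonneg hB0 hε]
  have b2 : |s' - ε * g j| ≤ 5 * B ^ 3 * ε * ζ := by
    have := abs_add_le_add hs s2
    rw [sub_add_sub_cancel] at this
    linarith
  have b3 : |a' j * s' - a j * (ε * g j)| ≤ 10 * B ^ 3 * ε * ζ := by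
    have := abs_add_le_add (abs_mul_le_mul (H.a_sub j) s1) (abs_mul_le_mul ha b2)
    rw [show (a' j - a j) * s' + a j * (s' - ε * g j) = a' j * s' - a j * (ε * g j) by ring] at this
    have : 0 ≤ B ^ 3 * ε * ζ := by positivity
    nlinarith
  have b4 : |a' j * s' - a j * s - ((a' j - a j) * (ε * g j) + a j * (ε * h * Φ j))| ≤
      9 * B ^ 3 * (ε * h) * ζ := by
    have := abs_add_le_add (abs_mul_le_mul (H.a_sub j) b2) (abs_mul_le_mul ha hs')
    rw [show (a' j - a j) * (s' - ε * g j) + a j * (s' - s - ε * h * Φ j) =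
      a' j * s' - a j * s - ((a' j - a j) * (ε * g j) + a j * (ε * h * Φ j)) by ring] at this
    nlinarith
  have b5 : |(a' j - a j) * (ε * g j) + a j * (ε * h * Φ j)| ≤ 3 * B * (ε * h) := by
    have h2 : |ε * h * Φ j| ≤ ε * h * B :=
      abs_mul_le_mul (le_of_eq (abs_of_nonneg (by positivity))) (H.hess_le j)
    have := abs_add_le_add (abs_mul_le_mul (H.a_sub j) (H.arg_le j)) (abs_mul_le_mul ha h2)
    have : 0 ≤ B * (ε * h) := by positivity
    nlinarith
  -- An exact telescoping of the difference into four products, each with one factor already known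
  -- to be smaller by `ζ` than its natural size.
  have key := abs_add_le_add (abs_add_le_add (abs_add_le_add (abs_mul_le_mul hr b1)
    (abs_mul_le_mul hD b3)) (abs_mul_le_mul hr1 b4)) (abs_mul_le_mul hr0 b5)
  set β1 := (a' j - a j) * (ε * g j) + a j * (ε * h * Φ j)
  rw [show (r' - r - D) * (a' j * s') + D * (a' j * s' - a j * (ε * g j)) +
    r * (a' j * s' - a j * s - β1) + (r - r0) * β1 =
    r' * (a' j * s') - r * (a j * s) - (D * (a j * (ε * g j)) + r0 * β1) by ring] at key
  refine key.trans ?_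
  have : 0 ≤ d * (B ^ 5 * (ε * h) * ε ^ 2 * ζ) := by positivity
  nlinarith

theorem abs_lead_le (H : LocalStep B ε h ζ a a' g g' Φ) (k : Fin d) :
    |a k * Real.cosh (ε * g k)| ≤ 3 ∧ |a' k * Real.cosh (ε * g' k)| ≤ 3 := by
  have hr : (B * ε) ^ 2 ≤ 1 :=
    pow_le_one₀ (mul_nonneg (by linarith [H.one_le]) H.eps_nonneg) H.mul_le
  have h1 : ∀ p, |p| ≤ B * ε → |Real.cosh p| ≤ 2 := fun p hp => by
    have := (abs_le.mp (cosh_sub_one_le H.mul_le hp)).2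
    rw [abs_of_pos (Real.cosh_pos _)]
    linarith
  constructor
  · refine (abs_mul_le_mul ((abs_of_nonneg (H.a_nonneg k)).trans_le (H.a_le k))
      (h1 _ (H.arg_le k))).trans (by norm_num)
  · refine (abs_mul_le_mul ((abs_of_nonneg (H.a_nonneg' k)).trans_le (H.a_le' k))
      (h1 _ (H.arg_le' k))).trans (by norm_num)

theorem abs_lead_sub_le (H : LocalStep B ε h ζ a a' g g' Φ) (k : Fin d) :
    |a' k * Real.cosh (ε * g' k) - a k * Real.cosh (ε * g k)| ≤ 8 * B ^ 2 * h := by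
  have hε := H.eps_nonneg
  have hh := H.h_nonneg
  have hB := H.one_le
  have hε1 : ε ≤ 1 := H.eps_le.trans H.zeta_le
  obtain ⟨-, -, -, hc, -⟩ := H.expansion k
  have hr : (B * ε) ^ 2 ≤ 1 := pow_le_one₀ (mul_nonneg (by linarith) hε) H.mul_le
  have h1 : |Real.cosh (ε * g' k)| ≤ 2 := by
    have := (abs_le.mp (cosh_sub_one_le H.mul_le (H.arg_le' k))).2
    rw [abs_of_pos (Real.cosh_pos _)]
    linarith
  have h2 := abs_add_le_add (abs_mul_le_mul (H.a_sub k) h1)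
    (abs_mul_le_mul ((abs_of_nonneg (H.a_nonneg k)).trans_le (H.a_le k)) hc)
  rw [show (a' k - a k) * Real.cosh (ε * g' k) + a k * (Real.cosh (ε * g' k) - Real.cosh (ε * g k))
    = a' k * Real.cosh (ε * g' k) - a k * Real.cosh (ε * g k) by ring] at h2
  refine h2.trans ?_
  have h3 : 4 * B ^ 2 * (ε * h) * ε ≤ 4 * B ^ 2 * (1 * h) * 1 := by gcongr
  have h4 : 1 * h ≤ B ^ 2 * h := by
    gcongr; exact one_le_pow₀ hB
  linarith

/-- Only the order `ε h` matters here: this bound serves the remainders of the commutator identity,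
where the increment multiplies second differences. -/
theorem abs_gam_sub_le (H : LocalStep B ε h ζ a a' g g' Φ) (k j : Fin d) :
    |gam ε a' g' k j - gam ε a g k j| ≤ 66 * B ^ 3 * (ε * h) := by
  have hε := H.eps_nonneg
  have hh := H.h_nonneg
  have hB := H.one_le
  have hμ : 0 ≤ ε * h := mul_nonneg hε hh
  have hA : |a' k * a' j - a k * a j| ≤ 3 * h := by
    have := abs_add_le_add
      (abs_mul_le_mul (H.a_sub k) ((abs_of_nonneg (H.a_nonneg' j)).trans_le (H.a_le' j)))
      (abs_mul_le_mul ((abs_of_nonneg (H.a_nonneg k)).trans_le (H.a_le k)) (H.a_sub j))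
    rw [show (a' k - a k) * a' j + a k * (a' j - a j) = a' k * a' j - a k * a j by ring] at this
    linarith
  have hA0 : |a k * a j * Φ j| ≤ 2 * B := by
    have := abs_mul_le_mul (abs_mul_le_mul ((abs_of_nonneg (H.a_nonneg k)).trans_le (H.a_le k))
      ((abs_of_nonneg (H.a_nonneg j)).trans_le (H.a_le j))) (H.hess_le j)
    linarith
  have h1 := abs_add_le_add (H.gam_sub k j) (abs_add_le_add
    (abs_mul_le_mul (le_of_eq (abs_of_nonneg hμ)) hA0) (abs_mul_le_mul hA (H.arg_le j)))
  rw [sub_add_cancel] at h1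
  refine h1.trans ?_
  have h2 : 60 * B ^ 3 * (ε * h) * ζ ≤ 60 * B ^ 3 * (ε * h) * 1 := by
    have := H.zeta_le
    gcongr
  have h3 : B * (ε * h) ≤ B ^ 3 * (ε * h) := by
    gcongr; exact le_self_pow₀ hB (by norm_num)
  have h4 : 0 ≤ B ^ 3 * (ε * h) := by positivity
  linarith

theorem abs_rho_mul_sub_le (H : LocalStep B ε h ζ a a' g g' Φ) (j : Fin d) :
    |rho ε a' g' * (a' j * Real.sinh (ε * g' j)) - rho ε a g * (a j * Real.sinh (ε * g j))| ≤
      d * (66 * B ^ 3 * (ε * h) * ε ^ 2) := by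
  have hε := H.eps_nonneg
  have hh := H.h_nonneg
  have hB := H.one_le
  have hB0 : 0 ≤ B := by linarith
  obtain ⟨-, hs, -, -, -⟩ := H.expansion j
  have s1 := abs_sinh_le H.mul_le (H.arg_le' j)
  have h1 : |rho ε a' g' - rho ε a g| ≤ d * (13 * B ^ 2 * (ε * h) * ε) := by
    rw [rho, rho, ← Finset.sum_sub_distrib]
    refine (Finset.abs_sum_le_sum_abs _ _).trans ((Finset.sum_le_card_nsmul _ _ _ ?_).trans_eq
      (by rw [Finset.card_univ, Fintype.card_fin, nsmul_eq_mul]))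
    intro k _
    obtain ⟨-, -, -, hc, -⟩ := H.expansion k
    have h2 := abs_add_le_add
      (abs_mul_le_mul (H.a_sub k) (cosh_sub_one_le H.mul_le (H.arg_le' k)))
      (abs_mul_le_mul ((abs_of_nonneg (H.a_nonneg k)).trans_le (H.a_le k)) hc)
    rw [show a' k * (2 * (Real.cosh (ε * g' k) - 1)) - a k * (2 * (Real.cosh (ε * g k) - 1)) =
      2 * ((a' k - a k) * (Real.cosh (ε * g' k) - 1) +
        a k * (Real.cosh (ε * g' k) - Real.cosh (ε * g k))) by ring, abs_mul, abs_two]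
    have h3 : 0 ≤ B ^ 2 * (ε * h) * ε := by positivity
    linarith
  have b1 : |a' j * Real.sinh (ε * g' j)| ≤ 3 * B * ε := by
    have := abs_mul_le_mul ((abs_of_nonneg (H.a_nonneg' j)).trans_le (H.a_le' j)) s1
    linarith [mul_nonneg hB0 hε]
  have b2 : |a' j * Real.sinh (ε * g' j) - a j * Real.sinh (ε * g j)| ≤ 8 * B * (ε * h) := by
    have := abs_add_le_add (abs_mul_le_mul (H.a_sub j) s1)
      (abs_mul_le_mul ((abs_of_nonneg (H.a_nonneg j)).trans_le (H.a_le j)) hs)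
    rw [show (a' j - a j) * Real.sinh (ε * g' j) +
      a j * (Real.sinh (ε * g' j) - Real.sinh (ε * g j)) =
      a' j * Real.sinh (ε * g' j) - a j * Real.sinh (ε * g j) by ring] at this
    have h3 : 0 ≤ B * (ε * h) := by positivity
    linarith
  have h4 := abs_add_le_add (abs_mul_le_mul h1 b1) (abs_mul_le_mul H.abs_rho_le b2)
  rw [show (rho ε a' g' - rho ε a g) * (a' j * Real.sinh (ε * g' j)) +
    rho ε a g * (a' j * Real.sinh (ε * g' j) - a j * Real.sinh (ε * g j)) =
    rho ε a' g' * (a' j * Real.sinh (ε * g' j)) - rho ε a g * (a j * Real.sinh (ε * g j)) by ring]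
    at h4
  refine h4.trans ?_
  have : 0 ≤ d * (B ^ 3 * (ε * h) * ε ^ 2) := by positivity
  linarith

end LocalStep

end LocalExpansion

/-! ### Positivity of the commutator form for large convexity parameter -/

section Positivity

variable {d : ℕ}

/-- The Hessian `4 λ x_l x_k - 2 t δ_{lk}` of the weight. -/
noncomputable def hess (lam t : ℝ) (x : Fin d → ℝ) (l k : Fin d) : ℝ :=
  4 * lam * x l * x k - if l = k then 2 * t else 0

theorem sum_sum_sq (y : Fin d → ℝ) :
    ∑ k : Fin d, ∑ j : Fin d, (y k ^ 2 + y j ^ 2) / 2 = d * ∑ k, y k ^ 2 := by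
  simp_rw [add_div, Finset.sum_add_distrib, Finset.sum_const, Finset.card_univ, Fintype.card_fin,
    nsmul_eq_mul, ← Finset.mul_sum, ← Finset.sum_div]
  ring

theorem neg_le_sum_sum_mul {r : Fin d → Fin d → ℝ} {c : ℝ} (hr : ∀ k j, |r k j| ≤ c)
    (y : Fin d → ℝ) :
    -(c * (d * ∑ k, y k ^ 2)) ≤ ∑ k, ∑ j, r k j * (y k * y j) := by
  rw [← sum_sum_sq, Finset.mul_sum, ← Finset.sum_neg_distrib]
  refine Finset.sum_le_sum fun k _ => ?_
  rw [Finset.mul_sum, ← Finset.sum_neg_distrib]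
  refine Finset.sum_le_sum fun j _ => ?_
  have h1 := hr k j
  have h2 : |y k * y j| ≤ (y k ^ 2 + y j ^ 2) / 2 := by
    rw [abs_le]; constructor <;> nlinarith [sq_nonneg (y k + y j), sq_nonneg (y k - y j)]
  have h3 := abs_mul_le_mul h1 h2
  exact (abs_le.mp h3).1

theorem sum_sum_mul_sq_le {r : Fin d → Fin d → ℝ} {c : ℝ} (hr : ∀ k j, |r k j| ≤ c)
    (y : Fin d → ℝ) :
    ∑ k, ∑ j, r k j * y k ^ 2 ≤ c * (d * ∑ k, y k ^ 2) := by
  have : c * (d * ∑ k, y k ^ 2) = ∑ k : Fin d, ∑ _j : Fin d, c * y k ^ 2 := by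
    simp_rw [Finset.sum_const, Finset.card_univ, Fintype.card_fin, nsmul_eq_mul, Finset.mul_sum]
    exact Finset.sum_congr rfl fun k _ => by ring
  rw [this]
  refine Finset.sum_le_sum fun k _ => Finset.sum_le_sum fun j _ => ?_
  exact mul_le_mul_of_nonneg_right (abs_le.mp (hr k j)).2 (sq_nonneg _)

/-- The Hessian is a rank one matrix with factor `λ` minus a multiple of the identity: the former
contributes a square, the latter a negative term whose size does not depend on `λ`. -/
theorem sum_sum_hess (lam t : ℝ) (a x z : Fin d → ℝ) :
    ∑ k, ∑ j, a k * a j * hess lam t x k j * (z k * z j) =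
      lam * (∑ k, 2 * a k * x k * z k) ^ 2 - 2 * t * ∑ k, a k ^ 2 * z k ^ 2 := by
  rw [sq, Finset.sum_mul_sum, Finset.mul_sum, Finset.mul_sum, ← Finset.sum_sub_distrib]
  refine Finset.sum_congr rfl fun k _ => ?_
  rw [Finset.mul_sum]
  have : ∑ j, a k * a j * (if k = j then 2 * t else 0) * (z k * z j) =
      2 * t * (a k ^ 2 * z k ^ 2) := by
    rw [Finset.sum_eq_single k] <;> simp +contextual [eq_comm]
    ring
  rw [← this, ← Finset.sum_sub_distrib]
  refine Finset.sum_congr rfl fun j _ => ?_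
  simp only [hess]; ring

theorem sum_hess_diag (lam t : ℝ) (a x : Fin d → ℝ) :
    ∑ j, a j * hess lam t x j j = lam * (4 * ∑ k, a k * x k ^ 2) - 2 * t * ∑ j, a j := by
  simp only [hess, if_true, Finset.mul_sum, ← Finset.sum_sub_distrib]
  exact Finset.sum_congr rfl fun j _ => by ring

variable {B ε h ζ lam t κ X : ℝ} {a x : Fin d → ℝ} {a' g' : Fin d → Fin d → ℝ}

/-- Positivity of the part of the commutator that is quadratic in the gradient. -/
theorem grad_form_lower
    (H : ∀ l, LocalStep B ε h ζ a (a' l) (fun k => -2 * t * x k) (g' l) (hess lam t x l))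
    (ha : ∀ k, 2 / 3 ≤ a k) (hX : ∀ k, |x k| ≤ X) (ht : 0 ≤ t) (ht' : t ≤ 3 / 2)
    (hlam : 0 ≤ lam) (hκ : 0 ≤ κ) (y : Fin d → ℝ) :
    ε * h * ((4 / 3 * lam * κ - 64 / 3 - 54 * d * X - 360 * d * B ^ 3 * ζ) * ∑ k, y k ^ 2) ≤
      ∑ k, ∑ j, (4 * (gam ε (a' k) (g' k) k j - gam ε a (fun k => -2 * t * x k) k j) *
          (y k * y j) -
        2 * (gam ε (a' j) (g' j) k j - gam ε a (fun k => -2 * t * x k) k j) * y k ^ 2) +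
      ∑ k, 2 * (ε * h * lam * (4 * (∑ k, a k * x k ^ 2) + κ)) *
        (a k * Real.cosh (ε * (-2 * t * x k))) * y k ^ 2 := by
  rcases isEmpty_or_nonempty (Fin d) with hd | ⟨⟨k0⟩⟩
  · simp
  have hε := (H k0).eps_nonneg
  have hh := (H k0).h_nonneg
  have hμ : 0 ≤ ε * h := mul_nonneg hε hh
  have hX0 : 0 ≤ X := (abs_nonneg _).trans (hX k0)
  set g : Fin d → ℝ := fun k => -2 * t * x k with hg
  have hgX : ∀ k, |ε * g k| ≤ ε * (3 * X) := by
    intro k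
    refine abs_mul_le_mul (le_of_eq (abs_of_nonneg hε)) ?_
    have : |-2 * t| ≤ 3 := by rw [abs_mul, abs_of_nonneg ht]; norm_num; linarith
    simpa [hg] using abs_mul_le_mul this (hX k)
  have ha43 : ∀ k, a k ≤ 4 / 3 := (H k0).a_le
  -- The variation of the coefficients enters at the same order `ε h` as the Hessian and cannot be
  -- made small. But `|g| ≤ 3 X` independently of `λ`, so it costs only `3 · 3 X = 9 X`, which a
  -- large `λ` dominates.
  have hstep : ∀ l k j, |gam ε (a' l) (g' l) k j - gam ε a g k j -
      ε * h * (a k * a j * hess lam t x l j)| ≤ ε * h * (9 * X + 60 * B ^ 3 * ζ) := by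
    intro l k j
    have h1 := (H l).gam_sub k j
    have hA : |a' l k * a' l j - a k * a j| ≤ 3 * h := by
      have := abs_add_le_add
        (abs_mul_le_mul ((H l).a_sub k)
          ((abs_of_nonneg ((H l).a_nonneg' j)).trans_le ((H l).a_le' j)))
        (abs_mul_le_mul ((abs_of_nonneg ((H l).a_nonneg k)).trans_le ((H l).a_le k))
          ((H l).a_sub j))
      rw [show (a' l k - a k) * a' l j + a k * (a' l j - a j) =
        a' l k * a' l j - a k * a j by ring] at this
      linarith
    have h2 := abs_add_le_add h1 (abs_mul_le_mul hA (hgX j))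
    rw [sub_add_eq_sub_sub, sub_add_cancel] at h2
    refine h2.trans (le_of_eq ?_)
    ring
  set c := ε * h * (9 * X + 60 * B ^ 3 * ζ)
  set r : Fin d → Fin d → Fin d → ℝ := fun l k j => gam ε (a' l) (g' l) k j - gam ε a g k j -
      ε * h * (a k * a j * hess lam t x l j) with hr
  have e1 := neg_le_sum_sum_mul (r := fun k j => r k k j) (fun k j => hstep k k j) y
  have e2 := sum_sum_mul_sq_le (r := fun k j => r j k j) (fun k j => hstep j k j) y
  have split : ∑ k, ∑ j, (4 * (gam ε (a' k) (g' k) k j - gam ε a g k j) * (y k * y j) -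
        2 * (gam ε (a' j) (g' j) k j - gam ε a g k j) * y k ^ 2) =
      4 * (ε * h) * (∑ k, ∑ j, a k * a j * hess lam t x k j * (y k * y j)) -
      2 * (ε * h) * ((∑ k, a k * y k ^ 2) * ∑ j, a j * hess lam t x j j) +
      4 * (∑ k, ∑ j, r k k j * (y k * y j)) - 2 * ∑ k, ∑ j, r j k j * y k ^ 2 := by
    rw [Finset.sum_mul_sum]
    simp only [Finset.mul_sum, ← Finset.sum_sub_distrib, ← Finset.sum_add_distrib]
    refine Finset.sum_congr rfl fun k _ => Finset.sum_congr rfl fun j _ => ?_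
    simp only [hr]; ring
  -- The trace of the Hessian contributes `-2 λ Gs` times the weighted gradient square and the
  -- multiplier contributes at least `2 λ (Gs + κ)` times it. The surplus `2 λ κ` with `a ≥ 2/3`
  -- gives `4/3 λ κ`. It pays for `8 t a² ≤ 8 · 3/2 · 16/9 = 64/3` and for six copies of the error
  -- `d (9 X + 60 B³ ζ)`.
  rw [split, sum_sum_hess, sum_hess_diag]
  set Gs := 4 * ∑ k, a k * x k ^ 2
  have hGs : 0 ≤ Gs := by
    refine mul_nonneg (by norm_num) (Finset.sum_nonneg fun k _ => ?_)
    have := ha k; positivity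
  have hm : 2 * (ε * h * lam * (Gs + κ)) * ∑ k, a k * y k ^ 2 ≤
      ∑ k, 2 * (ε * h * lam * (Gs + κ)) * (a k * Real.cosh (ε * g k)) * y k ^ 2 := by
    rw [Finset.mul_sum]
    refine Finset.sum_le_sum fun k _ => ?_
    rw [mul_assoc _ (a k * _)]
    have h0 := ha k
    have h1 : a k * 1 ≤ a k * Real.cosh (ε * g k) := by
      gcongr; exact Real.one_le_cosh _
    rw [mul_one] at h1
    gcongr
  have hlow : 2 / 3 * ∑ k, y k ^ 2 ≤ ∑ k, a k * y k ^ 2 := by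
    rw [Finset.mul_sum]
    exact Finset.sum_le_sum fun k _ => mul_le_mul_of_nonneg_right (ha k) (sq_nonneg _)
  have hup : ∑ k, a k ^ 2 * y k ^ 2 ≤ 16 / 9 * ∑ k, y k ^ 2 := by
    rw [Finset.mul_sum]
    refine Finset.sum_le_sum fun k _ => mul_le_mul_of_nonneg_right ?_ (sq_nonneg _)
    nlinarith [ha k, ha43 k]
  have hasum : 0 ≤ ∑ j, a j := Finset.sum_nonneg fun k _ => by linarith [ha k]
  set Y := ∑ k, y k ^ 2
  set Ya := ∑ k, a k * y k ^ 2
  set Yb := ∑ k, a k ^ 2 * y k ^ 2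
  have hY : 0 ≤ Y := Finset.sum_nonneg fun k _ => sq_nonneg _
  have hYa : 0 ≤ Ya := by linarith
  set sq1 := (∑ k, 2 * a k * x k * y k) ^ 2
  have hsq1 : 0 ≤ sq1 := sq_nonneg _
  have f1 : 0 ≤ ε * h * (lam * sq1) := by positivity
  have f2 : ε * h * (t * Yb) ≤ ε * h * (3 / 2 * (16 / 9 * Y)) := by gcongr
  have f3 : 0 ≤ ε * h * (t * ((∑ j, a j) * Ya)) := by positivity
  have f4 : ε * h * (lam * κ * (2 / 3 * Y)) ≤ ε * h * (lam * κ * Ya) := by gcongr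
  have e1' : -(c * (d * Y)) = -(ε * h * (9 * X + 60 * B ^ 3 * ζ) * (d * Y)) := rfl
  have e2' : c * (d * Y) = ε * h * (9 * X + 60 * B ^ 3 * ζ) * (d * Y) := rfl
  rw [e1'] at e1
  rw [e2'] at e2
  linarith

set_option maxHeartbeats 1000000 in
/-- Positivity of the zero order part of the commutator. -/
theorem zero_form_lower
    (H : ∀ l, LocalStep B ε h ζ a (a' l) (fun k => -2 * t * x k) (g' l) (hess lam t x l))
    (ha : ∀ k, 2 / 3 ≤ a k) (hX : ∀ k, |x k| ≤ X) (ht : 1 / 2 ≤ t) (ht' : t ≤ 3 / 2)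
    (hlam : 0 ≤ lam) (hκ : 0 ≤ κ) (hG : κ ≤ 4 * ∑ k, a k * x k ^ 2) :
    ε * h * ε ^ 2 * (lam * κ ^ 2 / 2 - 144 * d ^ 2 * X ^ 3 - 192 * d * X ^ 2 - 96 * d ^ 2 * X ^ 2
        - (300 * d ^ 2 * B ^ 5 + 6 * d * B ^ 4 * lam * (6 * d * X ^ 2 + κ)) * ζ) ≤
      ∑ j, 2 * (rho ε (a' j) (g' j) * (a' j j * Real.sinh (ε * g' j j)) -
        rho ε a (fun k => -2 * t * x k) * (a j * Real.sinh (ε * (-2 * t * x j)))) -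
      2 * rho ε a (fun k => -2 * t * x k) *
        (ε * h * lam * (4 * (∑ k, a k * x k ^ 2) + κ)) := by
  rcases isEmpty_or_nonempty (Fin d) with hd | ⟨⟨k0⟩⟩
  · have hd0 : d = 0 := by
      rcases Nat.eq_zero_or_pos d with h0 | h0
      · exact h0
      · exact (hd.false ⟨0, h0⟩).elim
    subst hd0
    have : κ = 0 := le_antisymm (by simpa using hG) hκ
    subst this
    simp
  have hε := (H k0).eps_nonneg
  have hh := (H k0).h_nonneg
  have hμ : 0 ≤ ε * h := mul_nonneg hε hh
  have hX0 : 0 ≤ X := (abs_nonneg _).trans (hX k0)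
  have hζ0 : 0 ≤ ζ := hε.trans (H k0).eps_le
  have hB0 : 0 ≤ B := by linarith [(H k0).one_le]
  have ht0 : 0 ≤ t := by linarith
  set g : Fin d → ℝ := fun k => -2 * t * x k with hg
  have hgX : ∀ k, |ε * g k| ≤ 3 * X * ε := by
    intro k
    have h1 : |-2 * t| ≤ 3 := by rw [abs_mul, abs_of_nonneg ht0]; norm_num; linarith
    have h2 : |g k| ≤ 3 * X := by simpa [hg] using abs_mul_le_mul h1 (hX k)
    rw [mul_comm]
    exact abs_mul_le_mul h2 (le_of_eq (abs_of_nonneg hε))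
  have ha43 : ∀ k, a k ≤ 4 / 3 := (H k0).a_le
  have haabs : ∀ k, |a k| ≤ 4 / 3 := fun k => by
    rw [abs_of_nonneg (by linarith [ha k])]; exact ha43 k
  have hxsq : ∀ k, x k ^ 2 ≤ X ^ 2 := fun k => by
    rw [← sq_abs]; exact pow_le_pow_left₀ (abs_nonneg _) (hX k) 2
  have card_le : ∀ (f : Fin d → ℝ) (c : ℝ), (∀ k, |f k| ≤ c) → |∑ k, f k| ≤ d * c := by
    intro f c hf
    refine (Finset.abs_sum_le_sum_abs _ _).trans ((Finset.sum_le_card_nsmul _ _ _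
      fun k _ => hf k).trans_eq (by rw [Finset.card_univ, Fintype.card_fin, nsmul_eq_mul]))
  set Gs := 4 * ∑ k, a k * x k ^ 2 with hGs
  have hGle : Gs ≤ 6 * d * X ^ 2 := by
    have := card_le (fun k => a k * x k ^ 2) (4 / 3 * X ^ 2) fun k =>
      abs_mul_le_mul (haabs k) ((abs_of_nonneg (sq_nonneg _)).trans_le (hxsq k))
    have h2 := le_of_abs_le this
    have : 0 ≤ d * X ^ 2 := by positivity
    linarith
  have hGle' : Gs ≤ 16 / 3 * (d * X ^ 2) := by
    have := card_le (fun k => a k * x k ^ 2) (4 / 3 * X ^ 2) fun k =>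
      abs_mul_le_mul (haabs k) ((abs_of_nonneg (sq_nonneg _)).trans_le (hxsq k))
    have h2 := le_of_abs_le this
    linarith
  have hG0 : 0 ≤ Gs := hκ.trans hG
  have hr0 : ∑ k, a k * (ε * g k) ^ 2 = ε ^ 2 * t ^ 2 * Gs := by
    rw [hGs, Finset.mul_sum, Finset.mul_sum]
    exact Finset.sum_congr rfl fun k _ => by simp only [hg]; ring
  have hrho := (H k0).rho_sub_sq
  rw [hr0] at hrho
  set r1 : Fin d → ℝ := fun j =>
    rho ε (a' j) (g' j) * (a' j j * Real.sinh (ε * g' j j)) -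
        rho ε a g * (a j * Real.sinh (ε * g j)) -
      ((∑ k, ((a' j k - a k) * (ε * g k) ^ 2 +
          2 * a k * (ε * g k) * (ε * h * hess lam t x j k))) * (a j * (ε * g j)) +
        (∑ k, a k * (ε * g k) ^ 2) * ((a' j j - a j) * (ε * g j) +
          a j * (ε * h * hess lam t x j j))) with hr1
  have e1 := card_le r1 _ fun j => (H j).rho_mul_sub j
  have e2 : |∑ j, (∑ k, (a' j k - a k) * (ε * g k) ^ 2) * (a j * (ε * g j))| ≤
      d * (d * (h * (3 * X * ε) ^ 2) * (4 / 3 * (3 * X * ε))) := by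
    refine card_le _ _ fun j => abs_mul_le_mul (card_le _ _ fun k => ?_)
      (abs_mul_le_mul (haabs j) (hgX j))
    refine abs_mul_le_mul ((H j).a_sub k) ?_
    rw [abs_pow]
    exact pow_le_pow_left₀ (abs_nonneg _) (hgX k) 2
  have e3 : |∑ j, (a' j j - a j) * (ε * g j)| ≤ d * (h * (3 * X * ε)) :=
    card_le _ _ fun j => abs_mul_le_mul ((H j).a_sub j) (hgX j)
  have hess1 := sum_sum_hess lam t a x (fun k => ε * g k)
  have hess2 := sum_hess_diag lam t a x
  have q1 : ∑ k, 2 * a k * x k * (ε * g k) = -(ε * t * Gs) := by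
    rw [hGs, Finset.mul_sum, Finset.mul_sum, ← Finset.sum_neg_distrib]
    exact Finset.sum_congr rfl fun k _ => by simp only [hg]; ring
  have q2 : ∑ k, a k ^ 2 * (ε * g k) ^ 2 ≤ ε ^ 2 * t ^ 2 * (64 / 9 * (d * X ^ 2)) := by
    have : ∑ k, a k ^ 2 * (ε * g k) ^ 2 ≤ ∑ _k : Fin d, ε ^ 2 * t ^ 2 * (64 / 9 * X ^ 2) := by
      refine Finset.sum_le_sum fun k _ => ?_
      have h1 : a k ^ 2 ≤ 16 / 9 := by nlinarith [ha k, ha43 k]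
      calc a k ^ 2 * (ε * g k) ^ 2 = ε ^ 2 * t ^ 2 * (4 * (a k ^ 2 * x k ^ 2)) := by
            simp only [hg]; ring
        _ ≤ ε ^ 2 * t ^ 2 * (4 * (16 / 9 * X ^ 2)) := by
            have := hxsq k
            gcongr
        _ = _ := by ring
    refine this.trans (le_of_eq ?_)
    rw [Finset.sum_const, Finset.card_univ, Fintype.card_fin, nsmul_eq_mul]; ring
  rw [q1] at hess1
  -- The first variation is sorted into the full Hessian form evaluated at `ε g`, the trace of the
  -- Hessian times the leading part of `ρ`, and the terms where a coefficient is differenced.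
  have split : ∑ j, 2 * (rho ε (a' j) (g' j) * (a' j j * Real.sinh (ε * g' j j)) -
        rho ε a g * (a j * Real.sinh (ε * g j))) =
      2 * ∑ j, r1 j + 2 * (∑ j, (∑ k, (a' j k - a k) * (ε * g k) ^ 2) * (a j * (ε * g j))) +
      4 * (ε * h) * (∑ k, ∑ j, a k * a j * hess lam t x k j * (ε * g k * (ε * g j))) +
      2 * (∑ k, a k * (ε * g k) ^ 2) * (∑ j, (a' j j - a j) * (ε * g j) +
        ε * h * ∑ j, a j * hess lam t x j j) := by
    have pw : ∀ j, 2 * (rho ε (a' j) (g' j) * (a' j j * Real.sinh (ε * g' j j)) -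
        rho ε a g * (a j * Real.sinh (ε * g j))) =
        2 * r1 j + 2 * ((∑ k, (a' j k - a k) * (ε * g k) ^ 2) * (a j * (ε * g j))) +
        4 * (ε * h) * (∑ i, a j * a i * hess lam t x j i * (ε * g j * (ε * g i))) +
        (2 * (∑ k, a k * (ε * g k) ^ 2) * ((a' j j - a j) * (ε * g j)) +
        2 * (∑ k, a k * (ε * g k) ^ 2) * (ε * h) * (a j * hess lam t x j j)) := by
      intro j
      have h5 : (∑ k, 2 * a k * (ε * g k) * (ε * h * hess lam t x j k)) * (a j * (ε * g j)) =
        2 * (ε * h) * ∑ i, (a j * a i * hess lam t x j i * (ε * g j * (ε * g i))) := by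
        rw [Finset.sum_mul, Finset.mul_sum]
        exact Finset.sum_congr rfl fun k _ => by ring
      simp only [hr1, Finset.sum_add_distrib, add_mul (∑ k, (a' j k - a k) * (ε * g k) ^ 2), h5]
      ring
    rw [Finset.sum_congr rfl fun j _ => pw j]
    simp only [Finset.sum_add_distrib, ← Finset.mul_sum]
    ring
  have hgoal : ∀ u : ℝ, ∑ j, 2 * (rho ε (a' j) (g' j) * (a' j j * Real.sinh (ε * g' j j)) -
        rho ε a g * (a j * Real.sinh (ε * (-2 * t * x j)))) - u =
      ∑ j, 2 * (rho ε (a' j) (g' j) * (a' j j * Real.sinh (ε * g' j j)) -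
        rho ε a g * (a j * Real.sinh (ε * g j))) - u := fun u => rfl
  rw [hgoal, split, hess1, hess2, hr0]
  rw [← hGs]
  set R1 := ∑ j, r1 j
  set U1 := ∑ j, (∑ k, (a' j k - a k) * (ε * g k) ^ 2) * (a j * (ε * g j))
  set W := ∑ j, (a' j j - a j) * (ε * g j)
  set Q2 := ∑ k, a k ^ 2 * (ε * g k) ^ 2
  have hAs := card_le a (4 / 3) haabs
  have hAs0 : 0 ≤ ∑ j, a j := Finset.sum_nonneg fun k _ => by linarith [ha k]
  rw [abs_of_nonneg hAs0] at hAs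
  set As := ∑ j, a j
  set ρ := rho ε a g
  have ht2 : t ^ 2 ≤ 9 / 4 := by nlinarith only [ht', ht0]
  have ht3 : t ^ 3 ≤ 27 / 8 := by
    calc t ^ 3 ≤ (3 / 2) ^ 3 := by gcongr
      _ = _ := by norm_num
  have ht2' : 1 / 4 ≤ t ^ 2 := by nlinarith only [ht]
  have hμε : 0 ≤ ε * h * ε ^ 2 := by positivity
  have f1 := (abs_le.mp e1).1
  have f2 := (abs_le.mp e2).1
  have f3 : -(36 * d ^ 2 * X ^ 3 * (ε * h * ε ^ 2)) ≤ ε ^ 2 * t ^ 2 * Gs * W := by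
    have h1 : |ε ^ 2 * t ^ 2 * Gs| ≤ ε ^ 2 * (9 / 4) * (16 / 3 * (d * X ^ 2)) := by
      rw [abs_of_nonneg (by positivity)]
      gcongr
    have h2 := (abs_le.mp (abs_mul_le_mul h1 e3)).1
    refine le_trans (le_of_eq ?_) h2
    ring
  have f4 : ε * h * (t * Q2) ≤ ε * h * ε ^ 2 * (24 * (d * X ^ 2)) := by
    calc ε * h * (t * Q2) ≤ ε * h * (t * (ε ^ 2 * t ^ 2 * (64 / 9 * (d * X ^ 2)))) := by gcongr
      _ = ε * h * ε ^ 2 * (t ^ 3 * (64 / 9 * (d * X ^ 2))) := by ring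
      _ ≤ ε * h * ε ^ 2 * (27 / 8 * (64 / 9 * (d * X ^ 2))) := by gcongr
      _ = _ := by ring
  have f5 : ε ^ 2 * t ^ 2 * Gs * (ε * h * (t * As)) ≤ ε * h * ε ^ 2 * (24 * (d ^ 2 * X ^ 2)) := by
    calc ε ^ 2 * t ^ 2 * Gs * (ε * h * (t * As)) = ε * h * ε ^ 2 * (t ^ 3 * Gs * As) := by ring
      _ ≤ ε * h * ε ^ 2 * (27 / 8 * (16 / 3 * (d * X ^ 2)) * (d * (4 / 3))) := by gcongr
      _ = _ := by ring
  have f6 : ρ * (ε * h * lam * (Gs + κ)) ≤ ε ^ 2 * t ^ 2 * Gs * (ε * h * lam * (Gs + κ)) +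
      ε * h * ε ^ 2 * (3 * d * B ^ 4 * lam * (6 * d * X ^ 2 + κ) * ζ) := by
    have h1 : ρ ≤ ε ^ 2 * t ^ 2 * Gs + d * (3 * B ^ 4 * ε ^ 2 * ζ) := by
      linarith [(abs_le.mp hrho).2]
    calc ρ * (ε * h * lam * (Gs + κ)) ≤
        (ε ^ 2 * t ^ 2 * Gs + d * (3 * B ^ 4 * ε ^ 2 * ζ)) * (ε * h * lam * (Gs + κ)) := by gcongr
      _ = ε ^ 2 * t ^ 2 * Gs * (ε * h * lam * (Gs + κ)) +
        d * (3 * B ^ 4 * ε ^ 2 * ζ) * (ε * h * lam * (Gs + κ)) := by ring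
      _ ≤ ε ^ 2 * t ^ 2 * Gs * (ε * h * lam * (Gs + κ)) +
        d * (3 * B ^ 4 * ε ^ 2 * ζ) * (ε * h * lam * (6 * d * X ^ 2 + κ)) := by gcongr
      _ = _ := by ring
  -- In units of `ε h ε² λ t²` the rank one part gives `4 Gs²`, the trace gives `2 Gs²`, and the
  -- multiplier removes `2 Gs (Gs + κ)`. What is left, `4 Gs² - 2 Gs κ`, is at least `2 κ²` because
  -- `Gs ≥ κ`, and `t² ≥ 1/4`.
  have f7 : ε * h * ε ^ 2 * (lam * κ ^ 2 / 2) ≤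
      ε * h * ε ^ 2 * (lam * (t ^ 2 * (4 * Gs ^ 2 - 2 * Gs * κ))) := by
    refine mul_le_mul_of_nonneg_left ?_ hμε
    rw [mul_div_assoc]
    refine mul_le_mul_of_nonneg_left ?_ hlam
    have h1 : 2 * κ ^ 2 ≤ 4 * Gs ^ 2 - 2 * Gs * κ := by nlinarith only [hκ, hG]
    nlinarith only [sq_nonneg κ, h1, ht2']
  linarith only [f1, f2, f3, f4, f5, f6, f7]

end Positivity

/-! ### Discrete `H²` regularity and the exact commutator identity -/

section Core

variable {G : Type*} [Fintype G] [AddCommGroup G] {d : ℕ}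

/-- `∑ (|δV|² + ε² V²)` is the energy controlled by the Carleman estimate; this is its first part. -/
noncomputable def gradSq (e : Fin d → G) (V : G → ℝ) : ℝ := ∑ n, ∑ k, fd (e k) V n ^ 2

noncomputable def hessSq (e : Fin d → G) (V : G → ℝ) : ℝ :=
  ∑ n, ∑ k, ∑ j, fd (e j) (fd (e k) V) n ^ 2

theorem gradSq_nonneg (e : Fin d → G) (V : G → ℝ) : 0 ≤ gradSq e V :=
  Finset.sum_nonneg fun _ _ => Finset.sum_nonneg fun _ _ => sq_nonneg _

theorem hessSq_nonneg (e : Fin d → G) (V : G → ℝ) : 0 ≤ hessSq e V :=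
  Finset.sum_nonneg fun _ _ => Finset.sum_nonneg fun _ _ => Finset.sum_nonneg fun _ _ => sq_nonneg _

theorem gradSq_eq (e : Fin d → G) (V : G → ℝ) : gradSq e V = ∑ k, ∑ n, fd (e k) V n ^ 2 :=
  Finset.sum_comm

theorem hessSq_eq (e : Fin d → G) (V : G → ℝ) :
    hessSq e V = ∑ k, ∑ j, ∑ n, fd (e j) (fd (e k) V) n ^ 2 := by
  rw [hessSq, Finset.sum_comm]
  exact Finset.sum_congr rfl fun k _ => Finset.sum_comm

theorem sum_diag_hess_le (e : Fin d → G) (V : G → ℝ) :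
    ∑ j, ∑ n, fd (e j) (fd (e j) V) n ^ 2 ≤ hessSq e V := by
  rw [hessSq_eq]
  refine Finset.sum_le_sum fun k _ => ?_
  exact Finset.single_le_sum (f := fun j => ∑ n, fd (e j) (fd (e k) V) n ^ 2)
    (fun j _ => Finset.sum_nonneg fun _ _ => sq_nonneg _) (Finset.mem_univ k)

theorem mul_le_add_sq {c y w θ K : ℝ} (hθ : 0 < θ) (hc : |c| ≤ K) :
    |c * y * w| ≤ θ * w ^ 2 + K ^ 2 / θ * y ^ 2 := by
  have h1 : |c * y * w| ≤ K * |y| * |w| := by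
    rw [abs_mul, abs_mul]; gcongr
  refine h1.trans ?_
  have hK : 0 ≤ K := (abs_nonneg _).trans hc
  have h2 : 0 ≤ (θ * |w| - K * |y|) ^ 2 / θ := by positivity
  have h5 : (θ * |w| - K * |y|) ^ 2 / θ =
      θ * w ^ 2 + K ^ 2 / θ * y ^ 2 - 2 * (K * |y| * |w|) := by
    rw [← sq_abs w, ← sq_abs y]; field_simp
    ring
  have h6 : 0 ≤ K * |y| * |w| := by positivity
  rw [h5] at h2
  linarith

variable {e : Fin d → G} {V : G → ℝ}

/-- Discrete `H²` regularity for the leading part `∑ α_k δ_k²`. -/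
theorem hessSq_le {Z : Set G} {K h : ℝ} {α : Fin d → G → ℝ}
    (hV0 : ∀ n ∉ Z, V n = 0) (hV1 : ∀ n ∉ Z, ∀ k, V (n + e k) = 0)
    (hV2 : ∀ n ∉ Z, ∀ k j, V (n + e k + e j) = 0)
    (hα : ∀ n ∈ Z, ∀ k, 2 / 3 ≤ α k n)
    (hαα : ∀ n ∈ Z, ∀ l k j, |fd (e l) (fun n => α k n * α j n) n| ≤ K * h) :
    1 / 3 * hessSq e V ≤ ∑ n, (∑ k, α k n * sd (e k) V n) ^ 2 +
      18 * (d + 1) * d * K ^ 2 * h ^ 2 * gradSq e V := by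
  have expand : ∑ n, (∑ k, α k n * sd (e k) V n) ^ 2 =
      ∑ k, ∑ j, ∑ n, α k n * α j n * sd (e k) V n * sd (e j) V n := by
    simp_rw [sq, Finset.sum_mul_sum]
    rw [Finset.sum_comm]
    refine Finset.sum_congr rfl fun k _ => ?_
    rw [Finset.sum_comm]
    exact Finset.sum_congr rfl fun j _ => Finset.sum_congr rfl fun n _ => by ring
  -- Weight in Young's inequality. The total loss is `θ (1 + d) = 1/9` of the second difference
  -- energy, out of the available `4/9 ≤ α_k α_j`, which leaves `1/3`.
  set θ : ℝ := 1 / (9 * (d + 1)) with hθ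
  have hθ0 : 0 < θ := by positivity
  have key : ∀ k j, 4 / 9 * ∑ n, fd (e j) (fd (e k) V) n ^ 2 -
      (θ * ∑ n, fd (e j) (fd (e k) V) n ^ 2 + θ * ∑ n, fd (e j) (fd (e j) V) n ^ 2 +
        2 * ((K * h) ^ 2 / θ) * ∑ n, fd (e k) V n ^ 2) ≤
      ∑ n, α k n * α j n * sd (e k) V n * sd (e j) V n := by
    intro k j
    rw [sum_sd_mul_sd (e k) (e j) (fun n => α k n * α j n) V]
    have t1 : 4 / 9 * ∑ n, fd (e j) (fd (e k) V) n ^ 2 ≤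
        ∑ n, α k n * α j n * fd (e j) (fd (e k) V) n ^ 2 := by
      rw [Finset.mul_sum]
      refine Finset.sum_le_sum fun n _ => ?_
      by_cases hn : n ∈ Z
      · have h1 := hα n hn k
        have h2 := hα n hn j
        refine mul_le_mul_of_nonneg_right ?_ (sq_nonneg _)
        nlinarith
      · have : fd (e j) (fd (e k) V) n = 0 := by
          simp [fd, hV0 n hn, hV1 n hn, hV2 n hn]
        simp [this]
    have t2 : -(θ * ∑ n, fd (e j) (fd (e k) V) n ^ 2 +
        (K * h) ^ 2 / θ * ∑ n, fd (e k) V n ^ 2) ≤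
        ∑ n, fd (e j) (fun n => α k n * α j n) n * fd (e k) V (n + e j) *
          fd (e j) (fd (e k) V) n := by
      rw [← sum_shift (e j) fun n => fd (e k) V n ^ 2, Finset.mul_sum, Finset.mul_sum,
        ← Finset.sum_add_distrib, ← Finset.sum_neg_distrib]
      refine Finset.sum_le_sum fun n _ => ?_
      by_cases hn : n ∈ Z
      · exact (abs_le.mp (mul_le_add_sq hθ0 (hαα n hn j k j))).1
      · have : fd (e j) (fd (e k) V) n = 0 := by
          simp [fd, hV0 n hn, hV1 n hn, hV2 n hn]
        rw [this, mul_zero]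
        have : 0 ≤ (K * h) ^ 2 / θ * fd (e k) V (n + e j) ^ 2 := by positivity
        linarith
    have t3 : ∑ n, fd (e k) (fun n => α k n * α j n) n * fd (e k) V n * sd (e j) V (n + e k) ≤
        θ * ∑ n, fd (e j) (fd (e j) V) n ^ 2 + (K * h) ^ 2 / θ * ∑ n, fd (e k) V n ^ 2 := by
      rw [← sum_shift (e k - e j) fun n => fd (e j) (fd (e j) V) n ^ 2, Finset.mul_sum,
        Finset.mul_sum, ← Finset.sum_add_distrib]
      refine Finset.sum_le_sum fun n _ => ?_
      -- A symmetric second difference is a translated iterated forward difference. The translation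
      -- is harmless after summation over the group.
      have hs : sd (e j) V (n + e k) = fd (e j) (fd (e j) V) (n + (e k - e j)) := by
        rw [sd_eq, ← add_sub_assoc]
        simp only [fd, sub_add_cancel]
      rw [hs]
      by_cases hn : n ∈ Z
      · exact (abs_le.mp (mul_le_add_sq hθ0 (hαα n hn k k j))).2
      · have : fd (e k) V n = 0 := by simp [fd, hV0 n hn, hV1 n hn]
        rw [this, mul_zero, zero_mul]
        positivity
    linarith
  have total := Finset.sum_le_sum fun k (_ : k ∈ Finset.univ) =>
    Finset.sum_le_sum fun j (_ : j ∈ Finset.univ) => key k j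
  rw [← expand] at total
  simp only [Finset.sum_sub_distrib, Finset.sum_add_distrib, ← Finset.mul_sum,
    Finset.sum_const, Finset.card_univ, Fintype.card_fin, nsmul_eq_mul] at total
  rw [← hessSq_eq, ← gradSq_eq] at total
  have hdiag := sum_diag_hess_le e V
  have hX2 := hessSq_nonneg e V
  set X2 := hessSq e V
  set Dg := ∑ j, ∑ n, fd (e j) (fd (e j) V) n ^ 2
  have h1 : θ * (d * Dg) ≤ θ * (d * X2) := by gcongr
  have h2 : θ * X2 + θ * (d * X2) = 1 / 9 * X2 := by
    rw [hθ]; field_simp; ring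
  have h3 : (K * h) ^ 2 / θ = 9 * (d + 1) * (K * h) ^ 2 := by rw [hθ]; field_simp
  rw [h3] at total
  linarith

/-- The exact commutator identity for the symmetric part `∑ α_k δ_k² + ρ` and the antisymmetric
part `-∑ β_j ∂_j - m`. -/
theorem two_mul_sum_symm_mul_antisymm (e : Fin d → G) (V : G → ℝ) (α β : Fin d → G → ℝ)
    (ρ m : G → ℝ) :
    2 * ∑ n, (∑ k, α k n * sd (e k) V n + ρ n * V n) *
        (-∑ j, β j n * cd (e j) V n - m n * V n) =
      ∑ n, (∑ k, ∑ j, (4 * fd (e k) (fun n => α k n * β j n) n * (fd (e k) V n * fd (e j) V n) -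
          2 * fd (e j) (fun n => α k n * β j n) n * fd (e k) V n ^ 2) +
        ∑ k, 2 * m n * α k n * fd (e k) V n ^ 2 +
        (∑ j, 2 * fd (e j) (fun n => ρ n * β j n) n - 2 * ρ n * m n) * V n ^ 2) +
      (∑ k, ∑ j, ∑ n, 2 * fd (e k) (fun n => α k n * β j n) n * fd (e k) V n *
          (cd (e j) V (n + e k) - 2 * fd (e j) V n) -
        ∑ k, ∑ j, ∑ n, 2 * fd (e j) (fun n => α k n * β j n) n * fd (e k) V n *
          fd (e j) (fd (e k) V) n +
        ∑ j, ∑ n, 2 * fd (e j) (fun n => ρ n * β j n) n * V n * fd (e j) V n +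
        ∑ k, ∑ n, 2 * fd (e k) (fun n => m n * α k n) n * V (n + e k) * fd (e k) V n) := by
  have h1 : ∀ k j, ∑ n, α k n * β j n * sd (e k) V n * cd (e j) V n = _ :=
    fun k j => sum_sd_mul_cd (e k) (e j) (fun n => α k n * β j n) V
  have h2 : ∀ j, ∑ n, ρ n * β j n * V n * cd (e j) V n = _ :=
    fun j => sum_mul_cd (e j) (fun n => ρ n * β j n) V
  have h3 : ∀ k, ∑ n, m n * α k n * V n * sd (e k) V n = _ :=
    fun k => sum_mul_sd (e k) (fun n => m n * α k n) V
  have lhs : ∑ n, (∑ k, α k n * sd (e k) V n + ρ n * V n) *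
        (-∑ j, β j n * cd (e j) V n - m n * V n) =
      -∑ k, ∑ j, ∑ n, α k n * β j n * sd (e k) V n * cd (e j) V n -
      ∑ j, ∑ n, ρ n * β j n * V n * cd (e j) V n -
      ∑ k, ∑ n, m n * α k n * V n * sd (e k) V n - ∑ n, ρ n * m n * V n ^ 2 := by
    have c1 : ∑ k, ∑ j, ∑ n, α k n * β j n * sd (e k) V n * cd (e j) V n =
        ∑ n, (∑ k, α k n * sd (e k) V n) * ∑ j, β j n * cd (e j) V n := by
      simp_rw [Finset.sum_mul_sum]
      rw [Finset.sum_comm (t := (Finset.univ : Finset (Fin d))) (s := (Finset.univ : Finset G))]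
      refine Finset.sum_congr rfl fun k _ => ?_
      rw [Finset.sum_comm]
      exact Finset.sum_congr rfl fun j _ => Finset.sum_congr rfl fun n _ => by ring
    have c2 : ∑ j, ∑ n, ρ n * β j n * V n * cd (e j) V n =
        ∑ n, ρ n * V n * ∑ j, β j n * cd (e j) V n := by
      rw [Finset.sum_comm]
      refine Finset.sum_congr rfl fun n _ => ?_
      rw [Finset.mul_sum]
      exact Finset.sum_congr rfl fun j _ => by ring
    have c3 : ∑ k, ∑ n, m n * α k n * V n * sd (e k) V n =
        ∑ n, m n * V n * ∑ k, α k n * sd (e k) V n := by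
      rw [Finset.sum_comm]
      refine Finset.sum_congr rfl fun n _ => ?_
      rw [Finset.mul_sum]
      exact Finset.sum_congr rfl fun j _ => by ring
    rw [c1, c2, c3, ← Finset.sum_neg_distrib, ← Finset.sum_sub_distrib, ← Finset.sum_sub_distrib,
      ← Finset.sum_sub_distrib]
    exact Finset.sum_congr rfl fun n _ => by ring
  rw [lhs]
  simp only [h1, h2, h3]
  have r1 : ∑ n, (∑ k, ∑ j, (4 * fd (e k) (fun n => α k n * β j n) n *
          (fd (e k) V n * fd (e j) V n) -
          2 * fd (e j) (fun n => α k n * β j n) n * fd (e k) V n ^ 2) +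
        ∑ k, 2 * m n * α k n * fd (e k) V n ^ 2 +
        (∑ j, 2 * fd (e j) (fun n => ρ n * β j n) n - 2 * ρ n * m n) * V n ^ 2) =
      ∑ k, ∑ j, ∑ n, (4 * fd (e k) (fun n => α k n * β j n) n * (fd (e k) V n * fd (e j) V n) -
          2 * fd (e j) (fun n => α k n * β j n) n * fd (e k) V n ^ 2) +
        ∑ k, ∑ n, 2 * m n * α k n * fd (e k) V n ^ 2 +
        (∑ j, ∑ n, 2 * fd (e j) (fun n => ρ n * β j n) n * V n ^ 2 -
          ∑ n, 2 * ρ n * m n * V n ^ 2) := by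
    simp only [Finset.sum_add_distrib, sub_mul, Finset.sum_mul, Finset.sum_sub_distrib]
    simp only [Finset.sum_comm (s := (Finset.univ : Finset G))]
  rw [r1]
  -- Summation by parts produces first differences at translated points. Bringing them back to `n`
  -- isolates a pointwise quadratic form in the gradient; the discrepancy is a first difference
  -- times second differences.
  have p1 : ∀ k j, ∑ n, fd (e k) (fun n => α k n * β j n) n *
        (fd (e k) V n * cd (e j) V (n + e k)) * 2 -
      ∑ n, fd (e j) (fun n => α k n * β j n) n * (fd (e k) V n * fd (e k) V (n + e j)) * 2 =
      ∑ n, (4 * fd (e k) (fun n => α k n * β j n) n * (fd (e k) V n * fd (e j) V n) -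
          2 * fd (e j) (fun n => α k n * β j n) n * fd (e k) V n ^ 2) +
      (∑ n, 2 * fd (e k) (fun n => α k n * β j n) n * fd (e k) V n *
          (cd (e j) V (n + e k) - 2 * fd (e j) V n) -
        ∑ n, 2 * fd (e j) (fun n => α k n * β j n) n * fd (e k) V n *
          fd (e j) (fd (e k) V) n) := by
    intro k j
    rw [← Finset.sum_sub_distrib, ← Finset.sum_sub_distrib, ← Finset.sum_add_distrib]
    refine Finset.sum_congr rfl fun n _ => ?_
    have : fd (e j) (fd (e k) V) n = fd (e k) V (n + e j) - fd (e k) V n := rfl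
    rw [this]
    ring
  have p2 : ∀ j, ∑ n, fd (e j) (fun n => ρ n * β j n) n * (V n * V (n + e j)) * 2 =
      ∑ n, 2 * fd (e j) (fun n => ρ n * β j n) n * V n ^ 2 +
      ∑ n, 2 * fd (e j) (fun n => ρ n * β j n) n * V n * fd (e j) V n := by
    intro j
    rw [← Finset.sum_add_distrib]
    refine Finset.sum_congr rfl fun n _ => ?_
    have : fd (e j) V n = V (n + e j) - V n := rfl
    rw [this]
    ring
  have p3 : ∀ k, ∑ n, m n * α k n * fd (e k) V n ^ 2 * 2 =
      ∑ n, 2 * m n * α k n * fd (e k) V n ^ 2 := fun k =>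
    Finset.sum_congr rfl fun n _ => by ring
  have p4 : ∀ k, ∑ n, fd (e k) (fun n => m n * α k n) n * V (n + e k) * fd (e k) V n * 2 =
      ∑ n, 2 * fd (e k) (fun n => m n * α k n) n * V (n + e k) * fd (e k) V n := fun k =>
    Finset.sum_congr rfl fun n _ => by ring
  have p5 : ∑ n, ρ n * m n * V n ^ 2 * 2 = ∑ n, 2 * ρ n * m n * V n ^ 2 :=
    Finset.sum_congr rfl fun n _ => by ring
  have q1 := Finset.sum_congr rfl fun k (_ : k ∈ Finset.univ) =>
    Finset.sum_congr rfl fun j (_ : j ∈ Finset.univ) => p1 k j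
  have q2 := Finset.sum_congr rfl fun j (_ : j ∈ Finset.univ) => p2 j
  have q3 := Finset.sum_congr rfl fun j (_ : j ∈ Finset.univ) => p3 j
  have q4 := Finset.sum_congr rfl fun j (_ : j ∈ Finset.univ) => p4 j
  simp only [Finset.sum_add_distrib, Finset.sum_sub_distrib, Finset.sum_neg_distrib,
    ← Finset.sum_mul] at q1 q2 q3 q4 p5 ⊢
  linarith

end Core

/-! ### Absorption of the discrete remainders and the abstract Carleman estimate -/

section Core

variable {G : Type*} [Fintype G] [AddCommGroup G] {d : ℕ}
variable {e : Fin d → G} {V : G → ℝ}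

theorem neg_le_sum_of_abs_le {ι : Type*} (s : Finset ι) {f g : ι → ℝ} (h : ∀ i ∈ s, |f i| ≤ g i) :
    -∑ i ∈ s, g i ≤ ∑ i ∈ s, f i := by
  rw [← Finset.sum_neg_distrib]
  exact Finset.sum_le_sum fun i hi => (abs_le.mp (h i hi)).1

/-- A central difference is twice a forward difference up to second differences: the deviation is a
sum of three of them at translated points, and translations do not change the sums. -/
theorem sum_sq_cd_sub_le (e : Fin d → G) (V : G → ℝ) :
    ∑ k, ∑ j, ∑ n, (cd (e j) V (n + e k) - 2 * fd (e j) V n) ^ 2 ≤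
      3 * (2 + d) * hessSq e V := by
  have h1 : ∀ k j, ∑ n, (cd (e j) V (n + e k) - 2 * fd (e j) V n) ^ 2 ≤
      6 * ∑ n, fd (e k) (fd (e j) V) n ^ 2 + 3 * ∑ n, fd (e j) (fd (e j) V) n ^ 2 := by
    intro k j
    have a1 := sum_shift_sub (e j) fun n => fd (e k) (fd (e j) V) n ^ 2
    have a2 := sum_shift_sub (e j) fun n => fd (e j) (fd (e j) V) n ^ 2
    have : ∑ n, (cd (e j) V (n + e k) - 2 * fd (e j) V n) ^ 2 ≤
        ∑ n, (3 * fd (e k) (fd (e j) V) n ^ 2 + 3 * fd (e k) (fd (e j) V) (n - e j) ^ 2 +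
          3 * fd (e j) (fd (e j) V) (n - e j) ^ 2) := by
      refine Finset.sum_le_sum fun n _ => ?_
      have hw : cd (e j) V (n + e k) - 2 * fd (e j) V n =
          fd (e k) (fd (e j) V) n + fd (e k) (fd (e j) V) (n - e j) -
            fd (e j) (fd (e j) V) (n - e j) := by
        simp only [fd, cd, sub_add_cancel, sub_add_eq_add_sub]
        ring
      rw [hw]
      nlinarith [sq_nonneg (fd (e k) (fd (e j) V) n - fd (e k) (fd (e j) V) (n - e j)),
        sq_nonneg (fd (e k) (fd (e j) V) n + fd (e j) (fd (e j) V) (n - e j)),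
        sq_nonneg (fd (e k) (fd (e j) V) (n - e j) + fd (e j) (fd (e j) V) (n - e j))]
    refine this.trans (le_of_eq ?_)
    simp only [Finset.sum_add_distrib, ← Finset.mul_sum]
    rw [a1, a2]; ring
  have total := Finset.sum_le_sum fun k (_ : k ∈ Finset.univ) =>
    Finset.sum_le_sum fun j (_ : j ∈ Finset.univ) => h1 k j
  refine total.trans ?_
  simp only [Finset.sum_add_distrib, ← Finset.mul_sum,
    Finset.sum_const, Finset.card_univ, Fintype.card_fin, nsmul_eq_mul]
  rw [Finset.sum_comm, ← hessSq_eq]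
  have hd := sum_diag_hess_le e V
  have : (d : ℝ) * ∑ j, ∑ n, fd (e j) (fd (e j) V) n ^ 2 ≤ d * hessSq e V := by gcongr
  linarith

/-- The numerical part of the absorption argument in the Carleman estimate. -/
theorem carleman_absorb {d : ℕ} {K ε h τ ζ μ X0 X1 X2 NQ NR NM NST NS CM e1 e2 e3 e4 : ℝ}
    (hK : 1 ≤ K) (hτ : 1 ≤ τ) (hζ0 : 0 < ζ) (hμ0 : 0 < μ) (hX0 : 0 ≤ X0) (hX1 : 0 ≤ X1)
    (hζ : 2000 * (d + 1) ^ 2 * K ^ 4 * ζ ≤ 1)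
    (hh2 : h ^ 2 ≤ μ * ζ) (hμ2 : μ ^ 2 ≤ μ * ε ^ 2 * ζ) (hτμ : τ * μ = ε ^ 2) (hε2 : ε ^ 2 ≤ ζ)
    (hR : NR ≤ 3 * d * K ^ 2 * h ^ 2 * (d * ε ^ 2 * X0 + 2 * X1))
    (hM : NM ≤ K ^ 2 * μ ^ 2 * X0) (hupper : NST ≤ 3 * NQ + 3 * NR + 3 * NM)
    (hS : 1 / 6 * X2 - 9 * (d + 1) * d * K ^ 2 * h ^ 2 * X1 - K ^ 2 * ε ^ 4 * X0 ≤ NS)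
    (hS0 : 0 ≤ NS) (hmain : 2 * μ * (X1 + ε ^ 2 * X0) ≤ CM)
    (E1 : -(1 / (2 * K ^ 2 * τ) / (6 * (7 + 3 * d)) * (3 * (2 + d) * X2) +
      d * ((2 * (K * μ)) ^ 2 / (1 / (2 * K ^ 2 * τ) / (6 * (7 + 3 * d))) * X1)) ≤ e1)
    (E2 : e2 ≤ 1 / (2 * K ^ 2 * τ) / (6 * (7 + 3 * d)) * X2 +
      d * ((2 * (K * μ)) ^ 2 / (1 / (2 * K ^ 2 * τ) / (6 * (7 + 3 * d))) * X1))
    (E3 : -(4 * K * μ * ζ * (X1 + d * (ε ^ 2 * X0))) ≤ e3)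
    (E4 : -(4 * K * μ * ζ * (X1 + d * (ε ^ 2 * X0))) ≤ e4)
    (hsq : NST ≥ NS + (CM + (e1 - e2 + e3 + e4))) :
    μ * (X1 + ε ^ 2 * X0) ≤ 3 * NQ := by
  have hτ0 : 0 < τ := by linarith
  have hK0 : 0 < K := by linarith
  -- The fraction of the symmetric part spent on second differences. Since `τ μ = ε²`, this choice
  -- makes `η K² ε⁴` equal to `μ ε² / 2`, so the cost of recovering second differences from the
  -- symmetric part stays within the zero order gain.
  set η : ℝ := 1 / (2 * K ^ 2 * τ) with hη
  have hη0 : 0 < η := by positivity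
  have hη1 : η ≤ 1 := by
    rw [hη, div_le_one (by positivity)]
    nlinarith [one_le_pow₀ hK (n := 2)]
  -- Chosen so that the two error sums use exactly the available second differences: `θ (3 (2 + d) +
  -- 1) = η / 6`.
  set θ : ℝ := η / (6 * (7 + 3 * d)) with hθ
  have hηS : η * (1 / 6 * X2 - 9 * (d + 1) * d * K ^ 2 * h ^ 2 * X1 - K ^ 2 * ε ^ 4 * X0) ≤
      NS := by
    calc _ ≤ η * NS := mul_le_mul_of_nonneg_left hS hη0.le
      _ ≤ 1 * NS := by gcongr
      _ = _ := one_mul _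
  have n1 : η * (K ^ 2 * ε ^ 4 * X0) = 1 / 2 * μ * (ε ^ 2 * X0) := by
    rw [hη, show ε ^ 4 = (τ * μ) * ε ^ 2 by rw [hτμ]; ring]
    field_simp
  have n2 : η * (9 * (d + 1) * d * K ^ 2 * h ^ 2 * X1) ≤ 9 * (d + 1) * d * K ^ 2 * (μ * ζ) * X1 := by
    calc η * (9 * (d + 1) * d * K ^ 2 * h ^ 2 * X1) ≤
        1 * (9 * (d + 1) * d * K ^ 2 * (μ * ζ) * X1) := by gcongr
      _ = _ := one_mul _
  -- The price of Young's inequality with the small weight `θ` of order `1/τ` is `μ² τ = μ ε²`. It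
  -- is smaller than the gradient gain `μ` because `ε² ≤ ζ`.
  have n3 : (2 * (K * μ)) ^ 2 / θ * X1 ≤ 48 * (7 + 3 * d) * K ^ 4 * (μ * ζ) * X1 := by
    have : (2 * (K * μ)) ^ 2 / θ = 48 * (7 + 3 * d) * K ^ 4 * (μ * (τ * μ)) := by
      rw [hθ, hη]; field_simp; ring
    rw [this, hτμ]
    gcongr
  have n4 : θ * (3 * (2 + d) * X2) + θ * X2 = η * (1 / 6 * X2) := by
    rw [hθ]; field_simp; ring
  have n5 : 3 * d * K ^ 2 * h ^ 2 * (d * ε ^ 2 * X0 + 2 * X1) ≤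
      3 * d * K ^ 2 * (μ * ζ) * (d * ε ^ 2 * X0 + 2 * X1) := by gcongr
  have n6 : K ^ 2 * μ ^ 2 * X0 ≤ K ^ 2 * (μ * ε ^ 2 * ζ) * X0 := by gcongr
  have n3' : d * ((2 * (K * μ)) ^ 2 / θ * X1) ≤ d * (48 * (7 + 3 * d) * K ^ 4 * (μ * ζ) * X1) := by
    gcongr
  have hc1 : (18 * d * K ^ 2 + 9 * (d + 1) * d * K ^ 2 + 96 * (7 + 3 * d) * d * K ^ 4 + 8 * K) ≤
      1000 * (d + 1) ^ 2 * K ^ 4 := by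
    have k1 : K ≤ K ^ 4 := le_self_pow₀ hK (by norm_num)
    have k2 : K ^ 2 ≤ K ^ 4 := pow_le_pow_right₀ hK (by norm_num)
    have hd0 : (0 : ℝ) ≤ d := Nat.cast_nonneg d
    have hd2 : (0 : ℝ) ≤ (d : ℝ) ^ 2 := by positivity
    have k3 : (d : ℝ) * K ^ 2 ≤ d * K ^ 4 := by gcongr
    have k4 : (d : ℝ) ^ 2 * K ^ 2 ≤ d ^ 2 * K ^ 4 := by gcongr
    have k5 : (0 : ℝ) ≤ d * K ^ 4 := by positivity
    have k6 : (0 : ℝ) ≤ d ^ 2 * K ^ 4 := by positivity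
    have k7 : (0 : ℝ) ≤ K ^ 4 := by positivity
    linarith only [k1, k2, k3, k4, k5, k6, k7]
  have hc2 : (9 * d ^ 2 * K ^ 2 + 3 * K ^ 2 + 8 * d * K) ≤ 1000 * (d + 1) ^ 2 * K ^ 4 := by
    have k1 : K ≤ K ^ 4 := le_self_pow₀ hK (by norm_num)
    have k2 : K ^ 2 ≤ K ^ 4 := pow_le_pow_right₀ hK (by norm_num)
    have hd0 : (0 : ℝ) ≤ d := Nat.cast_nonneg d
    have k3 : (d : ℝ) * K ≤ d * K ^ 4 := by gcongr
    have k4 : (d : ℝ) ^ 2 * K ^ 2 ≤ d ^ 2 * K ^ 4 := by gcongr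
    have k5 : (0 : ℝ) ≤ d * K ^ 4 := by positivity
    have k6 : (0 : ℝ) ≤ d ^ 2 * K ^ 4 := by positivity
    have k7 : (0 : ℝ) ≤ K ^ 4 := by positivity
    linarith only [k1, k2, k3, k4, k5, k6, k7]
  have hz1 : (18 * d * K ^ 2 + 9 * (d + 1) * d * K ^ 2 + 96 * (7 + 3 * d) * d * K ^ 4 + 8 * K) * ζ ≤
      1 / 2 := by
    have := mul_le_mul_of_nonneg_right hc1 hζ0.le
    linarith only [this, hζ]
  have hz2 : (9 * d ^ 2 * K ^ 2 + 3 * K ^ 2 + 8 * d * K) * ζ ≤ 1 / 2 := by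
    have := mul_le_mul_of_nonneg_right hc2 hζ0.le
    linarith only [this, hζ]
  have w1 := mul_le_mul_of_nonneg_right hz1 (mul_nonneg hμ0.le hX1)
  have w2 := mul_le_mul_of_nonneg_right hz2 (mul_nonneg hμ0.le
    (mul_nonneg (sq_nonneg ε) hX0))
  have w3 : 0 ≤ μ * X1 := by positivity
  have w4 : 0 ≤ μ * (ε ^ 2 * X0) := by positivity
  have c1 : NST ≤ 3 * NQ + 9 * d * K ^ 2 * (μ * ζ) * (d * ε ^ 2 * X0 + 2 * X1) +
      3 * (K ^ 2 * (μ * ε ^ 2 * ζ) * X0) := by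
    linarith only [hupper, hR, hM, n5, n6]
  have c2 : NS + (e1 - e2) ≥ -(9 * (d + 1) * d * K ^ 2 * (μ * ζ) * X1) -
      1 / 2 * μ * (ε ^ 2 * X0) - 2 * (d * (48 * (7 + 3 * d) * K ^ 4 * (μ * ζ) * X1)) := by
    linarith only [hηS, n1, n2, E1, E2, n3', n4]
  linarith only [c1, c2, hsq, hmain, E3, E4, w1, w2, w3, w4]

set_option maxHeartbeats 2000000 in
/-- The abstract Carleman estimate: a conjugated operator `Q` close to the sum of a symmetric part
and an antisymmetric part whose commutator form is positive. -/
theorem carleman_core {Z : Set G} {K ε h τ ζ : ℝ} {α β : Fin d → G → ℝ} {ρ m Q : G → ℝ}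
    (hK : 1 ≤ K) (hτ : 1 ≤ τ) (hτζ : 1 ≤ τ * ζ) (hε : ε = τ * h) (hh : 0 < h)
    (hεζ : ε ≤ ζ) (hζ1 : ζ ≤ 1) (hζ : 2000 * (d + 1) ^ 2 * K ^ 4 * ζ ≤ 1)
    (hV0 : ∀ n ∉ Z, V n = 0) (hV1 : ∀ n ∉ Z, ∀ k, V (n + e k) = 0)
    (hV2 : ∀ n ∉ Z, ∀ k j, V (n + e k + e j) = 0)
    (hα : ∀ n ∈ Z, ∀ k, 2 / 3 ≤ α k n)
    (hαα : ∀ n ∈ Z, ∀ l k j, |fd (e l) (fun n => α k n * α j n) n| ≤ K * h)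
    (hγ : ∀ n ∈ Z, ∀ l k j, |fd (e l) (fun n => α k n * β j n) n| ≤ K * (ε * h))
    (hρβ : ∀ n ∈ Z, ∀ j, |fd (e j) (fun n => ρ n * β j n) n| ≤ K * (ε * h) * ε ^ 2)
    (hmα : ∀ n ∈ Z, ∀ k, |fd (e k) (fun n => m n * α k n) n| ≤ K * (ε * h) * h)
    (hρ : ∀ n ∈ Z, |ρ n| ≤ K * ε ^ 2) (hm : ∀ n ∈ Z, |m n| ≤ K * (ε * h))
    (hpos : ∀ n ∈ Z, ∀ (y : Fin d → ℝ) (v : ℝ), 2 * (ε * h) * (∑ k, y k ^ 2 + ε ^ 2 * v ^ 2) ≤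
      ∑ k, ∑ j, (4 * fd (e k) (fun n => α k n * β j n) n * (y k * y j) -
          2 * fd (e j) (fun n => α k n * β j n) n * y k ^ 2) +
        ∑ k, 2 * m n * α k n * y k ^ 2 +
        (∑ j, 2 * fd (e j) (fun n => ρ n * β j n) n - 2 * ρ n * m n) * v ^ 2)
    (hQ : ∀ n, |Q n - (∑ k, α k n * sd (e k) V n + ρ n * V n - ∑ j, β j n * cd (e j) V n)| ≤
      K * h * ∑ k, (ε * |V n| + |fd (e k) V n| + |fd (e k) V (n - e k)|)) :
    ε * h * (gradSq e V + ε ^ 2 * ∑ n, V n ^ 2) ≤ 3 * ∑ n, Q n ^ 2 := by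
  have hτ0 : 0 < τ := by linarith
  have hε0 : 0 < ε := by rw [hε]; positivity
  have hμ0 : 0 < ε * h := by positivity
  have hζ0 : 0 < ζ := hε0.trans_le hεζ
  have hK0 : 0 < K := by linarith
  set μ := ε * h with hμ
  -- Largeness of `τ` enters here: `h² = μ / τ` and `1 / τ ≤ ζ`, so first order errors with a factor
  -- `h` have squares that are small relative to `μ`.
  have hh2 : h ^ 2 ≤ μ * ζ := by
    rw [hμ, hε]
    nlinarith only [sq_nonneg h, hτζ]
  have hμ2 : μ ^ 2 ≤ μ * ε ^ 2 * ζ := by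
    calc μ ^ 2 = ε ^ 2 * h ^ 2 := by rw [hμ]; ring
      _ ≤ ε ^ 2 * (μ * ζ) := by gcongr
      _ = _ := by ring
  have hτμ : τ * μ = ε ^ 2 := by rw [hμ]; nth_rewrite 2 [hε]; rw [hε]; ring
  have hε2 : ε ^ 2 ≤ ζ := by nlinarith only [hε0, hεζ, hζ1]
  set X1 := gradSq e V
  set X0 := ∑ n, V n ^ 2
  set X2 := hessSq e V
  have hX1 : 0 ≤ X1 := gradSq_nonneg e V
  have hX2 : 0 ≤ X2 := hessSq_nonneg e V
  have hX0 : 0 ≤ X0 := Finset.sum_nonneg fun _ _ => sq_nonneg _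
  set S : G → ℝ := fun n => ∑ k, α k n * sd (e k) V n + ρ n * V n with hS
  -- Subtracting `m V` from the antisymmetric part adds `2 m α |δV|² - 2 ρ m V²` to the commutator
  -- form at leading order. Restoring `m V` in the equation costs only `K² μ² X0`.
  set T : G → ℝ := fun n => -∑ j, β j n * cd (e j) V n - m n * V n with hT
  have hfd0 : ∀ n ∉ Z, ∀ k, fd (e k) V n = 0 := fun n hn k => by
    simp [fd, hV0 n hn, hV1 n hn]
  -- the right-hand side
  have hR : ∑ n, (Q n - (S n + T n + m n * V n)) ^ 2 ≤
      3 * d * K ^ 2 * h ^ 2 * (d * ε ^ 2 * X0 + 2 * X1) := by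
    have hpt : ∀ n, (Q n - (S n + T n + m n * V n)) ^ 2 ≤ 3 * d * K ^ 2 * h ^ 2 *
        ∑ k, (ε ^ 2 * V n ^ 2 + fd (e k) V n ^ 2 + fd (e k) V (n - e k) ^ 2) := by
      intro n
      have h1 := hQ n
      rw [show Q n - (S n + T n + m n * V n) = Q n - (∑ k, α k n * sd (e k) V n + ρ n * V n -
        ∑ j, β j n * cd (e j) V n) by simp only [hS, hT]; ring]
      rw [← sq_abs]
      refine (pow_le_pow_left₀ (abs_nonneg _) h1 2).trans ?_
      rw [mul_pow]
      have h2 := sq_sum_le_card_mul_sum_sq (s := (Finset.univ : Finset (Fin d)))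
        (f := fun k => ε * |V n| + |fd (e k) V n| + |fd (e k) V (n - e k)|)
      rw [Finset.card_univ, Fintype.card_fin] at h2
      have h3 : ∑ k, (ε * |V n| + |fd (e k) V n| + |fd (e k) V (n - e k)|) ^ 2 ≤
          3 * ∑ k, (ε ^ 2 * V n ^ 2 + fd (e k) V n ^ 2 + fd (e k) V (n - e k) ^ 2) := by
        rw [Finset.mul_sum]
        refine Finset.sum_le_sum fun k _ => ?_
        rw [← sq_abs (V n), ← sq_abs (fd (e k) V n), ← sq_abs (fd (e k) V (n - e k))]
        nlinarith only [sq_nonneg (ε * |V n| - |fd (e k) V n|),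
          sq_nonneg (ε * |V n| - |fd (e k) V (n - e k)|),
          sq_nonneg (|fd (e k) V n| - |fd (e k) V (n - e k)|)]
      calc (K * h) ^ 2 * (∑ k, (ε * |V n| + |fd (e k) V n| + |fd (e k) V (n - e k)|)) ^ 2 ≤
          (K * h) ^ 2 * (d * (3 * ∑ k, (ε ^ 2 * V n ^ 2 + fd (e k) V n ^ 2 +
            fd (e k) V (n - e k) ^ 2))) := by
            gcongr
            exact h2.trans (by gcongr)
        _ = _ := by ring
    refine (Finset.sum_le_sum fun n _ => hpt n).trans (le_of_eq ?_)
    rw [← Finset.mul_sum]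
    congr 1
    rw [Finset.sum_comm]
    simp only [Finset.sum_add_distrib, ← Finset.mul_sum]
    have : ∀ k, ∑ n, fd (e k) V (n - e k) ^ 2 = ∑ n, fd (e k) V n ^ 2 := fun k =>
      sum_shift_sub (e k) fun n => fd (e k) V n ^ 2
    simp only [this, ← gradSq_eq, Finset.sum_const, Finset.card_univ, Fintype.card_fin,
      nsmul_eq_mul]
    ring
  have hmV : ∑ n, (m n * V n) ^ 2 ≤ K ^ 2 * μ ^ 2 * X0 := by
    rw [Finset.mul_sum]
    refine Finset.sum_le_sum fun n _ => ?_
    by_cases hn : n ∈ Z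
    · rw [mul_pow, ← sq_abs (m n), show K ^ 2 * μ ^ 2 = (K * μ) ^ 2 by ring]
      have := hm n hn
      gcongr
    · simp [hV0 n hn]
  have hρV : ∑ n, (ρ n * V n) ^ 2 ≤ K ^ 2 * ε ^ 4 * X0 := by
    rw [Finset.mul_sum]
    refine Finset.sum_le_sum fun n _ => ?_
    by_cases hn : n ∈ Z
    · rw [mul_pow, ← sq_abs (ρ n), show K ^ 2 * ε ^ 4 = (K * ε ^ 2) ^ 2 by ring]
      have := hρ n hn
      gcongr
    · simp [hV0 n hn]
  have hupper : ∑ n, (S n + T n) ^ 2 ≤ 3 * ∑ n, Q n ^ 2 +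
      3 * ∑ n, (Q n - (S n + T n + m n * V n)) ^ 2 + 3 * ∑ n, (m n * V n) ^ 2 := by
    rw [Finset.mul_sum, Finset.mul_sum, Finset.mul_sum, ← Finset.sum_add_distrib,
      ← Finset.sum_add_distrib]
    refine Finset.sum_le_sum fun n _ => ?_
    have : ∀ q r v : ℝ, (q - r - v) ^ 2 ≤ 3 * q ^ 2 + 3 * r ^ 2 + 3 * v ^ 2 := fun q r v => by
      nlinarith only [sq_nonneg (q + r), sq_nonneg (q + v), sq_nonneg (r - v)]
    have h1 := this (Q n) (Q n - (S n + T n + m n * V n)) (m n * V n)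
    rwa [show Q n - (Q n - (S n + T n + m n * V n)) - m n * V n = S n + T n by ring] at h1
  -- the symmetric part
  have hsymm : 1 / 2 * ∑ n, (∑ k, α k n * sd (e k) V n) ^ 2 - ∑ n, (ρ n * V n) ^ 2 ≤
      ∑ n, S n ^ 2 := by
    rw [Finset.mul_sum, ← Finset.sum_sub_distrib]
    refine Finset.sum_le_sum fun n _ => ?_
    simp only [hS]
    nlinarith only [sq_nonneg (∑ k, α k n * sd (e k) V n + 2 * (ρ n * V n))]
  have hreg := hessSq_le (e := e) (V := V) hV0 hV1 hV2 hα hαα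
  have hS0 : 0 ≤ ∑ n, S n ^ 2 := Finset.sum_nonneg fun _ _ => sq_nonneg _
  -- the commutator
  have hcomm := two_mul_sum_symm_mul_antisymm e V α β ρ m
  have hmain : 2 * μ * (X1 + ε ^ 2 * X0) ≤ ∑ n, (∑ k, ∑ j, (4 * fd (e k)
          (fun n => α k n * β j n) n * (fd (e k) V n * fd (e j) V n) -
          2 * fd (e j) (fun n => α k n * β j n) n * fd (e k) V n ^ 2) +
        ∑ k, 2 * m n * α k n * fd (e k) V n ^ 2 +
        (∑ j, 2 * fd (e j) (fun n => ρ n * β j n) n - 2 * ρ n * m n) * V n ^ 2) := by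
    have : 2 * μ * (X1 + ε ^ 2 * X0) =
        ∑ n, 2 * μ * (∑ k, fd (e k) V n ^ 2 + ε ^ 2 * V n ^ 2) := by
      rw [← Finset.mul_sum, Finset.sum_add_distrib, ← Finset.mul_sum]; rfl
    rw [this]
    refine Finset.sum_le_sum fun n _ => ?_
    by_cases hn : n ∈ Z
    · exact hpos n hn (fun k => fd (e k) V n) (V n)
    · simp [hfd0 n hn, hV0 n hn]
  set η : ℝ := 1 / (2 * K ^ 2 * τ) with hη
  have hη0 : 0 < η := by positivity
  have hη1 : η ≤ 1 := by
    rw [hη, div_le_one (by positivity)]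
    nlinarith [one_le_pow₀ hK (n := 2)]
  set θ : ℝ := η / (6 * (7 + 3 * d)) with hθ
  have hθ0 : 0 < θ := by positivity
  have E1 : -(θ * (3 * (2 + d) * X2) + d * ((2 * (K * μ)) ^ 2 / θ * X1)) ≤
      ∑ k, ∑ j, ∑ n, 2 * fd (e k) (fun n => α k n * β j n) n * fd (e k) V n *
          (cd (e j) V (n + e k) - 2 * fd (e j) V n) := by
    have h1 : ∀ k j n, |2 * fd (e k) (fun n => α k n * β j n) n * fd (e k) V n *
          (cd (e j) V (n + e k) - 2 * fd (e j) V n)| ≤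
        θ * (cd (e j) V (n + e k) - 2 * fd (e j) V n) ^ 2 +
          (2 * (K * μ)) ^ 2 / θ * fd (e k) V n ^ 2 := by
      intro k j n
      by_cases hn : n ∈ Z
      · refine mul_le_add_sq hθ0 ?_
        rw [abs_mul, abs_two]
        exact mul_le_mul_of_nonneg_left (hγ n hn k k j) (by norm_num)
      · rw [hfd0 n hn k, mul_zero, zero_mul, abs_zero]
        positivity
    have h2 := Finset.sum_le_sum fun k (_ : k ∈ Finset.univ) =>
      Finset.sum_le_sum fun j (_ : j ∈ Finset.univ) =>
        neg_le_sum_of_abs_le Finset.univ fun n _ => h1 k j n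
    refine le_trans ?_ h2
    simp only [Finset.sum_neg_distrib, Finset.sum_add_distrib, ← Finset.mul_sum, Finset.sum_const,
      Finset.card_univ, Fintype.card_fin, nsmul_eq_mul]
    rw [← gradSq_eq]
    have h3 := mul_le_mul_of_nonneg_left (sum_sq_cd_sub_le e V) hθ0.le
    refine neg_le_neg ?_
    linarith only [h3]
  have E2 : ∑ k, ∑ j, ∑ n, 2 * fd (e j) (fun n => α k n * β j n) n * fd (e k) V n *
          fd (e j) (fd (e k) V) n ≤ θ * X2 + d * ((2 * (K * μ)) ^ 2 / θ * X1) := by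
    have h1 : ∀ k j n, 2 * fd (e j) (fun n => α k n * β j n) n * fd (e k) V n *
          fd (e j) (fd (e k) V) n ≤
        θ * fd (e j) (fd (e k) V) n ^ 2 + (2 * (K * μ)) ^ 2 / θ * fd (e k) V n ^ 2 := by
      intro k j n
      by_cases hn : n ∈ Z
      · refine le_of_abs_le (mul_le_add_sq hθ0 ?_)
        rw [abs_mul, abs_two]
        exact mul_le_mul_of_nonneg_left (hγ n hn j k j) (by norm_num)
      · rw [hfd0 n hn k, mul_zero, zero_mul]
        positivity
    have h2 := Finset.sum_le_sum fun k (_ : k ∈ Finset.univ) =>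
      Finset.sum_le_sum fun j (_ : j ∈ Finset.univ) =>
        Finset.sum_le_sum fun n (_ : n ∈ Finset.univ) => h1 k j n
    refine h2.trans (le_of_eq ?_)
    simp only [Finset.sum_add_distrib, ← Finset.mul_sum, Finset.sum_const,
      Finset.card_univ, Fintype.card_fin, nsmul_eq_mul]
    rw [← gradSq_eq, ← hessSq_eq]
    ring
  have E3 : -(4 * K * μ * ζ * (X1 + d * (ε ^ 2 * X0))) ≤
      ∑ j, ∑ n, 2 * fd (e j) (fun n => ρ n * β j n) n * V n * fd (e j) V n := by
    have h1 : ∀ j n, |2 * fd (e j) (fun n => ρ n * β j n) n * V n * fd (e j) V n| ≤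
        4 * K * μ * ζ * fd (e j) V n ^ 2 + 4 * K * μ * ζ * (ε ^ 2 * V n ^ 2) := by
      intro j n
      by_cases hn : n ∈ Z
      · have hc : |2 * fd (e j) (fun n => ρ n * β j n) n| ≤ 2 * (K * μ * ε ^ 2) := by
          rw [abs_mul, abs_two]
          exact mul_le_mul_of_nonneg_left (hρβ n hn j) (by norm_num)
        -- The weight `K μ ε` balances a gradient against `ε V`, the natural scale of the energy;
        -- both sides then carry `ε ≤ ζ`.
        refine (mul_le_add_sq (θ := K * μ * ε) (by positivity) hc).trans ?_
        refine add_le_add ?_ ?_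
        · gcongr
          linarith only [hK0]
        · rw [show (2 * (K * μ * ε ^ 2)) ^ 2 / (K * μ * ε) * V n ^ 2 =
            4 * K * μ * ε * (ε ^ 2 * V n ^ 2) by field_simp; ring]
          gcongr
      · rw [hfd0 n hn j, mul_zero, abs_zero]
        positivity
    have h2 := Finset.sum_le_sum fun j (_ : j ∈ Finset.univ) =>
        neg_le_sum_of_abs_le Finset.univ fun n _ => h1 j n
    refine le_trans (le_of_eq ?_) h2
    simp only [Finset.sum_neg_distrib, Finset.sum_add_distrib, ← Finset.mul_sum, Finset.sum_const,
      Finset.card_univ, Fintype.card_fin, nsmul_eq_mul]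
    rw [← gradSq_eq]
    ring
  have E4 : -(4 * K * μ * ζ * (X1 + d * (ε ^ 2 * X0))) ≤
      ∑ k, ∑ n, 2 * fd (e k) (fun n => m n * α k n) n * V (n + e k) * fd (e k) V n := by
    have h1 : ∀ k n, |2 * fd (e k) (fun n => m n * α k n) n * V (n + e k) * fd (e k) V n| ≤
        4 * K * μ * ζ * fd (e k) V n ^ 2 + 4 * K * μ * ζ * (ε ^ 2 * V (n + e k) ^ 2) := by
      intro j n
      by_cases hn : n ∈ Z
      · have hc : |2 * fd (e j) (fun n => m n * α j n) n| ≤ 2 * (K * μ * h) := by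
          rw [abs_mul, abs_two]
          exact mul_le_mul_of_nonneg_left (hmα n hn j) (by norm_num)
        -- With the weight `K μ ζ` the zero order cost is `4 K μ h² / ζ`, and `h = ε / τ ≤ ε ζ`
        -- bounds it by `4 K μ ζ ε²`.
        refine (mul_le_add_sq (θ := K * μ * ζ) (by positivity) hc).trans ?_
        refine add_le_add ?_ ?_
        · gcongr
          linarith only [hK0]
        · have h3 : (2 * (K * μ * h)) ^ 2 / (K * μ * ζ) * V (n + e j) ^ 2 =
            4 * K * μ * (h ^ 2 / ζ * V (n + e j) ^ 2) := by field_simp; ring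
          rw [h3, show 4 * K * μ * ζ * (ε ^ 2 * V (n + e j) ^ 2) =
            4 * K * μ * (ζ * ε ^ 2 * V (n + e j) ^ 2) by ring]
          gcongr
          rw [div_le_iff₀ hζ0, hε]
          have : 1 ≤ (τ * ζ) ^ 2 := one_le_pow₀ hτζ
          nlinarith only [this, sq_nonneg h]
      · rw [hfd0 n hn j, mul_zero, abs_zero]
        positivity
    have h2 := Finset.sum_le_sum fun j (_ : j ∈ Finset.univ) =>
        neg_le_sum_of_abs_le Finset.univ fun n _ => h1 j n
    refine le_trans (le_of_eq ?_) h2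
    have h4 : ∀ k, ∑ n, V (n + e k) ^ 2 = X0 := fun k => sum_shift (e k) fun n => V n ^ 2
    simp only [Finset.sum_neg_distrib, Finset.sum_add_distrib, ← Finset.mul_sum, Finset.sum_const,
      Finset.card_univ, Fintype.card_fin, nsmul_eq_mul, h4]
    rw [← gradSq_eq]
    ring
  -- The square of the antisymmetric part is discarded. That of the symmetric part must be kept,
  -- because it controls the second differences.
  have hsq : ∑ n, (S n + T n) ^ 2 ≥ ∑ n, S n ^ 2 + 2 * ∑ n, S n * T n := by
    rw [Finset.mul_sum, ← Finset.sum_add_distrib]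
    exact Finset.sum_le_sum fun n _ => by nlinarith only [sq_nonneg (T n)]
  have hST : 2 * ∑ n, S n * T n = 2 * ∑ n, (∑ k, α k n * sd (e k) V n + ρ n * V n) *
        (-∑ j, β j n * cd (e j) V n - m n * V n) := rfl
  rw [hST, hcomm] at hsq
  exact carleman_absorb hK hτ hζ0 hμ0 hX0 hX1 hζ hh2 hμ2 hτμ hε2 hR hmV hupper
    (by linarith only [hsymm, hreg, hρV]) hS0 hmain E1 E2 E3 E4 hsq

end Core

/-! ### The convexified quadratic weight and its expansion on the mesh -/

section Weight

variable {d : ℕ}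

/-- The defining function `s - |x|²` of the sphere of squared radius `s`. -/
def psi (s : ℝ) (x : Fin d → ℝ) : ℝ := s - ∑ k, x k ^ 2

/-- The Carleman weight. -/
noncomputable def phi (lam s : ℝ) (x : Fin d → ℝ) : ℝ := psi s x + lam / 2 * psi s x ^ 2

/-- The gradient of the Carleman weight. -/
def grd (lam s : ℝ) (x : Fin d → ℝ) (k : Fin d) : ℝ := -2 * (1 + lam * psi s x) * x k

/-- The point `x + c e_l`. -/
def step (c : ℝ) (l : Fin d) (x : Fin d → ℝ) : Fin d → ℝ := fun k => x k + if k = l then c else 0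

theorem psi_step (s c : ℝ) (l : Fin d) (x : Fin d → ℝ) :
    psi s (step c l x) = psi s x - 2 * c * x l - c ^ 2 := by
  have : ∑ k, step c l x k ^ 2 = ∑ k, x k ^ 2 + (2 * c * x l + c ^ 2) := by
    have h1 : ∀ k, step c l x k ^ 2 = x k ^ 2 + if k = l then 2 * c * x l + c ^ 2 else 0 := by
      intro k
      by_cases hk : k = l
      · subst hk; simp only [step, if_true]; ring
      · simp [step, hk]
    simp only [h1, Finset.sum_add_distrib, Finset.sum_ite_eq', Finset.mem_univ, if_true]
  rw [psi, psi, this]; ring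

variable {lam s X c : ℝ} {x : Fin d → ℝ}

theorem abs_psi_step_sub_le (hX : 1 ≤ X) (hx : ∀ k, |x k| ≤ X) (hc : |c| ≤ 1) (l : Fin d) :
    |psi s (step c l x) - psi s x| ≤ 3 * X * |c| := by
  rw [psi_step, show psi s x - 2 * c * x l - c ^ 2 - psi s x = -(c * (2 * x l + c)) by ring, abs_neg,
    abs_mul, mul_comm]
  refine mul_le_mul_of_nonneg_right ?_ (abs_nonneg _)
  have := abs_add_le (2 * x l) c
  rw [abs_mul, abs_two] at this
  linarith [hx l]

/-- The weight is a quadratic polynomial in `psi` and `psi` is quadratic in `x`, so the remainder is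
the explicit expression `-(1 + λψ) c²` plus `λ/2` times the squared increment of `psi`. -/
theorem abs_phi_step_sub_le (hlam : 0 ≤ lam) (hX : 1 ≤ X) (hx : ∀ k, |x k| ≤ X) (hc : |c| ≤ 1)
    (ht : |1 + lam * psi s x| ≤ 3 / 2) (l : Fin d) :
    |phi lam s (step c l x) - phi lam s x - c * grd lam s x l| ≤
      (2 + 5 * lam * X ^ 2) * c ^ 2 := by
  have h1 := abs_psi_step_sub_le (s := s) hX hx hc l
  have h2 : phi lam s (step c l x) - phi lam s x - c * grd lam s x l =
      -(1 + lam * psi s x) * c ^ 2 + lam / 2 * (psi s (step c l x) - psi s x) ^ 2 := by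
    rw [phi, phi, grd, psi_step]; ring
  rw [h2]
  have h3 : (psi s (step c l x) - psi s x) ^ 2 ≤ 9 * X ^ 2 * c ^ 2 := by
    rw [← sq_abs, ← sq_abs c]
    calc |psi s (step c l x) - psi s x| ^ 2 ≤ (3 * X * |c|) ^ 2 := by gcongr
      _ = _ := by ring
  have h4 : |-(1 + lam * psi s x) * c ^ 2| ≤ 3 / 2 * c ^ 2 := by
    rw [abs_mul, abs_neg, abs_of_nonneg (sq_nonneg c)]
    gcongr
  have h5 : |lam / 2 * (psi s (step c l x) - psi s x) ^ 2| ≤ lam / 2 * (9 * X ^ 2 * c ^ 2) := by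
    rw [abs_of_nonneg (by positivity)]
    gcongr
  refine (abs_add_le_add h4 h5).trans ?_
  have : 0 ≤ lam * X ^ 2 * c ^ 2 := by positivity
  linarith [sq_nonneg c]

/-- The constant bounding the weight and its derivatives. -/
def wconst (lam X : ℝ) : ℝ := 20 * lam * X ^ 2 + 6 * X + 3

theorem localStep_of_weight {h ε ζ : ℝ} {a a' : Fin d → ℝ} (l : Fin d)
    (hlam : 0 ≤ lam) (hX : 1 ≤ X) (hx : ∀ k, |x k| ≤ X)
    (hψ : |lam * psi s x| ≤ 1 / 2) (hh : 0 < h) (hε : 0 ≤ ε) (hhζ : h ≤ ζ) (hεζ : ε ≤ ζ)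
    (hζ : ζ ≤ 1) (hBε : wconst lam X * ε ≤ 1)
    (ha : ∀ k, 2 / 3 ≤ a k ∧ a k ≤ 4 / 3) (ha' : ∀ k, 2 / 3 ≤ a' k ∧ a' k ≤ 4 / 3)
    (hd : ∀ k, |a' k - a k| ≤ h) :
    LocalStep (wconst lam X) ε h ζ a a' (grd lam s x) (grd lam s (step h l x))
      (hess lam (1 + lam * psi s x) x l) := by
  have hX0 : 0 ≤ X := by linarith
  have hlX : 0 ≤ lam * X ^ 2 := by positivity
  have hXX : X ≤ X ^ 2 := le_self_pow₀ hX (by norm_num)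
  have hlX' : lam * X ≤ lam * X ^ 2 := by gcongr
  have hlX0 : 0 ≤ lam * X := by positivity
  have hh1 : |h| ≤ 1 := by rw [abs_of_pos hh]; linarith
  have ht : |1 + lam * psi s x| ≤ 3 / 2 := by
    rw [abs_le] at hψ ⊢; constructor <;> linarith [hψ.1, hψ.2]
  have hΔ := abs_psi_step_sub_le (s := s) hX hx hh1 l
  rw [abs_of_pos hh] at hΔ
  have hΔ1 : |psi s (step h l x) - psi s x| ≤ 3 * X :=
    hΔ.trans (by nlinarith)
  have ht' : |1 + lam * psi s (step h l x)| ≤ 3 / 2 + 3 * (lam * X) := by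
    have h1 := abs_add_le_add ht (abs_mul_le_mul (le_of_eq (abs_of_nonneg hlam)) hΔ1)
    rw [show 1 + lam * psi s x + lam * (psi s (step h l x) - psi s x) =
      1 + lam * psi s (step h l x) by ring] at h1
    linarith
  have hx' : ∀ k, |step h l x k| ≤ 2 * X := by
    intro k
    refine (abs_add_le _ _).trans ?_
    have : |if k = l then h else 0| ≤ 1 := by split_ifs <;> simp [hh1]
    linarith [hx k]
  refine ⟨?_, hε, hh.le, hεζ, hhζ, hζ, hBε, fun k => by linarith [(ha k).1], fun k => (ha k).2,
    fun k => by linarith [(ha' k).1], fun k => (ha' k).2, hd, ?_, ?_, ?_, ?_⟩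
  · unfold wconst; linarith
  · intro k
    have := abs_mul_le_mul (abs_mul_le_mul (le_of_eq (abs_neg (2 : ℝ))) ht) (hx k)
    rw [abs_two] at this
    refine this.trans ?_
    unfold wconst; linarith
  · intro k
    have := abs_mul_le_mul (abs_mul_le_mul (le_of_eq (abs_neg (2 : ℝ))) ht') (hx' k)
    rw [abs_two] at this
    refine this.trans ?_
    unfold wconst; nlinarith
  · intro k
    have h1 : |4 * lam * x l * x k| ≤ 4 * lam * X * X :=
      abs_mul_le_mul (abs_mul_le_mul (le_of_eq (abs_of_nonneg (by positivity))) (hx l)) (hx k)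
    have h2 : |if l = k then 2 * (1 + lam * psi s x) else 0| ≤ 3 := by
      split_ifs
      · rw [abs_mul, abs_two]; linarith
      · simp
    refine (abs_sub _ _).trans ?_
    unfold wconst; nlinarith
  · intro k
    -- The gradient is a cubic polynomial, so its remainder beyond the Hessian term is also exact
    -- and visibly quadratic in `h`.
    have e1 : grd lam s (step h l x) k - grd lam s x k - h * hess lam (1 + lam * psi s x) x l k =
        2 * lam * x k * h ^ 2 -
          if k = l then 2 * lam * h * (psi s (step h l x) - psi s x) else 0 := by
      by_cases hk : k = l
      · subst hk
        simp only [grd, hess, psi_step, step, if_true]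
        ring
      · simp only [grd, hess, psi_step, step, hk, if_false, Ne.symm hk]
        ring
    rw [e1]
    have h1 : |2 * lam * x k * h ^ 2| ≤ 2 * lam * X * h ^ 2 :=
      abs_mul_le_mul (abs_mul_le_mul (le_of_eq (abs_of_nonneg (by positivity))) (hx k))
        (le_of_eq (abs_of_nonneg (by positivity)))
    have h2 : |if k = l then 2 * lam * h * (psi s (step h l x) - psi s x) else 0| ≤
        2 * lam * h * (3 * X * h) := by
      split_ifs
      · exact abs_mul_le_mul (le_of_eq (abs_of_nonneg (by positivity))) hΔ
      · rw [abs_zero]; positivity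
    refine (abs_sub _ _).trans ?_
    have h3 : wconst lam X * h * h ≤ wconst lam X * h * ζ := by
      have : 0 ≤ wconst lam X := by unfold wconst; linarith
      gcongr
    refine le_trans ?_ h3
    have h4 : 8 * (lam * X) ≤ wconst lam X := by unfold wconst; linarith
    have h5 : 8 * (lam * X) * (h * h) ≤ wconst lam X * (h * h) :=
      mul_le_mul_of_nonneg_right h4 (by positivity)
    linarith

end Weight

/-! ### Conjugation of the elliptic operator by the weight -/

section Carleman

variable {G : Type*} [AddCommGroup G] {d : ℕ}

/-- The undivided elliptic operator `∑ δ_k (a_k δ_k z)`. -/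
def ellip (e : Fin d → G) (a : Fin d → G → ℝ) (z : G → ℝ) (n : G) : ℝ :=
  ∑ k, (a k n * (z (n + e k) - z n) - a k (n - e k) * (z n - z (n - e k)))

/-- A set `Z` of mesh points near a sphere of squared radius `s`, with coordinates `x` and elliptic
Lipschitz coefficients `a`. -/
structure SphereLayer (e : Fin d → G) (h X lam s κ : ℝ) (a : Fin d → G → ℝ)
    (x : G → Fin d → ℝ) (Z : Set G) : Prop where
  coeff : ∀ k n, 2 / 3 ≤ a k n ∧ a k n ≤ 4 / 3
  coeff_add : ∀ n ∈ Z, ∀ k l, |a k (n + e l) - a k n| ≤ h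
  coeff_sub : ∀ n ∈ Z, ∀ k, |a k (n - e k) - a k n| ≤ h
  x_add : ∀ n ∈ Z, ∀ l, x (n + e l) = step h l (x n)
  x_sub : ∀ n ∈ Z, ∀ l, x (n - e l) = step (-h) l (x n)
  x_le : ∀ n ∈ Z, ∀ k, |x n k| ≤ X
  psi_le : ∀ n ∈ Z, |lam * psi s (x n)| ≤ 1 / 2
  kap_le : ∀ n ∈ Z, κ ≤ 8 / 3 * ∑ k, x n k ^ 2

variable {e : Fin d → G} {h X lam s κ : ℝ} {a : Fin d → G → ℝ} {x : G → Fin d → ℝ} {Z : Set G}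

theorem SphereLayer.localStep (H : SphereLayer e h X lam s κ a x Z) {ε ζ : ℝ}
    (hlam : 0 ≤ lam) (hX : 1 ≤ X) (hh : 0 < h) (hε : 0 ≤ ε) (hhζ : h ≤ ζ) (hεζ : ε ≤ ζ)
    (hζ : ζ ≤ 1) (hBε : wconst lam X * ε ≤ 1) {n : G} (hn : n ∈ Z) (l : Fin d) :
    LocalStep (wconst lam X) ε h ζ (fun k => a k n) (fun k => a k (n + e l))
      (grd lam s (x n)) (grd lam s (x (n + e l))) (hess lam (1 + lam * psi s (x n)) (x n) l) := by
  rw [H.x_add n hn l]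
  exact localStep_of_weight l hlam hX (H.x_le n hn) (H.psi_le n hn) hh hε hhζ hεζ hζ hBε
    (fun k => H.coeff k n) (fun k => H.coeff k _) (fun k => H.coeff_add n hn k l)

theorem exp_sub_le {p q : ℝ} (hp : |p| ≤ 1) (hq : |q| ≤ 1) :
    |Real.exp q - Real.exp p| ≤ 3 * |q - p| := by
  refine abs_image_sub_le_of_deriv Real.hasDerivAt_exp (fun y hy => ?_) hp hq
  rw [abs_of_pos (Real.exp_pos y)]
  have h1 := Real.exp_le_exp.mpr (le_of_abs_le hy)
  have h2 := Real.exp_one_lt_d9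
  linarith

/-- The conjugated operator is, up to first order terms with a factor `h`, the sum of its symmetric
and antisymmetric parts. -/
theorem SphereLayer.conj_sub_le (H : SphereLayer e h X lam s κ a x Z) {τ : ℝ}
    (hlam : 0 ≤ lam) (hX : 1 ≤ X) (hh : 0 < h) (hh1 : h ≤ 1) (hτ : 0 ≤ τ)
    (hBε : wconst lam X * (τ * h) ≤ 1 / 2) (V : G → ℝ) {n : G} (hn : n ∈ Z) :
    |Real.exp (τ * phi lam s (x n)) *
        ellip e a (fun n => Real.exp (-(τ * phi lam s (x n))) * V n) n -
      (∑ k, a k n * Real.cosh (τ * h * grd lam s (x n) k) * sd (e k) V n +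
        rho (τ * h) (fun k => a k n) (grd lam s (x n)) * V n -
        ∑ k, a k n * Real.sinh (τ * h * grd lam s (x n) k) * cd (e k) V n)| ≤
      14 * wconst lam X * h *
        ∑ k, (τ * h * |V n| + |fd (e k) V n| + |fd (e k) V (n - e k)|) := by
  set B := wconst lam X with hB
  set ε := τ * h with hε
  have hε0 : 0 ≤ ε := mul_nonneg hτ hh.le
  have hX0 : 0 ≤ X := by linarith
  have hlX : 0 ≤ lam * X ^ 2 := by positivity
  have hB1 : 1 ≤ B := by rw [hB]; unfold wconst; linarith
  have hBh : 2 + 5 * lam * X ^ 2 ≤ B := by rw [hB]; unfold wconst; linarith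
  have ht : |1 + lam * psi s (x n)| ≤ 3 / 2 := by
    have := H.psi_le n hn
    rw [abs_le] at this ⊢; constructor <;> linarith [this.1, this.2]
  have hgB : ∀ k, |grd lam s (x n) k| ≤ B := by
    intro k
    have := abs_mul_le_mul (abs_mul_le_mul (le_of_eq (abs_neg (2 : ℝ))) ht) (H.x_le n hn k)
    rw [abs_two] at this
    refine this.trans ?_
    rw [hB]; unfold wconst; linarith
  have hp : ∀ k, |ε * grd lam s (x n) k| ≤ B * ε := fun k => by
    rw [mul_comm B]; exact abs_mul_le_mul (le_of_eq (abs_of_nonneg hε0)) (hgB k)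
  have hμ : B * (ε * h) ≤ 1 / 2 := by
    have h1 : B * (ε * h) = B * ε * h := by ring
    have h2 : 0 ≤ B * ε := mul_nonneg (by linarith) hε0
    rw [h1]; nlinarith
  have hp1 : ∀ k, |ε * grd lam s (x n) k| ≤ 1 := fun k => (hp k).trans (by linarith)
  have hθ : ∀ k, |τ * phi lam s (x (n + e k)) - τ * phi lam s (x n) -
      ε * grd lam s (x n) k| ≤ B * (ε * h) := by
    intro k
    rw [H.x_add n hn k]
    have h1 := abs_phi_step_sub_le (c := h) hlam hX (H.x_le n hn)
      (by rw [abs_of_pos hh]; exact hh1) ht k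
    have h2 := abs_mul_le_mul (le_of_eq (abs_of_nonneg hτ)) h1
    rw [show τ * (phi lam s (step h k (x n)) - phi lam s (x n) - h * grd lam s (x n) k) =
      τ * phi lam s (step h k (x n)) - τ * phi lam s (x n) - ε * grd lam s (x n) k by
        rw [hε]; ring] at h2
    refine h2.trans ?_
    rw [show τ * ((2 + 5 * lam * X ^ 2) * h ^ 2) = (2 + 5 * lam * X ^ 2) * (ε * h) by
      rw [hε]; ring]
    gcongr
  have hθ' : ∀ k, |τ * phi lam s (x n) - τ * phi lam s (x (n - e k)) -
      ε * grd lam s (x n) k| ≤ B * (ε * h) := by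
    intro k
    rw [H.x_sub n hn k]
    have h1 := abs_phi_step_sub_le (c := -h) hlam hX (H.x_le n hn)
      (by rw [abs_neg, abs_of_pos hh]; exact hh1) ht k
    have h2 := abs_mul_le_mul (le_of_eq (abs_of_nonneg hτ)) h1
    rw [← abs_neg, show -(τ * (phi lam s (step (-h) k (x n)) - phi lam s (x n) -
      -h * grd lam s (x n) k)) =
      τ * phi lam s (x n) - τ * phi lam s (step (-h) k (x n)) - ε * grd lam s (x n) k by
        rw [hε]; ring] at h2
    refine h2.trans ?_
    rw [show τ * ((2 + 5 * lam * X ^ 2) * (-h) ^ 2) = (2 + 5 * lam * X ^ 2) * (ε * h) by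
      rw [hε]; ring]
    gcongr
  -- Two substitutions are made in each direction. The increments of `τ φ` become `± ε g_k`, with an
  -- error `B ε h`. The coefficient at `n - e k` becomes the one at `n`, with an error `h` that
  -- multiplies quantities which are themselves first order.
  have hpt : ∀ k, |a k n * (Real.exp (-(τ * phi lam s (x (n + e k)) - τ * phi lam s (x n))) *
        V (n + e k) - V n) +
      a k (n - e k) * (Real.exp (τ * phi lam s (x n) - τ * phi lam s (x (n - e k))) *
        V (n - e k) - V n) -
      a k n * (Real.exp (-(ε * grd lam s (x n) k)) * V (n + e k) +
        Real.exp (ε * grd lam s (x n) k) * V (n - e k) - 2 * V n)| ≤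
      14 * B * h * (ε * |V n| + |fd (e k) V n| + |fd (e k) V (n - e k)|) := by
    intro k
    have t1 := hθ k
    have t2 := hθ' k
    have t3 := hp k
    have t4 := hp1 k
    set θ := τ * phi lam s (x (n + e k)) - τ * phi lam s (x n)
    set θ' := τ * phi lam s (x n) - τ * phi lam s (x (n - e k))
    set p := ε * grd lam s (x n) k
    have hBε' : B * ε ≤ 1 / 2 := hBε
    have hBε0 : 0 ≤ B * ε := mul_nonneg (by linarith) hε0
    have hμ0 : 0 ≤ B * (ε * h) := mul_nonneg (by linarith) (mul_nonneg hε0 hh.le)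
    have a1 : |θ| ≤ 1 := by
      have := abs_add_le_add t1 t3
      rw [sub_add_cancel] at this; linarith
    have a2' : |θ'| ≤ B * (ε * h) + B * ε := by
      have := abs_add_le_add t2 t3
      rwa [sub_add_cancel] at this
    have a2 : |θ'| ≤ 1 := by linarith
    have hhε : B * (ε * h) ≤ B * ε := by
      rw [← mul_assoc]; nlinarith
    have b1 : |Real.exp (-θ) - Real.exp (-p)| ≤ 3 * (B * (ε * h)) := by
      refine (exp_sub_le (by rwa [abs_neg]) (by rwa [abs_neg])).trans ?_
      rw [show -θ - -p = -(θ - p) by ring, abs_neg]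
      linarith
    have b2 : |Real.exp θ' - Real.exp p| ≤ 3 * (B * (ε * h)) :=
      (exp_sub_le t4 a2).trans (by linarith)
    have b3 : |Real.exp θ' - 1| ≤ 6 * (B * ε) := by
      have := exp_sub_le (p := 0) (q := θ') (by simp) a2
      rw [Real.exp_zero, sub_zero] at this
      linarith
    have v1 : |V (n + e k)| ≤ |V n| + |fd (e k) V n| := by
      have := abs_add_le (V n) (fd (e k) V n)
      rwa [show V n + fd (e k) V n = V (n + e k) by simp [fd]] at this
    have v2 : |V (n - e k)| ≤ |V n| + |fd (e k) V (n - e k)| := by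
      have := abs_sub (V n) (fd (e k) V (n - e k))
      rwa [show V n - fd (e k) V (n - e k) = V (n - e k) by simp [fd]] at this
    have v3 : |V (n - e k) - V n| ≤ |fd (e k) V (n - e k)| := by
      rw [abs_sub_comm]; simp [fd]
    have ha : |a k n| ≤ 4 / 3 := by
      rw [abs_of_nonneg (by linarith [(H.coeff k n).1])]; exact (H.coeff k n).2
    have key := abs_add_le_add (abs_add_le_add (abs_mul_le_mul ha (abs_mul_le_mul b1 v1))
      (abs_mul_le_mul (H.coeff_sub n hn k) (abs_add_le_add (abs_mul_le_mul b3 v2) v3)))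
      (abs_mul_le_mul ha (abs_mul_le_mul b2 v2))
    rw [show a k n * ((Real.exp (-θ) - Real.exp (-p)) * V (n + e k)) +
        (a k (n - e k) - a k n) * ((Real.exp θ' - 1) * V (n - e k) + (V (n - e k) - V n)) +
        a k n * ((Real.exp θ' - Real.exp p) * V (n - e k)) =
      a k n * (Real.exp (-θ) * V (n + e k) - V n) +
        a k (n - e k) * (Real.exp θ' * V (n - e k) - V n) -
        a k n * (Real.exp (-p) * V (n + e k) + Real.exp p * V (n - e k) - 2 * V n) by ring] at key
    refine key.trans ?_
    set A := |V n|
    set D1 := |fd (e k) V n|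
    set D2 := |fd (e k) V (n - e k)|
    have hA : 0 ≤ A := abs_nonneg _
    have hD1 : 0 ≤ D1 := abs_nonneg _
    have hD2 : 0 ≤ D2 := abs_nonneg _
    have w1 : B * ε * (h * D1) ≤ 1 / 2 * (h * D1) := by gcongr
    have w2 : B * ε * (h * D2) ≤ 1 / 2 * (h * D2) := by gcongr
    have w3 : 1 * (h * D1) ≤ B * (h * D1) := by gcongr
    have w4 : 1 * (h * D2) ≤ B * (h * D2) := by gcongr
    have w5 : 0 ≤ B * (h * D1) := by positivity
    have w6 : 0 ≤ B * (h * D2) := by positivity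
    linarith only [w1, w2, w3, w4, w5, w6]
  have hsum : Real.exp (τ * phi lam s (x n)) *
        ellip e a (fun n => Real.exp (-(τ * phi lam s (x n))) * V n) n -
      (∑ k, a k n * Real.cosh (ε * grd lam s (x n) k) * sd (e k) V n +
        rho ε (fun k => a k n) (grd lam s (x n)) * V n -
        ∑ k, a k n * Real.sinh (ε * grd lam s (x n) k) * cd (e k) V n) =
      ∑ k, (a k n * (Real.exp (-(τ * phi lam s (x (n + e k)) - τ * phi lam s (x n))) *
        V (n + e k) - V n) +
      a k (n - e k) * (Real.exp (τ * phi lam s (x n) - τ * phi lam s (x (n - e k))) *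
        V (n - e k) - V n) -
      a k n * (Real.exp (-(ε * grd lam s (x n) k)) * V (n + e k) +
        Real.exp (ε * grd lam s (x n) k) * V (n - e k) - 2 * V n)) := by
    rw [ellip, Finset.mul_sum, rho, Finset.sum_mul, ← Finset.sum_add_distrib,
      ← Finset.sum_sub_distrib, ← Finset.sum_sub_distrib]
    refine Finset.sum_congr rfl fun k _ => ?_
    have q1 : Real.exp (-(τ * phi lam s (x (n + e k)) - τ * phi lam s (x n))) =
        Real.exp (τ * phi lam s (x n)) * Real.exp (-(τ * phi lam s (x (n + e k)))) := by
      rw [← Real.exp_add]; congr 1; ring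
    have q2 : Real.exp (τ * phi lam s (x n) - τ * phi lam s (x (n - e k))) =
        Real.exp (τ * phi lam s (x n)) * Real.exp (-(τ * phi lam s (x (n - e k)))) := by
      rw [← Real.exp_add]; congr 1
    have q3 : Real.exp (τ * phi lam s (x n)) * Real.exp (-(τ * phi lam s (x n))) = 1 := by
      rw [← Real.exp_add, add_neg_cancel, Real.exp_zero]
    -- Writing `e^{∓p} = cosh p ∓ sinh p` groups the three values of `V` as `cosh p · sd V + 2 (cosh
    -- p - 1) V - sinh p · cd V`.
    rw [q1, q2, ← Real.cosh_sub_sinh (ε * grd lam s (x n) k),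
      ← Real.cosh_add_sinh (ε * grd lam s (x n) k), sd, cd]
    linear_combination (-(a k n) - a k (n - e k)) * V n * q3
  rw [hsum, Finset.mul_sum]
  exact (Finset.abs_sum_le_sum_abs _ _).trans (Finset.sum_le_sum fun k _ => hpt k)

end Carleman

/-! ### The Carleman estimate in a layer around a sphere -/

section Carleman

variable {d : ℕ}

/-- The size of the coefficients in the commutator argument. -/
def carlConst (d : ℕ) (lam X κ : ℝ) : ℝ := 500 * (d + 1) * (κ + 1) * wconst lam X ^ 5

set_option maxHeartbeats 1000000 in
/-- The Carleman estimate near a sphere, for large `τ` and small `τ h`. -/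
theorem carleman {G : Type*} [Fintype G] [AddCommGroup G] {e : Fin d → G} {h X lam s κ τ ζ : ℝ}
    {a : Fin d → G → ℝ} {x : G → Fin d → ℝ} {Z : Set G} {V : G → ℝ}
    (H : SphereLayer e h X lam s κ a x Z) (hX : 1 ≤ X) (hlam : 0 ≤ lam) (hκ : 0 ≤ κ)
    (hlam1 : 64 / 3 + 54 * d * X + 4 ≤ 4 / 3 * lam * κ)
    (hlam2 : 144 * d ^ 2 * X ^ 3 + 192 * d * X ^ 2 + 96 * d ^ 2 * X ^ 2 + 4 ≤ lam * κ ^ 2 / 2)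
    (hh : 0 < h) (hζ1 : ζ ≤ 1) (hζ : 2000 * (d + 1) ^ 2 * carlConst d lam X κ ^ 4 * ζ ≤ 1)
    (hτ0 : 0 < τ) (hτζ : 1 ≤ τ * ζ) (hεζ : τ * h ≤ ζ)
    (hV0 : ∀ n ∉ Z, V n = 0) (hV1 : ∀ n ∉ Z, ∀ k, V (n + e k) = 0)
    (hV1' : ∀ n ∉ Z, ∀ k, V (n - e k) = 0)
    (hV2 : ∀ n ∉ Z, ∀ k j, V (n + e k + e j) = 0) :
    τ * h * h * (gradSq e V + (τ * h) ^ 2 * ∑ n, V n ^ 2) ≤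
      3 * ∑ n, (Real.exp (τ * phi lam s (x n)) *
        ellip e a (fun n => Real.exp (-(τ * phi lam s (x n))) * V n) n) ^ 2 := by
  set B := wconst lam X with hB
  set K := carlConst d lam X κ with hK
  have hX0 : 0 ≤ X := by linarith
  have hlX : 0 ≤ lam * X ^ 2 := by positivity
  have hB3 : 3 ≤ B := by rw [hB]; unfold wconst; linarith
  have hB1 : 1 ≤ B := by linarith
  have hlX20 : 20 * (lam * X ^ 2) ≤ B := by rw [hB]; unfold wconst; linarith
  have hlB : lam ≤ B := by
    have : lam * 1 ≤ lam * X ^ 2 := by gcongr; exact one_le_pow₀ hX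
    linarith
  have hd0 : (0 : ℝ) ≤ d := Nat.cast_nonneg d
  -- The coefficient bounds checked below are of the form `c B^i` with `i ≤ 5`, so a single constant
  -- `K` dominates them.
  have hKB : ∀ (i : ℕ), i ≤ 5 → ∀ c : ℝ, c ≤ 500 * (d + 1) * (κ + 1) → 0 ≤ c →
      c * B ^ i ≤ K := by
    intro i hi c hc hc0
    rw [hK]; unfold carlConst
    exact mul_le_mul hc (pow_le_pow_right₀ hB1 hi) (by positivity) (by positivity)
  have hdκ : 0 ≤ d * κ := by positivity
  have hK1 : 1 ≤ K := by
    have := hKB 0 (by norm_num) 1 (by nlinarith) (by norm_num)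
    simpa using this
  have hB5K : B ^ 5 ≤ K := by
    have := hKB 5 le_rfl 1 (by nlinarith) (by norm_num)
    simpa using this
  have hζ0 : 0 < ζ := by
    by_contra hneg
    have := mul_nonpos_of_nonneg_of_nonpos hτ0.le (not_lt.mp hneg)
    linarith
  have hτ1 : 1 ≤ τ := by nlinarith
  set ε := τ * h with hε
  have hε0 : 0 < ε := mul_pos hτ0 hh
  have hhζ : h ≤ ζ := by
    refine le_trans ?_ hεζ
    rw [hε]; nlinarith
  have hKζ : 2000 * (d + 1) ^ 2 * K * ζ ≤ 1 := by
    refine le_trans ?_ hζ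
    gcongr
    exact le_self_pow₀ hK1 (by norm_num)
  have hKζ' : 2000 * K * ζ ≤ 1 := by
    refine le_trans ?_ hKζ
    have h1 : (1 : ℝ) ≤ (d + 1) ^ 2 := one_le_pow₀ (by linarith)
    have h2 : 0 ≤ K * ζ := by positivity
    nlinarith
  have hBK : B ≤ K := (le_self_pow₀ hB1 (by norm_num)).trans hB5K
  have hBε : B * ε ≤ 1 / 2 := by
    calc B * ε ≤ K * ζ := by gcongr
      _ ≤ 1 / 2 := by linarith
  have hloc : ∀ n ∈ Z, ∀ l, LocalStep B ε h ζ (fun k => a k n) (fun k => a k (n + e l))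
      (grd lam s (x n)) (grd lam s (x (n + e l)))
      (hess lam (1 + lam * psi s (x n)) (x n) l) := fun n hn l =>
    H.localStep hlam hX hh hε0.le hhζ hεζ hζ1 (by linarith) hn l
  have ht : ∀ n ∈ Z, 1 / 2 ≤ 1 + lam * psi s (x n) ∧ 1 + lam * psi s (x n) ≤ 3 / 2 := by
    intro n hn
    have := abs_le.mp (H.psi_le n hn)
    constructor <;> linarith [this.1, this.2]
  have hGle : ∀ n ∈ Z, 4 * ∑ k, a k n * x n k ^ 2 ≤ 6 * d * X ^ 2 := by
    intro n hn
    have : ∑ k, a k n * x n k ^ 2 ≤ ∑ _k : Fin d, 4 / 3 * X ^ 2 := by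
      refine Finset.sum_le_sum fun k _ => ?_
      have h1 : x n k ^ 2 ≤ X ^ 2 := by
        rw [← sq_abs]; exact pow_le_pow_left₀ (abs_nonneg _) (H.x_le n hn k) 2
      have h2 := H.coeff k n
      exact mul_le_mul h2.2 h1 (sq_nonneg _) (by norm_num)
    rw [Finset.sum_const, Finset.card_univ, Fintype.card_fin, nsmul_eq_mul] at this
    have : 0 ≤ d * X ^ 2 := by positivity
    linarith
  have hG0 : ∀ n, 0 ≤ 4 * ∑ k, a k n * x n k ^ 2 := fun n =>
    mul_nonneg (by norm_num) (Finset.sum_nonneg fun k _ =>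
      mul_nonneg (by linarith [(H.coeff k n).1]) (sq_nonneg _))
  -- The sum `4 ∑ a x²` is the `λ` part of the weighted trace of the Hessian, which this multiplier
  -- cancels in the gradient form. The surplus `κ` tips the gradient form to positive while
  -- remaining affordable in the zero order form.
  set m : G → ℝ := fun n => ε * h * lam * (4 * ∑ k, a k n * x n k ^ 2 + κ) with hm
  have hmle : ∀ n ∈ Z, |m n| ≤ (6 * d + κ) * B * (ε * h) := by
    intro n hn
    have h1 := hG0 n
    have h2 := hGle n hn
    rw [hm, abs_of_nonneg (by positivity)]
    calc ε * h * lam * (4 * ∑ k, a k n * x n k ^ 2 + κ) ≤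
        ε * h * lam * (6 * d * X ^ 2 + κ) := by gcongr
      _ = ε * h * (6 * d * (lam * X ^ 2) + κ * lam) := by ring
      _ ≤ ε * h * (6 * d * B + κ * B) := by gcongr; linarith
      _ = _ := by ring
  have hmsub : ∀ n ∈ Z, ∀ l, |m (n + e l) - m n| ≤ 32 * d * B * (ε * h) * h := by
    intro n hn l
    have h1 : |∑ k, a k (n + e l) * x (n + e l) k ^ 2 - ∑ k, a k n * x n k ^ 2| ≤
        d * (8 * X ^ 2 * h) := by
      rw [← Finset.sum_sub_distrib]
      refine (Finset.abs_sum_le_sum_abs _ _).trans ((Finset.sum_le_card_nsmul _ _ _ ?_).trans_eq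
        (by rw [Finset.card_univ, Fintype.card_fin, nsmul_eq_mul]))
      intro k _
      have hxk := H.x_le n hn k
      rw [H.x_add n hn l]
      have h2 : |step h l (x n) k - x n k| ≤ h := by
        simp only [step, add_sub_cancel_left]
        split_ifs
        · exact le_of_eq (abs_of_pos hh)
        · simpa using hh.le
      have h3 : |step h l (x n) k| ≤ 2 * X := by
        have := abs_add_le_add h2 hxk
        rw [sub_add_cancel] at this
        linarith
      have h4 : |step h l (x n) k + x n k| ≤ 3 * X :=
        (abs_add_le_add h3 hxk).trans (by linarith)
      have ha : |a k n| ≤ 4 / 3 := by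
        rw [abs_of_nonneg (by linarith [(H.coeff k n).1])]; exact (H.coeff k n).2
      have h5 := abs_add_le_add (abs_mul_le_mul (H.coeff_add n hn k l) (abs_mul_le_mul h3 h3))
        (abs_mul_le_mul ha (abs_mul_le_mul h2 h4))
      rw [show (a k (n + e l) - a k n) * (step h l (x n) k * step h l (x n) k) +
        a k n * ((step h l (x n) k - x n k) * (step h l (x n) k + x n k)) =
        a k (n + e l) * step h l (x n) k ^ 2 - a k n * x n k ^ 2 by ring] at h5
      refine h5.trans ?_
      have : X * h ≤ X ^ 2 * h := by gcongr; exact le_self_pow₀ hX (by norm_num)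
      linarith
    have h2 := abs_mul_le_mul (le_of_eq (abs_of_nonneg
      (show 0 ≤ ε * h * lam * 4 by positivity))) h1
    rw [show ε * h * lam * 4 * (∑ k, a k (n + e l) * x (n + e l) k ^ 2 - ∑ k, a k n * x n k ^ 2) =
      m (n + e l) - m n by simp only [hm]; ring] at h2
    refine h2.trans ?_
    calc ε * h * lam * 4 * (d * (8 * X ^ 2 * h)) = 32 * d * (lam * X ^ 2) * (ε * h) * h := by ring
      _ ≤ 32 * d * B * (ε * h) * h := by gcongr; linarith
  have hfdγ : ∀ n l k j, fd (e l) (fun n => a k n * Real.cosh (ε * grd lam s (x n) k) *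
      (a j n * Real.sinh (ε * grd lam s (x n) j))) n =
      gam ε (fun k => a k (n + e l)) (grd lam s (x (n + e l))) k j -
        gam ε (fun k => a k n) (grd lam s (x n)) k j := by
    intro n l k j
    simp only [fd, gam]; ring
  refine carleman_core (Z := Z) (K := K) (ζ := ζ) (τ := τ) (ε := ε) (h := h)
    (α := fun k n => a k n * Real.cosh (ε * grd lam s (x n) k))
    (β := fun k n => a k n * Real.sinh (ε * grd lam s (x n) k))
    (ρ := fun n => rho ε (fun k => a k n) (grd lam s (x n))) (m := m)
    hK1 hτ1 hτζ rfl hh hεζ hζ1 hζ hV0 hV1 hV2 ?_ ?_ ?_ ?_ ?_ ?_ ?_ ?_ ?_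
  · intro n _ k
    have h1 := (H.coeff k n).1
    have h2 := Real.one_le_cosh (ε * grd lam s (x n) k)
    nlinarith
  · intro n hn l k j
    have hk := (hloc n hn l).abs_lead_sub_le k
    have hj := (hloc n hn l).abs_lead_sub_le j
    have h1 := abs_add_le_add (abs_mul_le_mul hk ((hloc n hn l).abs_lead_le j).2)
      (abs_mul_le_mul ((hloc n hn l).abs_lead_le k).1 hj)
    simp only [fd]
    refine le_trans (le_of_eq ?_) (h1.trans ?_)
    · congr 1; ring
    · have := hKB 2 (by norm_num) 48 (by nlinarith) (by norm_num)
      have := mul_le_mul_of_nonneg_right this hh.le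
      linarith
  · intro n hn l k j
    rw [hfdγ]
    refine ((hloc n hn l).abs_gam_sub_le k j).trans ?_
    have := hKB 3 (by norm_num) 66 (by nlinarith) (by norm_num)
    gcongr
  · intro n hn j
    refine ((hloc n hn j).abs_rho_mul_sub_le j).trans ?_
    have := hKB 3 (by norm_num) (66 * d) (by nlinarith) (by positivity)
    have := mul_le_mul_of_nonneg_right this (show 0 ≤ ε * h * ε ^ 2 by positivity)
    linarith
  · intro n hn k
    have h1 := abs_add_le_add (abs_mul_le_mul (hmsub n hn k) ((hloc n hn k).abs_lead_le k).2)
      (abs_mul_le_mul (hmle n hn) ((hloc n hn k).abs_lead_sub_le k))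
    simp only [fd]
    refine le_trans (le_of_eq ?_) (h1.trans ?_)
    · congr 1; ring
    · have h2 := hKB 3 (by norm_num) (144 * d + 8 * κ) (by nlinarith) (by positivity)
      have h3 := mul_le_mul_of_nonneg_right h2 (show 0 ≤ ε * h * h by positivity)
      have h4 : d * B * (ε * h * h) ≤ d * B ^ 3 * (ε * h * h) := by
        gcongr; exact le_self_pow₀ hB1 (by norm_num)
      linarith
  · intro n hn
    rcases isEmpty_or_nonempty (Fin d) with he | ⟨⟨k0⟩⟩
    · simp only [rho, Finset.univ_eq_empty, Finset.sum_empty, abs_zero]; positivity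
    refine (hloc n hn k0).abs_rho_le.trans ?_
    have := hKB 2 (by norm_num) (3 * d) (by nlinarith) (by positivity)
    have := mul_le_mul_of_nonneg_right this (show 0 ≤ ε ^ 2 by positivity)
    linarith
  · intro n hn
    refine (hmle n hn).trans ?_
    have := hKB 1 (by norm_num) (6 * d + κ) (by nlinarith) (by positivity)
    rw [pow_one] at this
    gcongr
  · intro n hn y v
    have hcf : ∀ k, 2 / 3 ≤ a k n := fun k => (H.coeff k n).1
    have hg := grad_form_lower (κ := κ) (hloc n hn) hcf (H.x_le n hn) (by linarith [(ht n hn).1])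
      (ht n hn).2 hlam hκ y
    have hκG : κ ≤ 4 * ∑ k, a k n * x n k ^ 2 := by
      refine (H.kap_le n hn).trans ?_
      have : 2 / 3 * ∑ k, x n k ^ 2 ≤ ∑ k, a k n * x n k ^ 2 := by
        rw [Finset.mul_sum]
        exact Finset.sum_le_sum fun k _ => mul_le_mul_of_nonneg_right (hcf k) (sq_nonneg _)
      linarith
    have hz := zero_form_lower (κ := κ) (hloc n hn) hcf (H.x_le n hn) (ht n hn).1
      (ht n hn).2 hlam hκ hκG
    have c1 : 2 ≤ 4 / 3 * lam * κ - 64 / 3 - 54 * d * X - 360 * d * B ^ 3 * ζ := by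
      have h1 := hKB 3 (by norm_num) (360 * d) (by nlinarith) (by positivity)
      have h2 := mul_le_mul_of_nonneg_right h1 hζ0.le
      linarith
    have c2 : 2 ≤ lam * κ ^ 2 / 2 - 144 * d ^ 2 * X ^ 3 - 192 * d * X ^ 2 - 96 * d ^ 2 * X ^ 2
        - (300 * d ^ 2 * B ^ 5 + 6 * d * B ^ 4 * lam * (6 * d * X ^ 2 + κ)) * ζ := by
      have h1 : 300 * d ^ 2 * B ^ 5 + 6 * d * B ^ 4 * lam * (6 * d * X ^ 2 + κ) ≤
          (d + 1) * (500 * (d + 1) * (κ + 1) * B ^ 5) := by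
        have e1 : 6 * d * B ^ 4 * lam * (6 * d * X ^ 2 + κ) =
          36 * d ^ 2 * B ^ 4 * (lam * X ^ 2) + 6 * d * κ * B ^ 4 * lam := by ring
        have e2 : 36 * d ^ 2 * B ^ 4 * (lam * X ^ 2) ≤ 36 * d ^ 2 * B ^ 4 * B := by
          gcongr; linarith
        have e3 : 6 * d * κ * B ^ 4 * lam ≤ 6 * d * κ * B ^ 4 * B := by gcongr
        have e4 : (336 * d ^ 2 + 6 * d * κ) * B ^ 5 ≤ (d + 1) * (500 * (d + 1) * (κ + 1)) * B ^ 5 := by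
          refine mul_le_mul_of_nonneg_right ?_ (by positivity)
          nlinarith [mul_nonneg hd0 hdκ, mul_nonneg hd0 hd0]
        linarith only [e1, e2, e3, e4]
      have h2 : (d + 1) * (500 * (d + 1) * (κ + 1) * B ^ 5) * ζ ≤ 1 := by
        have : (500 * (d + 1) * (κ + 1) * B ^ 5) = K := rfl
        rw [this]
        refine le_trans ?_ hKζ
        have h1 : 0 ≤ K * ζ := by positivity
        nlinarith [mul_nonneg hd0 h1, mul_nonneg hd0 (mul_nonneg hd0 h1)]
      have h3 := mul_le_mul_of_nonneg_right h1 hζ0.le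
      linarith
    have hy : 0 ≤ ∑ k, y k ^ 2 := Finset.sum_nonneg fun _ _ => sq_nonneg _
    have f1 : 2 * (ε * h) * ∑ k, y k ^ 2 ≤ ε * h * ((4 / 3 * lam * κ - 64 / 3 - 54 * d * X -
        360 * d * B ^ 3 * ζ) * ∑ k, y k ^ 2) := by
      have := mul_le_mul_of_nonneg_right c1 (show 0 ≤ ε * h * ∑ k, y k ^ 2 by positivity)
      linarith
    have f2 : 2 * (ε * h) * ε ^ 2 ≤ ε * h * ε ^ 2 * (lam * κ ^ 2 / 2 - 144 * d ^ 2 * X ^ 3 -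
        192 * d * X ^ 2 - 96 * d ^ 2 * X ^ 2 -
        (300 * d ^ 2 * B ^ 5 + 6 * d * B ^ 4 * lam * (6 * d * X ^ 2 + κ)) * ζ) := by
      have := mul_le_mul_of_nonneg_right c2 (show 0 ≤ ε * h * ε ^ 2 by positivity)
      linarith
    have f3 := mul_le_mul_of_nonneg_right (f2.trans hz) (sq_nonneg v)
    have f4 := f1.trans hg
    simp only [hfdγ]
    have e1 : ∀ k, 2 * m n * (a k n * Real.cosh (ε * grd lam s (x n) k)) * y k ^ 2 =
      2 * (ε * h * lam * (4 * ∑ k, a k n * x n k ^ 2 + κ)) *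
        (a k n * Real.cosh (ε * (-2 * (1 + lam * psi s (x n)) * x n k))) * y k ^ 2 := fun k => rfl
    have e2 : ∀ j, 2 * fd (e j) (fun n => rho ε (fun k => a k n) (grd lam s (x n)) *
        (a j n * Real.sinh (ε * grd lam s (x n) j))) n =
        2 * (rho ε (fun k => a k (n + e j)) (grd lam s (x (n + e j))) *
          (a j (n + e j) * Real.sinh (ε * grd lam s (x (n + e j)) j)) -
        rho ε (fun k => a k n) (fun k => -2 * (1 + lam * psi s (x n)) * x n k) *
          (a j n * Real.sinh (ε * (-2 * (1 + lam * psi s (x n)) * x n j)))) := fun j => rfl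
    have e3 : 2 * rho ε (fun k => a k n) (grd lam s (x n)) * m n =
      2 * rho ε (fun k => a k n) (fun k => -2 * (1 + lam * psi s (x n)) * x n k) *
        (ε * h * lam * (4 * ∑ k, a k n * x n k ^ 2 + κ)) := rfl
    rw [Finset.sum_congr rfl fun k _ => e1 k, Finset.sum_congr rfl fun k _ => e2 k, e3]
    have f5 := add_le_add f4 f3
    refine le_trans (le_of_eq ?_) f5
    ring
  · intro n
    by_cases hn : n ∈ Z
    · have h1 := H.conj_sub_le hlam hX hh (by linarith) hτ0.le hBε V hn
      refine h1.trans ?_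
      have h2 := hKB 1 (by norm_num) 14 (by nlinarith) (by norm_num)
      rw [pow_one] at h2
      have h3 : 0 ≤ ∑ k, (ε * |V n| + |fd (e k) V n| + |fd (e k) V (n - e k)|) :=
        Finset.sum_nonneg fun k _ => by positivity
      gcongr
    · have h1 : ellip e a (fun n => Real.exp (-(τ * phi lam s (x n))) * V n) n = 0 := by
        simp [ellip, hV0 n hn, hV1 n hn, hV1' n hn]
      have h2 : ∀ k, sd (e k) V n = 0 := fun k => by
        simp [sd, hV0 n hn, hV1 n hn, hV1' n hn]
      have h3 : ∀ k, cd (e k) V n = 0 := fun k => by simp [cd, hV1 n hn, hV1' n hn]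
      simp only [h1, h2, h3, hV0 n hn, mul_zero, Finset.sum_const_zero, add_zero, sub_zero,
        abs_zero]
      have h3 : 0 ≤ ∑ k, (ε * |(0 : ℝ)| + |fd (e k) V n| + |fd (e k) V (n - e k)|) :=
        Finset.sum_nonneg fun k _ => by positivity
      positivity

end Carleman

/-! ### A smooth cutoff function on the line -/

section Cutoff

/-- A smooth cutoff function with bounds for its first and second order Taylor remainders. -/
structure Cutoff (f f' : ℝ → ℝ) (L : ℝ) : Prop where
  one_le : 1 ≤ L
  nonneg : ∀ t, 0 ≤ f t
  le_one : ∀ t, f t ≤ 1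
  eq_one : ∀ t, |t| ≤ 1 / 4 → f t = 1
  eq_zero : ∀ t, 3 / 8 ≤ |t| → f t = 0
  deriv_le : ∀ t, |f' t| ≤ L
  sub_le : ∀ t p, |f (t + p) - f t| ≤ L * |p|
  taylor_le : ∀ t p, |f (t + p) - f t - f' t * p| ≤ L * p ^ 2

/-- Compact support makes the bump function and its derivative globally Lipschitz. The Taylor bound
is the mean value inequality for the remainder, whose derivative is an increment of the derivative
of the bump. -/
theorem exists_cutoff : ∃ f f' L, Cutoff f f' L := by
  let b : ContDiffBump (0 : ℝ) := ⟨1 / 4, 3 / 8, by norm_num, by norm_num⟩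
  have hb : ContDiff ℝ 2 (b : ℝ → ℝ) := b.contDiff
  have hb' : ContDiff ℝ 1 (deriv (b : ℝ → ℝ)) := by
    have := (contDiff_succ_iff_deriv (n := 1) (f := (b : ℝ → ℝ))).1 (by rw [one_add_one_eq_two]; exact hb)
    exact this.2.2
  have hs : HasCompactSupport (b : ℝ → ℝ) := b.hasCompactSupport
  obtain ⟨C, hC⟩ := hb.lipschitzWith_of_hasCompactSupport hs (by norm_num)
  obtain ⟨C', hC'⟩ := hb'.lipschitzWith_of_hasCompactSupport hs.deriv (by norm_num)
  have hd : ∀ t, HasDerivAt (b : ℝ → ℝ) (deriv b t) t := fun t =>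
    (hb.differentiable (by norm_num) t).hasDerivAt
  have h1 : ∀ x y : ℝ, |b x - b y| ≤ C * |x - y| := fun x y => by
    simpa [Real.dist_eq] using hC.dist_le_mul x y
  have h2 : ∀ x y : ℝ, |deriv b x - deriv b y| ≤ C' * |x - y| := fun x y => by
    simpa [Real.dist_eq] using hC'.dist_le_mul x y
  refine ⟨b, deriv b, 1 + C + C', by linarith [C.2, C'.2], fun t => b.nonneg, fun t => b.le_one,
    fun t ht => b.one_of_mem_closedBall (by rw [mem_closedBall_zero_iff]; exact ht),
    fun t ht => b.zero_of_le_dist (by simpa [Real.dist_eq] using ht), fun t => ?_, fun t p => ?_,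
    fun t p => ?_⟩
  · have := norm_deriv_le_of_lipschitz hC (x₀ := t)
    rw [Real.norm_eq_abs] at this
    linarith [C'.2]
  · have := h1 (t + p) t
    rw [add_sub_cancel_left] at this
    refine this.trans (mul_le_mul_of_nonneg_right (by linarith [C'.2]) (abs_nonneg p))
  · have hder : ∀ y, HasDerivAt (fun y => b (t + y) - b t - deriv b t * y)
        (deriv b (t + y) - deriv b t) y := by
      intro y
      have e1 : HasDerivAt (fun y => b (t + y)) (deriv b (t + y)) y := by
        simpa using (hd (t + y)).comp_const_add t y
      have e2 : HasDerivAt (fun y => deriv b t * y) (deriv b t) y := by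
        simpa using (hasDerivAt_id y).const_mul (deriv b t)
      exact (e1.sub_const _).sub e2
    have := abs_image_sub_le_of_deriv (r := |p|) (C := C' * |p|) (a := 0) (b := p) hder
      (fun y hy => ?_) (by simp) le_rfl
    · simp only [add_zero, sub_self, mul_zero, sub_zero] at this
      refine this.trans ?_
      rw [mul_assoc, abs_mul_abs_self, ← sq]
      exact mul_le_mul_of_nonneg_right (by linarith [C.2]) (sq_nonneg p)
    · have := h2 (t + y) t
      rw [add_sub_cancel_left] at this
      exact this.trans (mul_le_mul_of_nonneg_left hy C'.2)

end Cutoff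

/-! ### Energy density and the commutator with a cutoff -/

section Energy

variable {G : Type*} [AddCommGroup G] {d : ℕ}

/-- The undivided energy density. -/
def en (h : ℝ) (e : Fin d → G) (v : G → ℝ) (n : G) : ℝ := h ^ 2 * v n ^ 2 + ∑ k, fd (e k) v n ^ 2

theorem en_nonneg (h : ℝ) (e : Fin d → G) (v : G → ℝ) (n : G) : 0 ≤ en h e v n :=
  add_nonneg (by positivity) (Finset.sum_nonneg fun _ _ => sq_nonneg _)

theorem sq_le_en (h : ℝ) (e : Fin d → G) (v : G → ℝ) (n : G) : h ^ 2 * v n ^ 2 ≤ en h e v n :=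
  le_add_of_nonneg_right (Finset.sum_nonneg fun _ _ => sq_nonneg _)

theorem fd_sq_le_en (h : ℝ) (e : Fin d → G) (v : G → ℝ) (n : G) (k : Fin d) :
    fd (e k) v n ^ 2 ≤ en h e v n :=
  (Finset.single_le_sum (f := fun k => fd (e k) v n ^ 2) (fun _ _ => sq_nonneg _)
    (Finset.mem_univ k)).trans (le_add_of_nonneg_left (by positivity))

/-- Leibniz rule: second differences of `v` cancel, and each remaining term carries a difference of
the cutoff. Hence the commutator is of first order and lives where the cutoff varies. -/
theorem ellip_mul_sub (e : Fin d → G) (a : Fin d → G → ℝ) (χ v : G → ℝ) (n : G) :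
    ellip e a (fun n => χ n * v n) n - χ n * ellip e a v n =
      ∑ k, (a k n * fd (e k) χ n * fd (e k) v n +
        a k (n - e k) * fd (e k) χ (n - e k) * fd (e k) v (n - e k) +
        (a k n * sd (e k) χ n + (a k n - a k (n - e k)) * fd (e k) χ (n - e k)) * v n) := by
  rw [ellip, ellip, Finset.mul_sum, ← Finset.sum_sub_distrib]
  refine Finset.sum_congr rfl fun k _ => ?_
  simp only [fd, sd, sub_add_cancel]
  ring

theorem ellip_mul_sub_sq_le {e : Fin d → G} {a : Fin d → G → ℝ} {χ : G → ℝ} {h K : ℝ} {n : G}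
    (hh : 0 ≤ h) (hK : 0 ≤ K) (ha : ∀ k n, |a k n| ≤ 4 / 3)
    (ha' : ∀ k, |a k (n - e k) - a k n| ≤ h)
    (h1 : ∀ k, |fd (e k) χ n| ≤ K * h) (h2 : ∀ k, |fd (e k) χ (n - e k)| ≤ K * h)
    (h3 : ∀ k, |sd (e k) χ n| ≤ K * h ^ 2) (v : G → ℝ) :
    (ellip e a (fun n => χ n * v n) n - χ n * ellip e a v n) ^ 2 ≤
      17 * d ^ 2 * K ^ 2 * h ^ 2 * (en h e v n + ∑ k, en h e v (n - e k)) := by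
  have hk : ∀ k, |a k n * fd (e k) χ n * fd (e k) v n +
        a k (n - e k) * fd (e k) χ (n - e k) * fd (e k) v (n - e k) +
        (a k n * sd (e k) χ n + (a k n - a k (n - e k)) * fd (e k) χ (n - e k)) * v n| ≤
      7 / 3 * K * h * (|fd (e k) v n| + |fd (e k) v (n - e k)| + h * |v n|) := by
    intro k
    have := abs_add_le_add (abs_add_le_add
      (abs_mul_le_mul (abs_mul_le_mul (ha k n) (h1 k)) (le_refl |fd (e k) v n|))
      (abs_mul_le_mul (abs_mul_le_mul (ha k (n - e k)) (h2 k)) (le_refl |fd (e k) v (n - e k)|)))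
      (abs_mul_le_mul (abs_add_le_add (abs_mul_le_mul (ha k n) (h3 k))
        (abs_mul_le_mul ((abs_sub_comm _ _).trans_le (ha' k)) (h2 k))) (le_refl |v n|))
    refine this.trans ?_
    have p1 : 0 ≤ K * h * |fd (e k) v n| := by positivity
    have p2 : 0 ≤ K * h * |fd (e k) v (n - e k)| := by positivity
    linarith only [p1, p2]
  -- The factor `7/3 = 4/3 + 1` adds the bound of the coefficient to that of its increment, and `3
  -- (7/3)² ≤ 17`.
  have hk2 : ∀ k, (a k n * fd (e k) χ n * fd (e k) v n +
        a k (n - e k) * fd (e k) χ (n - e k) * fd (e k) v (n - e k) +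
        (a k n * sd (e k) χ n + (a k n - a k (n - e k)) * fd (e k) χ (n - e k)) * v n) ^ 2 ≤
      17 * K ^ 2 * h ^ 2 * (en h e v n + en h e v (n - e k)) := by
    intro k
    rw [← sq_abs]
    refine (pow_le_pow_left₀ (abs_nonneg _) (hk k) 2).trans ?_
    have q1 : (|fd (e k) v n| + |fd (e k) v (n - e k)| + h * |v n|) ^ 2 ≤
        3 * (fd (e k) v n ^ 2 + fd (e k) v (n - e k) ^ 2 + h ^ 2 * v n ^ 2) := by
      rw [← sq_abs (fd (e k) v n), ← sq_abs (fd (e k) v (n - e k)), ← sq_abs (v n)]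
      nlinarith only [sq_nonneg (|fd (e k) v n| - |fd (e k) v (n - e k)|),
        sq_nonneg (|fd (e k) v n| - h * |v n|), sq_nonneg (|fd (e k) v (n - e k)| - h * |v n|)]
    have q2 : fd (e k) v n ^ 2 + h ^ 2 * v n ^ 2 ≤ en h e v n := by
      have := Finset.single_le_sum (f := fun k => fd (e k) v n ^ 2) (fun _ _ => sq_nonneg _)
        (Finset.mem_univ k)
      rw [en]; linarith
    have q3 := fd_sq_le_en h e v (n - e k) k
    rw [mul_pow]
    calc (7 / 3 * K * h) ^ 2 * (|fd (e k) v n| + |fd (e k) v (n - e k)| + h * |v n|) ^ 2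
        ≤ (7 / 3 * K * h) ^ 2 * (3 * (en h e v n + en h e v (n - e k))) := by
          gcongr; linarith
      _ ≤ _ := by
          have : 0 ≤ K ^ 2 * h ^ 2 * (en h e v n + en h e v (n - e k)) := by
            have := en_nonneg h e v n
            have := en_nonneg h e v (n - e k)
            positivity
          linarith only [this]
  rw [ellip_mul_sub]
  refine (sq_sum_le_card_mul_sum_sq (s := Finset.univ)).trans ?_
  rw [Finset.card_univ, Fintype.card_fin]
  calc (d : ℝ) * _ ≤ d * ∑ k : Fin d, 17 * K ^ 2 * h ^ 2 * (en h e v n + en h e v (n - e k)) := by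
        gcongr with k; exact hk2 k
    _ = d * (17 * K ^ 2 * h ^ 2) * (d * en h e v n + ∑ k, en h e v (n - e k)) := by
        rw [← Finset.mul_sum, Finset.sum_add_distrib, Finset.sum_const, Finset.card_univ,
          Fintype.card_fin, nsmul_eq_mul]; ring
    _ ≤ d * (17 * K ^ 2 * h ^ 2) * (d * (en h e v n + ∑ k, en h e v (n - e k))) := by
        have hd : ∑ k, en h e v (n - e k) ≤ d * ∑ k, en h e v (n - e k) := by
          rcases Nat.eq_zero_or_pos d with h0 | h0
          · subst h0; simp
          · refine le_mul_of_one_le_left (Finset.sum_nonneg fun _ _ => en_nonneg _ _ _ _) ?_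
            exact_mod_cast h0
        gcongr
        rw [mul_add]; linarith
    _ = _ := by ring

end Energy

/-! ### Cutoff and weight inside the layer -/

section Layer

variable {G : Type*} [AddCommGroup G] {d : ℕ} {e : Fin d → G} {h X lam s κ L : ℝ}
  {a : Fin d → G → ℝ} {x : G → Fin d → ℝ} {Z : Set G} {f f' : ℝ → ℝ}

/-- The constant bounding the differences of a cutoff function of the weight. -/
def cutConst (L lam X : ℝ) : ℝ := L * (18 * lam ^ 2 * X ^ 2 + 3 * lam * X + 2 * lam)

theorem SphereLayer.abs_step_le (H : SphereLayer e h X lam s κ a x Z) (hX : 1 ≤ X)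
    (hlam : 0 ≤ lam) (hh : 0 < h) (hh1 : h ≤ 1) {n : G} (hn : n ∈ Z) (k : Fin d) :
    |lam * (-2 * h * x n k - h ^ 2)| ≤ 3 * lam * X * h ∧
      |lam * (2 * h * x n k - h ^ 2)| ≤ 3 * lam * X * h := by
  have h1 := H.x_le n hn k
  have h2 : |2 * x n k| ≤ 2 * X := by rw [abs_mul, abs_two]; linarith
  have h3 : |-2 * x n k - h| ≤ 3 * X := by
    refine (abs_sub _ _).trans ?_
    rw [neg_mul, abs_neg, abs_of_pos hh]; linarith
  have h4 : |2 * x n k - h| ≤ 3 * X := by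
    refine (abs_sub _ _).trans ?_
    rw [abs_of_pos hh]; linarith
  constructor
  · rw [show lam * (-2 * h * x n k - h ^ 2) = lam * h * (-2 * x n k - h) by ring, abs_mul,
      abs_of_nonneg (by positivity : 0 ≤ lam * h)]
    calc lam * h * |-2 * x n k - h| ≤ lam * h * (3 * X) := by gcongr
      _ = _ := by ring
  · rw [show lam * (2 * h * x n k - h ^ 2) = lam * h * (2 * x n k - h) by ring, abs_mul,
      abs_of_nonneg (by positivity : 0 ≤ lam * h)]
    calc lam * h * |2 * x n k - h| ≤ lam * h * (3 * X) := by gcongr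
      _ = _ := by ring

theorem SphereLayer.psi_add (H : SphereLayer e h X lam s κ a x Z) {n : G} (hn : n ∈ Z)
    (k : Fin d) : lam * psi s (x (n + e k)) =
      lam * psi s (x n) + lam * (-2 * h * x n k - h ^ 2) := by
  rw [H.x_add n hn, psi_step]; ring

theorem SphereLayer.psi_sub (H : SphereLayer e h X lam s κ a x Z) {n : G} (hn : n ∈ Z)
    (k : Fin d) : lam * psi s (x (n - e k)) =
      lam * psi s (x n) + lam * (2 * h * x n k - h ^ 2) := by
  rw [H.x_sub n hn, psi_step]; ring

theorem SphereLayer.cutoff_bounds (H : SphereLayer e h X lam s κ a x Z) (F : Cutoff f f' L)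
    (hX : 1 ≤ X) (hlam : 0 ≤ lam) (hh : 0 < h) (hh1 : h ≤ 1) {n : G} (hn : n ∈ Z) (k : Fin d) :
    |fd (e k) (fun n => f (lam * psi s (x n))) n| ≤ cutConst L lam X * h ∧
    |fd (e k) (fun n => f (lam * psi s (x n))) (n - e k)| ≤ cutConst L lam X * h ∧
    |sd (e k) (fun n => f (lam * psi s (x n))) n| ≤ cutConst L lam X * h ^ 2 := by
  have hL : 0 ≤ L := by linarith [F.one_le]
  have hX0 : 0 ≤ X := by linarith
  obtain ⟨hp, hq⟩ := H.abs_step_le hX hlam hh hh1 hn k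
  have hK : L * (3 * lam * X * h) ≤ cutConst L lam X * h := by
    unfold cutConst
    rw [mul_assoc L]
    refine mul_le_mul_of_nonneg_left ?_ hL
    have : 0 ≤ (18 * lam ^ 2 * X ^ 2 + 2 * lam) * h := by positivity
    linarith
  simp only [fd, sd, sub_add_cancel, H.psi_add hn, H.psi_sub hn]
  set t := lam * psi s (x n)
  set p := lam * (-2 * h * x n k - h ^ 2) with hpd
  set q := lam * (2 * h * x n k - h ^ 2) with hqd
  refine ⟨(F.sub_le t p).trans ((mul_le_mul_of_nonneg_left hp hL).trans hK), ?_, ?_⟩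
  · rw [abs_sub_comm]
    exact (F.sub_le t q).trans ((mul_le_mul_of_nonneg_left hq hL).trans hK)
  -- The forward and backward increments `p`, `q` of `λψ` nearly cancel, `p + q = -2 λ h²`. Hence
  -- the linear Taylor terms contribute at order `h²` only.
  · have h1 := abs_add_le_add (abs_add_le_add (F.taylor_le t p) (F.taylor_le t q))
      (abs_mul_le_mul (F.deriv_le t) (le_refl |p + q|))
    rw [show f (t + p) - f t - f' t * p + (f (t + q) - f t - f' t * q) + f' t * (p + q) =
      f (t + p) + f (t + q) - 2 * f t by ring] at h1
    refine h1.trans ?_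
    have e1 : |p + q| = 2 * lam * h ^ 2 := by
      rw [hpd, hqd, show lam * (-2 * h * x n k - h ^ 2) + lam * (2 * h * x n k - h ^ 2) =
        -(2 * lam * h ^ 2) by ring, abs_neg, abs_of_nonneg (by positivity)]
    have e2 : p ^ 2 ≤ (3 * lam * X * h) ^ 2 := by
      rw [← sq_abs p]; exact pow_le_pow_left₀ (abs_nonneg _) hp 2
    have e3 : q ^ 2 ≤ (3 * lam * X * h) ^ 2 := by
      rw [← sq_abs q]; exact pow_le_pow_left₀ (abs_nonneg _) hq 2
    rw [e1]
    have e4 : L * p ^ 2 + L * q ^ 2 ≤ L * (18 * lam ^ 2 * X ^ 2 * h ^ 2) := by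
      rw [← mul_add]; exact mul_le_mul_of_nonneg_left (by linarith) hL
    have e5 : 0 ≤ L * (3 * lam * X * h ^ 2) := by positivity
    unfold cutConst
    linarith

theorem SphereLayer.abs_phi_sub_le (H : SphereLayer e h X lam s κ a x Z)
    (hX : 1 ≤ X) (hlam : 0 ≤ lam) (hh : 0 < h) (hh1 : h ≤ 1) {n : G} (hn : n ∈ Z) (k : Fin d) :
    |phi lam s (x (n + e k)) - phi lam s (x n)| ≤ wconst lam X * h := by
  have ht : |1 + lam * psi s (x n)| ≤ 3 / 2 := by
    have := H.psi_le n hn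
    rw [abs_le] at this ⊢; constructor <;> linarith [this.1, this.2]
  have h1 := abs_phi_step_sub_le (c := h) hlam hX (H.x_le n hn)
      (by rw [abs_of_pos hh]; exact hh1) ht k
  have h2 : |grd lam s (x n) k| ≤ 3 * X := by
    have := abs_mul_le_mul (abs_mul_le_mul (le_of_eq (abs_neg (2 : ℝ))) ht) (H.x_le n hn k)
    rw [abs_two] at this
    refine this.trans (by linarith)
  have h3 := abs_add_le_add h1 (abs_mul_le_mul (le_of_eq (abs_of_pos hh)) h2)
  rw [sub_add_cancel, ← H.x_add n hn] at h3
  refine h3.trans ?_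
  have h4 : (2 + 5 * lam * X ^ 2) * h ^ 2 ≤ (2 + 5 * lam * X ^ 2) * h := by
    have : 0 ≤ lam * X ^ 2 := by positivity
    refine mul_le_mul_of_nonneg_left ?_ (by linarith)
    nlinarith
  have h5 : 0 ≤ (15 * (lam * X ^ 2) + 3 * X + 1) * h := by positivity
  unfold wconst
  linarith

/-- Undoing the conjugation where the cutoff is constant. -/
theorem SphereLayer.exp_mul_en_le (H : SphereLayer e h X lam s κ a x Z) {τ : ℝ}
    (hX : 1 ≤ X) (hlam : 0 ≤ lam) (hh : 0 < h) (hh1 : h ≤ 1) (hτ : 1 ≤ τ)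
    (hB : wconst lam X * (τ * h) ≤ 1) {χ v : G → ℝ} {n : G} (hn : n ∈ Z) (hχ : χ n = 1)
    (hχ' : ∀ k, χ (n + e k) = 1) :
    Real.exp (2 * τ * phi lam s (x n)) * en h e v n ≤
      (18 * d * wconst lam X ^ 2 + 19) *
        (∑ k, fd (e k) (fun n => Real.exp (τ * phi lam s (x n)) * (χ n * v n)) n ^ 2 +
          (τ * h) ^ 2 * (Real.exp (τ * phi lam s (x n)) * (χ n * v n)) ^ 2) := by
  set B := wconst lam X
  set V := fun n => Real.exp (τ * phi lam s (x n)) * (χ n * v n) with hV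
  have hE : Real.exp (2 * τ * phi lam s (x n)) = Real.exp (τ * phi lam s (x n)) ^ 2 := by
    rw [← Real.exp_nat_mul]; congr 1; push_cast; ring
  have hVn : V n = Real.exp (τ * phi lam s (x n)) * v n := by simp [hV, hχ]
  have hVk : ∀ k, V (n + e k) = Real.exp (τ * phi lam s (x (n + e k))) * v (n + e k) := by
    intro k; simp [hV, hχ']
  have hτh : 0 ≤ τ * h := by positivity
  have hk : ∀ k, Real.exp (τ * phi lam s (x n)) ^ 2 * fd (e k) v n ^ 2 ≤
      18 * fd (e k) V n ^ 2 + 18 * B ^ 2 * ((τ * h) ^ 2 * V n ^ 2) := by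
    intro k
    set θ := τ * phi lam s (x (n + e k)) - τ * phi lam s (x n) with hθ
    have h1 : |θ| ≤ B * (τ * h) := by
      rw [hθ, ← mul_sub, abs_mul, abs_of_nonneg (by linarith : 0 ≤ τ)]
      calc τ * _ ≤ τ * (B * h) := by
            gcongr; exact H.abs_phi_sub_le hX hlam hh hh1 hn k
        _ = _ := by ring
    have h2 : |-θ| ≤ 1 := by rw [abs_neg]; linarith
    have h3 : |Real.exp (-θ) - 1| ≤ 3 * (B * (τ * h)) := by
      have := exp_sub_le (p := 0) (q := -θ) (by simp) h2
      rw [Real.exp_zero, sub_zero, abs_neg] at this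
      linarith
    have h4 : |Real.exp (-θ)| ≤ 3 := by
      rw [Real.abs_exp]
      have q1 := Real.exp_le_exp.mpr (le_of_abs_le h2)
      have q2 := Real.exp_one_lt_d9
      linarith
    have q1 : Real.exp (-θ) * Real.exp (τ * phi lam s (x (n + e k))) =
        Real.exp (τ * phi lam s (x n)) := by
      rw [← Real.exp_add]; congr 1; rw [hθ]; ring
    -- Differencing `v = e^{-τφ} V` leaves a zero order term whose factor is `O(τh)`, exactly the
    -- weight that `V` carries in the conjugated energy.
    have key : Real.exp (τ * phi lam s (x n)) * fd (e k) v n =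
        Real.exp (-θ) * fd (e k) V n + (Real.exp (-θ) - 1) * V n := by
      rw [fd, fd, hVn, hVk]
      linear_combination (-v (n + e k)) * q1
    have h5 := abs_add_le_add (abs_mul_le_mul h4 (le_refl |fd (e k) V n|))
      (abs_mul_le_mul h3 (le_refl |V n|))
    rw [← key] at h5
    rw [← mul_pow, ← sq_abs]
    refine (pow_le_pow_left₀ (abs_nonneg _) h5 2).trans ?_
    rw [← sq_abs (fd (e k) V n), ← sq_abs (V n)]
    nlinarith only [sq_nonneg (3 * |fd (e k) V n| - 3 * (B * (τ * h)) * |V n|)]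
  have h0 : Real.exp (τ * phi lam s (x n)) ^ 2 * (h ^ 2 * v n ^ 2) ≤ (τ * h) ^ 2 * V n ^ 2 := by
    rw [hVn]
    have : h ^ 2 ≤ (τ * h) ^ 2 := pow_le_pow_left₀ hh.le (by nlinarith) 2
    calc Real.exp (τ * phi lam s (x n)) ^ 2 * (h ^ 2 * v n ^ 2) =
          h ^ 2 * (Real.exp (τ * phi lam s (x n)) * v n) ^ 2 := by ring
      _ ≤ _ := by gcongr
  have hs := Finset.sum_le_sum fun k (_ : k ∈ Finset.univ) => hk k
  rw [← Finset.mul_sum, Finset.sum_add_distrib, Finset.sum_const, Finset.card_univ,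
    Fintype.card_fin, nsmul_eq_mul, ← Finset.mul_sum] at hs
  change _ ≤ (18 * d * B ^ 2 + 19) * (∑ k, fd (e k) V n ^ 2 + (τ * h) ^ 2 * V n ^ 2)
  rw [hE, en, mul_add]
  have w1 : 0 ≤ ∑ k, fd (e k) V n ^ 2 := Finset.sum_nonneg fun _ _ => sq_nonneg _
  have w2 : 0 ≤ (τ * h) ^ 2 * V n ^ 2 := by positivity
  have w3 : 0 ≤ (18 * d * B ^ 2 + 1) * ∑ k, fd (e k) V n ^ 2 := by positivity
  linarith only [hs, h0, w1, w2, w3]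

end Layer

/-! ### Propagation of smallness across a sphere -/

section Layer

variable {d : ℕ}

/-- The weight is `1/λ` times the function `t + t²/2` of `t = λψ`, which increases for `t ≥ -1`.
Thresholds for `λψ` therefore translate into explicit exponents. -/
theorem phi_eq {lam : ℝ} (hlam : 0 < lam) (s : ℝ) (x : Fin d → ℝ) :
    phi lam s x = (lam * psi s x + (lam * psi s x) ^ 2 / 2) / lam := by
  rw [phi]; field_simp

theorem phi_le_of_le {lam s t : ℝ} (hlam : 0 < lam) {x : Fin d → ℝ} (h1 : -1 ≤ lam * psi s x)
    (h2 : lam * psi s x ≤ t) : phi lam s x ≤ (t + t ^ 2 / 2) / lam := by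
  rw [phi_eq hlam]
  refine div_le_div_of_nonneg_right ?_ hlam.le
  nlinarith

theorem le_phi_of_le {lam s t : ℝ} (hlam : 0 < lam) {x : Fin d → ℝ} (h1 : -1 ≤ t)
    (h2 : t ≤ lam * psi s x) : (t + t ^ 2 / 2) / lam ≤ phi lam s x := by
  rw [phi_eq hlam]
  refine div_le_div_of_nonneg_right ?_ hlam.le
  nlinarith

theorem sq_add_le {α x y c b : ℝ} (hc : |c| ≤ x + y) (hb : |α - c| ≤ b) :
    α ^ 2 ≤ 3 * (x ^ 2 + y ^ 2 + b ^ 2) := by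
  have h1 : |α| ≤ b + (x + y) := by
    have := abs_add_le_add hb hc
    rwa [sub_add_cancel] at this
  rw [← sq_abs]
  refine (pow_le_pow_left₀ (abs_nonneg _) h1 2).trans ?_
  nlinarith only [sq_nonneg (b - x), sq_nonneg (b - y), sq_nonneg (x - y)]

variable {G : Type*} [Fintype G] [AddCommGroup G] {e : Fin d → G} {h X lam s κ L : ℝ}
  {a : Fin d → G → ℝ} {x : G → Fin d → ℝ} {f f' : ℝ → ℝ}

theorem sum_add_sum_shift (e : Fin d → G) (g : G → ℝ) :
    ∑ n, (g n + ∑ k, g (n - e k)) = (1 + d) * ∑ n, g n := by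
  rw [Finset.sum_add_distrib, Finset.sum_comm]
  simp only [sum_shift_sub]
  rw [Finset.sum_const, Finset.card_univ, Fintype.card_fin, nsmul_eq_mul]
  ring

/-- The constant in the propagation of smallness across a sphere. -/
noncomputable def layerConst (d : ℕ) (L lam X : ℝ) : ℝ :=
  18 * (18 * d * wconst lam X ^ 2 + 19) * (1 + 17 * d ^ 2 * cutConst L lam X ^ 2 * (1 + d))

/-- The right-hand side of the Carleman estimate for a truncated solution. -/
theorem SphereLayer.source_le {M τ QA QB I : ℝ} {v F : G → ℝ}
    (H : SphereLayer e h X lam s κ a x {n | |lam * psi s (x n)| ≤ 1 / 2}) (Fc : Cutoff f f' L)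
    (hX : 1 ≤ X) (hlam : 0 < lam) (hh : 0 < h) (hh1 : h ≤ 1) (hhX : 3 * lam * X * h ≤ 1 / 16)
    (hτ : 0 ≤ τ) (heq : ∀ n, |lam * psi s (x n)| ≤ 1 / 2 →
      |ellip e a v n| ≤ h ^ 2 * (M * |v n| + |F n|))
    (hQA : ∑ n, en h e v n ≤ QA) (hQB : ∑ n, h ^ 2 * F n ^ 2 ≤ QB)
    (hI : ∑ n, {n | 0 < psi s (x n)}.indicator (en h e v) n ≤ I) :
    ∑ n, (Real.exp (τ * phi lam s (x n)) *
        ellip e a (fun n => f (lam * psi s (x n)) * v n) n) ^ 2 ≤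
      3 * (h ^ 4 * M ^ 2 * ∑ n, (Real.exp (τ * phi lam s (x n)) *
          (f (lam * psi s (x n)) * v n)) ^ 2 +
        h ^ 2 * Real.exp (2 * τ / lam) * QB +
        h ^ 2 * (17 * d ^ 2 * cutConst L lam X ^ 2 * (1 + d)) * (Real.exp (2 * τ / lam) * I +
          Real.exp (-(87 / 256 * τ / lam)) * QA)) := by
  set Z := {n | |lam * psi s (x n)| ≤ 1 / 2} with hZ
  set χ : G → ℝ := fun n => f (lam * psi s (x n)) with hχ
  set V : G → ℝ := fun n => Real.exp (τ * phi lam s (x n)) * (χ n * v n) with hV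
  set K := cutConst L lam X with hK
  set E := Real.exp (2 * τ / lam) with hE
  set O := Real.exp (-(87 / 256 * τ / lam)) with hO
  set ι := {n | 0 < psi s (x n)}.indicator (en h e v) with hι
  have hι0 : ∀ n, 0 ≤ ι n := fun n => Set.indicator_nonneg (fun n _ => en_nonneg h e v n) n
  have hX0 : 0 ≤ X := by linarith
  have hL0 : 0 ≤ L := by linarith [Fc.one_le]
  have hK0 : 0 ≤ K := by rw [hK]; unfold cutConst; positivity
  have hE0 : 0 < E := Real.exp_pos _
  have hO0 : 0 < O := Real.exp_pos _
  have ha : ∀ k n, |a k n| ≤ 4 / 3 := fun k n => by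
    rw [abs_of_nonneg (by linarith [(H.coeff k n).1])]; exact (H.coeff k n).2
  have hadd : ∀ n ∈ Z, ∀ k, |lam * psi s (x (n + e k)) - lam * psi s (x n)| ≤ 1 / 16 := by
    intro n hn k
    rw [H.psi_add hn, add_sub_cancel_left]
    exact ((H.abs_step_le hX hlam.le hh hh1 hn k).1).trans hhX
  have hsub : ∀ n ∈ Z, ∀ k, |lam * psi s (x (n - e k)) - lam * psi s (x n)| ≤ 1 / 16 := by
    intro n hn k
    rw [H.psi_sub hn, add_sub_cancel_left]
    exact ((H.abs_step_le hX hlam.le hh hh1 hn k).2).trans hhX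
  have hexp : ∀ n, Real.exp (τ * phi lam s (x n)) ^ 2 = Real.exp (2 * τ * phi lam s (x n)) := by
    intro n; rw [← Real.exp_nat_mul]; congr 1; push_cast; ring
  -- On the layer `λψ ≤ 1/2`, so `λφ ≤ 1/2 + 1/8 ≤ 1`.
  have hEn : ∀ n ∈ Z, Real.exp (τ * phi lam s (x n)) ^ 2 ≤ E := by
    intro n hn
    rw [hexp, hE]
    refine Real.exp_le_exp.mpr ?_
    have hn' := abs_le.1 (show |lam * psi s (x n)| ≤ 1 / 2 from hn)
    have := phi_le_of_le hlam (by linarith [hn'.1]) hn'.2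
    have h2 : (1 / 2 + (1 / 2) ^ 2 / 2) / lam ≤ 1 / lam := by
      refine div_le_div_of_nonneg_right (by norm_num) hlam.le
    calc 2 * τ * phi lam s (x n) ≤ 2 * τ * (1 / lam) := by gcongr; linarith
      _ = _ := by ring
  -- The exponent comes from `2 (-3/16 + (3/16)²/2) = -87/256`.
  have hon : ∀ n ∈ Z, lam * psi s (x n) ≤ -(3 / 16) →
      Real.exp (τ * phi lam s (x n)) ^ 2 ≤ O := by
    intro n hn hneg
    rw [hexp, hO]
    refine Real.exp_le_exp.mpr ?_
    have hn' := abs_le.1 (show |lam * psi s (x n)| ≤ 1 / 2 from hn)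
    have := phi_le_of_le hlam (by linarith [hn'.1]) hneg
    calc 2 * τ * phi lam s (x n) ≤ 2 * τ * ((-(3 / 16) + (-(3 / 16)) ^ 2 / 2) / lam) := by gcongr
      _ = _ := by ring
  have hpt : ∀ n, (Real.exp (τ * phi lam s (x n)) * ellip e a (fun n => χ n * v n) n) ^ 2 ≤
      3 * (h ^ 4 * M ^ 2 * V n ^ 2 + h ^ 2 * E * (h ^ 2 * F n ^ 2) +
        h ^ 2 * (17 * d ^ 2 * K ^ 2) * (E * (ι n + ∑ k, ι (n - e k)) +
          O * (en h e v n + ∑ k, en h e v (n - e k)))) := by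
    intro n
    have hi0 : 0 ≤ ι n + ∑ k, ι (n - e k) :=
      add_nonneg (hι0 n) (Finset.sum_nonneg fun _ _ => hι0 _)
    have he0 : 0 ≤ en h e v n + ∑ k, en h e v (n - e k) :=
      add_nonneg (en_nonneg _ _ _ _) (Finset.sum_nonneg fun _ _ => en_nonneg _ _ _ _)
    have hrest : 0 ≤ h ^ 2 * (17 * d ^ 2 * K ^ 2) * (E * (ι n + ∑ k, ι (n - e k)) +
          O * (en h e v n + ∑ k, en h e v (n - e k))) := by positivity
    by_cases hn : n ∈ Z
    · set P := Real.exp (τ * phi lam s (x n)) with hP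
      have hP0 : 0 < P := Real.exp_pos _
      set c := ellip e a (fun n => χ n * v n) n - χ n * ellip e a v n with hc
      have hχ0 : 0 ≤ χ n := Fc.nonneg _
      have hχ1 : χ n ≤ 1 := Fc.le_one _
      have h1 : |P * (χ n * ellip e a v n)| ≤ h ^ 2 * M * |V n| + h ^ 2 * P * |F n| := by
        have hVn : |V n| = P * (χ n * |v n|) := by
          rw [hV]; simp only [abs_mul, abs_of_nonneg hχ0, abs_of_pos hP0, ← hP]
        rw [abs_mul, abs_mul, abs_of_nonneg hχ0, abs_of_pos hP0, hVn]
        have q1 := heq n hn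
        have q2 : χ n * |ellip e a v n| ≤ χ n * (h ^ 2 * (M * |v n| + |F n|)) := by gcongr
        have q3 : χ n * (h ^ 2 * |F n|) ≤ 1 * (h ^ 2 * |F n|) := by gcongr
        calc P * (χ n * |ellip e a v n|) ≤ P * (χ n * (h ^ 2 * (M * |v n|)) + h ^ 2 * |F n|) := by
              gcongr; linarith
          _ = _ := by ring
      have h2 : (P * ellip e a (fun n => χ n * v n) n) ^ 2 ≤
          3 * ((h ^ 2 * M * |V n|) ^ 2 + (h ^ 2 * P * |F n|) ^ 2 + |P * c| ^ 2) := by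
        refine sq_add_le h1 (le_of_eq ?_)
        rw [hc]; ring_nf
      refine h2.trans ?_
      have h3 : (h ^ 2 * P * |F n|) ^ 2 ≤ h ^ 2 * E * (h ^ 2 * F n ^ 2) := by
        rw [mul_pow, mul_pow, sq_abs]
        have := hEn n hn
        calc (h ^ 2) ^ 2 * P ^ 2 * F n ^ 2 ≤ (h ^ 2) ^ 2 * E * F n ^ 2 := by gcongr
          _ = _ := by ring
      have h4 : (h ^ 2 * M * |V n|) ^ 2 = h ^ 4 * M ^ 2 * V n ^ 2 := by
        rw [mul_pow, mul_pow, sq_abs]; ring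
      have hc2 : c ^ 2 ≤ 17 * d ^ 2 * K ^ 2 * h ^ 2 * (en h e v n + ∑ k, en h e v (n - e k)) :=
        ellip_mul_sub_sq_le hh.le hK0 ha (H.coeff_sub n hn)
          (fun k => (H.cutoff_bounds Fc hX hlam.le hh hh1 hn k).1)
          (fun k => (H.cutoff_bounds Fc hX hlam.le hh hh1 hn k).2.1)
          (fun k => (H.cutoff_bounds Fc hX hlam.le hh hh1 hn k).2.2) v
      have h5 : |P * c| ^ 2 ≤ h ^ 2 * (17 * d ^ 2 * K ^ 2) * (E * (ι n + ∑ k, ι (n - e k)) +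
          O * (en h e v n + ∑ k, en h e v (n - e k))) := by
        rw [sq_abs, mul_pow]
        by_cases hpos : 3 / 16 ≤ lam * psi s (x n)
        · have i1 : ∀ m, 1 / 16 < lam * psi s (x m) → ι m = en h e v m := by
            intro m hm
            refine Set.indicator_of_mem ?_ _
            by_contra hneg
            have := mul_nonpos_of_nonneg_of_nonpos hlam.le (not_lt.1 hneg)
            linarith
          have i2 : ∑ k, en h e v (n - e k) = ∑ k, ι (n - e k) := by
            refine Finset.sum_congr rfl fun k _ => (i1 _ ?_).symm
            have := (abs_le.1 (hsub n hn k)).1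
            linarith
          rw [← i1 n (by linarith), i2] at hc2 ⊢
          have := hEn n hn
          have hOi : 0 ≤ h ^ 2 * (17 * d ^ 2 * K ^ 2) * (O * (ι n + ∑ k, ι (n - e k))) := by
            positivity
          calc P ^ 2 * c ^ 2 ≤ E * (17 * d ^ 2 * K ^ 2 * h ^ 2 * (ι n + ∑ k, ι (n - e k))) := by
                gcongr
            _ ≤ _ := by linarith only [hOi]
        · by_cases hneg : lam * psi s (x n) ≤ -(3 / 16)
          · have := hon n hn hneg
            have hEi : 0 ≤ h ^ 2 * (17 * d ^ 2 * K ^ 2) * (E * (ι n + ∑ k, ι (n - e k))) := by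
              positivity
            calc P ^ 2 * c ^ 2 ≤ O * (17 * d ^ 2 * K ^ 2 * h ^ 2 *
                  (en h e v n + ∑ k, en h e v (n - e k))) := by gcongr
              _ ≤ _ := by linarith only [hEi]
          · have o1 : ∀ m, |lam * psi s (x m) - lam * psi s (x n)| ≤ 1 / 16 → χ m = 1 := by
              intro m hm
              refine Fc.eq_one _ ?_
              rw [abs_le] at hm ⊢
              constructor <;> linarith [hm.1, hm.2]
            have o2 : c = 0 := by
              have c0 := o1 n (by simp)
              have c1 := fun k => o1 _ (hadd n hn k)
              have c2 := fun k => o1 _ (hsub n hn k)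
              rw [hc, ellip, ellip, c0]
              simp [c1, c2]
            rw [o2]; simpa using hrest
      rw [h4]; linarith
    -- The support of the cutoff is at least two steps away from the complement of the layer,
    -- because `3/8 + 2/16 = 1/2`.
    · have z1 : ∀ m, |lam * psi s (x m)| ≤ 3 / 8 → m ∈ Z ∧ ∀ k, m + e k ∈ Z ∧ m - e k ∈ Z := by
        intro m hm
        have hmZ : m ∈ Z := by
          change |lam * psi s (x m)| ≤ 1 / 2
          linarith
        refine ⟨hmZ, fun k => ⟨?_, ?_⟩⟩
        · change |lam * psi s (x (m + e k))| ≤ 1 / 2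
          have := abs_add_le_add (hadd m hmZ k) hm
          rw [sub_add_cancel] at this; linarith
        · change |lam * psi s (x (m - e k))| ≤ 1 / 2
          have := abs_add_le_add (hsub m hmZ k) hm
          rw [sub_add_cancel] at this; linarith
      have z2 : χ n = 0 := by
        refine Fc.eq_zero _ (le_of_not_ge fun hc => hn (z1 n hc).1)
      have z3 : ∀ k, χ (n + e k) = 0 := fun k => Fc.eq_zero _ (le_of_not_ge fun hc => hn (by
        simpa using ((z1 _ hc).2 k).2))
      have z4 : ∀ k, χ (n - e k) = 0 := fun k => Fc.eq_zero _ (le_of_not_ge fun hc => hn (by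
        simpa using ((z1 _ hc).2 k).1))
      have : ellip e a (fun n => χ n * v n) n = 0 := by
        rw [ellip]; simp [z2, z3, z4]
      rw [this]
      have : 0 ≤ h ^ 4 * M ^ 2 * V n ^ 2 := by positivity
      have : 0 ≤ h ^ 2 * E * (h ^ 2 * F n ^ 2) := by positivity
      simp only [mul_zero, ne_eq, OfNat.ofNat_ne_zero, not_false_eq_true, zero_pow]
      linarith
  refine (Finset.sum_le_sum fun n _ => hpt n).trans ?_
  rw [← Finset.mul_sum, Finset.sum_add_distrib, Finset.sum_add_distrib, ← Finset.mul_sum,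
    ← Finset.mul_sum, ← Finset.mul_sum, ← Finset.mul_sum, Finset.sum_add_distrib, ← Finset.mul_sum,
    ← Finset.mul_sum, sum_add_sum_shift, sum_add_sum_shift]
  rw [← Finset.mul_sum] at hQB
  have r1 : h ^ 2 * E * (h ^ 2 * ∑ n, F n ^ 2) ≤ h ^ 2 * E * QB := by gcongr
  have r2 : h ^ 2 * (17 * d ^ 2 * K ^ 2) * (E * ((1 + d) * ∑ n, ι n) +
      O * ((1 + d) * ∑ n, en h e v n)) ≤
      h ^ 2 * (17 * d ^ 2 * K ^ 2) * (E * ((1 + d) * I) + O * ((1 + d) * QA)) := by gcongr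
  refine mul_le_mul_of_nonneg_left ?_ (by norm_num)
  linarith

/-- Propagation of smallness across a sphere. -/
theorem SphereLayer.propagate {M τ ζ QA QB I : ℝ} {v F : G → ℝ}
    (H : SphereLayer e h X lam s κ a x {n | |lam * psi s (x n)| ≤ 1 / 2}) (Fc : Cutoff f f' L)
    (hX : 1 ≤ X) (hlam : 0 < lam) (hκ : 0 ≤ κ)
    (hlam1 : 64 / 3 + 54 * d * X + 4 ≤ 4 / 3 * lam * κ)
    (hlam2 : 144 * d ^ 2 * X ^ 3 + 192 * d * X ^ 2 + 96 * d ^ 2 * X ^ 2 + 4 ≤ lam * κ ^ 2 / 2)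
    (hh : 0 < h) (hh1 : h ≤ 1) (hhX : 3 * lam * X * h ≤ 1 / 16)
    (hζ1 : ζ ≤ 1) (hζ : 2000 * (d + 1) ^ 2 * carlConst d lam X κ ^ 4 * ζ ≤ 1)
    (hτ1 : 1 ≤ τ) (hτζ : 1 ≤ τ * ζ) (hεζ : τ * h ≤ ζ) (hB : wconst lam X * (τ * h) ≤ 1)
    (hτM : 18 * M ^ 2 ≤ τ) (heq : ∀ n, |lam * psi s (x n)| ≤ 1 / 2 →
      |ellip e a v n| ≤ h ^ 2 * (M * |v n| + |F n|))
    (hQA : ∑ n, en h e v n ≤ QA) (hQB : ∑ n, h ^ 2 * F n ^ 2 ≤ QB)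
    (hI : ∑ n, {n | 0 < psi s (x n)}.indicator (en h e v) n ≤ I) :
    ∑ n, {n | -(1 / 8) < lam * psi s (x n) ∧ psi s (x n) ≤ 0}.indicator (en h e v) n ≤
      layerConst d L lam X * (Real.exp (4 / lam * τ) * (QB + I) +
        Real.exp (-(1 / (10 * lam) * τ)) * QA) := by
  set Z := {n | |lam * psi s (x n)| ≤ 1 / 2} with hZ
  set χ : G → ℝ := fun n => f (lam * psi s (x n)) with hχ
  set V : G → ℝ := fun n => Real.exp (τ * phi lam s (x n)) * (χ n * v n) with hV
  have hX0 : 0 ≤ X := by linarith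
  have hL0 : 0 ≤ L := by linarith [Fc.one_le]
  have hadd : ∀ n ∈ Z, ∀ k, |lam * psi s (x (n + e k)) - lam * psi s (x n)| ≤ 1 / 16 := by
    intro n hn k
    rw [H.psi_add hn, add_sub_cancel_left]
    exact ((H.abs_step_le hX hlam.le hh hh1 hn k).1).trans hhX
  have hsub : ∀ n ∈ Z, ∀ k, |lam * psi s (x (n - e k)) - lam * psi s (x n)| ≤ 1 / 16 := by
    intro n hn k
    rw [H.psi_sub hn, add_sub_cancel_left]
    exact ((H.abs_step_le hX hlam.le hh hh1 hn k).2).trans hhX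
  have hτ0 : 0 < τ := by linarith
  have s0 : ∀ m, V m ≠ 0 → |lam * psi s (x m)| ≤ 3 / 8 := by
    intro m hm
    by_contra hc
    refine hm ?_
    have : χ m = 0 := Fc.eq_zero _ (not_le.1 hc).le
    simp [hV, this]
  have s1 : ∀ m ∈ Z, ∀ k c, |lam * psi s (x m)| ≤ c → |lam * psi s (x (m + e k))| ≤ c + 1 / 16 ∧
      |lam * psi s (x (m - e k))| ≤ c + 1 / 16 := by
    intro m hm k c hc
    constructor
    · have := abs_add_le_add (hadd m hm k) hc
      rw [sub_add_cancel] at this; linarith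
    · have := abs_add_le_add (hsub m hm k) hc
      rw [sub_add_cancel] at this; linarith
  have sZ : ∀ m c, |lam * psi s (x m)| ≤ c → c ≤ 1 / 2 → m ∈ Z := fun m c h1 h2 => h1.trans h2
  have hcar := carleman (V := V) H hX hlam.le hκ hlam1 hlam2 hh hζ1 hζ hτ0 hτζ hεζ
    (fun n hn => by
      by_contra hc
      exact hn (sZ n _ (s0 n hc) (by norm_num)))
    (fun n hn k => by
      by_contra hc
      have t1 := s0 _ hc
      have t2 := (s1 _ (sZ _ _ t1 (by norm_num)) k _ t1).2
      rw [add_sub_cancel_right] at t2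
      exact hn (sZ _ _ t2 (by norm_num)))
    (fun n hn k => by
      by_contra hc
      have t1 := s0 _ hc
      have t2 := (s1 _ (sZ _ _ t1 (by norm_num)) k _ t1).1
      rw [sub_add_cancel] at t2
      exact hn (sZ _ _ t2 (by norm_num)))
    (fun n hn k j => by
      by_contra hc
      have t1 := s0 _ hc
      have t2 := (s1 _ (sZ _ _ t1 (by norm_num)) j _ t1).2
      rw [add_sub_cancel_right] at t2
      have t3 := (s1 _ (sZ _ _ t2 (by norm_num)) k _ t2).2
      rw [add_sub_cancel_right] at t3
      exact hn (sZ _ _ t3 (by norm_num)))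
  have hw : (fun n => Real.exp (-(τ * phi lam s (x n))) * V n) = fun n => χ n * v n := by
    funext n
    rw [hV]; simp only
    rw [← mul_assoc, ← Real.exp_add, neg_add_cancel, Real.exp_zero, one_mul]
  rw [hw] at hcar
  have hsrc := H.source_le Fc hX hlam hh hh1 hhX hτ0.le heq hQA hQB hI
  set K2 := 17 * d ^ 2 * cutConst L lam X ^ 2 * (1 + d) with hK2
  set E := Real.exp (2 * τ / lam) with hE
  set O := Real.exp (-(87 / 256 * τ / lam)) with hO
  set S := gradSq e V + (τ * h) ^ 2 * ∑ n, V n ^ 2 with hS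
  have hV0 : 0 ≤ ∑ n, V n ^ 2 := Finset.sum_nonneg fun _ _ => sq_nonneg _
  have hK20 : 0 ≤ K2 := by rw [hK2]; positivity
  have hS0 : 0 ≤ S := add_nonneg (gradSq_nonneg e V) (by positivity)
  have hQA0 : 0 ≤ QA := (Finset.sum_nonneg fun n _ => en_nonneg h e v n).trans hQA
  have hQB0 : 0 ≤ QB := (Finset.sum_nonneg fun n _ => by positivity).trans hQB
  have hI0 : 0 ≤ I := (Finset.sum_nonneg fun n _ =>
    Set.indicator_nonneg (fun n _ => en_nonneg h e v n) n).trans hI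
  -- The potential is absorbed into the zero order gain `τ³ h⁴ ∑ V²`. The constants `3 · 3` produce
  -- `9`, so a factor `18` leaves half of the left-hand side.
  have habs : 18 * (h ^ 4 * M ^ 2 * ∑ n, V n ^ 2) ≤ τ * h * h * S := by
    have h1 : τ * h * h * ((τ * h) ^ 2 * ∑ n, V n ^ 2) ≤ τ * h * h * S := by
      refine mul_le_mul_of_nonneg_left ?_ (by positivity)
      rw [hS]; linarith [gradSq_nonneg e V]
    have h2 : 18 * M ^ 2 ≤ τ ^ 3 := hτM.trans (le_self_pow₀ hτ1 (by norm_num))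
    refine le_trans ?_ h1
    calc 18 * (h ^ 4 * M ^ 2 * ∑ n, V n ^ 2) = (18 * M ^ 2) * (h ^ 4 * ∑ n, V n ^ 2) := by ring
      _ ≤ τ ^ 3 * (h ^ 4 * ∑ n, V n ^ 2) := by gcongr
      _ = _ := by ring
  have hSle : S ≤ 18 * (E * QB + K2 * (E * I + O * QA)) := by
    have h1 : τ * h * h * S ≤ 18 * (h ^ 2 * E * QB + h ^ 2 * K2 * (E * I + O * QA)) := by
      linarith
    have h2 : h ^ 2 * S ≤ τ * h * h * S := by
      have : 1 * (h ^ 2 * S) ≤ τ * (h ^ 2 * S) := by gcongr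
      linarith
    refine le_of_mul_le_mul_left ?_ (pow_pos hh 2)
    linarith
  set K1 := 18 * d * wconst lam X ^ 2 + 19 with hK1
  have hK10 : 0 ≤ K1 := by rw [hK1]; positivity
  set T := {n | -(1 / 8) < lam * psi s (x n) ∧ psi s (x n) ≤ 0} with hT
  -- Lower bound of the squared weight where `λψ > -1/8`: the exponent is `2 (-1/8 + (1/8)²/2) =
  -- -15/64`.
  set P := Real.exp (-(15 / 64 * τ / lam)) with hP
  have hP0 : 0 < P := Real.exp_pos _
  have hpt : ∀ n, P * T.indicator (en h e v) n ≤
      K1 * (∑ k, fd (e k) V n ^ 2 + (τ * h) ^ 2 * V n ^ 2) := by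
    intro n
    by_cases hn : n ∈ T
    · rw [Set.indicator_of_mem hn]
      have hn1 := hn.1
      have hn2 : lam * psi s (x n) ≤ 0 := mul_nonpos_of_nonneg_of_nonpos hlam.le hn.2
      have hna : |lam * psi s (x n)| ≤ 1 / 8 := abs_le.2 ⟨hn1.le, by linarith⟩
      have hnZ : n ∈ Z := sZ n _ hna (by norm_num)
      have hle := H.exp_mul_en_le (χ := χ) (v := v) hX hlam.le hh hh1 hτ1 hB hnZ
        (Fc.eq_one _ (by linarith))
        (fun k => Fc.eq_one _ ((s1 n hnZ k _ hna).1.trans (by norm_num)))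
      refine le_trans ?_ hle
      refine mul_le_mul_of_nonneg_right ?_ (en_nonneg _ _ _ _)
      rw [hP]
      refine Real.exp_le_exp.mpr ?_
      have := le_phi_of_le (x := x n) (s := s) hlam (by norm_num : (-1 : ℝ) ≤ -(1 / 8)) hn1.le
      calc -(15 / 64 * τ / lam) = 2 * τ * ((-(1 / 8) + (-(1 / 8)) ^ 2 / 2) / lam) := by ring
        _ ≤ _ := by gcongr
    · rw [Set.indicator_of_notMem hn, mul_zero]
      have : 0 ≤ ∑ k, fd (e k) V n ^ 2 := Finset.sum_nonneg fun _ _ => sq_nonneg _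
      positivity
  have hsum : P * ∑ n, T.indicator (en h e v) n ≤ K1 * S := by
    rw [Finset.mul_sum]
    refine (Finset.sum_le_sum fun n _ => hpt n).trans (le_of_eq ?_)
    rw [← Finset.mul_sum, Finset.sum_add_distrib, ← Finset.mul_sum, hS, gradSq]
  have hfin : P * ∑ n, T.indicator (en h e v) n ≤
      18 * K1 * (1 + K2) * (E * (QB + I) + O * QA) := by
    refine hsum.trans ((mul_le_mul_of_nonneg_left hSle hK10).trans ?_)
    have g1 : 0 ≤ K1 * (K2 * (E * QB) + E * I + O * QA) := by positivity
    linarith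
  have hPE : E ≤ P * Real.exp (4 / lam * τ) := by
    rw [hP, hE, ← Real.exp_add]
    refine Real.exp_le_exp.mpr ?_
    have : 0 ≤ τ / lam := by positivity
    rw [show 2 * τ / lam = 2 * (τ / lam) by ring,
      show -(15 / 64 * τ / lam) + 4 / lam * τ = (4 - 15 / 64) * (τ / lam) by ring]
    exact mul_le_mul_of_nonneg_right (by norm_num) this
  -- The gain is the gap between the two level sets of the weight: `87/256 - 15/64 = 27/256 > 1/10`.
  have hPO : O ≤ P * Real.exp (-(1 / (10 * lam) * τ)) := by
    rw [hP, hO, ← Real.exp_add]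
    refine Real.exp_le_exp.mpr ?_
    have : 0 ≤ τ / lam := by positivity
    rw [show -(87 / 256 * τ / lam) = -(87 / 256) * (τ / lam) by ring,
      show -(15 / 64 * τ / lam) + -(1 / (10 * lam) * τ) = -(15 / 64 + 1 / 10) * (τ / lam) by
        field_simp; ring]
    exact mul_le_mul_of_nonneg_right (by norm_num) this
  refine le_of_mul_le_mul_left (hfin.trans ?_) hP0
  calc 18 * K1 * (1 + K2) * (E * (QB + I) + O * QA)
      ≤ 18 * K1 * (1 + K2) * (P * Real.exp (4 / lam * τ) * (QB + I) +
          P * Real.exp (-(1 / (10 * lam) * τ)) * QA) := by gcongr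
    _ = _ := by rw [layerConst, ← hK1, ← hK2]; ring

end Layer

/-! ### The periodic mesh carrying the extended problem -/

section Torus

/-- The periodic mesh with `3 (N + 1)` points in each direction. -/
abbrev Torus (d N : ℕ) : Type := Fin d → ZMod (3 * N + 3)

/-- The unit step in direction `k`. -/
def te (d N : ℕ) (k : Fin d) : Torus d N := Pi.single k 1

/-- The position of a mesh point in the fundamental domain `[-1, 2)^d`. -/
noncomputable def pos {d : ℕ} (N : ℕ) (n : Torus d N) : Fin d → ℝ :=
  fun k => meshSize N * ((n k).val : ℝ) - 1

variable {d N : ℕ}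

theorem meshSize_pos (N : ℕ) : 0 < meshSize N := by unfold meshSize; positivity

theorem meshSize_mul (N : ℕ) : meshSize N * ((N : ℝ) + 1) = 1 := by
  unfold meshSize; field_simp

theorem meshSize_le_one (N : ℕ) : meshSize N ≤ 1 := by
  unfold meshSize
  rw [div_le_one (by positivity)]
  linarith [(Nat.cast_nonneg N : (0 : ℝ) ≤ N)]

instance : Fact (1 < 3 * N + 3) := ⟨by omega⟩

theorem add_te_val (n : Torus d N) (l : Fin d) (hl : (n l).val + 1 < 3 * N + 3) (k : Fin d) :
    ((n + te d N l) k).val = (n k).val + if k = l then 1 else 0 := by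
  by_cases hk : k = l
  · subst hk
    simp only [Pi.add_apply, te, Pi.single_eq_same, if_true]
    rw [ZMod.val_add_of_lt] <;> rw [ZMod.val_one]
    exact hl
  · simp [te, hk]

theorem sub_te_val (n : Torus d N) (l : Fin d) (hl : 1 ≤ (n l).val) (k : Fin d) :
    ((n - te d N l) k).val = (n k).val - if k = l then 1 else 0 := by
  by_cases hk : k = l
  · subst hk
    simp only [Pi.sub_apply, te, Pi.single_eq_same, if_true]
    rw [ZMod.val_sub (by rw [ZMod.val_one]; exact hl), ZMod.val_one]
  · simp [te, hk]

theorem pos_add (n : Torus d N) (l : Fin d) (hl : (n l).val + 1 < 3 * N + 3) :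
    pos N (n + te d N l) = step (meshSize N) l (pos N n) := by
  funext k
  simp only [pos, step, add_te_val n l hl]
  by_cases hk : k = l
  · subst hk; simp; ring
  · simp [hk]

theorem pos_sub (n : Torus d N) (l : Fin d) (hl : 1 ≤ (n l).val) :
    pos N (n - te d N l) = step (-meshSize N) l (pos N n) := by
  funext k
  simp only [pos, step, sub_te_val n l hl]
  by_cases hk : k = l
  · subst hk; simp [Nat.cast_sub hl]; ring
  · simp [hk]

theorem val_add_one_lt_of_pos_lt {n : Torus d N} {k : Fin d} (hk : pos N n k < 2 - meshSize N) :
    (n k).val + 1 < 3 * N + 3 := by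
  have h0 := meshSize_pos N
  have h1 := meshSize_mul N
  have h2 : meshSize N * (((n k).val : ℝ) + 1) < meshSize N * (3 * (N : ℝ) + 3) := by
    simp only [pos] at hk; linarith
  have h3 := lt_of_mul_lt_mul_left h2 h0.le
  exact_mod_cast h3

theorem one_le_val_of_lt_pos {n : Torus d N} {k : Fin d} (hk : -1 < pos N n k) :
    1 ≤ (n k).val := by
  by_contra hc
  have : (n k).val = 0 := by omega
  simp [pos, this] at hk

end Torus

/-! ### Exponential smallness estimates and their transfer -/

section Good

variable {d : ℕ}

/-- An approximate solution `v` of an elliptic difference equation in the region `V`, with total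
energy at most `QA`, and with source and energy in the region `B` at most `QB`. -/
structure Config (d N : ℕ) (M : ℝ) (V B : Set (Fin d → ℝ)) (a : Fin d → Torus d N → ℝ)
    (v F : Torus d N → ℝ) (QA QB : ℝ) : Prop where
  coeff : ∀ k n, 2 / 3 ≤ a k n ∧ a k n ≤ 4 / 3
  coeff_add : ∀ k l n, (n l).val + 1 < 3 * N + 3 → |a k (n + te d N l) - a k n| ≤ meshSize N
  eqn : ∀ n, pos N n ∈ V →
    |ellip (te d N) a v n| ≤ meshSize N ^ 2 * (M * |v n| + |F n|)
  energy : ∑ n, en (meshSize N) (te d N) v n ≤ QA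
  source : ∑ n, meshSize N ^ 2 * F n ^ 2 ≤ QB
  base : ∑ n, {n | pos N n ∈ B}.indicator (en (meshSize N) (te d N) v) n ≤ QB

/-- The energy in the region `S`. -/
noncomputable def enOn {N : ℕ} (S : Set (Fin d → ℝ)) (v : Torus d N → ℝ) : ℝ :=
  ∑ n, {n | pos N n ∈ S}.indicator (en (meshSize N) (te d N) v) n

theorem enOn_mono {N : ℕ} {S S' : Set (Fin d → ℝ)} (h : S ⊆ S') (v : Torus d N → ℝ) :
    enOn S v ≤ enOn S' v :=
  Finset.sum_le_sum fun n _ => Set.indicator_le_indicator_of_subset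
    (show {n | pos N n ∈ S} ⊆ {n | pos N n ∈ S'} from fun _ hn => h hn)
    (fun n => en_nonneg _ _ _ n) n

theorem enOn_nonneg {N : ℕ} (S : Set (Fin d → ℝ)) (v : Torus d N → ℝ) : 0 ≤ enOn S v :=
  Finset.sum_nonneg fun n _ => Set.indicator_nonneg (fun n _ => en_nonneg _ _ _ n) n

theorem enOn_le {N : ℕ} (S : Set (Fin d → ℝ)) (v : Torus d N → ℝ) :
    enOn S v ≤ ∑ n, en (meshSize N) (te d N) v n :=
  Finset.sum_le_sum fun n _ => Set.indicator_le_self' (fun _ _ => en_nonneg _ _ _ _) n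

theorem enOn_union_le {N : ℕ} (S S' : Set (Fin d → ℝ)) (v : Torus d N → ℝ) :
    enOn (S ∪ S') v ≤ enOn S v + enOn S' v := by
  rw [enOn, enOn, enOn, ← Finset.sum_add_distrib]
  refine Finset.sum_le_sum fun n _ => ?_
  have := en_nonneg (meshSize N) (te d N) v n
  by_cases h1 : pos N n ∈ S <;> by_cases h2 : pos N n ∈ S' <;> simp [Set.indicator, h1, h2, this]

/-- The energy in `S` is controlled by the source, up to a small multiple of the total energy. -/
def Good (d : ℕ) (M : ℝ) (V B S : Set (Fin d → ℝ)) : Prop :=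
  ∃ h₀ ε C α β : ℝ, 0 < h₀ ∧ 0 < ε ∧ 0 < C ∧ 0 < α ∧ 0 < β ∧
    ∀ (N : ℕ) (a : Fin d → Torus d N → ℝ) (v F : Torus d N → ℝ) (QA QB : ℝ),
      Config d N M V B a v F QA QB → meshSize N ≤ h₀ → ∀ τ : ℝ, 0 < τ → τ * meshSize N ≤ ε →
      enOn S v ≤ C * (Real.exp (-(α * τ)) * QA + Real.exp (β * τ) * QB)

variable {M : ℝ} {V B S S' : Set (Fin d → ℝ)}

section

variable {N : ℕ} {a : Fin d → Torus d N → ℝ} {v F : Torus d N → ℝ} {QA QB : ℝ}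

theorem Config.QA_nonneg (H : Config d N M V B a v F QA QB) : 0 ≤ QA :=
  (Finset.sum_nonneg fun n _ => en_nonneg _ _ _ n).trans H.energy

theorem Config.QB_nonneg (H : Config d N M V B a v F QA QB) : 0 ≤ QB :=
  (Finset.sum_nonneg fun n _ => by positivity).trans H.source

end

theorem Good.mono (h : Good d M V B S') (hS : S ⊆ S') : Good d M V B S := by
  obtain ⟨h₀, ε, C, α, β, p1, p2, p3, p4, p5, H⟩ := h
  exact ⟨h₀, ε, C, α, β, p1, p2, p3, p4, p5, fun N a v F QA QB hc hN τ hτ hτh =>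
    (enOn_mono hS v).trans (H N a v F QA QB hc hN τ hτ hτh)⟩

theorem good_base : Good d M V B B := by
  refine ⟨1, 1, 1, 1, 1, one_pos, one_pos, one_pos, one_pos, one_pos,
    fun N a v F QA QB hc _ τ hτ _ => ?_⟩
  refine hc.base.trans ?_
  have h1 := hc.QA_nonneg
  have h2 := hc.QB_nonneg
  have h3 : (1 : ℝ) ≤ Real.exp (1 * τ) := Real.one_le_exp (by linarith)
  have h4 : 1 * QB ≤ Real.exp (1 * τ) * QB := by gcongr
  have h5 : 0 ≤ Real.exp (-(1 * τ)) * QA := by positivity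
  linarith

theorem Good.union (h : Good d M V B S) (h' : Good d M V B S') : Good d M V B (S ∪ S') := by
  obtain ⟨h₀, ε, C, α, β, p1, p2, p3, p4, p5, H⟩ := h
  obtain ⟨h₀', ε', C', α', β', p1', p2', p3', p4', p5', H'⟩ := h'
  refine ⟨min h₀ h₀', min ε ε', C + C', min α α', max β β', lt_min p1 p1', lt_min p2 p2',
    by linarith, lt_min p4 p4', lt_max_of_lt_left p5, fun N a v F QA QB hc hN τ hτ hτh => ?_⟩
  have t1 := H N a v F QA QB hc (hN.trans (min_le_left _ _)) τ hτ (hτh.trans (min_le_left _ _))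
  have t2 := H' N a v F QA QB hc (hN.trans (min_le_right _ _)) τ hτ (hτh.trans (min_le_right _ _))
  refine (enOn_union_le S S' v).trans ((add_le_add t1 t2).trans ?_)
  have h1 := hc.QA_nonneg
  have h2 := hc.QB_nonneg
  rw [add_mul]
  have e1 : Real.exp (-(α * τ)) ≤ Real.exp (-(min α α' * τ)) :=
    Real.exp_le_exp.2 (neg_le_neg (mul_le_mul_of_nonneg_right (min_le_left _ _) hτ.le))
  have e2 : Real.exp (-(α' * τ)) ≤ Real.exp (-(min α α' * τ)) :=
    Real.exp_le_exp.2 (neg_le_neg (mul_le_mul_of_nonneg_right (min_le_right _ _) hτ.le))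
  have e3 : Real.exp (β * τ) ≤ Real.exp (max β β' * τ) :=
    Real.exp_le_exp.2 (mul_le_mul_of_nonneg_right (le_max_left _ _) hτ.le)
  have e4 : Real.exp (β' * τ) ≤ Real.exp (max β β' * τ) :=
    Real.exp_le_exp.2 (mul_le_mul_of_nonneg_right (le_max_right _ _) hτ.le)
  gcongr

/-- A propagation estimate transfers smallness from `S` to `S'`. -/
theorem Good.of_propagate (h : Good d M V B S) {C' A b τ₀ ε' h₀' : ℝ} (hC' : 0 < C') (hA : 0 < A)
    (hb : 0 < b) (hε' : 0 < ε') (hh₀' : 0 < h₀')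
    (H' : ∀ (N : ℕ) (a : Fin d → Torus d N → ℝ) (v F : Torus d N → ℝ) (QA QB : ℝ),
      Config d N M V B a v F QA QB → meshSize N ≤ h₀' → ∀ τ : ℝ, τ₀ ≤ τ → τ * meshSize N ≤ ε' →
      enOn S' v ≤ C' * (Real.exp (A * τ) * (QB + enOn S v) + Real.exp (-(b * τ)) * QA)) :
    Good d M V B S' := by
  obtain ⟨h₀, ε, C, α, β, p1, p2, p3, p4, p5, H⟩ := h
  -- The known estimate is used at `τ`, the propagation estimate at `κ τ`. Then the loss `e^{A κ τ}`
  -- is at most `e^{α τ / 2}`, and half of the decay `e^{-α τ}` survives.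
  set κ := min 1 (α / (2 * A)) with hκ
  have hκ0 : 0 < κ := lt_min one_pos (by positivity)
  have hκ1 : κ ≤ 1 := min_le_left _ _
  have hκA : A * κ ≤ α / 2 := by
    calc A * κ ≤ A * (α / (2 * A)) := by gcongr; exact min_le_right _ _
      _ = α / 2 := by field_simp
  set α' := min (α / 2) (b * κ) with hα'
  have hα0 : 0 < α' := lt_min (by positivity) (by positivity)
  refine ⟨min h₀ h₀', min ε ε', C' * (1 + C) + Real.exp (α' * (τ₀ / κ)), α', α / 2 + β,
    lt_min p1 hh₀', lt_min p2 hε', by positivity, hα0, by positivity,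
    fun N a v F QA QB hc hN τ hτ hτh => ?_⟩
  have h1 := hc.QA_nonneg
  have h2 := hc.QB_nonneg
  have hh := meshSize_pos N
  rw [add_mul]
  by_cases hcase : τ₀ ≤ κ * τ
  · have t1 := H N a v F QA QB hc (hN.trans (min_le_left _ _)) τ hτ (hτh.trans (min_le_left _ _))
    have t2 := H' N a v F QA QB hc (hN.trans (min_le_right _ _)) (κ * τ) hcase (by
      refine le_trans ?_ (hτh.trans (min_le_right _ _))
      gcongr
      exact mul_le_of_le_one_left hτ.le hκ1)
    have e1 : Real.exp (A * (κ * τ)) ≤ Real.exp (α / 2 * τ) := by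
      refine Real.exp_le_exp.2 ?_
      rw [← mul_assoc]; gcongr
    have e2 : Real.exp (-(b * (κ * τ))) ≤ Real.exp (-(α' * τ)) := by
      refine Real.exp_le_exp.2 (neg_le_neg ?_)
      rw [← mul_assoc]; gcongr; exact min_le_right _ _
    have e3 : Real.exp (α / 2 * τ) * Real.exp (-(α * τ)) ≤ Real.exp (-(α' * τ)) := by
      rw [← Real.exp_add]
      refine Real.exp_le_exp.2 ?_
      have : α' * τ ≤ α / 2 * τ := by gcongr; exact min_le_left _ _
      linarith
    have e4 : Real.exp (α / 2 * τ) ≤ Real.exp ((α / 2 + β) * τ) := by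
      refine Real.exp_le_exp.2 ?_
      gcongr; linarith
    have e5 : Real.exp (α / 2 * τ) * Real.exp (β * τ) = Real.exp ((α / 2 + β) * τ) := by
      rw [← Real.exp_add, add_mul]
    have h0 := enOn_nonneg S v
    have key : Real.exp (A * (κ * τ)) * (QB + enOn S v) + Real.exp (-(b * (κ * τ))) * QA ≤
        (1 + C) * (Real.exp (-(α' * τ)) * QA + Real.exp ((α / 2 + β) * τ) * QB) := by
      calc _ ≤ Real.exp (α / 2 * τ) * (QB +
            C * (Real.exp (-(α * τ)) * QA + Real.exp (β * τ) * QB)) +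
            Real.exp (-(α' * τ)) * QA := by gcongr
        _ = Real.exp (α / 2 * τ) * QB + C * ((Real.exp (α / 2 * τ) * Real.exp (-(α * τ))) * QA +
            (Real.exp (α / 2 * τ) * Real.exp (β * τ)) * QB) + Real.exp (-(α' * τ)) * QA := by ring
        _ ≤ Real.exp ((α / 2 + β) * τ) * QB + C * (Real.exp (-(α' * τ)) * QA +
            Real.exp ((α / 2 + β) * τ) * QB) + Real.exp (-(α' * τ)) * QA := by
          rw [e5]; gcongr
        _ = _ := by ring
    refine t2.trans ((mul_le_mul_of_nonneg_left key hC'.le).trans ?_)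
    rw [← mul_assoc]
    refine le_add_of_nonneg_right (by positivity)
  -- For `τ` below `τ₀ / κ` propagation is not available, but the total energy is a sufficient
  -- bound: the decay factor is bounded below there, and its reciprocal goes into the constant.
  · have t1 := (enOn_le S' v).trans hc.energy
    refine t1.trans ?_
    have e1 : 1 ≤ Real.exp (α' * (τ₀ / κ)) * Real.exp (-(α' * τ)) := by
      rw [← Real.exp_add]
      refine Real.one_le_exp ?_
      have : τ ≤ τ₀ / κ := by rw [le_div_iff₀ hκ0]; linarith
      have : α' * τ ≤ α' * (τ₀ / κ) := by gcongr
      linarith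
    have e2 : 1 * QA ≤ Real.exp (α' * (τ₀ / κ)) * Real.exp (-(α' * τ)) * QA := by gcongr
    have e3 : 0 ≤ C' * (1 + C) * (Real.exp (-(α' * τ)) * QA + Real.exp ((α / 2 + β) * τ) * QB) := by
      positivity
    have e4 : 0 ≤ Real.exp (α' * (τ₀ / κ)) * (Real.exp ((α / 2 + β) * τ) * QB) := by positivity
    linarith

end Good

/-! ### Growing concentric balls -/

section Ball

variable {d : ℕ} {M : ℝ} {V B : Set (Fin d → ℝ)}

/-- The open Euclidean ball of squared radius `s`. -/
def eball (y : Fin d → ℝ) (s : ℝ) : Set (Fin d → ℝ) := {x | ∑ k, (x k - y k) ^ 2 < s}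

/-- Points of `V` stay away from the edge of the fundamental domain, so steps from the layer never
wrap around, and coordinate differences in `V` are at most `2`. The layer also avoids the centre:
`|x-y|² ≥ s - 1/(2λ) ≥ s₁/2`, which gives `κ = 4/3 s₁` and keeps the weight free of critical points.
-/
theorem Config.sphereLayer {N : ℕ} {a : Fin d → Torus d N → ℝ} {v F : Torus d N → ℝ} {QA QB : ℝ}
    (H : Config d N M V B a v F QA QB) (hV : ∀ x ∈ V, ∀ k, -(1 / 2) < x k ∧ x k < 3 / 2)
    (hN : meshSize N ≤ 1 / 4) {y : Fin d → ℝ} (hy : y ∈ V) {s s₁ lam : ℝ} (hlam : 0 < lam)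
    (hls : 1 / lam ≤ s₁) (hs : s₁ ≤ s) (hball : ∀ x, ∑ k, (x k - y k) ^ 2 ≤ s + 1 / (2 * lam) → x ∈ V) :
    SphereLayer (te d N) (meshSize N) 2 lam s (4 / 3 * s₁) a (fun n k => pos N n k - y k)
      {n | |lam * psi s (fun k => pos N n k - y k)| ≤ 1 / 2} := by
  have hψ : ∀ n : Torus d N, |lam * psi s (fun k => pos N n k - y k)| ≤ 1 / 2 →
      |psi s (fun k => pos N n k - y k)| ≤ 1 / (2 * lam) := by
    intro n hn
    rw [abs_mul, abs_of_pos hlam] at hn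
    rw [le_div_iff₀ (by positivity)]
    linarith
  have hmem : ∀ n : Torus d N, |lam * psi s (fun k => pos N n k - y k)| ≤ 1 / 2 →
      pos N n ∈ V := by
    intro n hn
    refine hball _ ?_
    have := (abs_le.1 (hψ n hn)).1
    rw [psi] at this
    linarith
  have hadd : ∀ n : Torus d N, |lam * psi s (fun k => pos N n k - y k)| ≤ 1 / 2 → ∀ l,
      (n l).val + 1 < 3 * N + 3 := fun n hn l =>
    val_add_one_lt_of_pos_lt (by linarith [(hV _ (hmem n hn) l).2])
  have hsub : ∀ n : Torus d N, |lam * psi s (fun k => pos N n k - y k)| ≤ 1 / 2 → ∀ l,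
      1 ≤ (n l).val := fun n hn l =>
    one_le_val_of_lt_pos (by linarith [(hV _ (hmem n hn) l).1])
  refine ⟨H.coeff, fun n hn k l => H.coeff_add k l n (hadd n hn l), fun n hn k => ?_,
    fun n hn l => ?_, fun n hn l => ?_, fun n hn k => ?_, fun n hn => hn, fun n hn => ?_⟩
  · have := H.coeff_add k k (n - te d N k) (by
      rw [sub_te_val n k (hsub n hn k)]
      have := hadd n hn k
      simp; omega)
    rw [sub_add_cancel, abs_sub_comm] at this
    exact this
  · funext k
    simp only [pos_add n l (hadd n hn l), step]; ring
  · funext k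
    simp only [pos_sub n l (hsub n hn l), step]; ring
  · have h1 := hV _ (hmem n hn) k
    have h2 := hV _ hy k
    rw [abs_le]; constructor <;> linarith [h1.1, h1.2, h2.1, h2.2]
  · have := (abs_le.1 (hψ n hn)).2
    have h2 : 1 / (2 * lam) = 1 / lam / 2 := by field_simp
    rw [psi] at this
    linarith

theorem enOn_eball_le {N : ℕ} {y : Fin d → ℝ} {s lam : ℝ} (hlam : 0 < lam) (v : Torus d N → ℝ) :
    enOn (eball y (s + 1 / (8 * lam))) v ≤ enOn (eball y s) v +
      ∑ n, {n | -(1 / 8) < lam * psi s (fun k => pos N n k - y k) ∧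
        psi s (fun k => pos N n k - y k) ≤ 0}.indicator (en (meshSize N) (te d N) v) n := by
  rw [enOn, enOn, ← Finset.sum_add_distrib]
  refine Finset.sum_le_sum fun n _ => ?_
  have i0 : ∀ T : Set (Torus d N), 0 ≤ T.indicator (en (meshSize N) (te d N) v) n := fun T =>
    Set.indicator_nonneg (fun n _ => en_nonneg _ _ _ n) n
  by_cases h1 : pos N n ∈ eball y (s + 1 / (8 * lam))
  · rw [Set.indicator_of_mem (show n ∈ {n | pos N n ∈ eball y (s + 1 / (8 * lam))} from h1)]
    by_cases h2 : pos N n ∈ eball y s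
    · rw [Set.indicator_of_mem (show n ∈ {n | pos N n ∈ eball y s} from h2)]
      exact le_add_of_nonneg_right (i0 _)
    · rw [Set.indicator_of_mem (s := {n | -(1 / 8) < lam * psi s (fun k => pos N n k - y k) ∧
        psi s (fun k => pos N n k - y k) ≤ 0})]
      · exact le_add_of_nonneg_left (i0 _)
      · simp only [eball, Set.mem_ofPred_eq, not_lt] at h1 h2
        simp only [Set.mem_ofPred_eq, psi]
        refine ⟨?_, by linarith⟩
        have h3 : -(1 / (8 * lam)) < s - ∑ k, (pos N n k - y k) ^ 2 := by linarith
        have h4 := mul_lt_mul_of_pos_left h3 hlam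
        rw [show lam * -(1 / (8 * lam)) = -(1 / 8) by field_simp] at h4
        exact h4
  · rw [Set.indicator_of_notMem (show n ∉ {n | pos N n ∈ eball y (s + 1 / (8 * lam))} from h1)]
    exact add_nonneg (i0 _) (i0 _)

theorem Config.propagate {N : ℕ} {a : Fin d → Torus d N → ℝ} {v F : Torus d N → ℝ} {QA QB : ℝ}
    (hc : Config d N M V B a v F QA QB) (hV : ∀ x ∈ V, ∀ k, -(1 / 2) < x k ∧ x k < 3 / 2)
    {f f' : ℝ → ℝ} {L s s₁ lam τ ζ : ℝ} {y : Fin d → ℝ} (Fc : Cutoff f f' L) (hy : y ∈ V)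
    (hlam : 0 < lam) (hs₁ : 0 < s₁) (hls : 1 / lam ≤ s₁) (hs : s₁ ≤ s)
    (hball : ∀ x, ∑ k, (x k - y k) ^ 2 ≤ s + 1 / (2 * lam) → x ∈ V)
    (hlam1 : 64 / 3 + 54 * d * 2 + 4 ≤ 4 / 3 * lam * (4 / 3 * s₁))
    (hlam2 : 144 * d ^ 2 * 2 ^ 3 + 192 * d * 2 ^ 2 + 96 * d ^ 2 * 2 ^ 2 + 4 ≤
      lam * (4 / 3 * s₁) ^ 2 / 2)
    (hN : meshSize N ≤ 1 / 4) (hN' : meshSize N ≤ 1 / (96 * lam)) (hζ1 : ζ ≤ 1)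
    (hζ : 2000 * (d + 1) ^ 2 * carlConst d lam 2 (4 / 3 * s₁) ^ 4 * ζ ≤ 1)
    (hζw : wconst lam 2 * ζ ≤ 1) (hτ1 : 1 ≤ τ) (hτζ : 1 ≤ τ * ζ) (hτh : τ * meshSize N ≤ ζ)
    (hτM : 18 * M ^ 2 ≤ τ) :
    enOn (eball y (s + 1 / (8 * lam))) v ≤ (1 + layerConst d L lam 2) *
      (Real.exp (4 / lam * τ) * (QB + enOn (eball y s) v) +
        Real.exp (-(1 / (10 * lam) * τ)) * QA) := by
  have hH := hc.sphereLayer hV hN hy hlam hls hs hball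
  have hw0 : 0 < wconst lam 2 := by unfold wconst; positivity
  have hX : 3 * lam * 2 * meshSize N ≤ 1 / 16 := by
    rw [le_div_iff₀ (by positivity)] at hN'
    linarith
  have hB : wconst lam 2 * (τ * meshSize N) ≤ 1 := by
    refine le_trans ?_ hζw; gcongr
  have heq : ∀ n, |lam * psi s (fun k => pos N n k - y k)| ≤ 1 / 2 →
      |ellip (te d N) a v n| ≤ meshSize N ^ 2 * (M * |v n| + |F n|) := by
    intro n hn
    refine hc.eqn n (hball _ ?_)
    rw [abs_mul, abs_of_pos hlam] at hn
    have h1 : |psi s (fun k => pos N n k - y k)| ≤ 1 / (2 * lam) := by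
      rw [le_div_iff₀ (by positivity)]
      linarith
    have := (abs_le.1 h1).1
    rw [psi] at this
    linarith
  have hI : ∑ n, {n | 0 < psi s (fun k => pos N n k - y k)}.indicator
      (en (meshSize N) (te d N) v) n ≤ enOn (eball y s) v := by
    refine le_of_eq ?_
    have : {n : Torus d N | 0 < psi s (fun k => pos N n k - y k)} = {n | pos N n ∈ eball y s} := by
      ext m; simp [psi, eball]
    rw [enOn, this]
  have hprop := hH.propagate Fc (by norm_num) hlam (by positivity) hlam1 hlam2
    (meshSize_pos N) (meshSize_le_one N) hX hζ1 hζ hτ1 hτζ hτh hB hτM heq hc.energy hc.source hI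
  refine (enOn_eball_le hlam v).trans ((add_le_add_right hprop _).trans ?_)
  have h1 := hc.QA_nonneg
  have h2 := hc.QB_nonneg
  have h3 := enOn_nonneg (eball y s) v
  have h4 : 1 ≤ Real.exp (4 / lam * τ) := Real.one_le_exp (by positivity)
  have h5 : 1 * enOn (eball y s) v ≤ Real.exp (4 / lam * τ) * enOn (eball y s) v := by gcongr
  have h6 : 0 ≤ Real.exp (4 / lam * τ) * QB := by positivity
  have h7 : 0 ≤ Real.exp (-(1 / (10 * lam) * τ)) * QA := by positivity
  rw [add_mul]
  linarith

/-- The Carleman step: smallness in a ball spreads to a slightly larger concentric ball. -/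
theorem exists_good_step (hV : ∀ x ∈ V, ∀ k, -(1 / 2) < x k ∧ x k < 3 / 2)
    {s₁ η : ℝ} (hs₁ : 0 < s₁) (hη : 0 < η) :
    ∃ c, 0 < c ∧ c ≤ η ∧ ∀ y ∈ V, ∀ s, s₁ ≤ s →
      (∀ x, ∑ k, (x k - y k) ^ 2 ≤ s + 4 * c → x ∈ V) →
      Good d M V B (eball y s) → Good d M V B (eball y (s + c)) := by
  obtain ⟨f, f', L, Fc⟩ := exists_cutoff
  -- All constraints on `λ` are lower bounds depending only on `d`, `s₁` and `η`. Hence the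
  -- increment of the squared radius is uniform in the centre and in the current radius.
  obtain ⟨lam, hlam0, hls, hlη, hlam1, hlam2⟩ : ∃ lam : ℝ, 0 < lam ∧ 1 / lam ≤ s₁ ∧
      1 / (8 * lam) ≤ η ∧ 64 / 3 + 54 * d * 2 + 4 ≤ 4 / 3 * lam * (4 / 3 * s₁) ∧
      144 * d ^ 2 * 2 ^ 3 + 192 * d * 2 ^ 2 + 96 * d ^ 2 * 2 ^ 2 + 4 ≤
        lam * (4 / 3 * s₁) ^ 2 / 2 := by
    have t1 := (Filter.tendsto_id (α := ℝ) (x := Filter.atTop)).atTop_mul_const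
      (show 0 < 4 / 3 * (4 / 3 * s₁) by positivity)
    have t2 := (Filter.tendsto_id (α := ℝ) (x := Filter.atTop)).atTop_mul_const
      (show 0 < (4 / 3 * s₁) ^ 2 / 2 by positivity)
    obtain ⟨lam, h0, h1, h2, h3, h4⟩ := ((Filter.eventually_gt_atTop (0 : ℝ)).and
      ((Filter.eventually_ge_atTop (1 / s₁)).and ((Filter.eventually_ge_atTop (1 / (8 * η))).and
      ((t1.eventually_ge_atTop _).and (t2.eventually_ge_atTop _))))).exists
    refine ⟨lam, h0, ?_, ?_, h3.trans (le_of_eq ?_), h4.trans (le_of_eq ?_)⟩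
    · rw [div_le_comm₀ h0 hs₁]; exact h1
    · rw [div_le_iff₀ (by positivity)] at h2 ⊢
      linarith
    · simp only [id]; ring
    · simp only [id]; ring
  refine ⟨1 / (8 * lam), by positivity, hlη, fun y hy s hs hball hgood => ?_⟩
  have h4c : 4 * (1 / (8 * lam)) = 1 / (2 * lam) := by field_simp; norm_num
  rw [h4c] at hball
  have hw0 : 0 < wconst lam 2 := by unfold wconst; positivity
  obtain ⟨ζ, hζ0, hζ1, hζK, hζw⟩ : ∃ ζ : ℝ, 0 < ζ ∧ ζ ≤ 1 ∧
      2000 * ((d : ℝ) + 1) ^ 2 * carlConst d lam 2 (4 / 3 * s₁) ^ 4 * ζ ≤ 1 ∧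
      wconst lam 2 * ζ ≤ 1 := by
    have hK0 : 0 ≤ 2000 * ((d : ℝ) + 1) ^ 2 * carlConst d lam 2 (4 / 3 * s₁) ^ 4 := by positivity
    generalize 2000 * ((d : ℝ) + 1) ^ 2 * carlConst d lam 2 (4 / 3 * s₁) ^ 4 = K at hK0
    have hden : 0 < 1 + K + wconst lam 2 := by linarith
    refine ⟨1 / (1 + K + wconst lam 2), by positivity, ?_, ?_, ?_⟩
    · rw [div_le_one hden]; linarith
    · rw [mul_one_div, div_le_one hden]; linarith
    · rw [mul_one_div, div_le_one hden]; linarith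
  have hLay : 0 < layerConst d L lam 2 := by unfold layerConst; positivity
  -- The threshold `τ₀` combines `τ ζ ≥ 1`, which includes `τ ≥ 1`, with the absorption of the
  -- potential. The bound `1/(96 λ)` on the mesh size is `3 λ · 2 · h ≤ 1/16`.
  refine hgood.of_propagate (C' := 1 + layerConst d L lam 2) (A := 4 / lam) (b := 1 / (10 * lam))
    (τ₀ := 1 / ζ + 18 * M ^ 2) (ε' := ζ) (h₀' := min (1 / 4) (1 / (96 * lam)))
    (by positivity) (by positivity) (by positivity) hζ0
    (lt_min (by norm_num) (by positivity)) fun N a v F QA QB hc hN τ hτ hτh => ?_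
  have hζi : 1 / ζ ≤ τ := by linarith only [hτ, sq_nonneg M]
  have hτζ : 1 ≤ τ * ζ := by rwa [div_le_iff₀ hζ0] at hζi
  have hτ1 : 1 ≤ τ := by
    have : 1 ≤ 1 / ζ := by rw [le_div_iff₀ hζ0]; linarith
    linarith
  have hτM : 18 * M ^ 2 ≤ τ := by
    have : 0 < 1 / ζ := by positivity
    linarith
  exact hc.propagate hV Fc hy hlam0 hs₁ hls hs hball hlam1 hlam2 (hN.trans (min_le_left _ _))
    (hN.trans (min_le_right _ _)) hζ1 hζK hζw hτ1 hτζ hτh hτM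

/-- Smallness in a ball spreads to any larger concentric ball well inside the region. -/
theorem Good.ball (hV : ∀ x ∈ V, ∀ k, -(1 / 2) < x k ∧ x k < 3 / 2)
    {s₁ s₂ s₃ : ℝ} (hs₁ : 0 < s₁) (hs : s₂ < s₃) {y : Fin d → ℝ}
    (hball : eball y s₃ ⊆ V) (h : Good d M V B (eball y s₁)) : Good d M V B (eball y s₂) := by
  rcases le_or_gt s₂ s₁ with hle | hlt
  · exact h.mono fun x hx => lt_of_lt_of_le hx hle
  have hy : y ∈ V := hball (by simp [eball]; linarith)
  -- Every step starts from a squared radius at most `s₂` and needs room `4 c`, which `c ≤ (s₃ -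
  -- s₂)/6` provides.
  obtain ⟨c, hc0, hc, H⟩ := exists_good_step (M := M) (B := B) hV hs₁
    (show 0 < (s₃ - s₂) / 6 by linarith)
  have hind : ∀ j : ℕ, s₁ + j * c ≤ s₂ + c → Good d M V B (eball y (s₁ + j * c)) := by
    intro j
    induction j with
    | zero => intro _; simpa using h
    | succ j ih =>
      intro hj
      push_cast at hj ⊢
      rw [show s₁ + (j + 1) * c = s₁ + j * c + c by ring] at hj ⊢
      refine H y hy _ ?_ (fun x hx => hball ?_) (ih (by linarith))
      · have : 0 ≤ (j : ℝ) * c := by positivity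
        linarith
      · change ∑ k, (x k - y k) ^ 2 < s₃
        linarith
  obtain ⟨j, hj1, hj2⟩ : ∃ j : ℕ, s₂ ≤ s₁ + j * c ∧ s₁ + j * c ≤ s₂ + c := by
    refine ⟨⌈(s₂ - s₁) / c⌉₊, ?_, ?_⟩
    · have := Nat.le_ceil ((s₂ - s₁) / c)
      rw [div_le_iff₀ hc0] at this; linarith
    · have := Nat.ceil_lt_add_one (a := (s₂ - s₁) / c) (by
        apply div_nonneg <;> linarith)
      have h2 := mul_le_mul_of_nonneg_right this.le hc0.le
      rw [add_mul, div_mul_cancel₀ _ hc0.ne'] at h2; linarith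
  exact (hind j hj2).mono fun x hx => lt_of_lt_of_le hx hj1

end Ball

/-! ### From one ball to compact sets in a connected region -/

section Chain

variable {d : ℕ} {M : ℝ} {V B : Set (Fin d → ℝ)}

theorem mem_eball_self (y : Fin d → ℝ) {s : ℝ} (hs : 0 < s) : y ∈ eball y s := by
  simpa [eball] using hs

theorem eball_mono (y : Fin d → ℝ) {s t : ℝ} (h : s ≤ t) : eball y s ⊆ eball y t :=
  fun _ hx => lt_of_lt_of_le hx h

theorem mem_eball_comm {x y : Fin d → ℝ} {s : ℝ} : x ∈ eball y s ↔ y ∈ eball x s := by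
  have : ∑ k, (x k - y k) ^ 2 = ∑ k, (y k - x k) ^ 2 :=
    Finset.sum_congr rfl fun k _ => by ring
  change ∑ k, (x k - y k) ^ 2 < s ↔ ∑ k, (y k - x k) ^ 2 < s
  rw [this]

/-- Radii are squared, so the triangle inequality takes the form `(a + b)² ≤ 2 a² + 2 b²`. -/
theorem mem_eball_trans {x y z : Fin d → ℝ} {s t : ℝ} (hz : z ∈ eball y s) (hx : x ∈ eball z t) :
    x ∈ eball y (2 * s + 2 * t) := by
  change ∑ k, (z k - y k) ^ 2 < s at hz
  change ∑ k, (x k - z k) ^ 2 < t at hx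
  change ∑ k, (x k - y k) ^ 2 < 2 * s + 2 * t
  have : ∑ k, (x k - y k) ^ 2 ≤ ∑ k, (2 * (z k - y k) ^ 2 + 2 * (x k - z k) ^ 2) :=
    Finset.sum_le_sum fun k _ => by nlinarith [sq_nonneg ((x k - z k) - (z k - y k))]
  rw [Finset.sum_add_distrib, ← Finset.mul_sum, ← Finset.mul_sum] at this
  linarith

theorem isOpen_eball (y : Fin d → ℝ) (s : ℝ) : IsOpen (eball y s) :=
  isOpen_lt (by fun_prop) continuous_const

theorem abs_lt_of_mem_eball {x y : Fin d → ℝ} {r : ℝ} (hr : 0 < r) (hx : x ∈ eball y (r ^ 2))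
    (k : Fin d) : |x k - y k| < r := by
  have h1 : (x k - y k) ^ 2 ≤ ∑ k, (x k - y k) ^ 2 :=
    Finset.single_le_sum (f := fun k => (x k - y k) ^ 2) (fun _ _ => sq_nonneg _)
      (Finset.mem_univ k)
  exact abs_lt_of_sq_lt_sq (lt_of_le_of_lt h1 hx) hr.le

theorem exists_eball_subset {W : Set (Fin d → ℝ)} (hW : IsOpen W) {y : Fin d → ℝ} (hy : y ∈ W) :
    ∃ s, 0 < s ∧ eball y s ⊆ W := by
  obtain ⟨ε, hε, hsub⟩ := Metric.isOpen_iff.1 hW y hy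
  refine ⟨ε ^ 2, by positivity, fun x hx => hsub ?_⟩
  rw [Metric.mem_ball, dist_pi_lt_iff hε]
  intro k
  rw [Real.dist_eq]
  exact abs_lt_of_mem_eball hε hx k

/-- The centres of good balls form an open set. It is relatively closed in `V`: a good ball near a
limit point may be tiny, but `Good.ball` enlarges it to a size dictated only by the room around that
limit point, so that it covers the limit point. Connectedness concludes. -/
theorem good_nhds_of_isPreconnected (hV : ∀ x ∈ V, ∀ k, -(1 / 2) < x k ∧ x k < 3 / 2)
    (hVo : IsOpen V) (hVc : IsPreconnected V) {y₀ : Fin d → ℝ} (hy₀ : y₀ ∈ V) {s₀ : ℝ}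
    (hs₀ : 0 < s₀) (h₀ : Good d M V B (eball y₀ s₀)) {y : Fin d → ℝ} (hy : y ∈ V) :
    ∃ s, 0 < s ∧ Good d M V B (eball y s) := by
  set U : Set (Fin d → ℝ) := {y | ∃ s, 0 < s ∧ Good d M V B (eball y s)} with hU
  have hUo : IsOpen U := by
    rw [isOpen_iff_mem_nhds]
    rintro z ⟨s, hs, hg⟩
    refine Filter.mem_of_superset ((isOpen_eball z (s / 4)).mem_nhds
      (mem_eball_self z (by linarith))) fun x hx => ⟨s / 4, by linarith, hg.mono fun w hw => ?_⟩
    have := mem_eball_trans hx hw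
    rwa [show 2 * (s / 4) + 2 * (s / 4) = s by ring] at this
  refine hVc.subset_of_closure_inter_subset hUo ⟨y₀, hy₀, s₀, hs₀, h₀⟩ ?_ hy
  rintro z ⟨hz, hzV⟩
  obtain ⟨R, hR, hRV⟩ := exists_eball_subset hVo hzV
  obtain ⟨w, hw, s, hs, hg⟩ := mem_closure_iff.1 hz _ (isOpen_eball z (R / 64))
    (mem_eball_self z (by linarith))
  have hsub : eball w (R / 4) ⊆ V := fun x hx => hRV (eball_mono z (by linarith)
    (mem_eball_trans hw hx))
  -- Since `w` is within squared distance `R/64` of `z`, the ball of squared radius `R/4` about `w`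
  -- fits into that of squared radius `R` about `z`. Conversely, the one of squared radius `R/64`
  -- about `z` fits into `R/16 ≤ R/8` about `w`.
  refine ⟨R / 64, by linarith, (hg.ball hV hs (show R / 8 < R / 4 by linarith) hsub).mono
    fun x hx => eball_mono w (by linarith) (mem_eball_trans (mem_eball_comm.1 hw) hx)⟩

theorem good_empty : Good d M V B ∅ := by
  refine ⟨1, 1, 1, 1, 1, one_pos, one_pos, one_pos, one_pos, one_pos,
    fun N a v F QA QB hc _ τ hτ _ => ?_⟩
  have h1 := hc.QA_nonneg
  have h2 := hc.QB_nonneg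
  have : enOn (∅ : Set (Fin d → ℝ)) v = 0 := by simp [enOn, Set.indicator]
  rw [this]; positivity

/-- Unique continuation along a connected region, from a ball to a compact subset. -/
theorem good_of_isCompact (hV : ∀ x ∈ V, ∀ k, -(1 / 2) < x k ∧ x k < 3 / 2)
    (hVo : IsOpen V) (hVc : IsPreconnected V) {y₀ : Fin d → ℝ} (hy₀ : y₀ ∈ V ∩ interior B)
    {K : Set (Fin d → ℝ)} (hK : IsCompact K) (hKV : K ⊆ V) : Good d M V B K := by
  obtain ⟨s₀, hs₀, hsub⟩ := exists_eball_subset isOpen_interior hy₀.2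
  have h₀ : Good d M V B (eball y₀ s₀) := good_base.mono (hsub.trans interior_subset)
  refine hK.induction_on (p := Good d M V B) good_empty (fun s t hst ht => ht.mono hst)
    (fun s t hs ht => hs.union ht) fun x hx => ?_
  obtain ⟨s, hs, hg⟩ := good_nhds_of_isPreconnected hV hVo hVc hy₀.1 hs₀ h₀ (hKV hx)
  exact ⟨eball x s, mem_nhdsWithin_of_mem_nhds ((isOpen_eball x s).mem_nhds (mem_eball_self x hs)),
    hg⟩

end Chain

/-! ### The collar of the cube as a connected union of slabs -/

section Region

variable {d : ℕ}

/-- The part of the unit cube within distance `r` of the face `x_k = 0` or `x_k = 1`. -/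
def slab (d : ℕ) (r : ℝ) (i : Fin d × Bool) : Set (Fin d → ℝ) :=
  {x | (∀ k, 0 < x k ∧ x k < 1) ∧ if i.2 then 1 - x i.1 < r else x i.1 < r}

theorem isOpen_slab (r : ℝ) (i : Fin d × Bool) : IsOpen (slab d r i) := by
  refine IsOpen.inter (s := {x : Fin d → ℝ | ∀ k, 0 < x k ∧ x k < 1})
    (t := {x : Fin d → ℝ | if i.2 then 1 - x i.1 < r else x i.1 < r}) ?_ ?_
  · simp only [Set.ofPred_forall]
    refine isOpen_iInter_of_finite fun k => ?_
    exact (isOpen_lt continuous_const (continuous_apply k)).inter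
      (isOpen_lt (continuous_apply k) continuous_const)
  · cases i.2
    · exact isOpen_lt (continuous_apply i.1) continuous_const
    · exact isOpen_lt (continuous_const.sub (continuous_apply i.1)) continuous_const

theorem convex_slab (r : ℝ) (i : Fin d × Bool) : Convex ℝ (slab d r i) := by
  rintro x ⟨hx, hx'⟩ y ⟨hy, hy'⟩ s t hs ht hst
  have key : ∀ {p q c : ℝ}, p < c → q < c → s * p + t * q < c := by
    intro p q c hp hq
    have : c = s * c + t * c := by rw [← add_mul, hst, one_mul]
    rw [this]
    rcases eq_or_lt_of_le hs with h | h
    · have ht1 : t = 1 := by linarith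
      subst h; subst ht1; linarith
    · have := mul_lt_mul_of_pos_left hp h
      have := mul_le_mul_of_nonneg_left hq.le ht
      linarith
  refine ⟨fun k => ⟨?_, ?_⟩, ?_⟩
  · have := key (neg_lt_zero.2 (hx k).1) (neg_lt_zero.2 (hy k).1)
    simp only [Pi.add_apply, Pi.smul_apply, smul_eq_mul]
    linarith
  · simpa using key (hx k).2 (hy k).2
  · cases hi : i.2
    · simp only [hi, Bool.false_eq_true, if_false] at hx' hy' ⊢
      simpa using key hx' hy'
    · simp only [hi, if_true] at hx' hy' ⊢
      have := key hx' hy'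
      simp only [Pi.add_apply, Pi.smul_apply, smul_eq_mul]
      linarith

theorem slab_inter_nonempty {r : ℝ} (hr : 0 < r) {i j : Fin d × Bool} (hij : i.1 ≠ j.1) :
    (slab d r i ∩ slab d r j).Nonempty := by
  obtain ⟨t, ht0, ht1, htr⟩ : ∃ t : ℝ, 0 < t ∧ t < 1 ∧ t < r := by
    obtain ⟨t, h0, h1⟩ := exists_between (lt_min one_pos hr)
    exact ⟨t, h0, h1.trans_le (min_le_left _ _), h1.trans_le (min_le_right _ _)⟩
  set c : Bool → ℝ := fun b => if b then 1 - t else t with hc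
  have hc01 : ∀ b, 0 < c b ∧ c b < 1 := by
    intro b; cases b <;> simp [hc] <;> constructor <;> linarith
  refine ⟨fun k => if k = i.1 then c i.2 else c j.2, ⟨fun k => ?_, ?_⟩, ⟨fun k => ?_, ?_⟩⟩
  · dsimp only; split_ifs <;> exact hc01 _
  · cases hi : i.2 <;> simp [hc, htr]
  · dsimp only; split_ifs <;> exact hc01 _
  · simp only [hij.symm, if_false]
    cases hi : j.2 <;> simp [hc, htr]

/-- Each slab is convex, and slabs attached to different coordinates meet near a common edge. Slabs
at opposite faces are linked through a slab of another coordinate, which exists because `d ≥ 2`. -/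
theorem isPreconnected_iUnion_slab (hd : 2 ≤ d) {r : ℝ} (hr : 0 < r) :
    IsPreconnected (⋃ i, slab d r i) := by
  refine IsPreconnected.iUnion_of_reflTransGen (fun i => (convex_slab r i).isPreconnected) ?_
  intro i j
  by_cases hij : i.1 = j.1
  · have : Nontrivial (Fin d) := Fin.nontrivial_iff_two_le.2 hd
    obtain ⟨k, hk⟩ := exists_ne i.1
    refine .trans (.single (slab_inter_nonempty (j := (k, true)) hr hk.symm))
      (.single (slab_inter_nonempty hr ?_))
    rw [← hij]; exact hk
  · exact .single (slab_inter_nonempty hr hij)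

end Region

/-! ### Poincaré and trace inequalities on the periodic mesh -/

section Trace

variable {d N : ℕ}

theorem sq_le_mul_sum_sq_sub (φ : ℕ → ℝ) (h0 : φ 0 = 0) {v m : ℕ} (hv : v ≤ m) :
    φ v ^ 2 ≤ m * ∑ t ∈ Finset.range m, (φ (t + 1) - φ t) ^ 2 := by
  have h1 : φ v = ∑ t ∈ Finset.range v, (φ (t + 1) - φ t) := by
    rw [Finset.sum_range_sub, h0, sub_zero]
  rw [h1]
  refine (sq_sum_le_card_mul_sum_sq (s := Finset.range v)).trans ?_
  rw [Finset.card_range]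
  gcongr

/-- Telescoping from the hyperplane where `w` vanishes and Cauchy–Schwarz. Extending the sum to the
whole line makes the bound independent of the `j`-th coordinate of `n`. -/
theorem sq_le_mul_sum_line (j : Fin d) (w : Torus d N → ℝ) (hw : ∀ n, n j = 0 → w n = 0)
    (n : Torus d N) :
    w n ^ 2 ≤ (3 * N + 3 : ℕ) * ∑ t : ZMod (3 * N + 3),
      fd (te d N j) w (Function.update n j t) ^ 2 := by
  have h1 := sq_le_mul_sum_sq_sub (fun t : ℕ => w (Function.update n j (t : ZMod (3 * N + 3))))
    (hw _ (by simp)) (ZMod.val_lt (n j)).le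
  simp only [ZMod.natCast_val, ZMod.cast_id', id, Function.update_eq_self] at h1
  refine h1.trans (le_of_eq ?_)
  congr 1
  have h2 : ∀ t : ZMod (3 * N + 3), Function.update n j t + te d N j =
      Function.update n j (t + 1) := by
    intro t; funext k
    by_cases hk : k = j
    · subst hk; simp [te]
    · simp [te, hk]
  simp only [fd, h2]
  refine Finset.sum_bij (fun t _ => (t : ZMod (3 * N + 3))) (fun _ _ => Finset.mem_univ _) ?_ ?_ ?_
  · intro a ha b hb hab
    have := congrArg ZMod.val hab
    rwa [ZMod.val_natCast_of_lt (Finset.mem_range.1 ha),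
      ZMod.val_natCast_of_lt (Finset.mem_range.1 hb)] at this
  · intro b _
    exact ⟨b.val, Finset.mem_range.2 (ZMod.val_lt b), by simp⟩
  · intro a _
    simp

theorem sum_eq_sum_split {β : Type*} [Fintype β] (j : Fin d) (H : (Fin d → β) → ℝ) :
    ∑ n, H n = ∑ z : {k // k ≠ j} → β, ∑ c, H ((Equiv.funSplitAt j β).symm (c, z)) := by
  rw [← (Equiv.funSplitAt j β).symm.sum_comp, Fintype.sum_prod_type_right]

theorem update_funSplitAt_symm {β : Type*} (j : Fin d) (c t : β) (z : {k // k ≠ j} → β) :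
    Function.update ((Equiv.funSplitAt j β).symm (c, z)) j t =
      (Equiv.funSplitAt j β).symm (t, z) := by
  funext k
  by_cases hk : k = j
  · subst hk; simp
  · simp [hk]

theorem sum_sum_update {β : Type*} [Fintype β] (j : Fin d) (F : (Fin d → β) → ℝ) :
    ∑ n, ∑ t, F (Function.update n j t) = Fintype.card β * ∑ n, F n := by
  rw [sum_eq_sum_split j, sum_eq_sum_split j F]
  simp only [update_funSplitAt_symm, Finset.sum_const, Finset.card_univ, nsmul_eq_mul,
    Finset.mul_sum]

/-- A hyperplane meets each line in direction `j` exactly once, so lines are not counted repeatedly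
as in `sum_sum_update`. The missing cardinality is the factor `1/h` that separates trace from volume
norms. -/
theorem sum_indicator_sum_update {β : Type*} [Fintype β] (j : Fin d) (c : β)
    (F : (Fin d → β) → ℝ) :
    ∑ n, {n : Fin d → β | n j = c}.indicator (fun n => ∑ t, F (Function.update n j t)) n =
      ∑ n, F n := by
  classical
  rw [sum_eq_sum_split j, sum_eq_sum_split j F]
  refine Finset.sum_congr rfl fun z _ => ?_
  simp only [Set.indicator, update_funSplitAt_symm, Set.mem_ofPred_eq]
  rw [Finset.sum_eq_single c]
  · simp
  · intro b _ hb
    simp [hb]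
  · simp

theorem meshSize_mul_card (N : ℕ) : meshSize N * ((3 * N + 3 : ℕ) : ℝ) = 3 := by
  have := meshSize_mul N
  push_cast; linarith

/-- The Poincaré inequality. -/
theorem meshSize_sq_mul_sum_sq_le (j : Fin d) (w : Torus d N → ℝ) (hw : ∀ n, n j = 0 → w n = 0) :
    meshSize N ^ 2 * ∑ n, w n ^ 2 ≤ 9 * gradSq (te d N) w := by
  have h1 : ∑ n, w n ^ 2 ≤ ∑ n, ((3 * N + 3 : ℕ) : ℝ) * ∑ t : ZMod (3 * N + 3),
      fd (te d N j) w (Function.update n j t) ^ 2 :=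
    Finset.sum_le_sum fun n _ => sq_le_mul_sum_line j w hw n
  rw [← Finset.mul_sum, sum_sum_update j (fun n => fd (te d N j) w n ^ 2), ZMod.card] at h1
  have h2 : ∑ n, fd (te d N j) w n ^ 2 ≤ gradSq (te d N) w :=
    Finset.sum_le_sum fun n _ => Finset.single_le_sum (f := fun k => fd (te d N k) w n ^ 2)
      (fun _ _ => sq_nonneg _) (Finset.mem_univ j)
  have h0 : (0 : ℝ) ≤ ((3 * N + 3 : ℕ) : ℝ) := Nat.cast_nonneg _
  calc meshSize N ^ 2 * ∑ n, w n ^ 2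
      ≤ meshSize N ^ 2 * (((3 * N + 3 : ℕ) : ℝ) * (((3 * N + 3 : ℕ) : ℝ) * gradSq (te d N) w)) := by
        gcongr; exact h1.trans (by gcongr)
    _ = (meshSize N * ((3 * N + 3 : ℕ) : ℝ)) ^ 2 * gradSq (te d N) w := by ring
    _ = _ := by rw [meshSize_mul_card]; ring

/-- The trace inequality. -/
theorem meshSize_mul_sum_trace_le (j : Fin d) (c : ZMod (3 * N + 3)) (w : Torus d N → ℝ)
    (hw : ∀ n, n j = 0 → w n = 0) :
    meshSize N * ∑ n, {n : Torus d N | n j = c}.indicator (fun n => w n ^ 2) n ≤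
      3 * gradSq (te d N) w := by
  have h1 : ∑ n, {n : Torus d N | n j = c}.indicator (fun n => w n ^ 2) n ≤
      ∑ n, ((3 * N + 3 : ℕ) : ℝ) * {n : Torus d N | n j = c}.indicator (fun n =>
        ∑ t : ZMod (3 * N + 3), fd (te d N j) w (Function.update n j t) ^ 2) n := by
    refine Finset.sum_le_sum fun n _ => ?_
    by_cases hn : n j = c
    · rw [Set.indicator_of_mem (show n ∈ {n : Torus d N | n j = c} from hn),
        Set.indicator_of_mem (show n ∈ {n : Torus d N | n j = c} from hn)]
      exact sq_le_mul_sum_line j w hw n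
    · rw [Set.indicator_of_notMem (show n ∉ {n : Torus d N | n j = c} from hn),
        Set.indicator_of_notMem (show n ∉ {n : Torus d N | n j = c} from hn), mul_zero]
  rw [← Finset.mul_sum, sum_indicator_sum_update j c (fun n => fd (te d N j) w n ^ 2)] at h1
  have h2 : ∑ n, fd (te d N j) w n ^ 2 ≤ gradSq (te d N) w :=
    Finset.sum_le_sum fun n _ => Finset.single_le_sum (f := fun k => fd (te d N k) w n ^ 2)
      (fun _ _ => sq_nonneg _) (Finset.mem_univ j)
  have hh := meshSize_pos N
  calc meshSize N * _ ≤ meshSize N * (((3 * N + 3 : ℕ) : ℝ) * gradSq (te d N) w) := by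
        gcongr; exact h1.trans (by gcongr)
    _ = (meshSize N * ((3 * N + 3 : ℕ) : ℝ)) * gradSq (te d N) w := by ring
    _ = _ := by rw [meshSize_mul_card]

end Trace

/-! ### Solving away a source on a hyperplane -/

section Lift

theorem sum_mul_ellip {G : Type*} [Fintype G] [AddCommGroup G] {d : ℕ} (e : Fin d → G)
    (a : Fin d → G → ℝ) (w : G → ℝ) :
    ∑ n, w n * ellip e a w n = -∑ k, ∑ n, a k n * fd (e k) w n ^ 2 := by
  simp only [ellip, Finset.mul_sum]
  rw [Finset.sum_comm, ← Finset.sum_neg_distrib]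
  refine Finset.sum_congr rfl fun k _ => ?_
  have := sum_by_parts (e k) w (fun n => a k n * fd (e k) w n)
  simp only [fd, sub_add_cancel] at this ⊢
  rw [this]
  congr 1
  exact Finset.sum_congr rfl fun n _ => by ring

theorem gradSq_le_neg_sum {G : Type*} [Fintype G] [AddCommGroup G] {d : ℕ} (e : Fin d → G)
    {a : Fin d → G → ℝ} (ha : ∀ k n, 2 / 3 ≤ a k n) (w : G → ℝ) :
    2 / 3 * gradSq e w ≤ -∑ n, w n * ellip e a w n := by
  rw [sum_mul_ellip, neg_neg, gradSq_eq, Finset.mul_sum]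
  refine Finset.sum_le_sum fun k _ => ?_
  rw [Finset.mul_sum]
  refine Finset.sum_le_sum fun n _ => ?_
  gcongr; exact ha k n

theorem ellip_add {G : Type*} [AddCommGroup G] {d : ℕ} (e : Fin d → G)
    (a : Fin d → G → ℝ) (w z : G → ℝ) (n : G) :
    ellip e a (fun n => w n + z n) n = ellip e a w n + ellip e a z n := by
  simp only [ellip]
  rw [← Finset.sum_add_distrib]
  exact Finset.sum_congr rfl fun k _ => by ring

theorem ellip_smul {G : Type*} [AddCommGroup G] {d : ℕ} (e : Fin d → G)
    (a : Fin d → G → ℝ) (c : ℝ) (w : G → ℝ) (n : G) :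
    ellip e a (fun n => c * w n) n = c * ellip e a w n := by
  simp only [ellip]
  rw [Finset.mul_sum]
  exact Finset.sum_congr rfl fun k _ => by ring

variable {d N : ℕ}

open Classical in
/-- The Dirichlet problem with zero data where some coordinate vanishes. -/
noncomputable def dirichletMap (a : Fin d → Torus d N → ℝ) :
    (Torus d N → ℝ) →ₗ[ℝ] (Torus d N → ℝ) where
  toFun w n := if ∃ k, n k = 0 then w n else ellip (te d N) a w n
  map_add' w z := by
    funext n
    have := ellip_add (te d N) a w z n
    simp only [Pi.add_apply]
    split_ifs
    · rfl
    · exact this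
  map_smul' c w := by
    funext n
    have := ellip_smul (te d N) a c w n
    simp only [Pi.smul_apply, smul_eq_mul, RingHom.id_apply]
    split_ifs
    · rfl
    · exact this

/-- In finite dimension uniqueness gives existence. A homogeneous solution has zero gradient energy
by summation by parts, hence vanishes by the Poincaré inequality. The zero set sits at position
`-1`, outside the regions used later. -/
theorem exists_dirichlet (hd : 0 < d) {a : Fin d → Torus d N → ℝ} (ha : ∀ k n, 2 / 3 ≤ a k n)
    (g : Torus d N → ℝ) :
    ∃ w : Torus d N → ℝ, (∀ n, (∃ k, n k = 0) → w n = 0) ∧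
      ∀ n, (¬∃ k, n k = 0) → ellip (te d N) a w n = g n := by
  classical
  have hinj : Function.Injective (dirichletMap a) := by
    rw [← LinearMap.ker_eq_bot, LinearMap.ker_eq_bot']
    intro w hw
    have h1 : ∀ n, (∃ k, n k = 0) → w n = 0 := by
      intro n hn
      have := congrFun hw n
      simpa [dirichletMap, hn] using this
    have h2 : ∀ n, (¬∃ k, n k = 0) → ellip (te d N) a w n = 0 := by
      intro n hn
      have := congrFun hw n
      simpa only [dirichletMap, LinearMap.coe_mk, AddHom.coe_mk, hn, if_false, Pi.zero_apply]
        using this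
    have h3 : ∑ n, w n * ellip (te d N) a w n = 0 := by
      refine Finset.sum_eq_zero fun n _ => ?_
      by_cases hn : ∃ k, n k = 0
      · rw [h1 n hn, zero_mul]
      · rw [h2 n hn, mul_zero]
    have h4 := gradSq_le_neg_sum (te d N) ha w
    rw [h3, neg_zero] at h4
    have h5 := meshSize_sq_mul_sum_sq_le ⟨0, hd⟩ w fun n hn => h1 n ⟨_, hn⟩
    have h6 : ∑ n, w n ^ 2 ≤ 0 := by
      have : 0 < meshSize N ^ 2 := pow_pos (meshSize_pos N) 2
      nlinarith
    funext n
    have h7 := (Finset.sum_eq_zero_iff_of_nonneg (s := Finset.univ) (f := fun n => w n ^ 2)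
      fun n _ => sq_nonneg (w n)).1
      (le_antisymm h6 (Finset.sum_nonneg fun _ _ => sq_nonneg _)) n (Finset.mem_univ n)
    simpa using h7
  obtain ⟨w, hw⟩ := (LinearMap.injective_iff_surjective.1 hinj)
    (fun n => if ∃ k, n k = 0 then 0 else g n)
  refine ⟨w, fun n hn => ?_, fun n hn => ?_⟩
  · have := congrFun hw n
    simpa [dirichletMap, hn] using this
  · have := congrFun hw n
    simpa only [dirichletMap, LinearMap.coe_mk, AddHom.coe_mk, hn, if_false] using this

/-- A source on a hyperplane is absorbed by a correction of comparable energy. -/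
theorem exists_lift (hd : 0 < d) {a : Fin d → Torus d N → ℝ} (ha : ∀ k n, 2 / 3 ≤ a k n)
    (j : Fin d) (c : ZMod (3 * N + 3)) (g : Torus d N → ℝ) (hg : ∀ n, n j ≠ c → g n = 0) :
    ∃ w : Torus d N → ℝ, (∀ n, (¬∃ k, n k = 0) → ellip (te d N) a w n = g n) ∧
      meshSize N * ∑ n, en (meshSize N) (te d N) w n ≤ 70 * ∑ n, g n ^ 2 := by
  obtain ⟨w, hw0, hw⟩ := exists_dirichlet hd ha g
  refine ⟨w, hw, ?_⟩
  have hh := meshSize_pos N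
  have hj : ∀ n, n j = 0 → w n = 0 := fun n hn => hw0 n ⟨j, hn⟩
  have h1 := gradSq_le_neg_sum (te d N) ha w
  set T := ∑ n, {n : Torus d N | n j = c}.indicator (fun n => w n ^ 2) n with hT
  -- The source lives on one hyperplane, so only the trace `T` of `w` is tested. As `h T ≤ 3
  -- gradSq`, the first term takes `1/3` of the gradient energy out of `2/3`. Together with the
  -- Poincaré factor the final constant is `(1 + 9) · 27/4 ≤ 70`.
  have h2 : -∑ n, w n * ellip (te d N) a w n ≤ meshSize N * T / 9 +
      9 / (4 * meshSize N) * ∑ n, g n ^ 2 := by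
    rw [← Finset.sum_neg_distrib, mul_div_right_comm, hT, Finset.mul_sum, Finset.mul_sum,
      ← Finset.sum_add_distrib]
    refine Finset.sum_le_sum fun n _ => ?_
    have i0 : 0 ≤ {n : Torus d N | n j = c}.indicator (fun n => w n ^ 2) n :=
      Set.indicator_nonneg (fun _ _ => sq_nonneg _) n
    by_cases hn : ∃ k, n k = 0
    · rw [hw0 n hn]
      simp only [zero_mul, neg_zero]
      positivity
    · rw [hw n hn]
      by_cases hc : n j = c
      · rw [Set.indicator_of_mem (show n ∈ {n : Torus d N | n j = c} from hc)]
        have : meshSize N / 9 * w n ^ 2 + 9 / (4 * meshSize N) * g n ^ 2 + w n * g n =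
            1 / (36 * meshSize N) * (2 * meshSize N * w n + 9 * g n) ^ 2 := by
          field_simp; ring
        have : 0 ≤ 1 / (36 * meshSize N) * (2 * meshSize N * w n + 9 * g n) ^ 2 := by positivity
        linarith
      · rw [hg n hc, mul_zero, neg_zero]
        positivity
  have h3 := meshSize_mul_sum_trace_le j c w hj
  rw [← hT] at h3
  have h4 := meshSize_sq_mul_sum_sq_le j w hj
  have h5 : ∑ n, en (meshSize N) (te d N) w n =
      meshSize N ^ 2 * ∑ n, w n ^ 2 + gradSq (te d N) w := by
    simp only [en, Finset.sum_add_distrib, Finset.mul_sum, gradSq]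
  have h6 : gradSq (te d N) w ≤ 27 / (4 * meshSize N) * ∑ n, g n ^ 2 := by
    have : 27 / (4 * meshSize N) * ∑ n, g n ^ 2 =
      3 * (9 / (4 * meshSize N) * ∑ n, g n ^ 2) := by ring
    rw [this]
    linarith
  rw [h5]
  have h7 : meshSize N * (27 / (4 * meshSize N) * ∑ n, g n ^ 2) = 27 / 4 * ∑ n, g n ^ 2 := by
    field_simp
  have h8 : 0 ≤ ∑ n, g n ^ 2 := Finset.sum_nonneg fun _ _ => sq_nonneg _
  calc meshSize N * (meshSize N ^ 2 * ∑ n, w n ^ 2 + gradSq (te d N) w)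
      ≤ meshSize N * (10 * (27 / (4 * meshSize N) * ∑ n, g n ^ 2)) := by
        gcongr; linarith
    _ = 10 * (meshSize N * (27 / (4 * meshSize N) * ∑ n, g n ^ 2)) := by ring
    _ ≤ _ := by rw [h7]; linarith

end Lift

/-! ### Pointwise bounds for the coefficients from the discrete hypotheses -/

section Coefficients

variable {d : ℕ}

theorem halfStep_apply (h : ℝ) (k i : Fin d) : halfStep h k i = if i = k then h / 2 else 0 := by
  by_cases hik : i = k <;> simp [halfStep, hik]

theorem normLInf_nonneg (W : Finset (E d)) (u : E d → ℝ) : 0 ≤ normLInf W u := NNReal.coe_nonneg _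

theorem abs_le_normLInf {W : Finset (E d)} (u : E d → ℝ) {x : E d} (hx : x ∈ W) :
    |u x| ≤ normLInf W u := by
  have : ‖u x‖₊ ≤ W.sup fun x => ‖u x‖₊ := Finset.le_sup (f := fun x => ‖u x‖₊) hx
  exact_mod_cast this

theorem subset_closureDir (h : ℝ) (k : Fin d) (W : Finset (E d)) : W ⊆ closureDir h k W := by
  classical
  intro x hx
  unfold closureDir star
  simp only [Finset.mem_union, Finset.mem_image]
  exact Or.inr ⟨x + halfStep h k, Or.inl ⟨x, hx, rfl⟩, by simp⟩

/-- The mesh point with integer coordinates `m`. -/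
noncomputable def gpt (N : ℕ) (m : Fin d → ℕ) : E d := WithLp.toLp 2 fun i => meshSize N * (m i : ℝ)

theorem gpt_apply (N : ℕ) (m : Fin d → ℕ) (i : Fin d) : gpt N m i = meshSize N * (m i : ℝ) := rfl

theorem gpt_mem_grid {N : ℕ} {m : Fin d → ℕ} (hm : ∀ i, m i ≤ N + 1) : gpt N m ∈ grid d N := by
  classical
  unfold grid
  rw [Finset.mem_image]
  exact ⟨fun i => ⟨m i, by have := hm i; omega⟩, Finset.mem_univ _, rfl⟩

theorem mem_grid_iff {N : ℕ} {x : E d} :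
    x ∈ grid d N ↔ ∃ m : Fin d → ℕ, (∀ i, m i ≤ N + 1) ∧ x = gpt N m := by
  classical
  constructor
  · intro hx
    unfold grid at hx
    rw [Finset.mem_image] at hx
    obtain ⟨m, -, rfl⟩ := hx
    exact ⟨fun i => m i, fun i => Nat.le_of_lt_succ (m i).2, rfl⟩
  · rintro ⟨m, hm, rfl⟩
    exact gpt_mem_grid hm

theorem mem_sample {N : ℕ} {S : Set (E d)} {x : E d} :
    x ∈ sample N S ↔ x ∈ grid d N ∧ x ∈ S := by
  classical
  unfold sample
  rw [Finset.mem_filter]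

theorem gpt_mem_cube_iff {N : ℕ} {m : Fin d → ℕ} :
    gpt N m ∈ cube d ↔ ∀ i, 1 ≤ m i ∧ m i ≤ N := by
  have h0 := meshSize_pos N
  have h1 := meshSize_mul N
  refine forall_congr' fun i => and_congr ?_ ?_
  · rw [gpt_apply, mul_pos_iff_of_pos_left h0, Nat.cast_pos]
    omega
  · rw [gpt_apply, ← h1, mul_lt_mul_iff_right₀ h0, ← Nat.cast_add_one, Nat.cast_lt]
    omega

theorem gpt_mem_cubeMesh_iff {N : ℕ} {m : Fin d → ℕ} :
    gpt N m ∈ cubeMesh d N ↔ ∀ i, 1 ≤ m i ∧ m i ≤ N := by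
  rw [cubeMesh, mem_sample, gpt_mem_cube_iff]
  exact ⟨fun h => h.2, fun h => ⟨gpt_mem_grid fun i => by have := (h i).2; omega, h⟩⟩

theorem isOpen_cube : IsOpen (cube d) := by
  have : cube d = ⋂ i, {x : E d | 0 < x i ∧ x i < 1} := by
    ext x; simp [cube]
  rw [this]
  refine isOpen_iInter_of_finite fun i => ?_
  have hc : Continuous fun x : E d => x i := by fun_prop
  exact (isOpen_lt continuous_const hc).inter (isOpen_lt hc continuous_const)

theorem tendsto_meshSize : Filter.Tendsto meshSize Filter.atTop (nhds 0) :=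
  tendsto_one_div_add_atTop_nhds_zero_nat

theorem tendsto_meshSize_mul_floor {t : ℝ} (ht : 0 ≤ t) :
    Filter.Tendsto (fun N : ℕ => meshSize N * (⌊t * ((N : ℝ) + 1)⌋₊ : ℝ)) Filter.atTop (nhds t) := by
  have h1 := tendsto_nat_floor_mul_div_atTop (R := ℝ) ht
  have h2 : Filter.Tendsto (fun N : ℕ => (N : ℝ) + 1) Filter.atTop Filter.atTop :=
    Filter.tendsto_atTop_add_const_right _ _ tendsto_natCast_atTop_atTop
  refine (h1.comp h2).congr fun N => ?_
  simp only [Function.comp, meshSize]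
  ring

/-- Half steps disappear in the limit of fine meshes. Together with continuity this converts
hypotheses on all small meshes into statements at arbitrary points of the cube, valid whatever mesh
is used afterwards. -/
theorem tendsto_gpt_floor {x : E d} (hx : x ∈ cube d) (j : Fin d) (c : ℝ) :
    Filter.Tendsto (fun N : ℕ => gpt N (fun i => ⌊x i * ((N : ℝ) + 1)⌋₊) +
      c • halfStep (meshSize N) j) Filter.atTop (nhds x) := by
  have h1 : Filter.Tendsto (fun N : ℕ => (fun i => meshSize N * (⌊x i * ((N : ℝ) + 1)⌋₊ : ℝ) :
      Fin d → ℝ)) Filter.atTop (nhds x.ofLp) :=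
    tendsto_pi_nhds.2 fun i => tendsto_meshSize_mul_floor (hx i).1.le
  have h2 := ((PiLp.continuous_toLp 2 (fun _ : Fin d => ℝ)).tendsto x.ofLp).comp h1
  have h3 : Filter.Tendsto (fun N : ℕ => c • halfStep (meshSize N) j) Filter.atTop
      (nhds (0 : E d)) := by
    have : Filter.Tendsto (fun N : ℕ => (c * (meshSize N / 2)) • EuclideanSpace.single j (1 : ℝ))
        Filter.atTop (nhds ((c * (0 / 2)) • EuclideanSpace.single j (1 : ℝ))) :=
      ((tendsto_meshSize.div_const 2).const_mul c).smul_const _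
    simp only [zero_div, mul_zero, zero_smul] at this
    refine this.congr fun N => ?_
    rw [halfStep, smul_smul]
  have h4 := h2.add h3
  rw [add_zero] at h4
  exact h4

theorem eventually_floor_mem {x : E d} (hx : x ∈ cube d) :
    ∀ᶠ N : ℕ in Filter.atTop, ∀ i, 1 ≤ ⌊x i * ((N : ℝ) + 1)⌋₊ ∧ ⌊x i * ((N : ℝ) + 1)⌋₊ ≤ N := by
  have h2 : Filter.Tendsto (fun N : ℕ => (N : ℝ) + 1) Filter.atTop Filter.atTop :=
    Filter.tendsto_atTop_add_const_right _ _ tendsto_natCast_atTop_atTop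
  rw [Filter.eventually_all]
  intro i
  filter_upwards [(h2.const_mul_atTop (hx i).1).eventually_ge_atTop 1] with N hN
  refine ⟨Nat.le_floor (by simpa using hN), ?_⟩
  have h3 : x i * ((N : ℝ) + 1) < ((N + 1 : ℕ) : ℝ) := by
    push_cast
    have : (0 : ℝ) < N + 1 := by positivity
    nlinarith [(hx i).2]
  have := (Nat.floor_lt (by have := (hx i).1; positivity)).2 h3
  omega

variable {h₁ : ℝ} {σ : Fin d → E d → ℝ}

theorem CoeffAssumption.continuousAt (H : CoeffAssumption h₁ σ) (k : Fin d) {x : E d}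
    (hx : x ∈ cube d) : ContinuousAt (σ k) x :=
  (H.continuousOn k).continuousAt (Filter.mem_of_superset (isOpen_cube.mem_nhds hx) subset_closure)

theorem eventually_meshSize_le (hh₁ : 0 < h₁) : ∀ᶠ N : ℕ in Filter.atTop, meshSize N ≤ h₁ :=
  (tendsto_meshSize.eventually_lt_const hh₁).mono fun _ h => h.le

/-- As the mesh is refined, each of the `d` averages in the sum over `j` tends to `σ k x`. The limit
of the sum is therefore `d` copies of one quantity, bounded by `1`. -/
theorem CoeffAssumption.abs_sub_one_le (H : CoeffAssumption h₁ σ) (hh₁ : 0 < h₁) (k : Fin d)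
    {x : E d} (hx : x ∈ cube d) : d * |σ k x - 1| ≤ 1 := by
  have hlim : ∀ j, Filter.Tendsto (fun N : ℕ => |A (meshSize N) j (σ k)
      (gpt N (fun i => ⌊x i * ((N : ℝ) + 1)⌋₊)) - 1|) Filter.atTop (nhds |σ k x - 1|) := by
    intro j
    have t1 := (H.continuousAt k hx).tendsto.comp (tendsto_gpt_floor hx j 1)
    have t2 := (H.continuousAt k hx).tendsto.comp (tendsto_gpt_floor hx j (-1))
    have t3 := (((t1.add t2).div_const 2).sub_const 1).abs
    rw [show (σ k x + σ k x) / 2 = σ k x by ring] at t3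
    refine t3.congr fun N => ?_
    simp only [Function.comp, A, one_smul, neg_smul, ← sub_eq_add_neg]
  have hsum := tendsto_finsetSum Finset.univ fun j (_ : j ∈ Finset.univ) => hlim j
  rw [Finset.sum_const, Finset.card_univ, Fintype.card_fin, nsmul_eq_mul] at hsum
  refine le_of_tendsto hsum ?_
  filter_upwards [eventually_floor_mem hx, eventually_meshSize_le hh₁] with N hN hN1
  have hmem := subset_closureDir (meshSize N) k _ (gpt_mem_cubeMesh_iff.2 hN)
  calc ∑ j, |A (meshSize N) j (σ k) (gpt N (fun i => ⌊x i * ((N : ℝ) + 1)⌋₊)) - 1|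
      ≤ ∑ j, normLInf (closureDir (meshSize N) k (cubeMesh d N))
          (fun x => A (meshSize N) j (σ k) x - 1) :=
        Finset.sum_le_sum fun j _ =>
          abs_le_normLInf (fun x => A (meshSize N) j (σ k) x - 1) hmem
    _ ≤ epsA N σ := Finset.single_le_sum
        (f := fun k => ∑ j, normLInf (closureDir (meshSize N) k (cubeMesh d N))
          (fun x => A (meshSize N) j (σ k) x - 1))
        (fun _ _ => Finset.sum_nonneg fun _ _ => normLInf_nonneg _ _) (Finset.mem_univ k)
    _ ≤ 1 := (H.epsA_lt N hN1).le

/-- The deviation from `1` is at most `1/d`, and `d ≥ 3` turns this into `1/3`. -/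
theorem CoeffAssumption.bounds (H : CoeffAssumption h₁ σ) (hh₁ : 0 < h₁) (hd : 3 ≤ d) (k : Fin d)
    {x : E d} (hx : x ∈ cube d) : 2 / 3 ≤ σ k x ∧ σ k x ≤ 4 / 3 := by
  have h1 := H.abs_sub_one_le hh₁ k hx
  have h2 : (3 : ℝ) ≤ d := by exact_mod_cast hd
  have h3 : |σ k x - 1| ≤ 1 / 3 := by nlinarith [abs_nonneg (σ k x - 1)]
  rw [abs_le] at h3
  constructor <;> linarith [h3.1, h3.2]

theorem CoeffAssumption.abs_jump_le (H : CoeffAssumption h₁ σ) {N : ℕ} (hN : meshSize N ≤ h₁)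
    (k j : Fin d) {z : E d} (hz : z ∈ cubeMesh d N) :
    |σ k (z + halfStep (meshSize N) j) - σ k (z - halfStep (meshSize N) j)| ≤ meshSize N := by
  have h0 := meshSize_pos N
  have h1 : |D (meshSize N) j (σ k) z| ≤ 1 := by
    refine le_trans ?_ (H.epsD_lt N hN).le
    calc |D (meshSize N) j (σ k) z|
        ≤ normLInf (closureDir (meshSize N) k (cubeMesh d N)) (D (meshSize N) j (σ k)) :=
          abs_le_normLInf _ (subset_closureDir _ _ _ hz)
      _ ≤ ∑ j, normLInf (closureDir (meshSize N) k (cubeMesh d N)) (D (meshSize N) j (σ k)) :=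
          Finset.single_le_sum (f := fun j => normLInf (closureDir (meshSize N) k (cubeMesh d N))
            (D (meshSize N) j (σ k))) (fun _ _ => normLInf_nonneg _ _) (Finset.mem_univ j)
      _ ≤ epsD N σ := Finset.single_le_sum
          (f := fun k => ∑ j, normLInf (closureDir (meshSize N) k (cubeMesh d N))
            (D (meshSize N) j (σ k)))
          (fun _ _ => Finset.sum_nonneg fun _ _ => normLInf_nonneg _ _) (Finset.mem_univ k)
  rw [D, abs_div, abs_of_pos h0, div_le_one h0] at h1
  exact h1

/-- The forward half step from a mesh point is the backward half step from the next one, so the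
jumps across `L + 1` consecutive mesh points telescope. -/
theorem CoeffAssumption.abs_chain_le (H : CoeffAssumption h₁ σ) {N : ℕ} (hN : meshSize N ≤ h₁)
    (k j : Fin d) {m : Fin d → ℕ} (hm : ∀ i, 1 ≤ m i ∧ m i ≤ N) (L : ℕ) (hL : m j + L ≤ N) :
    |σ k (gpt N (Function.update m j (m j + L)) + halfStep (meshSize N) j) -
      σ k (gpt N m - halfStep (meshSize N) j)| ≤ (L + 1) * meshSize N := by
  induction L with
  | zero =>
    have := H.abs_jump_le hN k j (gpt_mem_cubeMesh_iff.2 hm)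
    simpa using this
  | succ L ih =>
    have h1 := ih (by omega)
    have h2 := H.abs_jump_le hN k j (z := gpt N (Function.update m j (m j + (L + 1))))
      (gpt_mem_cubeMesh_iff.2 fun i => by
        by_cases hi : i = j
        · subst hi; simp; omega
        · simpa [hi] using hm i)
    have h3 : gpt N (Function.update m j (m j + (L + 1))) - halfStep (meshSize N) j =
        gpt N (Function.update m j (m j + L)) + halfStep (meshSize N) j := by
      ext i
      simp only [PiLp.sub_apply, PiLp.add_apply, gpt_apply, halfStep_apply]
      by_cases hi : i = j
      · subst hi; simp; ring
      · simp [hi]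
    rw [h3] at h2
    have := abs_add_le_add h2 h1
    rw [sub_add_sub_cancel] at this
    refine this.trans (le_of_eq ?_)
    push_cast; ring

/-- The coefficients are Lipschitz along coordinate directions. -/
theorem CoeffAssumption.abs_sub_le (H : CoeffAssumption h₁ σ) (hh₁ : 0 < h₁) (k j : Fin d)
    {x y : E d} (hx : x ∈ cube d) (hy : y ∈ cube d) (hxy : ∀ i, i ≠ j → x i = y i)
    (hle : x j ≤ y j) : |σ k y - σ k x| ≤ y j - x j := by
  have t1 := (H.continuousAt k hy).tendsto.comp (tendsto_gpt_floor hy j 1)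
  have t2 := (H.continuousAt k hx).tendsto.comp (tendsto_gpt_floor hx j (-1))
  have t3 := (t1.sub t2).abs
  have r1 := tendsto_meshSize_mul_floor (hy j).1.le
  have r2 := tendsto_meshSize_mul_floor (hx j).1.le
  have r3 := (r1.sub r2).add tendsto_meshSize
  rw [add_zero] at r3
  refine le_of_tendsto_of_tendsto t3 r3 ?_
  filter_upwards [eventually_floor_mem hx, eventually_floor_mem hy, eventually_meshSize_le hh₁]
    with N hNx hNy hN1
  have hfl : ⌊x j * ((N : ℝ) + 1)⌋₊ ≤ ⌊y j * ((N : ℝ) + 1)⌋₊ := by gcongr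
  obtain ⟨L, hL⟩ := Nat.exists_eq_add_of_le hfl
  have h1 := H.abs_chain_le hN1 k j hNx L (by rw [← hL]; exact (hNy j).2)
  have h2 : Function.update (fun i => ⌊x i * ((N : ℝ) + 1)⌋₊) j (⌊x j * ((N : ℝ) + 1)⌋₊ + L) =
      fun i => ⌊y i * ((N : ℝ) + 1)⌋₊ := by
    funext i
    by_cases hi : i = j
    · subst hi; simp [hL]
    · simp [hi, hxy i hi]
  rw [h2] at h1
  simp only [Function.comp, one_smul, neg_smul, ← sub_eq_add_neg]
  refine h1.trans (le_of_eq ?_)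
  rw [hL]; push_cast; ring

end Coefficients

/-! ### Closure, boundary and distance to the boundary of the cube -/

section CubeTopology

variable {d : ℕ}

theorem closure_cube : closure (cube d) = {x : E d | ∀ i, 0 ≤ x i ∧ x i ≤ 1} := by
  have h1 : cube d = (EuclideanSpace.equiv (Fin d) ℝ).toHomeomorph ⁻¹'
      Set.univ.pi fun _ => Set.Ioo (0 : ℝ) 1 := by
    ext x; simp [cube]
  rw [h1, ← Homeomorph.preimage_closure, closure_pi_set]
  ext x
  simp only [closure_Ioo zero_ne_one, Set.mem_preimage, Set.mem_pi, Set.mem_univ, true_implies,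
    Set.mem_Icc]
  rfl

theorem mem_frontier_cube_iff {x : E d} :
    x ∈ frontier (cube d) ↔ (∀ i, 0 ≤ x i ∧ x i ≤ 1) ∧ x ∉ cube d := by
  rw [isOpen_cube.frontier_eq, closure_cube]
  rfl

theorem exists_coord_of_mem_frontier {x : E d} (hx : x ∈ frontier (cube d)) :
    ∃ k, x k = 0 ∨ x k = 1 := by
  rw [mem_frontier_cube_iff] at hx
  by_contra hc
  push Not at hc
  exact hx.2 fun i => ⟨lt_of_le_of_ne (hx.1 i).1 (hc i).1.symm, lt_of_le_of_ne (hx.1 i).2 (hc i).2⟩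

theorem infDist_frontier_le {x : E d} (hx : x ∈ cube d) (k : Fin d) {c : ℝ} (hc : c = 0 ∨ c = 1) :
    Metric.infDist x (frontier (cube d)) ≤ |x k - c| := by
  set y : E d := x - EuclideanSpace.single k (x k - c) with hy
  have hyi : ∀ i, y i = if i = k then c else x i := by
    intro i
    by_cases hi : i = k
    · subst hi; simp [hy]
    · simp [hy, hi]
  have hmem : y ∈ frontier (cube d) := by
    rw [mem_frontier_cube_iff]
    refine ⟨fun i => ?_, fun hcube => ?_⟩
    · rw [hyi]
      split_ifs
      · rcases hc with rfl | rfl <;> norm_num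
      · exact ⟨(hx i).1.le, (hx i).2.le⟩
    · have := hcube k
      rw [hyi, if_pos rfl] at this
      rcases hc with rfl | rfl
      · exact lt_irrefl _ this.1
      · exact lt_irrefl _ this.2
  refine (Metric.infDist_le_dist_of_mem hmem).trans (le_of_eq ?_)
  rw [dist_eq_norm, hy, sub_sub_cancel, PiLp.norm_single, Real.norm_eq_abs]

theorem exists_coord_of_infDist_lt (hd : 0 < d) {x : E d} (hx : x ∈ cube d) {r : ℝ}
    (hr : Metric.infDist x (frontier (cube d)) < r) : ∃ k, x k < r ∨ 1 - x k < r := by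
  have hne : (frontier (cube d)).Nonempty := by
    refine ⟨0, mem_frontier_cube_iff.2 ⟨fun i => by simp, fun h => ?_⟩⟩
    exact lt_irrefl _ (h ⟨0, hd⟩).1
  obtain ⟨y, hy, hxy⟩ := (Metric.infDist_lt_iff hne).1 hr
  obtain ⟨k, hk⟩ := exists_coord_of_mem_frontier hy
  have h1 : |x k - y k| < r := by
    refine lt_of_le_of_lt ?_ hxy
    rw [dist_eq_norm]
    exact PiLp.norm_apply_le (x - y) k
  refine ⟨k, ?_⟩
  rcases hk with h | h
  · left; rw [h, sub_zero, abs_of_pos (hx k).1] at h1; exact h1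
  · right; rw [h, abs_sub_comm, abs_of_pos (by linarith [(hx k).2])] at h1; exact h1

end CubeTopology

/-! ### Extension by zero to the periodic mesh -/

section Extension

variable {d N : ℕ}

theorem pos_eq (n : Torus d N) (k : Fin d) :
    pos N n k = meshSize N * (((n k).val : ℝ) - ((N + 1 : ℕ) : ℝ)) := by
  have := meshSize_mul N
  simp only [pos]; push_cast; linarith

theorem pos_pos_iff {n : Torus d N} {k : Fin d} : 0 < pos N n k ↔ N + 1 < (n k).val := by
  rw [pos_eq, mul_pos_iff_of_pos_left (meshSize_pos N), sub_pos, Nat.cast_lt]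

theorem pos_nonneg_iff {n : Torus d N} {k : Fin d} : 0 ≤ pos N n k ↔ N + 1 ≤ (n k).val := by
  rw [pos_eq, mul_nonneg_iff_of_pos_left (meshSize_pos N), sub_nonneg, Nat.cast_le]

theorem one_sub_pos (n : Torus d N) (k : Fin d) :
    1 - pos N n k = meshSize N * (((2 * N + 2 : ℕ) : ℝ) - ((n k).val : ℝ)) := by
  have := meshSize_mul N
  simp only [pos]; push_cast; linarith

theorem pos_lt_one_iff {n : Torus d N} {k : Fin d} : pos N n k < 1 ↔ (n k).val < 2 * N + 2 := by
  rw [← sub_pos, one_sub_pos, mul_pos_iff_of_pos_left (meshSize_pos N), sub_pos, Nat.cast_lt]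

theorem pos_le_one_iff {n : Torus d N} {k : Fin d} : pos N n k ≤ 1 ↔ (n k).val ≤ 2 * N + 2 := by
  rw [← sub_nonneg, one_sub_pos, mul_nonneg_iff_of_pos_left (meshSize_pos N), sub_nonneg,
    Nat.cast_le]

theorem pos_eq_zero_iff {n : Torus d N} {k : Fin d} : pos N n k = 0 ↔ (n k).val = N + 1 := by
  rw [le_antisymm_iff, pos_nonneg_iff, ← not_lt (a := (0 : ℝ)), pos_pos_iff]; omega

theorem pos_eq_one_iff {n : Torus d N} {k : Fin d} : pos N n k = 1 ↔ (n k).val = 2 * N + 2 := by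
  rw [le_antisymm_iff, pos_le_one_iff, ← not_lt (b := (1 : ℝ)), pos_lt_one_iff]; omega

/-- The position as a point of Euclidean space. -/
noncomputable def pt (n : Torus d N) : E d := WithLp.toLp 2 (pos N n)

theorem pt_apply (n : Torus d N) (k : Fin d) : pt n k = pos N n k := rfl

theorem pt_injective : Function.Injective (pt : Torus d N → E d) := by
  intro n n' h
  funext k
  have h1 : pos N n k = pos N n' k := by rw [← pt_apply, h, pt_apply]
  rw [pos_eq, pos_eq] at h1
  have h2 := mul_left_cancel₀ (meshSize_pos N).ne' h1
  have h3 : ((n k).val : ℝ) = ((n' k).val : ℝ) := by linarith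
  exact ZMod.val_injective _ (by exact_mod_cast h3)

theorem pt_mem_cube_iff {n : Torus d N} :
    pt n ∈ cube d ↔ ∀ k, N + 1 < (n k).val ∧ (n k).val < 2 * N + 2 :=
  forall_congr' fun _ => and_congr pos_pos_iff pos_lt_one_iff

theorem pt_mem_grid {n : Torus d N} (hn : ∀ k, N + 1 ≤ (n k).val ∧ (n k).val ≤ 2 * N + 2) :
    pt n ∈ grid d N := by
  rw [mem_grid_iff]
  refine ⟨fun k => (n k).val - (N + 1), fun k => Nat.sub_le_iff_le_add.2 (by have := (hn k).2; omega), ?_⟩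
  ext k
  rw [pt_apply, pos_eq, gpt_apply, Nat.cast_sub (hn k).1]

theorem pt_mem_cubeMesh {n : Torus d N} (hn : pt n ∈ cube d) : pt n ∈ cubeMesh d N := by
  rw [cubeMesh, mem_sample]
  refine ⟨pt_mem_grid fun k => ?_, hn⟩
  have := pt_mem_cube_iff.1 hn k
  omega

theorem exists_pt_of_mem_grid {x : E d} (hx : x ∈ grid d N) : ∃ n : Torus d N, pt n = x := by
  obtain ⟨m, hm, rfl⟩ := mem_grid_iff.1 hx
  refine ⟨fun k => ((m k + (N + 1) : ℕ) : ZMod (3 * N + 3)), ?_⟩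
  ext k
  rw [pt_apply, pos_eq, gpt_apply, ZMod.val_natCast_of_lt (by have := hm k; omega)]
  push_cast; ring

theorem pt_add (n : Torus d N) (k : Fin d) (hk : (n k).val + 1 < 3 * N + 3) :
    pt (n + te d N k) = pt n + halfStep (meshSize N) k + halfStep (meshSize N) k := by
  ext i
  simp only [PiLp.add_apply, pt_apply, halfStep_apply, pos_add n k hk, step]
  split_ifs <;> ring

theorem pt_sub (n : Torus d N) (k : Fin d) (hk : 1 ≤ (n k).val) :
    pt (n - te d N k) = pt n - halfStep (meshSize N) k - halfStep (meshSize N) k := by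
  ext i
  simp only [PiLp.sub_apply, pt_apply, halfStep_apply, pos_sub n k hk, step]
  split_ifs <;> ring

open Classical in
/-- The extension by zero of a mesh function in the cube to the periodic mesh. -/
noncomputable def ext (N : ℕ) (u : E d → ℝ) (n : Torus d N) : ℝ :=
  if pt n ∈ cube d then u (pt n) else 0

theorem ext_of_mem {u : E d → ℝ} {n : Torus d N} (hn : pt n ∈ cube d) : ext N u n = u (pt n) :=
  if_pos hn

theorem ext_of_notMem {u : E d → ℝ} {n : Torus d N} (hn : pt n ∉ cube d) : ext N u n = 0 :=
  if_neg hn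

/-- The Dirichlet condition is what makes the extension by zero agree with `u` on the closed cube,
and hence in all stencils centred in the open cube. -/
theorem ext_of_mem_closure {u : E d → ℝ} (hu : ∀ x ∈ cubeBdry d N, u x = 0) {n : Torus d N}
    (hn : ∀ k, N + 1 ≤ (n k).val ∧ (n k).val ≤ 2 * N + 2) : ext N u n = u (pt n) := by
  by_cases h : pt n ∈ cube d
  · exact ext_of_mem h
  · rw [ext_of_notMem h, hu]
    rw [cubeBdry, mem_sample, mem_frontier_cube_iff]
    exact ⟨pt_mem_grid hn, fun k => ⟨pos_nonneg_iff.2 (hn k).1, pos_le_one_iff.2 (hn k).2⟩, h⟩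

theorem closed_add {n : Torus d N} (hn : pt n ∈ cube d) (l k : Fin d) :
    N + 1 ≤ ((n + te d N l) k).val ∧ ((n + te d N l) k).val ≤ 2 * N + 2 := by
  have h := pt_mem_cube_iff.1 hn
  rw [add_te_val n l (by have := (h l).2; omega)]
  have := h k
  split_ifs <;> omega

theorem closed_sub {n : Torus d N} (hn : pt n ∈ cube d) (l k : Fin d) :
    N + 1 ≤ ((n - te d N l) k).val ∧ ((n - te d N l) k).val ≤ 2 * N + 2 := by
  have h := pt_mem_cube_iff.1 hn
  rw [sub_te_val n l (by have := (h l).1; omega)]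
  have := h k
  split_ifs <;> omega

end Extension

/-! ### Extension of the coefficients to the periodic mesh -/

section TorusCoefficients

variable {d N : ℕ}

/-- Projection onto `[h/2, 1 - h/2]`. -/
noncomputable def clamp (h t : ℝ) : ℝ := max (h / 2) (min (1 - h / 2) t)

theorem clamp_mem {h : ℝ} (h0 : 0 < h) (h1 : h ≤ 1) (t : ℝ) : 0 < clamp h t ∧ clamp h t < 1 := by
  refine ⟨lt_max_of_lt_left (by linarith), max_lt (by linarith) ?_⟩
  exact lt_of_le_of_lt (min_le_left _ _) (by linarith)

theorem clamp_eq {h t : ℝ} (h0 : h / 2 ≤ t) (h1 : t ≤ 1 - h / 2) : clamp h t = t := by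
  rw [clamp, min_eq_right h1, max_eq_right h0]

theorem clamp_mono (h : ℝ) {s t : ℝ} (hst : s ≤ t) : clamp h s ≤ clamp h t :=
  max_le_max_left _ (min_le_min_left _ hst)

theorem clamp_add_le (h t : ℝ) {c : ℝ} (hc : 0 ≤ c) : clamp h (t + c) ≤ clamp h t + c := by
  unfold clamp
  refine max_le (by linarith [le_max_left (h / 2) (min (1 - h / 2) t)]) ?_
  have h1 : min (1 - h / 2) (t + c) ≤ min (1 - h / 2) t + c := by
    rw [← min_add_add_right]
    exact min_le_min_right _ (by linarith)
  linarith [le_max_right (h / 2) (min (1 - h / 2) t)]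

/-- The midpoint of the edge from `n` to `n + e_k`, projected into the cube. -/
noncomputable def mid (k : Fin d) (n : Torus d N) : E d := WithLp.toLp 2 fun i =>
  clamp (meshSize N) (pos N n i + if i = k then meshSize N / 2 else 0)

/-- The coefficients on the periodic mesh. -/
noncomputable def tcoeff (N : ℕ) (σ : Fin d → E d → ℝ) (k : Fin d) (n : Torus d N) : ℝ :=
  σ k (mid k n)

theorem mid_mem_cube (k : Fin d) (n : Torus d N) : mid k n ∈ cube d := fun _ =>
  clamp_mem (meshSize_pos N) (meshSize_le_one N) _

variable {h₁ : ℝ} {σ : Fin d → E d → ℝ}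

/-- Clamping acts coordinatewise, is monotone and does not increase distances. A mesh step therefore
moves the projected midpoint by at most `h` in one coordinate, and the Lipschitz bound inside the
cube applies. -/
theorem tcoeff_add_sub_le (H : CoeffAssumption h₁ σ) (hh₁ : 0 < h₁) (k l : Fin d) (n : Torus d N)
    (hl : (n l).val + 1 < 3 * N + 3) :
    |tcoeff N σ k (n + te d N l) - tcoeff N σ k n| ≤ meshSize N := by
  have h0 := meshSize_pos N
  have hi : ∀ i, mid k (n + te d N l) i = clamp (meshSize N)
      ((pos N n i + if i = k then meshSize N / 2 else 0) + if i = l then meshSize N else 0) := by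
    intro i
    change clamp _ _ = _
    rw [pos_add n l hl, step]
    congr 1; ring
  have hl' : mid k (n + te d N l) l = clamp (meshSize N)
      ((pos N n l + if l = k then meshSize N / 2 else 0) + meshSize N) := by
    rw [hi, if_pos rfl]
  have hn : ∀ i, mid k n i = clamp (meshSize N)
    (pos N n i + if i = k then meshSize N / 2 else 0) := fun i => rfl
  refine (H.abs_sub_le hh₁ k l (mid_mem_cube k n) (mid_mem_cube k (n + te d N l)) ?_ ?_).trans ?_
  · intro i hil
    rw [hi, if_neg hil, add_zero, hn]
  · rw [hl', hn]
    exact clamp_mono _ (by linarith)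
  · rw [hl', hn]
    linarith [clamp_add_le (meshSize N)
      (pos N n l + if l = k then meshSize N / 2 else 0) h0.le]

theorem le_pos_of_val {n : Torus d N} {k : Fin d} (hk : N + 1 < (n k).val) :
    meshSize N ≤ pos N n k := by
  rw [pos_eq]
  have h1 : ((N + 1 : ℕ) : ℝ) + 1 ≤ ((n k).val : ℝ) := by exact_mod_cast hk
  have := meshSize_pos N
  nlinarith

theorem pos_le_of_val {n : Torus d N} {k : Fin d} (hk : (n k).val < 2 * N + 2) :
    pos N n k ≤ 1 - meshSize N := by
  have h2 := one_sub_pos n k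
  have h1 : ((n k).val : ℝ) + 1 ≤ ((2 * N + 2 : ℕ) : ℝ) := by exact_mod_cast hk
  have := meshSize_pos N
  nlinarith

theorem mid_eq {k : Fin d} {n : Torus d N}
    (hn : ∀ i, i ≠ k → N + 1 < (n i).val ∧ (n i).val < 2 * N + 2)
    (hk : N + 1 ≤ (n k).val ∧ (n k).val < 2 * N + 2) :
    mid k n = pt n + halfStep (meshSize N) k := by
  have h0 := meshSize_pos N
  ext i
  change clamp _ _ = pt n i + halfStep (meshSize N) k i
  rw [halfStep_apply, pt_apply]
  by_cases hi : i = k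
  · subst hi
    have h1 := pos_nonneg_iff.2 hk.1
    have h2 := pos_le_of_val hk.2
    rw [if_pos rfl]
    exact clamp_eq (by linarith) (by linarith)
  · have h1 := le_pos_of_val (hn i hi).1
    have h2 := pos_le_of_val (hn i hi).2
    rw [if_neg hi, add_zero]
    exact clamp_eq (by linarith) (by linarith)

theorem mid_sub_eq {k : Fin d} {n : Torus d N}
    (hn : ∀ i, i ≠ k → N + 1 < (n i).val ∧ (n i).val < 2 * N + 2)
    (hk : N + 1 < (n k).val ∧ (n k).val ≤ 2 * N + 2) :
    mid k (n - te d N k) = pt n - halfStep (meshSize N) k := by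
  have hv := sub_te_val n k (by omega)
  rw [mid_eq, pt_sub n k (by omega), sub_add_cancel]
  · intro i hi
    rw [hv, if_neg hi]; exact hn i hi
  · rw [hv, if_pos rfl]; omega

/-- In the cube the operator on the periodic mesh is the given one. -/
theorem ellip_ext {u : E d → ℝ} (hu : ∀ x ∈ cubeBdry d N, u x = 0) {n : Torus d N}
    (hn : pt n ∈ cube d) :
    ellip (te d N) (tcoeff N σ) (ext N u) n =
      meshSize N ^ 2 * laplacian (meshSize N) σ u (pt n) := by
  have h0 := meshSize_pos N
  have hv := pt_mem_cube_iff.1 hn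
  rw [ellip, laplacian, Finset.mul_sum]
  refine Finset.sum_congr rfl fun k _ => ?_
  rw [ext_of_mem_closure hu (closed_add hn k), ext_of_mem_closure hu (closed_sub hn k),
    ext_of_mem hn, tcoeff, tcoeff, mid_eq (fun i _ => hv i) ⟨(hv k).1.le, (hv k).2⟩,
    mid_sub_eq (fun i _ => hv i) ⟨(hv k).1, (hv k).2.le⟩,
    pt_add n k (by have := (hv k).2; omega), pt_sub n k (by have := (hv k).1; omega)]
  simp only [D, add_sub_cancel_right, sub_add_cancel]
  field_simp

end TorusCoefficients

/-! ### Membership in the mesh operations -/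

section Star

variable {d : ℕ}

theorem mem_star_iff {h : ℝ} {k : Fin d} {W : Finset (E d)} {x : E d} :
    x ∈ star h k W ↔ x - halfStep h k ∈ W ∨ x + halfStep h k ∈ W := by
  classical
  unfold star
  simp only [Finset.mem_union, Finset.mem_image]
  refine or_congr ⟨?_, fun hx => ⟨_, hx, sub_add_cancel _ _⟩⟩
    ⟨?_, fun hx => ⟨_, hx, add_sub_cancel_right _ _⟩⟩
  · rintro ⟨y, hy, rfl⟩; rwa [add_sub_cancel_right]
  · rintro ⟨y, hy, rfl⟩; rwa [sub_add_cancel]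

theorem mem_closureDir_iff {h : ℝ} {k : Fin d} {W : Finset (E d)} {x : E d} :
    x ∈ closureDir h k W ↔ x - halfStep h k - halfStep h k ∈ W ∨ x ∈ W ∨
      x + halfStep h k + halfStep h k ∈ W := by
  rw [closureDir, mem_star_iff, mem_star_iff, mem_star_iff, sub_add_cancel, add_sub_cancel_right]
  tauto

theorem mem_bdryDir_iff {h : ℝ} {k : Fin d} {W : Finset (E d)} {x : E d} :
    x ∈ bdryDir h k W ↔ x ∈ closureDir h k W ∧ x ∉ W := by
  classical
  unfold bdryDir
  rw [Finset.mem_sdiff]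

theorem mem_meshClosure_iff {h : ℝ} {W : Finset (E d)} {x : E d} :
    x ∈ meshClosure h W ↔ ∃ k j, j ≠ k ∧
      (x - halfStep h j - halfStep h j ∈ closureDir h k W ∨
        x + halfStep h j + halfStep h j ∈ closureDir h k W) := by
  classical
  unfold meshClosure
  simp only [Finset.mem_biUnion, Finset.mem_univ, true_and, Finset.mem_erase, Finset.mem_union,
    Finset.mem_image, and_true, two_smul]
  refine exists_congr fun k => exists_congr fun j => and_congr Iff.rfl (or_congr ?_ ?_)
  · constructor
    · rintro ⟨y, hy, rfl⟩
      rwa [sub_sub, add_sub_cancel_right]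
    · exact fun hx => ⟨_, hx, by abel⟩
  · constructor
    · rintro ⟨y, hy, rfl⟩
      rwa [add_assoc, sub_add_cancel]
    · exact fun hx => ⟨_, hx, by abel⟩

theorem halfStep_ne {h : ℝ} {k i : Fin d} (hik : i ≠ k) : halfStep h k i = 0 := by
  rw [halfStep_apply, if_neg hik]

theorem halfStep_self (h : ℝ) (k : Fin d) : halfStep h k k = h / 2 := by
  rw [halfStep_apply, if_pos rfl]

end Star

/-! ### The discrete normal derivative as a surface source -/

section Face

variable {d N : ℕ}

theorem mem_cube_of_mem_cubeMesh {x : E d} (hx : x ∈ cubeMesh d N) : x ∈ cube d :=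
  (mem_sample.1 hx).2

/-- Moving in direction `k` does not change the coordinate `j`, so the stencil never reaches the
open cube. -/
theorem normal_eq_zero {x : E d} {j k : Fin d} (hkj : j ≠ k) (hx : x j = 0 ∨ x j = 1) (h : ℝ) :
    normal h k (cubeMesh d N) x = 0 := by
  have key : ∀ y ∈ cubeMesh d N, y j ≠ 0 ∧ y j ≠ 1 := fun y hy =>
    ⟨((mem_cube_of_mem_cubeMesh hy) j).1.ne', ((mem_cube_of_mem_cubeMesh hy) j).2.ne⟩
  unfold normal
  rw [if_neg]
  rw [mem_bdryDir_iff, mem_closureDir_iff]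
  rintro ⟨h1, -⟩
  rcases h1 with h1 | h1 | h1 <;> have := key _ h1 <;>
    simp only [PiLp.sub_apply, PiLp.add_apply, halfStep_ne hkj, sub_zero, add_zero] at this <;> tauto

theorem normal_eq_neg_one {n : Torus d N} {j : Fin d} (hj : (n j).val = N + 1)
    (hn : pt (n + te d N j) ∈ cube d) : normal (meshSize N) j (cubeMesh d N) (pt n) = -1 := by
  have h0 := meshSize_pos N
  have hx : pt n j = 0 := by rw [pt_apply, pos_eq_zero_iff]; exact hj
  have hlt : (n j).val + 1 < 3 * N + 3 := by
    have := (pt_mem_cube_iff.1 hn j).2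
    have h2 : N ≠ 0 := by
      rintro rfl
      have := pt_mem_cube_iff.1 hn j
      omega
    omega
  have hmem : pt n + halfStep (meshSize N) j + halfStep (meshSize N) j ∈ cubeMesh d N := by
    rw [← pt_add n j hlt]; exact pt_mem_cubeMesh hn
  have hnot : ∀ y : E d, y j ≤ 0 → y ∉ cubeMesh d N := fun y hy hmem =>
    absurd ((mem_cube_of_mem_cubeMesh hmem) j).1 (not_lt.2 hy)
  have hstar : pt n - halfStep (meshSize N) j ∉ star (meshSize N) j (cubeMesh d N) := by
    rw [mem_star_iff, sub_add_cancel]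
    rintro (h | h)
    · refine hnot _ ?_ h
      simp only [PiLp.sub_apply, halfStep_self, hx]; linarith
    · exact hnot _ hx.le h
  unfold normal
  rw [if_pos, if_neg, if_pos]
  · exact ⟨hstar, mem_star_iff.2 (Or.inr hmem)⟩
  · exact fun h => hstar h.1
  · rw [mem_bdryDir_iff, mem_closureDir_iff]
    exact ⟨Or.inr (Or.inr hmem), hnot _ hx.le⟩

theorem normal_eq_one {n : Torus d N} {j : Fin d} (hj : (n j).val = 2 * N + 2)
    (hn : pt (n - te d N j) ∈ cube d) : normal (meshSize N) j (cubeMesh d N) (pt n) = 1 := by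
  have h0 := meshSize_pos N
  have hx : pt n j = 1 := by rw [pt_apply, pos_eq_one_iff]; exact hj
  have hmem : pt n - halfStep (meshSize N) j - halfStep (meshSize N) j ∈ cubeMesh d N := by
    rw [← pt_sub n j (by omega)]; exact pt_mem_cubeMesh hn
  have hnot : ∀ y : E d, 1 ≤ y j → y ∉ cubeMesh d N := fun y hy hmem =>
    absurd ((mem_cube_of_mem_cubeMesh hmem) j).2 (not_lt.2 hy)
  have hstar : pt n + halfStep (meshSize N) j ∉ star (meshSize N) j (cubeMesh d N) := by
    rw [mem_star_iff, add_sub_cancel_right]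
    rintro (h | h)
    · exact hnot _ hx.ge h
    · refine hnot _ ?_ h
      simp only [PiLp.add_apply, halfStep_self, hx]; linarith
  unfold normal
  rw [if_pos, if_pos]
  · exact ⟨mem_star_iff.2 (Or.inl hmem), hstar⟩
  · rw [mem_bdryDir_iff, mem_closureDir_iff]
    exact ⟨Or.inl hmem, hnot _ hx.ge⟩

theorem ext_of_coord {u : E d → ℝ} {n : Torus d N} (j : Fin d)
    (hj : (n j).val ≤ N + 1 ∨ 2 * N + 2 ≤ (n j).val) : ext N u n = 0 :=
  ext_of_notMem fun h => by have := pt_mem_cube_iff.1 h j; omega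

/-- On a face the extended solution has the normal derivative as its source. -/
theorem ellip_ext_face {σ : Fin d → E d → ℝ} {u : E d → ℝ} (hu : ∀ x ∈ cubeBdry d N, u x = 0)
    (hN : 1 ≤ N) {n : Torus d N} {j : Fin d}
    (hn : ∀ i, i ≠ j → N + 1 < (n i).val ∧ (n i).val < 2 * N + 2)
    (hj : (n j).val = N + 1 ∨ (n j).val = 2 * N + 2) :
    ellip (te d N) (tcoeff N σ) (ext N u) n =
      -(meshSize N * normalDeriv (meshSize N) (cubeMesh d N) σ u (pt n)) := by
  have h0 := meshSize_pos N
  have hux : u (pt n) = 0 := by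
    rw [← ext_of_mem_closure hu (n := n), ext_of_coord j (by omega)]
    intro k
    by_cases hk : k = j
    · subst hk; omega
    · have := hn k hk; omega
  have hxj : pt n j = 0 ∨ pt n j = 1 := by
    rw [pt_apply, pos_eq_zero_iff, pos_eq_one_iff]; exact hj
  have hun : ext N u n = 0 := ext_of_coord j (by omega)
  -- Tangential neighbours stay on the hyperplane of the face, where the extension is zero. In
  -- direction `j` only the inner neighbour contributes; two undivided differences against one
  -- divided difference give the factor `h`.
  rw [ellip, normalDeriv, Finset.sum_eq_single j, Finset.sum_eq_single j]
  · rcases hj with hj | hj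
    · have hadd := add_te_val n j (by omega)
      have hcube : pt (n + te d N j) ∈ cube d := by
        rw [pt_mem_cube_iff]
        intro k
        rw [hadd]
        split_ifs with hk
        · subst hk; omega
        · exact hn k hk
      have hsub : ext N u (n - te d N j) = 0 := ext_of_coord j (by
        rw [sub_te_val n j (by omega)]; omega)
      rw [normal_eq_neg_one hj hcube, hun, hsub, ext_of_mem hcube, tcoeff, mid_eq hn (by omega),
        pt_add n j (by omega), trace, normal_eq_neg_one hj hcube]
      rw [if_neg (by norm_num), if_pos rfl, D, add_sub_cancel_right, hux]
      field_simp
      ring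
    · have hsub := sub_te_val n j (by omega)
      have hcube : pt (n - te d N j) ∈ cube d := by
        rw [pt_mem_cube_iff]
        intro k
        rw [hsub]
        split_ifs with hk
        · subst hk; omega
        · exact hn k hk
      have hadd : ext N u (n + te d N j) = 0 := ext_of_coord j (by
        rw [add_te_val n j (by omega)]; omega)
      rw [normal_eq_one hj hcube, hun, hadd, ext_of_mem hcube, tcoeff, tcoeff,
        mid_sub_eq hn (by omega), pt_sub n j (by omega), trace, normal_eq_one hj hcube]
      rw [if_pos rfl, D, sub_add_cancel, hux]
      field_simp
      ring
  · intro k _ hk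
    rw [normal_eq_zero hk.symm hxj, mul_zero]
  · simp
  · intro k _ hk
    have e1 : (n + te d N k) j = n j := by simp [te, hk.symm]
    have e2 : (n - te d N k) j = n j := by simp [te, hk.symm]
    rw [hun, ext_of_coord (n := n + te d N k) j (by rw [e1]; omega),
      ext_of_coord (n := n - te d N k) j (by rw [e2]; omega)]
    ring
  · simp

end Face

/-! ### Discrete `H¹` norms compared with undivided energies -/

section Norms

theorem sum_le_sum_of_injective {α β : Type*} [Fintype α] {φ : α → β} (hφ : Function.Injective φ)
    {t : Finset β} {F : α → ℝ} {G : β → ℝ} (hG : ∀ x ∈ t, 0 ≤ G x)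
    (h : ∀ a, F a = 0 ∨ (φ a ∈ t ∧ F a ≤ G (φ a))) : ∑ a, F a ≤ ∑ x ∈ t, G x := by
  classical
  have h1 : ∀ a, F a ≠ 0 → φ a ∈ t ∧ F a ≤ G (φ a) := fun a ha => (h a).resolve_left ha
  rw [← Finset.sum_filter_ne_zero]
  calc ∑ a with F a ≠ 0, F a ≤ ∑ a with F a ≠ 0, G (φ a) :=
        Finset.sum_le_sum fun a ha => (h1 a (Finset.mem_filter.1 ha).2).2
    _ = ∑ x ∈ (Finset.univ.filter fun a => F a ≠ 0).image φ, G x :=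
        (Finset.sum_image fun a _ b _ hab => hφ hab).symm
    _ ≤ _ := by
        refine Finset.sum_le_sum_of_subset_of_nonneg ?_ fun x hx _ => hG x hx
        intro x hx
        obtain ⟨a, ha, rfl⟩ := Finset.mem_image.1 hx
        exact (h1 a (Finset.mem_filter.1 ha).2).1

theorem sum_le_sum_indicator {α β : Type*} [Fintype α] (φ : α → β) {t : Finset β} {F : α → ℝ}
    {G : β → ℝ} {S : Set α} (hF : ∀ a, 0 ≤ F a)
    (h : ∀ x ∈ t, ∃ a ∈ S, φ a = x ∧ G x ≤ F a) : ∑ x ∈ t, G x ≤ ∑ a, S.indicator F a := by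
  classical
  rcases t.eq_empty_or_nonempty with rfl | ⟨x₀, hx₀⟩
  · simpa using Finset.sum_nonneg fun a _ => Set.indicator_nonneg (fun a _ => hF a) a
  have : Nonempty α := ⟨(h x₀ hx₀).choose⟩
  choose! ψ hψS hψ hG using h
  calc ∑ x ∈ t, G x ≤ ∑ x ∈ t, S.indicator F (ψ x) := Finset.sum_le_sum fun x hx => by
        rw [Set.indicator_of_mem (hψS x hx)]; exact hG x hx
    _ = ∑ a ∈ t.image ψ, S.indicator F a := by
        refine (Finset.sum_image fun a ha b hb hab => ?_).symm
        rw [← hψ a ha, ← hψ b hb, hab]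
    _ ≤ _ := Finset.sum_le_sum_of_subset_of_nonneg (Finset.subset_univ _) fun a _ _ =>
        Set.indicator_nonneg (fun a _ => hF a) a

variable {d N : ℕ}

/-- The closure is built from translated sets only, so membership of a point requires an interior
neighbour in some direction. For `N ≥ 2` one of the two neighbours in any direction is interior. -/
theorem cubeMesh_subset_meshClosure (hd : 2 ≤ d) (hN : 2 ≤ N) :
    cubeMesh d N ⊆ meshClosure (meshSize N) (cubeMesh d N) := by
  intro x hx
  obtain ⟨n, rfl⟩ := exists_pt_of_mem_grid (mem_sample.1 hx).1
  have hv := pt_mem_cube_iff.1 (mem_cube_of_mem_cubeMesh hx)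
  rw [mem_meshClosure_iff]
  refine ⟨⟨0, by omega⟩, ⟨1, by omega⟩, by simp, ?_⟩
  set j : Fin d := ⟨1, by omega⟩
  have hj := hv j
  by_cases hc : (n j).val + 1 < 2 * N + 2
  · right
    rw [← pt_add n j (by omega)]
    refine subset_closureDir _ _ _ (pt_mem_cubeMesh (pt_mem_cube_iff.2 fun k => ?_))
    rw [add_te_val n j (by omega)]
    have := hv k
    split_ifs with hk
    · subst hk; omega
    · omega
  · left
    rw [← pt_sub n j (by omega)]
    refine subset_closureDir _ _ _ (pt_mem_cubeMesh (pt_mem_cube_iff.2 fun k => ?_))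
    rw [sub_te_val n j (by omega)]
    have := hv k
    split_ifs with hk
    · subst hk; omega
    · omega

/-- An edge with one end in the open cube has both ends in the closed cube, where the extension and
`u` agree. Its midpoint belongs to the dual mesh over which the `H¹` norm sums. -/
theorem fd_ext {u : E d → ℝ} (hu : ∀ x ∈ cubeBdry d N, u x = 0) {n : Torus d N} {k : Fin d}
    (h : pt n ∈ cube d ∨ pt (n + te d N k) ∈ cube d) :
    fd (te d N k) (ext N u) n = meshSize N * D (meshSize N) k u (pt n + halfStep (meshSize N) k) ∧
      pt n + halfStep (meshSize N) k ∈ star (meshSize N) k (cubeMesh d N) := by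
  have h0 := meshSize_pos N
  have hboth : (∀ i, N + 1 ≤ (n i).val ∧ (n i).val ≤ 2 * N + 2) ∧
      (∀ i, N + 1 ≤ ((n + te d N k) i).val ∧ ((n + te d N k) i).val ≤ 2 * N + 2) ∧
      (n k).val + 1 < 3 * N + 3 := by
    rcases h with h | h
    · have hv := pt_mem_cube_iff.1 h
      exact ⟨fun i => ⟨(hv i).1.le, (hv i).2.le⟩, closed_add h k, by have := (hv k).2; omega⟩
    · have hv := pt_mem_cube_iff.1 h
      have h1 := closed_sub h k
      rw [add_sub_cancel_right] at h1
      refine ⟨h1, fun i => ⟨(hv i).1.le, (hv i).2.le⟩, ?_⟩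
      have h2 := sub_te_val (n + te d N k) k (by have := (hv k).1; omega) k
      rw [add_sub_cancel_right, if_pos rfl] at h2
      have := (hv k).2
      omega
  obtain ⟨h1, h2, h3⟩ := hboth
  constructor
  · rw [fd, ext_of_mem_closure hu h1, ext_of_mem_closure hu h2, D, add_sub_cancel_right,
      pt_add n k h3]
    field_simp
  · rw [mem_star_iff, add_sub_cancel_right, ← pt_add n k h3]
    exact h.imp pt_mem_cubeMesh pt_mem_cubeMesh

theorem normH1_sq (h : ℝ) (hh : 0 ≤ h) (W : Finset (E d)) (u : E d → ℝ) :
    normH1 h W u ^ 2 =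
      h ^ d * (∑ x ∈ meshClosure h W, |u x| ^ 2 + ∑ k, ∑ x ∈ star h k W, |D h k u x| ^ 2) := by
  rw [normH1, Real.sq_sqrt]
  · simp only [sqNormL2, ← Finset.mul_sum, ← mul_add]
  · refine add_nonneg ?_ (Finset.sum_nonneg fun k _ => ?_) <;>
      exact mul_nonneg (by positivity) (Finset.sum_nonneg fun _ _ => by positivity)

/-- The energy of the extension is bounded by the discrete `H¹` norm. -/
theorem sum_en_ext_le (hd : 2 ≤ d) (hN : 2 ≤ N) {u : E d → ℝ}
    (hu : ∀ x ∈ cubeBdry d N, u x = 0) :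
    meshSize N ^ d * ∑ n, en (meshSize N) (te d N) (ext N u) n ≤
      meshSize N ^ 2 * normH1 (meshSize N) (cubeMesh d N) u ^ 2 := by
  have h0 := meshSize_pos N
  rw [normH1_sq _ h0.le]
  have h1 : ∑ n, ext N u n ^ 2 ≤ ∑ x ∈ meshClosure (meshSize N) (cubeMesh d N), |u x| ^ 2 := by
    refine sum_le_sum_of_injective pt_injective (fun x _ => by positivity) fun n => ?_
    by_cases hn : pt n ∈ cube d
    · right
      refine ⟨cubeMesh_subset_meshClosure hd hN (pt_mem_cubeMesh hn), ?_⟩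
      rw [ext_of_mem hn, sq_abs]
    · left; rw [ext_of_notMem hn]; norm_num
  have h2 : ∀ k, ∑ n, fd (te d N k) (ext N u) n ^ 2 ≤
      meshSize N ^ 2 * ∑ x ∈ star (meshSize N) k (cubeMesh d N), |D (meshSize N) k u x| ^ 2 := by
    intro k
    rw [Finset.mul_sum]
    refine sum_le_sum_of_injective (φ := fun n => pt n + halfStep (meshSize N) k)
      (fun a b hab => pt_injective (add_right_cancel hab)) (fun x _ => by positivity) fun n => ?_
    by_cases hn : pt n ∈ cube d ∨ pt (n + te d N k) ∈ cube d
    · right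
      obtain ⟨e1, e2⟩ := fd_ext hu hn
      refine ⟨e2, ?_⟩
      rw [e1, sq_abs, mul_pow]
    · left
      rw [not_or] at hn
      rw [fd, ext_of_notMem hn.1, ext_of_notMem hn.2]; norm_num
  have h3 : ∑ n, en (meshSize N) (te d N) (ext N u) n =
      meshSize N ^ 2 * ∑ n, ext N u n ^ 2 + ∑ k, ∑ n, fd (te d N k) (ext N u) n ^ 2 := by
    simp only [en, Finset.sum_add_distrib, Finset.mul_sum]
    rw [Finset.sum_comm]
  rw [h3]
  have h4 := Finset.sum_le_sum fun k (_ : k ∈ Finset.univ) => h2 k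
  rw [← Finset.mul_sum] at h4
  calc _ ≤ meshSize N ^ d * (meshSize N ^ 2 * ∑ x ∈ meshClosure (meshSize N) (cubeMesh d N),
          |u x| ^ 2 + meshSize N ^ 2 * ∑ k, ∑ x ∈ star (meshSize N) k (cubeMesh d N),
          |D (meshSize N) k u x| ^ 2) := by gcongr
    _ = _ := by ring

/-- A compact neighbourhood of the shell in the collar. -/
def shellNhd (d : ℕ) (ϱ : ℝ) : Set (Fin d → ℝ) :=
  {x | (∀ k, ϱ / 2 ≤ x k ∧ x k ≤ 1 - ϱ / 2) ∧ ∃ k, x k ≤ 4 * ϱ ∨ 1 - x k ≤ 4 * ϱ}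

theorem isCompact_shellNhd (d : ℕ) (ϱ : ℝ) : IsCompact (shellNhd d ϱ) := by
  have h1 : shellNhd d ϱ = (Set.univ.pi fun _ => Set.Icc (ϱ / 2) (1 - ϱ / 2)) ∩
      ⋃ k, {x : Fin d → ℝ | x k ≤ 4 * ϱ ∨ 1 - x k ≤ 4 * ϱ} := by
    ext x; simp [shellNhd, Pi.le_def, forall_and]
  rw [h1]
  refine (isCompact_univ_pi fun _ => isCompact_Icc).inter_right
    (isClosed_iUnion_of_finite fun k => ?_)
  exact (isClosed_le (continuous_apply k) continuous_const).union
    (isClosed_le (continuous_const.sub (continuous_apply k)) continuous_const)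

theorem mem_cube_of_mem_shellNhd {ϱ : ℝ} (hϱ : 0 < ϱ) {n : Torus d N}
    (hn : pos N n ∈ shellNhd d ϱ) : pt n ∈ cube d := fun k => by
  have := hn.1 k
  rw [pt_apply]
  constructor <;> linarith [this.1, this.2]

theorem shell_coords (hd : 0 < d) {ϱ : ℝ} {x : E d} (hx : x ∈ shell d ϱ (3 * ϱ)) :
    (∀ k, ϱ ≤ x k ∧ x k ≤ 1 - ϱ) ∧ ∃ k, x k < 3 * ϱ ∨ 1 - x k < 3 * ϱ := by
  obtain ⟨hc, h1, h2⟩ := hx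
  refine ⟨fun k => ⟨?_, ?_⟩, exists_coord_of_infDist_lt hd hc h2⟩
  · have := infDist_frontier_le hc k (Or.inl rfl)
    rw [sub_zero, abs_of_pos (hc k).1] at this
    linarith
  · have := infDist_frontier_le hc k (Or.inr rfl)
    rw [abs_sub_comm, abs_of_pos (by linarith [(hc k).2])] at this
    linarith

/-- `n` lies within `c` steps of the shell. -/
def NearShell (ϱ c : ℝ) (n : Torus d N) : Prop :=
  (∀ k, ϱ - c * meshSize N ≤ pos N n k ∧ pos N n k ≤ 1 - ϱ + c * meshSize N) ∧
    ∃ k, pos N n k < 3 * ϱ + c * meshSize N ∨ 1 - pos N n k < 3 * ϱ + c * meshSize N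

theorem NearShell.mem_shellNhd {ϱ c : ℝ} {n : Torus d N} (hn : NearShell ϱ c n)
    (hc : c * meshSize N ≤ ϱ / 2) : pos N n ∈ shellNhd d ϱ := by
  have h0 := meshSize_pos N
  obtain ⟨h1, k, h2⟩ := hn
  refine ⟨fun k => ⟨by linarith [(h1 k).1], by linarith [(h1 k).2]⟩, k, ?_⟩
  rcases h2 with h2 | h2
  · left
    have := (h1 k).1
    linarith
  · right
    have := (h1 k).2
    linarith

theorem NearShell.of_step {ϱ c t : ℝ} {n n' : Torus d N} {k : Fin d} (hn : NearShell ϱ c n)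
    (ht : |t| ≤ meshSize N) (h : pos N n' = step t k (pos N n)) : NearShell ϱ (c + 1) n' := by
  have h0 := meshSize_pos N
  rw [abs_le] at ht
  obtain ⟨h1, j, h2⟩ := hn
  have h3 : ∀ i, pos N n i - meshSize N ≤ pos N n' i ∧ pos N n' i ≤ pos N n i + meshSize N := by
    intro i
    rw [h, step]
    split_ifs <;> constructor <;> linarith
  refine ⟨fun i => ⟨?_, ?_⟩, j, ?_⟩
  · linarith [(h1 i).1, (h3 i).1]
  · linarith [(h1 i).2, (h3 i).2]
  · refine h2.imp (fun h => ?_) (fun h => ?_)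
    · linarith [(h3 j).2]
    · linarith [(h3 j).1]

theorem NearShell.add {ϱ c : ℝ} (hϱ : 0 < ϱ) {n : Torus d N} (hn : NearShell ϱ c n)
    (hc : c * meshSize N ≤ ϱ / 2) (k : Fin d) :
    pt (n + te d N k) = pt n + halfStep (meshSize N) k + halfStep (meshSize N) k ∧
      NearShell ϱ (c + 1) (n + te d N k) := by
  have hv := pt_mem_cube_iff.1 (mem_cube_of_mem_shellNhd hϱ (hn.mem_shellNhd hc)) k
  exact ⟨pt_add n k (by omega), hn.of_step (abs_of_pos (meshSize_pos N)).le (pos_add n k (by omega))⟩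

theorem NearShell.sub {ϱ c : ℝ} (hϱ : 0 < ϱ) {n : Torus d N} (hn : NearShell ϱ c n)
    (hc : c * meshSize N ≤ ϱ / 2) (k : Fin d) :
    pt (n - te d N k) = pt n - halfStep (meshSize N) k - halfStep (meshSize N) k ∧
      NearShell ϱ (c + 1) (n - te d N k) := by
  have hv := pt_mem_cube_iff.1 (mem_cube_of_mem_shellNhd hϱ (hn.mem_shellNhd hc)) k
  exact ⟨pt_sub n k (by omega), hn.of_step
    (by rw [abs_neg]; exact (abs_of_pos (meshSize_pos N)).le) (pos_sub n k (by omega))⟩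

theorem NearShell.mono {ϱ c c' : ℝ} (h : c ≤ c') {n : Torus d N} (hn : NearShell ϱ c n) :
    NearShell ϱ c' n := by
  have : c * meshSize N ≤ c' * meshSize N := mul_le_mul_of_nonneg_right h (meshSize_pos N).le
  obtain ⟨h1, k, h2⟩ := hn
  exact ⟨fun k => ⟨by linarith [(h1 k).1], by linarith [(h1 k).2]⟩, k,
    h2.imp (fun h => by linarith) (fun h => by linarith)⟩

theorem exists_nearShell (hd : 0 < d) {ϱ : ℝ} {x : E d} (hx : x ∈ sample N (shell d ϱ (3 * ϱ))) :
    ∃ n : Torus d N, pt n = x ∧ NearShell ϱ 0 n := by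
  obtain ⟨hg, hs⟩ := mem_sample.1 hx
  obtain ⟨n, rfl⟩ := exists_pt_of_mem_grid hg
  obtain ⟨h1, k, h2⟩ := shell_coords hd hs
  simp only [pt_apply] at h1 h2
  exact ⟨n, rfl, fun k => ⟨by linarith [(h1 k).1], by linarith [(h1 k).2]⟩, k, by
    rw [zero_mul, add_zero]; exact h2⟩

theorem exists_nearShell_closureDir (hd : 0 < d) {ϱ : ℝ} (hϱ : 0 < ϱ) {x : E d} {k : Fin d}
    (hx : x ∈ closureDir (meshSize N) k (sample N (shell d ϱ (3 * ϱ)))) :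
    ∃ n : Torus d N, pt n = x ∧ NearShell ϱ 1 n := by
  rcases mem_closureDir_iff.1 hx with h | h | h <;> obtain ⟨n, hn, hs⟩ := exists_nearShell hd h
  · obtain ⟨h1, h2⟩ := hs.add hϱ (by linarith) k
    exact ⟨_, by rw [h1, hn]; abel, h2.mono (by norm_num)⟩
  · exact ⟨n, hn, hs.mono (by norm_num)⟩
  · obtain ⟨h1, h2⟩ := hs.sub hϱ (by linarith) k
    exact ⟨_, by rw [h1, hn]; abel, h2.mono (by norm_num)⟩

/-- The discrete `H¹` norm on the shell is bounded by the energy near the shell. -/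
theorem normH1_shell_le (hd : 0 < d) {ϱ : ℝ} (hϱ : 0 < ϱ) (hh : 2 * meshSize N ≤ ϱ / 2)
    {u : E d → ℝ} (hu : ∀ x ∈ cubeBdry d N, u x = 0) :
    meshSize N ^ 2 * normH1 (meshSize N) (sample N (shell d ϱ (3 * ϱ))) u ^ 2 ≤
      meshSize N ^ d * enOn (shellNhd d ϱ) (ext N u) := by
  have h0 := meshSize_pos N
  set K := {n : Torus d N | pos N n ∈ shellNhd d ϱ} with hK
  rw [normH1_sq _ h0.le]
  have h1 : ∑ x ∈ meshClosure (meshSize N) (sample N (shell d ϱ (3 * ϱ))), |u x| ^ 2 ≤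
      ∑ n, K.indicator (fun n => ext N u n ^ 2) n := by
    refine sum_le_sum_indicator pt (fun n => sq_nonneg _) fun x hx => ?_
    -- The discrete closure reaches two steps beyond the sampled shell: one in direction `k` and one
    -- in direction `j`.
    obtain ⟨n, hn, hs⟩ : ∃ n : Torus d N, pt n = x ∧ NearShell ϱ 2 n := by
      obtain ⟨k, j, -, h | h⟩ := mem_meshClosure_iff.1 hx <;>
        obtain ⟨n, hn, hs⟩ := exists_nearShell_closureDir hd hϱ h
      · obtain ⟨h1, h2⟩ := hs.add hϱ (by linarith) j
        exact ⟨_, by rw [h1, hn]; abel, h2.mono (by norm_num)⟩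
      · obtain ⟨h1, h2⟩ := hs.sub hϱ (by linarith) j
        exact ⟨_, by rw [h1, hn]; abel, h2.mono (by norm_num)⟩
    have hmem := hs.mem_shellNhd hh
    refine ⟨n, hmem, hn, ?_⟩
    rw [ext_of_mem (mem_cube_of_mem_shellNhd hϱ hmem), hn, sq_abs]
  have h2 : ∀ k, meshSize N ^ 2 * ∑ x ∈ star (meshSize N) k (sample N (shell d ϱ (3 * ϱ))),
      |D (meshSize N) k u x| ^ 2 ≤ ∑ n, K.indicator (fun n => fd (te d N k) (ext N u) n ^ 2) n := by
    intro k
    rw [Finset.mul_sum]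
    refine sum_le_sum_indicator (fun n => pt n + halfStep (meshSize N) k) (fun n => sq_nonneg _)
      fun x hx => ?_
    obtain ⟨n, hn, hs⟩ : ∃ n : Torus d N, pt n + halfStep (meshSize N) k = x ∧
        NearShell ϱ 1 n := by
      rcases mem_star_iff.1 hx with h | h <;> obtain ⟨n, hn, hs⟩ := exists_nearShell hd h
      · exact ⟨n, by rw [hn]; abel, hs.mono (by norm_num)⟩
      · obtain ⟨h1, h2⟩ := hs.sub hϱ (by linarith) k
        exact ⟨_, by rw [h1, hn]; abel, h2.mono (by norm_num)⟩
    have hmem := hs.mem_shellNhd (by linarith)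
    refine ⟨n, hmem, hn, ?_⟩
    rw [(fd_ext hu (Or.inl (mem_cube_of_mem_shellNhd hϱ hmem))).1, hn, sq_abs, mul_pow]
  have h3 : enOn (shellNhd d ϱ) (ext N u) = meshSize N ^ 2 *
      ∑ n, K.indicator (fun n => ext N u n ^ 2) n +
      ∑ k, ∑ n, K.indicator (fun n => fd (te d N k) (ext N u) n ^ 2) n := by
    rw [enOn, Finset.sum_comm, Finset.mul_sum, ← Finset.sum_add_distrib]
    refine Finset.sum_congr rfl fun n _ => ?_
    by_cases hn : n ∈ K
    · simp only [← hK, Set.indicator_of_mem hn, en]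
    · simp only [← hK, Set.indicator_of_notMem hn, mul_zero, Finset.sum_const_zero, add_zero]
  rw [h3]
  have h4 := Finset.sum_le_sum fun k (_ : k ∈ Finset.univ) => h2 k
  rw [← Finset.mul_sum] at h4
  calc _ = meshSize N ^ d * (meshSize N ^ 2 *
        ∑ x ∈ meshClosure (meshSize N) (sample N (shell d ϱ (3 * ϱ))), |u x| ^ 2 +
        meshSize N ^ 2 * ∑ k, ∑ x ∈ star (meshSize N) k (sample N (shell d ϱ (3 * ϱ))),
          |D (meshSize N) k u x| ^ 2) := by ring
    _ ≤ _ := by gcongr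

end Norms

/-! ### A ball through the observed face and the region of propagation -/

section Patch

variable {d : ℕ}

theorem convex_eball (y : Fin d → ℝ) (s : ℝ) : Convex ℝ (eball y s) := by
  intro x hx z hz a b ha hb hab
  change ∑ k, (x k - y k) ^ 2 < s at hx
  change ∑ k, (z k - y k) ^ 2 < s at hz
  change ∑ k, ((a • x + b • z) k - y k) ^ 2 < s
  have h1 : ∑ k, ((a • x + b • z) k - y k) ^ 2 ≤
      ∑ k, (a * (x k - y k) ^ 2 + b * (z k - y k) ^ 2) := by
    refine Finset.sum_le_sum fun k _ => ?_
    simp only [Pi.add_apply, Pi.smul_apply, smul_eq_mul]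
    obtain rfl : b = 1 - a := by linarith
    nlinarith [mul_nonneg (mul_nonneg ha hb) (sq_nonneg (x k - z k))]
  rw [Finset.sum_add_distrib, ← Finset.mul_sum, ← Finset.mul_sum] at h1
  refine lt_of_le_of_lt h1 ?_
  rcases eq_or_lt_of_le ha with h | h
  · obtain rfl : b = 1 := by linarith
    rw [← h]; linarith
  · have := mul_lt_mul_of_pos_left hx h
    have := mul_le_mul_of_nonneg_left hz.le hb
    have : s = a * s + b * s := by rw [← add_mul, hab, one_mul]
    linarith

theorem step_mem_eball {c s : ℝ} (hc : c ^ 2 < s) (j : Fin d) (p : Fin d → ℝ) :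
    step c j p ∈ eball p s := by
  change ∑ k, (step c j p k - p k) ^ 2 < s
  have : ∀ k, (step c j p k - p k) ^ 2 = if k = j then c ^ 2 else 0 := by
    intro k; simp only [step, add_sub_cancel_left]; split_ifs <;> ring
  simp only [this, Finset.sum_ite_eq', Finset.mem_univ, if_true]
  exact hc

/-- The coordinate of the face. -/
def side (b : Bool) : ℝ := if b then 1 else 0

/-- A ball centred on the face `x_j = side b`, away from the other faces, which meets the boundary
inside the set `U`. -/
structure FacePatch (U : Set (E d)) (δ : ℝ) (j : Fin d) (b : Bool) (p : Fin d → ℝ) (r : ℝ) :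
    Prop where
  r_pos : 0 < r
  center : p j = side b
  mem : ∀ x ∈ eball p r, WithLp.toLp 2 x ∈ U
  inside : ∀ x ∈ eball p r, ∀ k, k ≠ j → 0 < x k ∧ x k < 1
  near : ∀ x ∈ eball p r, |x j - side b| < δ

/-- The given boundary point may lie on an edge of the cube. Sliding it slightly towards the centre
of its face keeps it in the open set and moves all other coordinates strictly inside `(0, 1)`. -/
theorem exists_facePatch {U : Set (E d)} (hU : IsOpen U)
    (hne : (U ∩ frontier (cube d)).Nonempty) {δ : ℝ} (hδ : 0 < δ) :
    ∃ j b p r, FacePatch U δ j b p r := by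
  obtain ⟨γ, hγU, hγ⟩ := hne
  obtain ⟨j, hj⟩ := exists_coord_of_mem_frontier hγ
  obtain ⟨b, hb⟩ : ∃ b, γ j = side b := by
    rcases hj with h | h
    · exact ⟨false, by simp [side, h]⟩
    · exact ⟨true, by simp [side, h]⟩
  rw [mem_frontier_cube_iff] at hγ
  set path : ℝ → Fin d → ℝ := fun t k => if k = j then γ k else γ k + t * (1 / 2 - γ k) with hpath
  have hcont : Continuous fun t => (WithLp.toLp 2 (path t) : E d) := by
    refine (PiLp.continuous_toLp 2 (fun _ : Fin d => ℝ)).comp (continuous_pi fun k => ?_)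
    by_cases hk : k = j
    · simp only [hpath, hk, if_true]; exact continuous_const
    · simp only [hpath, hk, if_false]; fun_prop
  have hp0 : (WithLp.toLp 2 (path 0) : E d) = γ := by
    ext k
    simp [hpath]
  have hev : ∀ᶠ t in nhdsWithin (0 : ℝ) (Set.Ioi 0), (WithLp.toLp 2 (path t) : E d) ∈ U :=
    (hcont.tendsto 0).mono_left nhdsWithin_le_nhds (by rw [hp0]; exact hU.mem_nhds hγU)
  obtain ⟨t, htU, ht0, ht1⟩ := (hev.and (Ioo_mem_nhdsGT (one_pos (α := ℝ)))).exists
  have hpin : ∀ k, k ≠ j → 0 < path t k ∧ path t k < 1 := by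
    intro k hk
    have := hγ.1 k
    simp only [hpath, hk, if_false]
    constructor <;> nlinarith [this.1, this.2]
  have hpj : path t j = side b := by simp [hpath, hb]
  have hWo : IsOpen ({x : Fin d → ℝ | (WithLp.toLp 2 x : E d) ∈ U} ∩
      ({x | ∀ k, k ≠ j → 0 < x k ∧ x k < 1} ∩ {x | |x j - side b| < δ})) := by
    refine (hU.preimage (PiLp.continuous_toLp 2 (fun _ : Fin d => ℝ))).inter (IsOpen.inter ?_ ?_)
    · simp only [Set.ofPred_forall]
      refine isOpen_iInter_of_finite fun k => isOpen_iInter_of_finite fun _ => ?_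
      exact (isOpen_lt continuous_const (continuous_apply k)).inter
        (isOpen_lt (continuous_apply k) continuous_const)
    · exact isOpen_lt ((continuous_apply j).sub continuous_const).abs continuous_const
  obtain ⟨r, hr, hsub⟩ := exists_eball_subset hWo (y := path t)
    ⟨htU, hpin, by
      change |path t j - side b| < δ
      rw [hpj, sub_self, abs_zero]; exact hδ⟩
  exact ⟨j, b, path t, r, hr, hpj, fun x hx => (hsub hx).1, fun x hx => (hsub hx).2.1,
    fun x hx => (hsub hx).2.2⟩

/-- The region of propagation: the collar together with the patch. -/
def region (r' : ℝ) (p : Fin d → ℝ) (r : ℝ) : Set (Fin d → ℝ) := (⋃ i, slab d r' i) ∪ eball p r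

/-- The part of the patch outside the cube. -/
def outer (j : Fin d) (b : Bool) (p : Fin d → ℝ) (r : ℝ) : Set (Fin d → ℝ) :=
  eball p r ∩ {x | if b then 1 < x j else x j < 0}

variable {U : Set (E d)} {ϱ δ r : ℝ} {j : Fin d} {b : Bool} {p : Fin d → ℝ}

theorem side_cases (b : Bool) : side b = 0 ∨ side b = 1 := by cases b <;> simp [side]

theorem FacePatch.region_bounds (F : FacePatch U δ j b p r) (hδ : δ ≤ 1 / 2) (r' : ℝ) :
    ∀ x ∈ region r' p r, ∀ k, -(1 / 2) < x k ∧ x k < 3 / 2 := by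
  rintro x (hx | hx) k
  · obtain ⟨i, hi⟩ := Set.mem_iUnion.1 hx
    have := hi.1 k
    constructor <;> linarith [this.1, this.2]
  · by_cases hk : k = j
    · subst hk
      have := abs_lt.1 (F.near x hx)
      rcases side_cases b with h | h <;> rw [h] at this <;>
        constructor <;> linarith [this.1, this.2]
    · have := F.inside x hx k hk
      constructor <;> linarith [this.1, this.2]

theorem isOpen_region (r' : ℝ) (p : Fin d → ℝ) (r : ℝ) : IsOpen (region r' p r) :=
  (isOpen_iUnion fun i => isOpen_slab r' i).union (isOpen_eball p r)

/-- The collar and the ball are each connected, and they share the point obtained from the centre of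
the ball by a short step into the cube. -/
theorem FacePatch.isPreconnected_region (F : FacePatch U δ j b p r) (hd : 2 ≤ d) {r' : ℝ}
    (hr' : 0 < r') : IsPreconnected (region r' p r) := by
  obtain ⟨c, hc0, hc1, hcr, hc2⟩ : ∃ c : ℝ, 0 < c ∧ c < 1 ∧ c < r' ∧ c ^ 2 < r := by
    obtain ⟨c, h0, h1⟩ := exists_between (lt_min (lt_min one_pos hr') F.r_pos)
    have h2 := lt_min_iff.1 h1
    have h3 := lt_min_iff.1 h2.1
    exact ⟨c, h0, h3.1, h3.2, by nlinarith [h3.1, h2.2]⟩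
  have hpin : ∀ k, k ≠ j → 0 < p k ∧ p k < 1 := F.inside p (mem_eball_self p F.r_pos)
  refine IsPreconnected.union (step (if b then -c else c) j p) ?_ (step_mem_eball ?_ j p)
    (isPreconnected_iUnion_slab hd hr') (convex_eball p r).isPreconnected
  · refine Set.mem_iUnion.2 ⟨(j, b), fun k => ?_, ?_⟩
    · by_cases hk : k = j
      · subst hk
        have := F.center
        cases b <;> simp [step, this, side] <;> constructor <;> linarith
      · simpa [step, hk] using hpin k hk
    · have := F.center
      cases b <;> simp [step, this, side, hcr]
  · cases b <;> simpa using hc2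

theorem FacePatch.exists_mem_outer (F : FacePatch U δ j b p r) (r' : ℝ) :
    ∃ y, y ∈ region r' p r ∩ interior (outer j b p r) := by
  obtain ⟨c, hc0, hc1, hc2⟩ : ∃ c : ℝ, 0 < c ∧ c < 1 ∧ c ^ 2 < r := by
    obtain ⟨c, h0, h1⟩ := exists_between (lt_min one_pos F.r_pos)
    have h2 := lt_min_iff.1 h1
    exact ⟨c, h0, h2.1, by nlinarith [h2.1, h2.2]⟩
  have hopen : IsOpen (outer j b p r) := by
    refine (isOpen_eball p r).inter ?_
    cases b
    · exact isOpen_lt (continuous_apply j) continuous_const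
    · exact isOpen_lt continuous_const (continuous_apply j)
  have hmem : step (if b then c else -c) j p ∈ eball p r := by
    refine step_mem_eball ?_ j p
    cases b <;> simpa using hc2
  refine ⟨step (if b then c else -c) j p, Or.inr hmem, ?_⟩
  rw [hopen.interior_eq]
  refine ⟨hmem, ?_⟩
  have := F.center
  cases b <;> simp [step, this, side, hc0]

end Patch

/-! ### Energy of sums -/

section Energy

variable {G : Type*} [AddCommGroup G] {d : ℕ}

theorem en_add_le (h : ℝ) (e : Fin d → G) (v w : G → ℝ) (n : G) :
    en h e (fun n => v n + w n) n ≤ 2 * en h e v n + 2 * en h e w n := by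
  have h1 : ∀ x y : ℝ, (x + y) ^ 2 ≤ 2 * x ^ 2 + 2 * y ^ 2 := fun x y => by
    nlinarith [sq_nonneg (x - y)]
  have h2 : ∑ k, fd (e k) (fun n => v n + w n) n ^ 2 ≤
      ∑ k, (2 * fd (e k) v n ^ 2 + 2 * fd (e k) w n ^ 2) := by
    refine Finset.sum_le_sum fun k _ => ?_
    refine le_trans (le_of_eq ?_) (h1 (fd (e k) v n) (fd (e k) w n))
    simp only [fd]; ring
  rw [Finset.sum_add_distrib, ← Finset.mul_sum, ← Finset.mul_sum] at h2
  have h3 := mul_le_mul_of_nonneg_left (h1 (v n) (w n)) (sq_nonneg h)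
  simp only [en]
  linarith

theorem en_neg (h : ℝ) (e : Fin d → G) (w : G → ℝ) (n : G) :
    en h e (fun n => -w n) n = en h e w n := by
  simp only [en, fd, neg_sq]
  congr 1
  exact Finset.sum_congr rfl fun k _ => by ring

end Energy

/-! ### The corrected extension as an approximate solution across the patch -/

section Configuration

variable {d N : ℕ} {U : Set (E d)} {ϱ r : ℝ} {j : Fin d} {b : Bool} {p : Fin d → ℝ}

/-- The integer coordinate of the face on the periodic mesh. -/
def sideVal (N : ℕ) (b : Bool) : ℕ := if b then 2 * N + 2 else N + 1

theorem pos_eq_side_iff {n : Torus d N} {k : Fin d} :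
    pos N n k = side b ↔ (n k).val = sideVal N b := by
  cases b
  · simpa [side, sideVal] using pos_eq_zero_iff
  · simpa [side, sideVal] using pos_eq_one_iff

theorem eq_sideVal_iff {n : Torus d N} {k : Fin d} :
    n k = ((sideVal N b : ℕ) : ZMod (3 * N + 3)) ↔ (n k).val = sideVal N b := by
  have hlt : sideVal N b < 3 * N + 3 := by unfold sideVal; split_ifs <;> omega
  constructor
  · intro h; rw [h, ZMod.val_natCast_of_lt hlt]
  · intro h; exact ZMod.val_injective _ (by rw [h, ZMod.val_natCast_of_lt hlt])

theorem FacePatch.val_inside (F : FacePatch U (min (1 / 2) (8 * ϱ)) j b p r) {n : Torus d N}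
    (hn : pos N n ∈ eball p r) {k : Fin d} (hk : k ≠ j) :
    N + 1 < (n k).val ∧ (n k).val < 2 * N + 2 :=
  ⟨pos_pos_iff.1 (F.inside _ hn k hk).1, pos_lt_one_iff.1 (F.inside _ hn k hk).2⟩

/-- A mesh point of the region is in the cube, on the face, or beyond it. -/
theorem FacePatch.trichotomy (F : FacePatch U (min (1 / 2) (8 * ϱ)) j b p r) {n : Torus d N}
    (hn : pos N n ∈ region (8 * ϱ) p r) :
    pt n ∈ collar d (8 * ϱ) ∨ (pos N n ∈ eball p r ∧ (n j).val = sideVal N b) ∨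
      pos N n ∈ outer j b p r := by
  by_cases hc : pt n ∈ cube d
  · left
    refine ⟨hc, ?_⟩
    rcases hn with hn | hn
    · obtain ⟨⟨k, b'⟩, hk, hk'⟩ := Set.mem_iUnion.1 hn
      have hkk := hk k
      cases b'
      · simp only [Bool.false_eq_true, if_false] at hk'
        refine (infDist_frontier_le hc k (Or.inl rfl)).trans_lt ?_
        rw [sub_zero, pt_apply, abs_of_pos hkk.1]; exact hk'
      · simp only [if_true] at hk'
        refine (infDist_frontier_le hc k (Or.inr rfl)).trans_lt ?_
        rw [abs_sub_comm, pt_apply, abs_of_pos (by linarith [hkk.2])]; exact hk'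
    · refine (infDist_frontier_le hc j (side_cases b)).trans_lt ?_
      rw [pt_apply]
      exact (F.near _ hn).trans_le (min_le_right _ _)
  · right
    have hball : pos N n ∈ eball p r := by
      rcases hn with hn | hn
      · obtain ⟨i, hi⟩ := Set.mem_iUnion.1 hn
        exact absurd (fun k => hi.1 k) hc
      · exact hn
    by_cases hj : (n j).val = sideVal N b
    · exact Or.inl ⟨hball, hj⟩
    · right
      refine ⟨hball, ?_⟩
      have hne : pos N n j ≠ side b := fun h => hj (pos_eq_side_iff.1 h)
      have hnear := abs_lt.1 ((F.near _ hball).trans_le (min_le_left _ _))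
      have hout : ¬(0 < pos N n j ∧ pos N n j < 1) := by
        intro h
        refine hc fun k => ?_
        by_cases hk : k = j
        · subst hk; exact h
        · exact F.inside _ hball k hk
      cases b
      · simp only [side, Bool.false_eq_true, if_false] at hnear hne
        change if false = true then 1 < pos N n j else pos N n j < 0
        rw [if_neg (by simp)]
        refine lt_of_le_of_ne (not_lt.1 fun h => hout ⟨h, ?_⟩) hne
        linarith [hnear.2]
      · simp only [side, if_true] at hnear hne
        change if true = true then 1 < pos N n j else pos N n j < 0
        rw [if_pos rfl]
        refine lt_of_le_of_ne (not_lt.1 fun h => hout ⟨?_, h⟩) hne.symm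
        linarith [hnear.1]

/-- The extension vanishes at and next to points beyond the face. -/
theorem FacePatch.ext_outer (F : FacePatch U (min (1 / 2) (8 * ϱ)) j b p r) {u : E d → ℝ}
    {n : Torus d N} (hN : 2 ≤ N) (hn : pos N n ∈ outer j b p r) :
    ext N u n = 0 ∧ ∀ k, ext N u (n + te d N k) = 0 ∧ ext N u (n - te d N k) = 0 := by
  obtain ⟨hball, hout⟩ := hn
  have hbd := F.region_bounds (min_le_left _ _) (8 * ϱ) _ (Or.inr hball) j
  have hh : meshSize N ≤ 1 / 3 := by
    unfold meshSize
    have : (2 : ℝ) ≤ N := by exact_mod_cast hN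
    gcongr; linarith
  have h1 : (n j).val + 1 < 3 * N + 3 := val_add_one_lt_of_pos_lt (by linarith [hbd.2])
  have h2 : 1 ≤ (n j).val := one_le_val_of_lt_pos (by linarith [hbd.1])
  have hv : (n j).val < N + 1 ∨ 2 * N + 2 < (n j).val := by
    cases b
    · left
      change if false = true then 1 < pos N n j else pos N n j < 0 at hout
      rw [if_neg (by simp), ← not_le, pos_nonneg_iff] at hout
      omega
    · right
      change if true = true then 1 < pos N n j else pos N n j < 0 at hout
      rw [if_pos rfl, ← not_le, pos_le_one_iff] at hout
      omega
  refine ⟨ext_of_coord j (by omega), fun k => ⟨ext_of_coord j ?_, ext_of_coord j ?_⟩⟩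
  · by_cases hk : k = j
    · subst hk
      rw [add_te_val n k h1, if_pos rfl]; omega
    · have : (n + te d N k) j = n j := by simp [te, Ne.symm hk]
      rw [this]; omega
  · by_cases hk : k = j
    · subst hk
      rw [sub_te_val n k h2, if_pos rfl]; omega
    · have : (n - te d N k) j = n j := by simp [te, Ne.symm hk]
      rw [this]; omega

theorem bdryNormL2_sq (h : ℝ) (hh : 0 ≤ h) (W : Finset (E d)) (g : E d → ℝ) :
    bdryNormL2 h W g ^ 2 = h ^ (d - 1) * ∑ x ∈ W, |g x| ^ 2 := by
  rw [bdryNormL2, Real.sq_sqrt]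
  exact mul_nonneg (by positivity) (Finset.sum_nonneg fun _ _ => by positivity)

/-- After subtracting a correction controlled by the normal derivative on the patch, the extension
by zero solves the equation across the patch. -/
theorem FacePatch.exists_config {M h₁ : ℝ} {σ : Fin d → E d → ℝ} {O : Set (E d)}
    {q f u : E d → ℝ} (F : FacePatch U (min (1 / 2) (8 * ϱ)) j b p r) (hd : 3 ≤ d)
    (hh₁ : 0 < h₁) (H : CoeffAssumption h₁ σ) (hN : 2 ≤ N) (hϱO : collar d (8 * ϱ) ⊆ O)
    (hq : normLInf (cubeMesh d N) q ≤ M) (hf : ∀ x ∈ sample N O, f x = 0)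
    (heq : ∀ x ∈ cubeMesh d N, -laplacian (meshSize N) σ u x + q x * u x = f x)
    (hu : ∀ x ∈ cubeBdry d N, u x = 0) :
    ∃ w : Torus d N → ℝ,
      Config d N M (region (8 * ϱ) p r) (outer j b p r) (tcoeff N σ)
        (fun n => ext N u n - w n) (fun n => M * w n)
        (2 * ∑ n, en (meshSize N) (te d N) (ext N u) n + 2 * ∑ n, en (meshSize N) (te d N) w n)
        ((1 + M ^ 2) * ∑ n, en (meshSize N) (te d N) w n) ∧
      meshSize N ^ d * ∑ n, en (meshSize N) (te d N) w n ≤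
        meshSize N ^ 2 * (70 * bdryNormL2 (meshSize N) (sample N (U ∩ frontier (cube d)))
          (normalDeriv (meshSize N) (cubeMesh d N) σ u) ^ 2) := by
  classical
  have h0 := meshSize_pos N
  have hM : 0 ≤ M := (normLInf_nonneg _ _).trans hq
  have hcoeff : ∀ k n, 2 / 3 ≤ tcoeff N σ k n ∧ tcoeff N σ k n ≤ 4 / 3 := fun k n =>
    H.bounds hh₁ hd k (mid_mem_cube k n)
  set P : Set (Torus d N) := {n | pos N n ∈ eball p r ∧ (n j).val = sideVal N b} with hP
  -- Only the surface source within the patch is removed. Elsewhere on the boundary the extension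
  -- does not solve the equation, but those points are outside the region.
  set g := P.indicator (ellip (te d N) (tcoeff N σ) (ext N u)) with hg
  obtain ⟨w, hw, hwE⟩ := exists_lift (by omega) (fun k n => (hcoeff k n).1) j
    ((sideVal N b : ℕ) : ZMod (3 * N + 3)) g (fun n hn => Set.indicator_of_notMem
      (fun hmem => hn (eq_sideVal_iff.2 hmem.2)) _)
  set Ew := ∑ n, en (meshSize N) (te d N) w n with hEw
  have hEw0 : 0 ≤ Ew := Finset.sum_nonneg fun n _ => en_nonneg _ _ _ n
  refine ⟨w, ⟨hcoeff, fun k l n hl => tcoeff_add_sub_le H hh₁ k l n hl, fun n hn => ?_, ?_, ?_, ?_⟩,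
    ?_⟩
  -- The Dirichlet set of `w` lies at position `-1`, while the region stays above `-1/2`. Hence `w`
  -- satisfies its equation throughout the region.
  · have hnz : ¬∃ k, n k = 0 := by
      rintro ⟨k, hk⟩
      have h1 := (F.region_bounds (min_le_left _ _) (8 * ϱ) _ hn k).1
      have h2 : 1 ≤ (n k).val := one_le_val_of_lt_pos (by linarith)
      rw [hk, ZMod.val_zero] at h2
      omega
    have hsub : ellip (te d N) (tcoeff N σ) (fun n => ext N u n - w n) n =
        ellip (te d N) (tcoeff N σ) (ext N u) n - g n := by
      have e1 := ellip_add (te d N) (tcoeff N σ) (fun n => ext N u n - w n) w n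
      simp only [sub_add_cancel] at e1
      rw [← hw n hnz]; linarith
    have hnn : 0 ≤ meshSize N ^ 2 * (M * |ext N u n - w n| + |M * w n|) := by positivity
    rw [hsub]
    rcases F.trichotomy hn with hcase | hcase | hcase
    -- In the collar `f = 0`, so the undivided operator gives `h² q u`. Splitting `u = v + w`
    -- produces the potential term and the source `M w`.
    · have hcube := hcase.1
      have hmesh := pt_mem_cubeMesh hcube
      have hg0 : g n = 0 := by
        refine Set.indicator_of_notMem (fun hmem => ?_) _
        have h1 := pos_eq_side_iff.2 hmem.2
        have h2 := hcube j
        rw [pt_apply, h1] at h2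
        rcases side_cases b with h | h <;> rw [h] at h2
        · exact lt_irrefl _ h2.1
        · exact lt_irrefl _ h2.2
      have hfx : f (pt n) = 0 := hf _ (mem_sample.2 ⟨(mem_sample.1 hmesh).1, hϱO hcase⟩)
      have hlap : laplacian (meshSize N) σ u (pt n) = q (pt n) * u (pt n) := by
        have := heq _ hmesh
        rw [hfx] at this; linarith
      rw [hg0, sub_zero, ellip_ext hu hcube, hlap, ext_of_mem hcube, abs_mul,
        abs_of_nonneg (sq_nonneg (meshSize N)), abs_mul]
      have hqx : |q (pt n)| ≤ M := (abs_le_normLInf q hmesh).trans hq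
      have hux : |u (pt n)| ≤ |u (pt n) - w n| + |w n| := by
        have := abs_add_le (u (pt n) - w n) (w n)
        rwa [sub_add_cancel] at this
      refine mul_le_mul_of_nonneg_left ?_ (sq_nonneg _)
      rw [abs_mul M, abs_of_nonneg hM]
      calc |q (pt n)| * |u (pt n)| ≤ M * (|u (pt n) - w n| + |w n|) := by gcongr
        _ = _ := by ring
    · have : g n = ellip (te d N) (tcoeff N σ) (ext N u) n :=
        Set.indicator_of_mem (show n ∈ P from hcase) _
      rw [this, sub_self, abs_zero]
      exact hnn
    · obtain ⟨e1, e2⟩ := F.ext_outer (u := u) hN hcase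
      have e3 : ellip (te d N) (tcoeff N σ) (ext N u) n = 0 := by
        rw [ellip]
        refine Finset.sum_eq_zero fun k _ => ?_
        rw [e1, (e2 k).1, (e2 k).2]; ring
      have e4 : g n = 0 := by
        by_cases hmem : n ∈ P
        · rw [hg, Set.indicator_of_mem hmem, e3]
        · exact Set.indicator_of_notMem hmem _
      rw [e3, e4, sub_zero, abs_zero]
      exact hnn
  · rw [Finset.mul_sum, Finset.mul_sum, ← Finset.sum_add_distrib]
    refine Finset.sum_le_sum fun n _ => ?_
    have := en_add_le (meshSize N) (te d N) (ext N u) (fun n => -w n) n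
    rw [en_neg] at this
    simpa only [sub_eq_add_neg] using this
  · have h1 : ∑ n, meshSize N ^ 2 * (M * w n) ^ 2 ≤ M ^ 2 * Ew := by
      rw [hEw, Finset.mul_sum]
      refine Finset.sum_le_sum fun n _ => ?_
      calc meshSize N ^ 2 * (M * w n) ^ 2 = M ^ 2 * (meshSize N ^ 2 * w n ^ 2) := by ring
        _ ≤ _ := by gcongr; exact sq_le_en _ _ _ _
    linarith
  -- Beyond the face the extension vanishes together with its neighbours, so there `v = -w` and the
  -- base energy is at most that of the correction.
  · have h1 : ∑ n, {n | pos N n ∈ outer j b p r}.indicator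
        (en (meshSize N) (te d N) fun n => ext N u n - w n) n ≤ Ew := by
      refine Finset.sum_le_sum fun n _ => ?_
      by_cases hn : pos N n ∈ outer j b p r
      · rw [Set.indicator_of_mem (show n ∈ {n | pos N n ∈ outer j b p r} from hn)]
        obtain ⟨e1, e2⟩ := F.ext_outer (u := u) hN hn
        refine le_of_eq ?_
        simp only [en, fd, e1, (e2 _).1]
        rw [zero_sub, neg_sq]
        congr 1
        exact Finset.sum_congr rfl fun k _ => by ring
      · rw [Set.indicator_of_notMem (show n ∉ {n | pos N n ∈ outer j b p r} from hn)]
        exact en_nonneg _ _ _ _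
    have h2 : 0 ≤ M ^ 2 * Ew := by positivity
    linarith
  · rw [bdryNormL2_sq _ h0.le]
    have h1 : ∑ n, g n ^ 2 ≤ ∑ x ∈ sample N (U ∩ frontier (cube d)), meshSize N ^ 2 *
        |normalDeriv (meshSize N) (cubeMesh d N) σ u x| ^ 2 := by
      refine sum_le_sum_of_injective pt_injective (fun x _ => by positivity) fun n => ?_
      by_cases hn : n ∈ P
      · right
        have hin := fun i hi => F.val_inside (k := i) hn.1 hi
        have hval : (n j).val = N + 1 ∨ (n j).val = 2 * N + 2 := by
          have h2 := hn.2
          cases b <;> simp [sideVal] at h2 <;> omega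
        have hclosed : ∀ k, N + 1 ≤ (n k).val ∧ (n k).val ≤ 2 * N + 2 := by
          intro k
          by_cases hk : k = j
          · subst hk; omega
          · have := hin k hk; omega
        refine ⟨mem_sample.2 ⟨pt_mem_grid hclosed, F.mem _ hn.1, ?_⟩, ?_⟩
        · rw [mem_frontier_cube_iff]
          refine ⟨fun k => ⟨pos_nonneg_iff.2 (hclosed k).1, pos_le_one_iff.2 (hclosed k).2⟩, ?_⟩
          rw [pt_mem_cube_iff]
          intro hc
          have := hc j
          omega
        · rw [hg, Set.indicator_of_mem hn, ellip_ext_face hu (by omega) hin hval, neg_sq, mul_pow,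
            sq_abs]
      · left
        rw [hg, Set.indicator_of_notMem hn]; norm_num
    rw [← Finset.mul_sum] at h1
    -- The lift estimate carries one factor `h` on the left, which converts `h^d` into the surface
    -- weight `h^(d-1)` of the boundary norm.
    obtain ⟨d', rfl⟩ : ∃ d', d = d' + 1 := ⟨d - 1, by omega⟩
    rw [Nat.add_sub_cancel]
    calc meshSize N ^ (d' + 1) * Ew = meshSize N ^ d' * (meshSize N * Ew) := by ring
      _ ≤ meshSize N ^ d' * (70 * (meshSize N ^ 2 * ∑ x ∈ sample N (U ∩ frontier (cube (d' + 1))),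
          |normalDeriv (meshSize N) (cubeMesh (d' + 1) N) σ u x| ^ 2)) := by
        refine mul_le_mul_of_nonneg_left (hwE.trans ?_) (by positivity)
        exact mul_le_mul_of_nonneg_left h1 (by norm_num)
      _ = _ := by ring

end Configuration

/-! ### Conclusion for the shell -/

section Final

variable {d : ℕ} {U : Set (E d)} {ϱ r M : ℝ} {j : Fin d} {b : Bool} {p : Fin d → ℝ}

/-- Smallness starts beyond the face, passes through the patch into the collar and reaches the shell
neighbourhood, a compact subset of the collar because `4 ϱ < 8 ϱ`. -/
theorem FacePatch.good_shellNhd (F : FacePatch U (min (1 / 2) (8 * ϱ)) j b p r) (hd : 2 ≤ d)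
    (hϱ : 0 < ϱ) : Good d M (region (8 * ϱ) p r) (outer j b p r) (shellNhd d ϱ) := by
  obtain ⟨y₀, hy₀⟩ := F.exists_mem_outer (8 * ϱ)
  refine good_of_isCompact (F.region_bounds (min_le_left _ _) _) (isOpen_region _ _ _)
    (F.isPreconnected_region hd (by linarith)) hy₀ (isCompact_shellNhd d ϱ) ?_
  rintro x ⟨hx, k, hk⟩
  refine Or.inl (Set.mem_iUnion.2 ?_)
  have hcube : ∀ i, 0 < x i ∧ x i < 1 := fun i => by
    constructor <;> linarith [(hx i).1, (hx i).2]
  rcases hk with hk | hk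
  · refine ⟨(k, false), hcube, ?_⟩
    simp only [Bool.false_eq_true, if_false]; linarith
  · refine ⟨(k, true), hcube, ?_⟩
    simp only [if_true]; linarith

theorem le_of_sq_le_add_sq {Y A B K : ℝ} (hA : 0 ≤ A) (hB : 0 ≤ B) (hK : 0 ≤ K)
    (h : Y ^ 2 ≤ K * (A ^ 2 + B ^ 2)) : Y ≤ (K + 1) * (A + B) := by
  refine le_of_sq_le_sq (h.trans ?_) (by positivity)
  have h1 : A ^ 2 + B ^ 2 ≤ (A + B) ^ 2 := by nlinarith [mul_nonneg hA hB]
  have h2 : K ≤ (K + 1) ^ 2 := by nlinarith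
  rw [mul_pow]
  exact mul_le_mul h2 h1 (by positivity) (by positivity)

/-- The unique continuation estimate for one solution, from the propagation of smallness. -/
theorem normH1_le_of_energy {N : ℕ} {τ C α β : ℝ} {u : E d → ℝ} {w : Torus d N → ℝ}
    {Nu Nb : ℝ} (hd : 0 < d) (hϱ : 0 < ϱ) (hh : 2 * meshSize N ≤ ϱ / 2)
    (hu : ∀ x ∈ cubeBdry d N, u x = 0) (hτ : 0 < τ) (hC : 0 < C) (hα : 0 < α) (hβ : 0 < β)
    (hNu : 0 ≤ Nu) (hNb : 0 ≤ Nb)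
    (hEu : meshSize N ^ d * ∑ n, en (meshSize N) (te d N) (ext N u) n ≤ meshSize N ^ 2 * Nu ^ 2)
    (hEw : meshSize N ^ d * ∑ n, en (meshSize N) (te d N) w n ≤ meshSize N ^ 2 * (70 * Nb ^ 2))
    (hgood : enOn (shellNhd d ϱ) (fun n => ext N u n - w n) ≤ C * (Real.exp (-(α * τ)) *
      (2 * ∑ n, en (meshSize N) (te d N) (ext N u) n + 2 * ∑ n, en (meshSize N) (te d N) w n) +
      Real.exp (β * τ) * ((1 + M ^ 2) * ∑ n, en (meshSize N) (te d N) w n))) :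
    normH1 (meshSize N) (sample N (shell d ϱ (3 * ϱ))) u ≤
      (4 * C + 70 * (6 * C + 2 * C * M ^ 2 + 2) + 1) *
        (Real.exp (-(α / 2) * τ) * Nu + Real.exp (β / 2 * τ) * Nb) := by
  have h0 := meshSize_pos N
  set Eu := ∑ n, en (meshSize N) (te d N) (ext N u) n
  set Ew := ∑ n, en (meshSize N) (te d N) w n with hEwd
  have hEw0 : 0 ≤ Ew := Finset.sum_nonneg fun n _ => en_nonneg _ _ _ n
  have h1 : enOn (shellNhd d ϱ) (ext N u) ≤
      2 * enOn (shellNhd d ϱ) (fun n => ext N u n - w n) + 2 * Ew := by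
    rw [enOn, enOn, hEwd, Finset.mul_sum, Finset.mul_sum, ← Finset.sum_add_distrib]
    refine Finset.sum_le_sum fun n _ => ?_
    have hw0 := en_nonneg (meshSize N) (te d N) w n
    by_cases hn : n ∈ {n : Torus d N | pos N n ∈ shellNhd d ϱ}
    · rw [Set.indicator_of_mem hn, Set.indicator_of_mem hn]
      have := en_add_le (meshSize N) (te d N) (fun n => ext N u n - w n) w n
      simpa only [sub_add_cancel] using this
    · rw [Set.indicator_of_notMem hn, Set.indicator_of_notMem hn]
      linarith
  have h2 := normH1_shell_le hd hϱ hh hu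
  set X := Real.exp (-(α * τ)) with hX
  set Y := Real.exp (β * τ) with hY
  have hX0 : 0 < X := Real.exp_pos _
  have hY0 : 0 < Y := Real.exp_pos _
  have hX1 : X ≤ 1 := Real.exp_le_one_iff.2 (by have := mul_pos hα hτ; linarith)
  have hY1 : 1 ≤ Y := Real.one_le_exp (by positivity)
  have hXY : X ≤ Y := hX1.trans hY1
  -- As `X ≤ 1 ≤ Y`, all the energy of `w` can be charged to the growing exponential: `4 C` from the
  -- total energy, `2 C (1 + M²)` from the data, and `2` from adding `w` back.
  have h3 : enOn (shellNhd d ϱ) (ext N u) ≤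
      4 * C * X * Eu + (6 * C + 2 * C * M ^ 2 + 2) * Y * Ew := by
    have g1 : C * (X * Ew) ≤ C * (Y * Ew) := by gcongr
    have g2 : 1 * Ew ≤ Y * Ew := by gcongr
    linarith
  have h4 : normH1 (meshSize N) (sample N (shell d ϱ (3 * ϱ))) u ^ 2 ≤
      4 * C * X * Nu ^ 2 + (6 * C + 2 * C * M ^ 2 + 2) * Y * (70 * Nb ^ 2) := by
    refine le_of_mul_le_mul_left (h2.trans ?_) (pow_pos h0 2)
    calc meshSize N ^ d * enOn (shellNhd d ϱ) (ext N u)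
        ≤ meshSize N ^ d * (4 * C * X * Eu + (6 * C + 2 * C * M ^ 2 + 2) * Y * Ew) := by gcongr
      _ = 4 * C * X * (meshSize N ^ d * Eu) +
          (6 * C + 2 * C * M ^ 2 + 2) * Y * (meshSize N ^ d * Ew) := by ring
      _ ≤ 4 * C * X * (meshSize N ^ 2 * Nu ^ 2) +
          (6 * C + 2 * C * M ^ 2 + 2) * Y * (meshSize N ^ 2 * (70 * Nb ^ 2)) := by gcongr
      _ = _ := by ring
  refine le_of_sq_le_add_sq (by positivity) (by positivity) (by positivity) (h4.trans ?_)
  have e1 : (Real.exp (-(α / 2) * τ) * Nu) ^ 2 = X * Nu ^ 2 := by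
    rw [mul_pow, ← Real.exp_nat_mul, hX]; congr 2; push_cast; ring
  have e2 : (Real.exp (β / 2 * τ) * Nb) ^ 2 = Y * Nb ^ 2 := by
    rw [mul_pow, ← Real.exp_nat_mul, hY]; congr 2; push_cast; ring
  rw [e1, e2]
  have g1 : 0 ≤ 70 * (6 * C + 2 * C * M ^ 2 + 2) * (X * Nu ^ 2) := by positivity
  have g2 : 0 ≤ 4 * C * (Y * Nb ^ 2) := by positivity
  linarith

end Final

end DiscreteUC

theorem proposition4p1 (d : ℕ) (hd : 3 ≤ d) (M : ℝ) (h₁ : ℝ) (hh₁ : 0 < h₁)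
    (Γ : Set (DiscreteUC.E d)) (hΓne : Γ.Nonempty)
    (hΓopen : ∃ U : Set (DiscreteUC.E d), IsOpen U ∧ Γ = U ∩ frontier (DiscreteUC.cube d))
    (i : Fin d)
    (hΓface :
      (∀ N : ℕ, DiscreteUC.sample N Γ ⊆
        DiscreteUC.bdryPos (DiscreteUC.meshSize N) i (DiscreteUC.cubeMesh d N)) ∨
      (∀ N : ℕ, DiscreteUC.sample N Γ ⊆
        DiscreteUC.bdryNeg (DiscreteUC.meshSize N) i (DiscreteUC.cubeMesh d N)))
    (O : Set (DiscreteUC.E d)) (hO : O ⊆ DiscreteUC.cube d)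
    (ϱ : ℝ) (hϱ : 0 < ϱ) (hϱO : DiscreteUC.collar d (8 * ϱ) ⊆ O) :
    ∃ h₀ ε C α₁ α₂ : ℝ, 0 < h₀ ∧ h₀ < 1 ∧ 0 < ε ∧ 0 < C ∧ 0 < α₁ ∧ 0 < α₂ ∧
      ∀ σ : Fin d → DiscreteUC.E d → ℝ, DiscreteUC.CoeffAssumption h₁ σ →
      ∀ (N : ℕ) (h : ℝ), h = DiscreteUC.meshSize N → h ≤ h₀ →
      ∀ τ : ℝ, 0 < h * τ → h * τ ≤ ε →
      ∀ q f u : DiscreteUC.E d → ℝ,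
        DiscreteUC.normLInf (DiscreteUC.cubeMesh d N) q ≤ M →
        (∀ x ∈ DiscreteUC.sample N O, f x = 0) →
        (∀ x ∈ DiscreteUC.cubeMesh d N, -DiscreteUC.laplacian h σ u x + q x * u x = f x) →
        (∀ x ∈ DiscreteUC.cubeBdry d N, u x = 0) →
        DiscreteUC.normH1 h (DiscreteUC.sample N (DiscreteUC.shell d ϱ (3 * ϱ))) u ≤
          C * (Real.exp (-α₁ * τ) * DiscreteUC.normH1 h (DiscreteUC.cubeMesh d N) u +
            Real.exp (α₂ * τ) *
              DiscreteUC.bdryNormL2 h (DiscreteUC.sample N Γ)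
                (DiscreteUC.normalDeriv h (DiscreteUC.cubeMesh d N) σ u)) := by
  obtain ⟨U, hU, rfl⟩ := hΓopen
  -- The patch is fixed before the coefficients, mesh and solution, so every later constant is
  -- uniform in them. The bound `1/2` keeps the ball away from the opposite face and from the ends
  -- of the periodic domain; `8 ϱ` keeps its inner part in the collar, where `f = 0`.
  obtain ⟨j, b, p, r, F⟩ := DiscreteUC.exists_facePatch hU hΓne
    (show 0 < min (1 / 2) (8 * ϱ) from lt_min (by norm_num) (by linarith))
  obtain ⟨h₀, ε, C, α, β, p1, p2, p3, p4, p5, hgood⟩ :=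
    F.good_shellNhd (M := M) (by omega) hϱ
  -- The bound `h ≤ 1/3` means `N ≥ 2`, and `h ≤ ϱ/4` leaves room for the two steps by which the
  -- `H¹` stencil leaves the shell. The exponents are halved because the energy is the square of the
  -- norm.
  refine ⟨min h₀ (min (1 / 3) (ϱ / 4)), ε, 4 * C + 70 * (6 * C + 2 * C * M ^ 2 + 2) + 1, α / 2,
    β / 2, lt_min p1 (lt_min (by norm_num) (by linarith)), ?_, p2, by positivity, by positivity,
    by positivity, ?_⟩
  · exact lt_of_le_of_lt ((min_le_right _ _).trans (min_le_left _ _)) (by norm_num)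
  rintro σ H N _ rfl hN τ hτ hτε q f u hq hf heq hu
  have h0 := DiscreteUC.meshSize_pos N
  have hN1 : DiscreteUC.meshSize N ≤ h₀ := hN.trans (min_le_left _ _)
  have hN2 : DiscreteUC.meshSize N ≤ 1 / 3 :=
    hN.trans ((min_le_right _ _).trans (min_le_left _ _))
  have hN3 : DiscreteUC.meshSize N ≤ ϱ / 4 :=
    hN.trans ((min_le_right _ _).trans (min_le_right _ _))
  have hN4 : 2 ≤ N := by
    have h1 := DiscreteUC.meshSize_mul N
    have h2 : (2 : ℝ) ≤ N := by nlinarith [(Nat.cast_nonneg N : (0 : ℝ) ≤ N)]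
    exact_mod_cast h2
  have hτ0 : 0 < τ := pos_of_mul_pos_right hτ h0.le
  obtain ⟨w, hc, hEw⟩ := F.exists_config hd hh₁ H hN4 hϱO hq hf heq hu
  exact DiscreteUC.normH1_le_of_energy (by omega) hϱ (by linarith) hu hτ0 p3 p4 p5
    (Real.sqrt_nonneg _) (Real.sqrt_nonneg _) (DiscreteUC.sum_en_ext_le (by omega) hN4 hu) hEw
    (hgood N _ _ _ _ _ hc hN1 τ hτ0 (by rwa [mul_comm]))
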